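/- Let $k$ be a field, $P$ a finite partially ordered set, $S=k[x_i : i\in P]$, and let $\mathfrak a\subset S$ be the Stanley–Reisner ideal of the order complex $\Delta(P)$ (the simplicial complex of nonempty chains of $P$), so that $A=S/\mathfrak a=k[\Delta(P)]$. Put $$\mathrm{Poin}_A(x,t)=\sum_{i\ge 0}\sum_{\alpha}\dim_k \mathrm{Tor}_i^A(k,k)_\alpha\, x^\alpha t^i,\qquad \mathrm{Hilb}_A(x,t)=\sum_{i\ge 0}\sum_{|\alpha|=i}\dim_k A_\alpha\,x^\alpha t^i .$$ *Notation.* $\mathrm{MinGen}(\mathfrak a)$ is the set of minimal monomial generators of $\mathfrak a$. For $I\subset\mathrm{MinGen}(\mathfrak a)$ let $m_I=\mathrm{lcm}(I)$, and let $cl(I)$ be the number of classes of the equivalence relation on $I$ generated by $m\sim n:\Leftrightarrow\gcd(m,n)\ne1$. For a family $F$ of subsets of $\mathrm{MinGen}(\mathfrak a)$ put $W_F(t,x)=1+\sum_{\emptyset\ne I\in F}(-1)^{cl(I)}m_I\,t^{cl(I)+|I|}$. *Standard matchings.* The Taylor resolution of $S/\mathfrak a$ has as basis the subsets $I$ of $\mathrm{MinGen}(\mathfrak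 a)$. For a complex of free $S$-modules with a basis, $[I:J]$ denotes the coefficient of $J$ in $\partial I$, and the edges of its graph are the pairs $I\to J$ of basis elements in successive degrees with $[I:J]\neq0$. An acyclic matching $N$ is a set of edges with unit coefficients such that each basis element lies on at most one edge of $N$ and such that reversing the edges of $N$ creates no directed cycle. The associated Morse complex has the unmatched elements as basis and as coefficients the sums of the weights of the paths in the graph with reversed $N$ (weight $[I:J]$ for an edge $I\to J$ not in $N$ and $-1/[I:J]$ for a reversed edge). Call an acyclic matching $N$ on such a complex $C$, whose basis consists of subsets of $\mathrm{MinGen}(\mathfrak a)$, *$i$-admissible* if every edge $I\to J$ of $N$ satisfies $m_I=m_J$ and $cl(J)-cl(I)=i-1$, and if there is $B\subset N$ such that $cl(I)=1$, $cl(J)=i$ for all $I\to J$ in $B$, and $N$ consists exactly of the $I\cup K\to J\cup K$ with $I\to J$ in $B$, $K\subset\mathrm{MinGen}(\mathfrak a)$, $\gcd(m_I,m_K)=1$ and both $I\cup K$, $J\cup K$ in the basis of $C$. A *standard matching* is a sequence $\mathcal M=\mathcal M_1\cup\mathcal M_2\cup\cdots$, where $\mathcal M_i$ is a finite list of $i$-admissible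 matchings, each on the Morse complex of all preceding ones (beginning with the Taylor resolution), only finitely many $\mathcal M_i$ are nonempty, and the final complex is minimal, i.e. has no edge $I\to J$ with $m_I=m_J$. A *first sequence* is a finite list $\mathcal M_1$ of $1$-admissible matchings, starting with the Taylor resolution, that is complete: in the resulting complex there is no edge $I\to J$ with $m_I=m_J$ and $cl(I)=cl(J)=1$. We write $I\notin\mathcal M_1$, resp. $I\notin\mathcal M$, if $I$ lies on no edge of $\mathcal M_1$, resp. of $\mathcal M$. *Properties (P) and (H).* For a first sequence $\mathcal M_1$ let $R$ be the quotient of the free algebra $k\langle Y_I : I\notin\mathcal M_1,\ cl(I)=1\rangle$ by the relations $Y_IY_J=(-1)^{(|I|+1)(|J|+1)}Y_JY_I$ for $\gcd(m_I,m_J)=1$, let $Y_I$ have degree $|I|+1$ and the multidegree of $m_I$, and let $\mathrm{Hilb}_R(x,t,z)=\sum_{i,\alpha}\dim_k R_{i,\alpha}\,x^\alpha t^{|\alpha|}z^i$. Then (P) is the equation $\mathrm{Poin}_A=\prod_{i\in P}(1+tx_i)\,\mathrm{Hilb}_R(x,1,t)$ and (H) is the equation $\mathrm{Hilb}_A=\big(\prod_{i\in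 P}(1-tx_i)\,\mathrm{Hilb}_R(x,t,-1)\big)^{-1}$. *nbc-sets.* With respect to a monomial order, $I$ is an nbc-set if there is no $m=x_ix_j\in\mathrm{MinGen}(\mathfrak a)$ such that adding the edge $\{i,j\}$ to the graph $\{\{p,q\} : x_px_q\in I\}$ on $P$ gives a graph with a circuit of which $m$ is the largest edge monomial. *Sting-chains.* Fix a linear extension $<$ of the order $\prec$ of $P$. $I$ is a sting-chain if there are $i_1<\dots<i_\nu$ in $P$, $\nu\ge2$, with $x_{i_1}x_{i_2},\dots,x_{i_{\nu-1}}x_{i_\nu}\in I$, where $x_{i_1}$ and $x_{i_\nu}$ are the first and the last variable dividing $m_I$, such that for each $x_rx_s\in I$ with $r<s$ there is $1\le j\le\nu-1$ with (a) $x_rx_s=x_{i_j}x_{i_{j+1}}$, or (b) $r=i_j$, $s<i_{j+1}$ and $x_sx_{i_{j+1}}\notin I$, or (c) $r>i_j$, $s=i_{j+1}$ and $i_j\prec r$. $\mathcal B$ is the set of unions $I=I_1\cup\dots\cup I_l$, $l\ge1$, of sting-chains for which the last variable dividing $m_{I_j}$ precedes the first variable dividing $m_{I_{j+1}}$ for all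 $j<l$. **Theorem.** There is a polynomial $W(t,x)\in\mathbb Z[x][t]$, invertible as a power series, such that $$\mathrm{Poin}_A(x,t)=\frac{\prod_{i\in P}(1+t\,x_i)}{W(t,x)},\qquad \mathrm{Hilb}_A(x,t)=\frac{W(-t,x)}{\prod_{i\in P}(1-t\,x_i)},$$ and 1. $W=W_F$ for the family $F$ of nbc-sets with respect to any monomial order; 2. $W=W_{\mathcal B}$ for any linear extension of $P$; 3. first sequences exist, and for every first sequence $\mathcal M_1$ we have $W=W_F$ for the family $F$ of all $I\notin\mathcal M_1$, and $A$ has properties (P) and (H); 4. for every standard matching $\mathcal M$, $\mathcal M_1$ is a first sequence, $\mathcal M_i$ has no edges for $i\ge3$ (so $\mathcal M=\mathcal M_1\cup\mathcal M_2$), and $W=W_F$ for the family $F$ of all $I\notin\mathcal M$. -/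

import Mathlib

noncomputable section

namespace MonomialRing

open MvPolynomial
open scoped Classical TensorProduct

universe u v

/-! ## Monomial ideals, minimal generators and multigraded Hilbert series -/

section Ideals

variable {k : Type u} [Field k] {σ : Type v} [Fintype σ]

/-- The divisibility-minimal monomials of an ideal form a finite set (Dickson). -/
theorem finite_minimal_monomials (a : Ideal (MvPolynomial σ k)) :
    {u : σ →₀ ℕ | Minimal (fun w => monomial w (1 : k) ∈ a) u}.Finite := by
  refine IsAntichain.finite_of_partiallyWellOrderedOn (r := (· ≤ ·)) ?_ (Set.isPWO_of_wellQuasiOrderedLE _)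
  intro x hx y hy hne hle
  exact hne (le_antisymm hle (hy.2 hx.1 hle))

/-- `MinGen(a)`: the minimal monomial generators of a monomial ideal `a`, as exponent vectors. -/
def minGens (a : Ideal (MvPolynomial σ k)) : Finset (σ →₀ ℕ) :=
  (finite_minimal_monomials a).toFinset

/-- The homogeneous component `A_α` of `A = k[x]/a`, for a monomial ideal `a`. -/
def component (a : Ideal (MvPolynomial σ k)) (α : σ →₀ ℕ) :
    Submodule k (MvPolynomial σ k ⧸ a) :=
  Submodule.span k {Ideal.Quotient.mk a (monomial α 1)}

/-- The ideal of `A = k[x]/a` generated by the variables. -/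
def irrelevant (a : Ideal (MvPolynomial σ k)) : Ideal (MvPolynomial σ k ⧸ a) :=
  Ideal.span (Set.range fun i : σ => Ideal.Quotient.mk a (X i))

/-- Formal power series in `t` whose coefficients are formal power series in the `x_i`. -/
abbrev Series (σ : Type v) : Type v := PowerSeries (MvPowerSeries σ ℤ)

/-- The variable `x_i` as a series. -/
def xvar (i : σ) : Series σ := PowerSeries.C (MvPowerSeries.X i)

/-- The variable `t` as a series. -/
def tvar (σ : Type v) : Series σ := PowerSeries.X

/-- A polynomial in `t` with coefficients in `ℤ[x]`, seen as a series. -/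
def toSeries (W : Polynomial (MvPolynomial σ ℤ)) : Series σ :=
  (W.map (MvPolynomial.coeToMvPowerSeries.ringHom (R := ℤ) (σ := σ)) :
    Polynomial (MvPowerSeries σ ℤ))

/-- The multigraded Hilbert series `Σ_i Σ_{|α| = i} dim_k (A_α) x^α t^i` of `A = k[x]/a`. -/
def hilbertSeries (a : Ideal (MvPolynomial σ k)) : Series σ :=
  PowerSeries.mk fun i => (fun α : σ →₀ ℕ =>
    if α.degree = i then (Module.finrank k (component a α) : ℤ) else 0 : MvPowerSeries σ ℤ)

end Ideals

/-! ## `Tor^A(k,k)` of a graded augmented commutative `k`-algebra, by its normalized bar complex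

For an augmentation ideal `𝔪` (so `A = k ⊕ 𝔪`) the complex `k ⊗_A B(A) ⊗_A k` is `𝔪^{⊗ n}` in
degree `n`, with differential
`[a_0|…|a_n] ↦ Σ_{j < n} (-1)^j [a_0|…|a_j a_{j+1}|…|a_n]`, and its homology is `Tor^A_n(k,k)`.
It is written for a `k`-module `M` (to be `𝔪`) with a bilinear product `μ` and a grading `ℳ`. -/

section Bar

variable {k : Type u} [Field k] {M : Type v} [AddCommGroup M] [Module k M]

/-- Changing one entry of a tuple changes one entry of a contraction of it, and linearly. -/
theorem contractNth_update (μ : M →ₗ[k] M →ₗ[k] M) {n : ℕ} (j : Fin n)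
    (g : Fin (n + 1) → M) (i : Fin (n + 1)) :
    ∃ (p : Fin n) (L : M →ₗ[k] M), ∀ x,
      Fin.contractNth j.castSucc (fun a b => μ a b) (Function.update g i x) =
        Function.update
          (Fin.contractNth j.castSucc (fun a b => μ a b) g) p (L x) := by
  rcases lt_trichotomy (i : ℕ) (j : ℕ) with h | h | h
  · refine ⟨⟨i, by omega⟩, LinearMap.id, fun x => ?_⟩
    funext q
    simp only [Fin.contractNth, Function.update_apply, Fin.ext_iff, Fin.val_castSucc, Fin.val_succ,
      LinearMap.id_apply]
    split_ifs <;> first | rfl | (exfalso; omega)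
  · refine ⟨j, μ.flip (g j.succ), fun x => ?_⟩
    funext q
    by_cases hq : q = j
    · subst hq
      simp [Fin.contractNth, Function.update_apply, Fin.ext_iff, h]
    · have hq' : (q : ℕ) ≠ j := fun e => hq (Fin.ext e)
      simp only [Fin.contractNth, Function.update_apply, Fin.ext_iff, Fin.val_castSucc,
        Fin.val_succ]
      split_ifs <;> first | rfl | (exfalso; omega)
  · by_cases h' : (i : ℕ) = j + 1
    · refine ⟨j, μ (g j.castSucc), fun x => ?_⟩
      funext q
      by_cases hq : q = j
      · subst hq
        simp [Fin.contractNth, Function.update_apply, Fin.ext_iff, h']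
      · have hq' : (q : ℕ) ≠ j := fun e => hq (Fin.ext e)
        simp only [Fin.contractNth, Function.update_apply, Fin.ext_iff, Fin.val_castSucc,
          Fin.val_succ]
        split_ifs <;> first | rfl | (exfalso; omega)
    · refine ⟨⟨i - 1, by omega⟩, LinearMap.id, fun x => ?_⟩
      funext q
      simp only [Fin.contractNth, Function.update_apply, Fin.ext_iff, Fin.val_castSucc,
        Fin.val_succ, LinearMap.id_apply]
      split_ifs <;> first | rfl | (exfalso; omega)

/-- The `j`-th face `[a_0|…|a_n] ↦ [a_0|…|a_j a_{j+1}|…|a_n]`. -/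
def barFace (μ : M →ₗ[k] M →ₗ[k] M) (n : ℕ) (j : Fin n) :
    (⨂[k]^(n + 1) M) →ₗ[k] (⨂[k]^n M) :=
  PiTensorProduct.lift
    { toFun := fun g => PiTensorProduct.tprod k
        (Fin.contractNth j.castSucc (fun a b => μ a b) g)
      map_update_add' := by
        intro inst g i x y
        obtain rfl : inst = instDecidableEqFin _ := Subsingleton.elim _ _
        obtain ⟨p, L, h⟩ := contractNth_update μ j g i
        rw [h, h, h, map_add, MultilinearMap.map_update_add]
      map_update_smul' := by
        intro inst g i c x
        obtain rfl : inst = instDecidableEqFin _ := Subsingleton.elim _ _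
        obtain ⟨p, L, h⟩ := contractNth_update μ j g i
        rw [h, h, map_smul, MultilinearMap.map_update_smul] }

/-- The bar differential from degree `n + 1` to degree `n`. -/
def barD (μ : M →ₗ[k] M →ₗ[k] M) (n : ℕ) : (⨂[k]^(n + 1) M) →ₗ[k] (⨂[k]^n M) :=
  ∑ j : Fin n, (-1 : k) ^ (j : ℕ) • barFace μ n j

/-- The part of degree `α` of the bar complex, for a grading `ℳ` of `M`. -/
def barComponent {D : Type*} [AddCommMonoid D] (ℳ : D → Submodule k M) (n : ℕ)
    (α : D) : Submodule k (⨂[k]^n M) :=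
  Submodule.span k {z | ∃ (β : Fin n → D) (g : Fin n → M),
    (∀ j, g j ∈ ℳ (β j)) ∧ ∑ j, β j = α ∧ z = PiTensorProduct.tprod k g}

/-- The cycles of degree `α` of the bar complex. -/
def barCycles {D : Type*} [AddCommMonoid D] (μ : M →ₗ[k] M →ₗ[k] M) (ℳ : D → Submodule k M) :
    (n : ℕ) → (α : D) → Submodule k (⨂[k]^n M)
  | 0, α => barComponent ℳ 0 α
  | n + 1, α => barComponent ℳ (n + 1) α ⊓ LinearMap.ker (barD μ n)

/-- The boundaries of degree `α` of the bar complex. -/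
def barBoundaries {D : Type*} [AddCommMonoid D] (μ : M →ₗ[k] M →ₗ[k] M) (ℳ : D → Submodule k M)
    (n : ℕ) (α : D) : Submodule k (⨂[k]^n M) :=
  (barComponent ℳ (n + 1) α).map (barD μ n)

/-- The dimension of the homology of the bar complex in degree `n` and multidegree `α`. -/
def barHomologyDim {D : Type*} [AddCommMonoid D] (μ : M →ₗ[k] M →ₗ[k] M) (ℳ : D → Submodule k M)
    (n : ℕ) (α : D) : ℕ :=
  Module.finrank k
    (barCycles μ ℳ n α ⧸ (barBoundaries μ ℳ n α).submoduleOf (barCycles μ ℳ n α))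

/-- The multiplication of an ideal. -/
def idealMul (k : Type u) [Field k] {A : Type v} [CommRing A] [Algebra k A] (𝔪 : Ideal A) :
    𝔪 →ₗ[k] 𝔪 →ₗ[k] 𝔪 :=
  LinearMap.mk₂ k (fun a b => ⟨(a : A) * b, 𝔪.mul_mem_right _ a.2⟩)
    (fun a b c => by ext; simp [add_mul])
    (fun r a b => by ext; simp)
    (fun a b c => by ext; simp [mul_add])
    (fun r a b => by ext; simp)

/-- `dim_k Tor_n^A(k,k)_α` for a commutative `k`-algebra `A` with grading `𝒜` and augmentation
ideal `𝔪`. -/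
def torDim {A : Type v} [CommRing A] [Algebra k A] {D : Type*} [AddCommMonoid D]
    (𝒜 : D → Submodule k A) (𝔪 : Ideal A) (n : ℕ) (α : D) : ℕ :=
  barHomologyDim (idealMul k 𝔪)
    (fun β => (𝒜 β).comap (𝔪.subtype.restrictScalars k)) n α

end Bar

section Monomial

variable {k : Type u} [Field k] {σ : Type v} [Fintype σ]

/-- The multigraded Poincaré–Betti series `Σ_i Σ_α dim_k (Tor_i^A(k,k)_α) x^α t^i` of
`A = k[x]/a`. -/
def poincareSeries (a : Ideal (MvPolynomial σ k)) : Series σ :=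
  PowerSeries.mk fun i => (fun α : σ →₀ ℕ =>
    (torDim (component a) (irrelevant a) i α : ℤ) : MvPowerSeries σ ℤ)

/-! ## Subsets of `MinGen(a)` -/

/-- The basis of the Taylor resolution: the subsets of `MinGen(a)`. -/
abbrev Cell (a : Ideal (MvPolynomial σ k)) : Type v := Finset (minGens a)

variable {a : Ideal (MvPolynomial σ k)}

/-- The (exponent of the) least common multiple `m_I`. -/
def lcmOf (I : Cell a) : σ →₀ ℕ := I.sup fun m => (m : σ →₀ ℕ)

/-- `gcd(x^α, x^β) = 1`. -/
def IsCoprimeMon (α β : σ →₀ ℕ) : Prop := α ⊓ β = 0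

/-- `cl(I)`: the number of classes of the equivalence relation on `I` generated by
`m ∼ n :⇔ gcd(m, n) ≠ 1`. -/
def cl (I : Cell a) : ℕ :=
  Nat.card (Quot fun m n : I => ¬ IsCoprimeMon (m.1 : σ →₀ ℕ) (n.1 : σ →₀ ℕ))

/-- `1 + Σ_{I ∈ F, I ≠ ∅} (-1)^{cl(I)} m_I t^{cl(I) + |I|}`. -/
def clSum (F : Cell a → Prop) : Polynomial (MvPolynomial σ ℤ) :=
  1 + ∑ I : Cell a with F I ∧ I.Nonempty,
    Polynomial.monomial (cl I + I.card) (monomial (lcmOf I) ((-1) ^ cl I))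

/-! ## Matchings and Morse complexes -/

/-- A complex of free `S`-modules with a distinguished basis `basis` of subsets of `MinGen(a)`,
where `I` has homological degree `|I|`; `coeff I J` is the coefficient `[I : J]` of `J` in `∂ I`. -/
structure BasedComplex (a : Ideal (MvPolynomial σ k)) where
  basis : Finset (Cell a)
  coeff : Matrix (Cell a) (Cell a) (MvPolynomial σ k)

/-- The Taylor resolution of `S/a`; signs are taken with respect to an enumeration of
`MinGen(a)`. -/
def taylor (a : Ideal (MvPolynomial σ k)) : BasedComplex a where
  basis := Finset.univ
  coeff I J := ∑ m ∈ I, if J = I.erase m then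
    (-1) ^ (I.filter fun n => (minGens a).equivFin n < (minGens a).equivFin m).card *
      monomial (lcmOf I - lcmOf J) 1 else 0

/-- A set of edges `I → J`. -/
abbrev Matching (a : Ideal (MvPolynomial σ k)) : Type v := Finset (Cell a × Cell a)

namespace BasedComplex

/-- `I → J` is an edge of the directed graph of the complex. -/
def Edge (C : BasedComplex a) (I J : Cell a) : Prop :=
  I ∈ C.basis ∧ J ∈ C.basis ∧ I.card = J.card + 1 ∧ C.coeff I J ≠ 0

/-- The edges of the graph in which the edges belonging to `N` are reversed. -/
def Step (C : BasedComplex a) (N : Matching a) (I J : Cell a) : Prop :=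
  (C.Edge I J ∧ (I, J) ∉ N) ∨ (J, I) ∈ N

/-- Acyclic matchings on the graph of a complex. -/
structure IsAcyclicMatching (C : BasedComplex a) (N : Matching a) : Prop where
  edge : ∀ e ∈ N, C.Edge e.1 e.2
  matching : ∀ e ∈ N, ∀ f ∈ N,
    (e.1 = f.1 ∨ e.1 = f.2 ∨ e.2 = f.1 ∨ e.2 = f.2) → e = f
  invertible : ∀ e ∈ N, IsUnit (C.coeff e.1 e.2)
  acyclic : ∀ I, ¬ Relation.TransGen (C.Step N) I I

/-- The weights of the edges of the graph in which the edges belonging to `N` are reversed. -/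
def weight (C : BasedComplex a) (N : Matching a) : Matrix (Cell a) (Cell a) (MvPolynomial σ k) :=
  fun I J => if (J, I) ∈ N then - Ring.inverse (C.coeff J I)
    else if C.Edge I J ∧ (I, J) ∉ N then C.coeff I J else 0

/-- `Γ(I, J)`: the sum of the weights of all paths from `I` to `J`. The entries of the `l`-th power
of the weight matrix are the weighted counts of the paths with `l` edges, and in an acyclic graph
a path has fewer edges than there are vertices. -/
def pathSum (C : BasedComplex a) (N : Matching a) : Matrix (Cell a) (Cell a) (MvPolynomial σ k) :=
  ∑ l ∈ Finset.range (Fintype.card (Cell a)), C.weight N ^ l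

/-- The Morse complex with respect to a matching `N`. -/
def morse (C : BasedComplex a) (N : Matching a) : BasedComplex a where
  basis := C.basis.filter fun I => ∀ e ∈ N, I ≠ e.1 ∧ I ≠ e.2
  coeff I J := if I.card = J.card + 1 then C.pathSum N I J else 0

/-- `T` is minimal: all edges `I → J` satisfy `m_I ≠ m_J`. -/
def IsMinimal (C : BasedComplex a) : Prop :=
  ∀ I J, C.Edge I J → lcmOf I ≠ lcmOf J

end BasedComplex

/-! ## Standard matchings -/

/-- `N` is an admissible matching for the `i`-th sequence of a standard matching on the complex
`C`: an acyclic matching that consists of multigraded edges `I → J` with `cl(J) - cl(I) = i - 1`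
and that is the closure, inside `C`, of a set `B ⊆ N` of edges `I → J` with `cl(I) = 1` and
`cl(J) = i` under passing from `I → J` to `I ∪ K → J ∪ K` with `gcd(m_I, m_K) = 1`. -/
structure IsStandardStep (i : ℕ) (C : BasedComplex a) (N : Matching a) : Prop where
  acyclicMatching : C.IsAcyclicMatching N
  graded : ∀ e ∈ N, lcmOf e.1 = lcmOf e.2
  cl_diff : ∀ e ∈ N, cl e.2 + 1 = cl e.1 + i
  closed : ∃ B ⊆ N, (∀ e ∈ B, cl e.1 = 1 ∧ cl e.2 = i) ∧
    ∀ f : Cell a × Cell a, f ∈ N ↔ ∃ e ∈ B, ∃ K : Cell a, IsCoprimeMon (lcmOf e.1) (lcmOf K) ∧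
      f = (e.1 ∪ K, e.2 ∪ K) ∧ e.1 ∪ K ∈ C.basis ∧ e.2 ∪ K ∈ C.basis

/-- `L` is a list of matchings, each admissible for the `i`-th sequence on the Morse complex
of the preceding ones, starting with the complex `C`. -/
def IsStandardSequence (i : ℕ) : BasedComplex a → List (Matching a) → Prop
  | _, [] => True
  | C, N :: L => IsStandardStep i C N ∧ IsStandardSequence i (C.morse N) L

/-- The Morse complex of a list of successive matchings. -/
def morseList (C : BasedComplex a) (L : List (Matching a)) : BasedComplex a :=
  L.foldl BasedComplex.morse C

/-- The Morse complex of the Taylor resolution after the sequences `M 1, …, M i`. -/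
def morseUpTo (M : ℕ → List (Matching a)) : ℕ → BasedComplex a
  | 0 => taylor a
  | i + 1 => morseList (morseUpTo M i) (M (i + 1))

/-- `M = ⋃_{i ≥ 1} M_i` is a standard matching on the Taylor resolution: `M_i` is a sequence
(list) of matchings as above on the Morse complex of `M_1, …, M_{i-1}`, all `M_i` but finitely many
are empty, and the resulting complex is minimal. The value `M 0` plays no role. -/
structure IsStandardMatching (M : ℕ → List (Matching a)) : Prop where
  sequence : ∀ i, IsStandardSequence (i + 1) (morseUpTo M i) (M (i + 1))
  minimal : ∃ n, (∀ i, n < i → M i = []) ∧ (morseUpTo M n).IsMinimal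

/-- `L` is a complete first sequence `M_1` on the Taylor resolution: it cannot be continued, since
in the resulting complex there is no edge `I → J` with `m_I = m_J` and `cl(I) = cl(J) = 1`. -/
structure IsFirstSequence (L : List (Matching a)) : Prop where
  sequence : IsStandardSequence 1 (taylor a) L
  complete : ∀ I J, (morseList (taylor a) L).Edge I J → lcmOf I = lcmOf J →
    ¬ (cl I = 1 ∧ cl J = 1)

/-- `I ∉ L` for a list `L` of matchings: `I` lies on no edge of `L`. -/
def Unmatched (L : List (Matching a)) (I : Cell a) : Prop :=
  ∀ N ∈ L, ∀ e ∈ N, I ≠ e.1 ∧ I ≠ e.2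

/-! ## The algebra `R` and the properties (P) and (H) -/

/-- The index set of the variables `Y_I` of `R`: the sets `I ∉ M_1` with `cl(I) = 1`. -/
abbrev YIndex (L : List (Matching a)) : Type v := {I : Cell a // Unmatched L I ∧ cl I = 1}

/-- The relations `Y_I Y_J = (-1)^{|Y_I| |Y_J|} Y_J Y_I` for `gcd(m_I, m_J) = 1`, where
`|Y_I| = |I| + 1`. -/
inductive YRel (L : List (Matching a)) :
    FreeAlgebra k (YIndex L) → FreeAlgebra k (YIndex L) → Prop
  | comm (I J : YIndex L) (h : IsCoprimeMon (lcmOf I.1) (lcmOf J.1)) :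
      YRel L (FreeAlgebra.ι k I * FreeAlgebra.ι k J)
        (((-1) ^ ((I.1.card + 1) * (J.1.card + 1)) : k) • (FreeAlgebra.ι k J * FreeAlgebra.ι k I))

/-- `R = k⟨Y_I⟩ / ⟨[Y_I, Y_J] : gcd(m_I, m_J) = 1⟩`. -/
abbrev RAlg (L : List (Matching a)) : Type _ := RingQuot (YRel L)

/-- The homogeneous component `R_{i,α}`, where `|Y_I| = |I| + 1` and `Y_I` has multidegree `m_I`. -/
def RComponent (L : List (Matching a)) (i : ℕ) (α : σ →₀ ℕ) : Submodule k (RAlg L) :=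
  Submodule.span k {z | ∃ w : List (YIndex L),
    (w.map fun I => I.1.card + 1).sum = i ∧ (w.map fun I => lcmOf I.1).sum = α ∧
    z = RingQuot.mkAlgHom k (YRel L) (w.map (FreeAlgebra.ι k)).prod}

/-- `Hilb_R(x, 1, t) = Σ_{i,α} dim_k(R_{i,α}) x^α t^i`. -/
def hilbR_one_t (L : List (Matching a)) : Series σ :=
  PowerSeries.mk fun i => (fun α : σ →₀ ℕ =>
    (Module.finrank k (RComponent L i α) : ℤ) : MvPowerSeries σ ℤ)

/-- `Hilb_R(x, t, -1) = Σ_{i,α} dim_k(R_{i,α}) x^α t^{|α|} (-1)^i`. -/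
def hilbR_t_neg_one (L : List (Matching a)) : Series σ :=
  PowerSeries.mk fun d => (fun α : σ →₀ ℕ =>
    if α.degree = d then ∑ᶠ i : ℕ, (-1) ^ i * (Module.finrank k (RComponent L i α) : ℤ)
    else 0 : MvPowerSeries σ ℤ)

/-- Property (P) of `k[x]/a`, with `R` formed with the first sequence `L`. -/
def PropertyP (L : List (Matching a)) : Prop :=
  poincareSeries a = (∏ i : σ, (1 + xvar i * tvar σ)) * hilbR_one_t L

/-- Property (H) of `k[x]/a`, with `R` formed with the first sequence `L`. -/
def PropertyH (L : List (Matching a)) : Prop :=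
  IsUnit ((∏ i : σ, (1 - xvar i * tvar σ)) * hilbR_t_neg_one L) ∧
  hilbertSeries a = Ring.inverse ((∏ i : σ, (1 - xvar i * tvar σ)) * hilbR_t_neg_one L)

/-! ## nbc-sets -/

/-- The exponent vector of `x_i x_j`. -/
def edgeMon (i j : σ) : σ →₀ ℕ := Finsupp.single i 1 + Finsupp.single j 1

/-- `x_i x_j ∈ I`. -/
def EdgeMem (I : Cell a) (i j : σ) : Prop := ∃ m ∈ I, (m : σ →₀ ℕ) = edgeMon i j

/-- The graph `G_I` of a set of squarefree quadratic monomials. -/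
def cellGraph (I : Cell a) : SimpleGraph σ where
  Adj i j := i ≠ j ∧ EdgeMem I i j
  symm := ⟨fun i j h => ⟨h.1.symm, by
    obtain ⟨m, hm, h⟩ := h.2
    exact ⟨m, hm, h.trans (add_comm _ _)⟩⟩⟩
  loopless := ⟨fun _ h => h.1 rfl⟩

/-- `I` is an nbc-set: there is no `m = x_i x_j ∈ MinGen(a)` such that adding the edge `{i, j}` to
`G_I` gives a graph with a circuit of which `m` is the largest edge. -/
def IsNBC (ord : MonomialOrder σ) (I : Cell a) : Prop :=
  ¬ ∃ (m : minGens a) (v : σ) (c : (cellGraph (insert m I)).Walk v v), c.IsCycle ∧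
    (∃ i j, s(i, j) ∈ c.edges ∧ (m : σ →₀ ℕ) = edgeMon i j) ∧
    ∀ i j, s(i, j) ∈ c.edges → ord.toSyn (edgeMon i j) ≤ ord.toSyn (m : σ →₀ ℕ)

end Monomial

/-! ## Order complexes and sting-chains -/

section Poset

variable (P : Type v) [PartialOrder P]

/-- The order complex `Δ(P)`: the faces are the nonempty finite chains of `P`. -/
def orderComplex : AbstractSimplicialComplex P where
  faces := {F | F.Nonempty ∧ IsChain (· ≤ ·) (F : Set P)}
  isRelLowerSet_faces := by
    intro F hF
    exact ⟨hF.1, fun G hG hne => ⟨hne, hF.2.mono (Finset.coe_subset.2 hG)⟩⟩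
  singleton_mem := by
    intro p
    exact ⟨Finset.singleton_nonempty p, by simp⟩

variable {P}

/-- The Stanley–Reisner ideal of a simplicial complex: it is generated by the squarefree monomials
of the non-faces. -/
def stanleyReisner (k : Type u) [Field k] (Δ : AbstractSimplicialComplex P) :
    Ideal (MvPolynomial P k) :=
  Ideal.span {f | ∃ F : Finset P, F.Nonempty ∧ F ∉ Δ ∧ f = ∏ i ∈ F, X i}

/-- The Stanley–Reisner ideal of the order complex of `P`. -/
abbrev posetIdeal (k : Type u) [Field k] (P : Type v) [PartialOrder P] :
    Ideal (MvPolynomial P k) :=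
  stanleyReisner k (orderComplex P)

variable {k : Type u} [Field k] [Fintype P] {a : Ideal (MvPolynomial P k)}

/-- `I` is a sting-chain, with respect to the labelling `ℓ` of `P` by natural numbers. The spine
`x_{i_1} x_{i_2}, …, x_{i_{ν-1}} x_{i_ν}` is given by `c = (i_1, …, i_ν)`, `ν = r + 2`. -/
def IsStingChain (ℓ : P → ℕ) (I : Cell a) : Prop :=
  ∃ (r : ℕ) (c : Fin (r + 2) → P), StrictMono (ℓ ∘ c) ∧
    (∀ j : Fin (r + 1), EdgeMem I (c j.castSucc) (c j.succ)) ∧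
    (c 0 ∈ (lcmOf I).support ∧ ∀ p ∈ (lcmOf I).support, ℓ (c 0) ≤ ℓ p) ∧
    (c (Fin.last _) ∈ (lcmOf I).support ∧ ∀ p ∈ (lcmOf I).support, ℓ p ≤ ℓ (c (Fin.last _))) ∧
    ∀ p q : P, ℓ p < ℓ q → EdgeMem I p q → ∃ j : Fin (r + 1),
      (p = c j.castSucc ∧ q = c j.succ) ∨
      (p = c j.castSucc ∧ ℓ q < ℓ (c j.succ) ∧ ¬ EdgeMem I q (c j.succ)) ∨
      (ℓ (c j.castSucc) < ℓ p ∧ q = c j.succ ∧ c j.castSucc < p)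

/-- `I = I_1 ∪ … ∪ I_l` for a chain of sting-chains `(I_1, …, I_l)`, i.e. sting-chains with
`max(I_j) < min(I_{j+1})`. The `I_j` are determined by `I`. -/
def IsChainOfStingChains (ℓ : P → ℕ) (I : Cell a) : Prop :=
  ∃ L : List (Cell a), (∀ J ∈ L, IsStingChain ℓ J) ∧
    L.IsChain (fun J K => ∀ p ∈ (lcmOf J).support, ∀ q ∈ (lcmOf K).support, ℓ p < ℓ q) ∧
    I = L.foldr (· ∪ ·) ∅

end Poset

end MonomialRing

end

/-! Let `K = Σ_I (-1)^{|I|} m_I` be the multigraded Euler characteristic of the Taylor resolution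
(`kSeries`). Inclusion–exclusion over the generators that divide a given monomial shows that `H = K
/ ∏ (1 - x_i)` is the sum of the monomials that survive in `A` (`kSeries_mul_ones`), which is the
Hilbert series up to the bookkeeping of `t`. Moreover `A` is Koszul: in each multidegree the bar
complex has homology only where the number of letters equals the total degree (`exact_words`), so
each Tor dimension is, up to sign, an Euler characteristic, that is, a coefficient of `1 / H`
(`torDim_posetIdeal`). Both formulas therefore hold when `W` is `K` with `x^α` replaced by
`(-1)^{|α|} x^α t^{|α|}` (`denominator`). For Koszulness the bar complex is filtered by the number
of inversions of a word of monomials. The part of the differential that preserves this number is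
contracted by splitting off the least variable of a letter (`homotopy_word`), and the rest is
handled by induction on the filtration.

What remains is a comparison of families of cells. A set `I` of generators is a graph on `P`, and
`W_F = W` as soon as every `I` in `F` satisfies `|I| + cl(I) = number of variables of m_I`, the edge
count of a forest, and the signed sum of the `m_I` over `F` is `K` (`clSum_eq_denominator`). For
nbc-sets the sum is Whitney's involution: toggle the smallest generator that closes a circuit as its
largest edge (`sum_not_bad`). For chains of sting-chains it is a recursion on the lowest vertex, in
which all blocks with interior vertices cancel (`stingSum_eq_ite`). For unmatched cells the sum is
immediate, as matched pairs have equal lcm and opposite signs; the forest count is the point.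

The forest count comes from homology. Whitney's toggling, read as an acyclic matching, shows that
the connected cells with a fixed lcm on `d` variables form a complex that is exact in degrees at
least `d` (`taylor_exactAbove`). Exactness passes to Morse complexes
(`BasedComplex.ExactAbove.morse`). A complete first sequence makes the differential of this strand
zero, so no cell of size at least `d` survives, while a connected cell has size at least `d - 1`.
For a standard matching only the final complex is known to be minimal. Induction on the number of
variables shows that a connected cell with a circuit which `M_1` leaves over could never be matched
later (`isCritical_of_circuit`); hence `M_1` is already complete. Counting then leaves room for
`M_2` only. First sequences exist because Whitney's matching, cut into levels according to the
smallest bad generator, is one.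

For (P) and (H), a cell is unmatched by a first sequence exactly if all its connected components
are. Thus `K` is, up to signs, the clique series of the coprimality relation on the variables of
`R`. The algebra `R` has a basis of traces (words up to exchanging independent letters), and by
Cartier and Foata the trace series is the inverse of the clique series
(`traceSeries_mul_cliqueSeries`). -/

set_option linter.unusedSectionVars false
noncomputable section
open MvPolynomial
open scoped Classical TensorProduct

namespace MonomialRing

/-! ### Algebraic Morse theory as identities in a noncommutative ring -/

section PerturbationAlgebra

variable {A : Type*} [Ring A] {D V S E G : A}

/-- The differential of the Morse complex, for `D = V + E` with matched part `E`, inverse `S` of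
`E`, and `G = (1 + V S)⁻¹`. -/
def morseDiff (V S E G : A) : A := (1 - E * S - S * E) * (G * V) * (1 - E * S - S * E)

/-- Elements act from the right: a chain is a row `Z` and its boundary is `Z * D`. Then `E * S` and
`S * E` project to the upper and lower ends of the matched edges, and `1 - E * S - S * E` projects
to the critical cells. `G` sums the zigzags along the matching. -/
structure IsMorseData (D V S E G : A) : Prop where
  hD : D = V + E
  DD : D * D = 0
  SS : S * S = 0
  EE : E * E = 0
  SES : S * E * S = S
  ESE : E * S * E = E
  GV : G * (1 + V * S) = 1
  VG : (1 + V * S) * G = 1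

namespace IsMorseData

variable (h : IsMorseData D V S E G)
include h

theorem G_eq : G = 1 - G * V * S := by
  have := h.GV
  rw [mul_add, mul_one, ← mul_assoc] at this
  exact eq_sub_of_add_eq this

/-- The two hypotheses say that `Z` lives on critical cells. The identity makes `Z ↦ Z * G` a chain
map from the Morse complex to the original complex. -/
theorem G_mul_D (Z : A) (hS : Z * S = 0) (hE : Z * E = 0) :
    Z * G * D = Z * morseDiff V S E G * G := by
  obtain ⟨hD, DD, SS, EE, SES, ESE, GV, VG⟩ := h
  have hG : G + G * V * S = 1 := by rw [← GV]; noncomm_ring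
  have hZG : Z * G * E = - (Z * G * V * (S * E)) := by
    have : Z * (G + G * V * S) * E = Z * E := by rw [hG, mul_one]
    rw [hE] at this
    rw [eq_neg_iff_add_eq_zero, ← this]; noncomm_ring
  have hy : Z * G * D = Z * G * V * (1 - S * E) := by
    rw [hD, mul_add, hZG]; noncomm_ring
  set y := Z * G * D with hydef
  have hyL : y * S = 0 := by
    rw [hy]
    calc Z * G * V * (1 - S * E) * S = Z * G * V * (S - S * E * S) := by noncomm_ring
      _ = 0 := by rw [SES, sub_self, mul_zero]
  have hyD : y * V + y * E = 0 := by
    rw [← mul_add, ← hD, hydef, mul_assoc, DD, mul_zero]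
  -- As a cycle without lower part, `y` allows `V` to be traded for `-E`. This turns the inverse of
  -- `G` into the projection to the critical cells.
  have hyM : y * (1 + V * S) = y * (1 - E * S - S * E) := by
    have h1 : y * V * S = - (y * E * S) := by
      rw [eq_neg_iff_add_eq_zero, ← add_mul, hyD, zero_mul]
    have h2 : y * S * E = 0 := by rw [hyL, zero_mul]
    calc y * (1 + V * S) = y + y * V * S := by noncomm_ring
      _ = y - y * E * S - y * S * E := by rw [h1, h2]; noncomm_ring
      _ = _ := by noncomm_ring
  have h3 : y = y * (1 - E * S - S * E) * G := by
    rw [← hyM, mul_assoc, VG, mul_one]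
  have h4 : y * (1 - E * S - S * E) = Z * morseDiff V S E G := by
    have hZ : Z * (1 - E * S - S * E) = Z := by
      calc Z * (1 - E * S - S * E) = Z - Z * E * S - Z * S * E := by noncomm_ring
        _ = Z := by rw [hS, hE]; simp
    have h5 : (1 - S * E) * (1 - E * S - S * E) = 1 - E * S - S * E := by
      calc (1 - S * E) * (1 - E * S - S * E) =
          1 - E * S - S * E - S * E + S * (E * E) * S + S * E * S * E := by noncomm_ring
        _ = _ := by rw [EE, SES]; noncomm_ring
    rw [hy, morseDiff, mul_assoc _ (1 - S * E), h5]
    nth_rewrite 1 [← hZ]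
    noncomm_ring
  rw [h3, h4]

theorem proj_mul_S : (1 - E * S - S * E) * S = 0 := by
  calc (1 - E * S - S * E) * S = S - E * (S * S) - S * E * S := by noncomm_ring
    _ = 0 := by rw [h.SS, h.SES]; noncomm_ring

theorem proj_mul_E : (1 - E * S - S * E) * E = 0 := by
  calc (1 - E * S - S * E) * E = E - E * S * E - S * (E * E) := by noncomm_ring
    _ = 0 := by rw [h.EE, h.ESE]; noncomm_ring

theorem S_mul_proj : S * (1 - E * S - S * E) = 0 := by
  calc S * (1 - E * S - S * E) = S - S * E * S - S * S * E := by noncomm_ring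
    _ = 0 := by rw [h.SS, h.SES]; noncomm_ring

omit h in
theorem proj_of (Z : A) (hS : Z * S = 0) (hE : Z * E = 0) : Z * (1 - E * S - S * E) = Z := by
  calc Z * (1 - E * S - S * E) = Z - Z * E * S - Z * S * E := by noncomm_ring
    _ = Z := by rw [hS, hE]; simp

theorem G_injective (Z Z' : A) (hZ : Z * G = Z' * G) : Z = Z' := by
  have := congrArg (· * (1 + V * S)) hZ
  simpa [mul_assoc, h.GV] using this

/-- `D * D = 0` is transported along the chain map given by `G`, which can be cancelled because `G`
is invertible. -/
theorem morseDiff_sq : morseDiff V S E G * morseDiff V S E G = 0 := by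
  have hs : morseDiff V S E G * S = 0 := by
    rw [morseDiff, mul_assoc, h.proj_mul_S, mul_zero]
  have he : morseDiff V S E G * E = 0 := by
    rw [morseDiff, mul_assoc, h.proj_mul_E, mul_zero]
  apply h.G_injective
  rw [← h.G_mul_D _ hs he]
  have h1 := h.G_mul_D (1 - E * S - S * E) h.proj_mul_S h.proj_mul_E
  have h2 : (1 - E * S - S * E) * morseDiff V S E G = morseDiff V S E G := by
    have : (1 - E * S - S * E) * (1 - E * S - S * E) = 1 - E * S - S * E :=
      proj_of _ h.proj_mul_S h.proj_mul_E
    rw [morseDiff, ← mul_assoc, ← mul_assoc, this]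
  rw [h2] at h1
  rw [← h1, mul_assoc, h.DD, mul_zero, zero_mul]

/-- Subtracting a boundary from a chain makes its lower part vanish. -/
theorem sub_boundary_S (Y : A) : (Y - Y * S * G * D) * S = 0 := by
  have h0 : Y * S * G * (1 + V * S) = Y * S := by rw [mul_assoc, h.GV, mul_one]
  have h1 : Y * S * G * S = 0 := by
    have : G * S = S * G * 0 + (G * S) := by simp
    have e : S * G = S - S * G * V * S := by
      nth_rewrite 1 [h.G_eq]; noncomm_ring
    rw [mul_assoc Y S G, e]
    calc Y * (S - S * G * V * S) * S = Y * (S * S) - Y * S * G * V * (S * S) := by noncomm_ring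
      _ = 0 := by rw [h.SS]; simp
  have h2 : Y * S * G * (E * S) = Y * S * G := by
    have e : S * G = S - S * G * V * S := by
      nth_rewrite 1 [h.G_eq]; noncomm_ring
    calc Y * S * G * (E * S) = Y * (S * G) * (E * S) := by noncomm_ring
      _ = Y * (S * E * S) - Y * S * G * V * (S * E * S) := by rw [e]; noncomm_ring
      _ = Y * (S - S * G * V * S) := by rw [h.SES]; noncomm_ring
      _ = Y * S * G := by rw [← e]; noncomm_ring
  calc (Y - Y * S * G * D) * S = Y * S - (Y * S * G * V * S + Y * S * G * (E * S)) := by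
        rw [h.hD]; noncomm_ring
    _ = Y * S - Y * S * G * (1 + V * S) := by rw [h2]; noncomm_ring
    _ = 0 := by rw [h0, sub_self]

/-- A chain without lower part whose boundary has none either is determined by its critical part:
the zigzags rebuild the rest. -/
theorem eq_proj_mul_G (Y : A) (hS : Y * S = 0) (hD : Y * D * S = 0) :
    Y = Y * (1 - E * S - S * E) * G := by
  have h1 : Y * V * S = - (Y * E * S) := by
    rw [eq_neg_iff_add_eq_zero, ← add_mul, ← mul_add, ← h.hD, hD]
  have h2 : Y * S * E = 0 := by rw [hS, zero_mul]
  have hyM : Y * (1 + V * S) = Y * (1 - E * S - S * E) := by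
    calc Y * (1 + V * S) = Y + Y * V * S := by noncomm_ring
      _ = Y - Y * E * S - Y * S * E := by rw [h1, h2]; noncomm_ring
      _ = _ := by noncomm_ring
  rw [← hyM, mul_assoc, h.VG, mul_one]

/-- After subtracting the boundary of `Z * S * G` the cycle has no lower part, so it is rebuilt from
its critical part, which is assumed to vanish. -/
theorem exact_of_no_critical (Z : A) (hZ : Z * D = 0)
    (hc : (Z - Z * S * G * D) * (1 - E * S - S * E) = 0) : ∃ Y, Y * D = Z := by
  refine ⟨Z * S * G, ?_⟩
  have := h.eq_proj_mul_G (Z - Z * S * G * D) (h.sub_boundary_S Z)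
    (by rw [sub_mul, hZ, mul_assoc (Z * S * G), h.DD]; simp)
  rw [hc, zero_mul] at this
  exact (sub_eq_zero.1 this).symm

/-- A primitive of `Z * G` in the original complex, corrected by a boundary to have no lower part,
is the image under `G` of its critical part; that critical part is a primitive of `Z` in the Morse
complex. -/
theorem exact_transfer (Z Y : A) (hS : Z * S = 0) (hY : Y * D = Z * G) :
    ∃ Y', Y' * morseDiff V S E G = Z := by
  set Y1 := Y - Y * S * G * D with hY1
  have h1 : Y1 * D = Z * G := by
    rw [hY1, sub_mul, hY, mul_assoc (Y * S * G), h.DD]; simp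
  have h2 : Z * G * S = 0 := by
    rw [h.G_eq]
    calc Z * (1 - G * V * S) * S = Z * S - Z * G * V * (S * S) := by noncomm_ring
      _ = 0 := by rw [hS, h.SS]; simp
  have h3 := h.eq_proj_mul_G Y1 (h.sub_boundary_S Y) (by rw [h1, h2])
  refine ⟨Y1 * (1 - E * S - S * E), ?_⟩
  apply h.G_injective
  rw [← h.G_mul_D, ← h3, h1]
  · rw [mul_assoc, h.proj_mul_S, mul_zero]
  · rw [mul_assoc, h.proj_mul_E, mul_zero]

end IsMorseData

end PerturbationAlgebra

end MonomialRing

end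

set_option linter.unusedSectionVars false
noncomputable section
open MvPolynomial
open scoped Classical TensorProduct

namespace MonomialRing

/-! ### Acyclic matchings on matrices, and path sums as Morse differentials -/

section MatrixMorse

variable {X R : Type*} [Fintype X] [DecidableEq X] [CommRing R]

/-- A matrix supported on an acyclic relation is nilpotent. -/
theorem pow_card_eq_zero_of_acyclic (W : Matrix X X R) (r : X → X → Prop)
    (hr : ∀ I, ¬ Relation.TransGen r I I) (hW : ∀ I J, W I J ≠ 0 → Relation.TransGen r I J) :
    W ^ Fintype.card X = 0 := by
  -- The number of vertices reachable from `I`. It drops along every nonzero entry, and it is less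
  -- than the number of all vertices because `I` is not reachable from itself.
  set ρ : X → ℕ := fun I => (Finset.univ.filter fun J => Relation.TransGen r I J).card with hρ
  have hlt : ∀ I J, W I J ≠ 0 → ρ J < ρ I := by
    intro I J h
    apply Finset.card_lt_card
    rw [Finset.ssubset_iff_of_subset]
    · exact ⟨J, by simpa using hW I J h, by simpa using hr J⟩
    · intro K hK
      simp only [Finset.mem_filter, Finset.mem_univ, true_and] at hK ⊢
      exact (hW I J h).trans hK
  have key : ∀ l I J, (W ^ l) I J ≠ 0 → ρ J + l ≤ ρ I := by
    intro l
    induction l with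
    | zero =>
      intro I J h
      rw [pow_zero, Matrix.one_apply] at h
      have : I = J := by by_contra h'; simp [h'] at h
      simp [this]
    | succ l ih =>
      intro I J h
      rw [pow_succ, Matrix.mul_apply] at h
      obtain ⟨K, -, hK⟩ := Finset.exists_ne_zero_of_sum_ne_zero h
      have h1 := ih I K (left_ne_zero_of_mul hK)
      have h2 := hlt K J (right_ne_zero_of_mul hK)
      omega
  ext I J
  by_contra h
  have h1 := key _ I J h
  have h2 : ρ I < Fintype.card X := by
    rw [← Finset.card_univ]
    apply Finset.card_lt_card
    rw [Finset.ssubset_iff_of_subset (Finset.subset_univ _)]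
    exact ⟨I, Finset.mem_univ _, by simpa using hr I⟩
  omega

/-- The edges of the graph of a matrix, with the edges in `N` reversed. -/
def matrixStep (D : Matrix X X R) (N : Finset (X × X)) (I J : X) : Prop :=
  (D I J ≠ 0 ∧ (I, J) ∉ N) ∨ (J, I) ∈ N

/-- An acyclic matching on the graph of the matrix of a differential. -/
structure IsMatrixMatching (deg : X → ℕ) (D : Matrix X X R) (N : Finset (X × X)) : Prop where
  sq : D * D = 0
  deg_eq : ∀ I J, D I J ≠ 0 → deg I = deg J + 1
  matching : ∀ e ∈ N, ∀ f ∈ N, (e.1 = f.1 ∨ e.1 = f.2 ∨ e.2 = f.1 ∨ e.2 = f.2) → e = f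
  invertible : ∀ e ∈ N, IsUnit (D e.1 e.2)
  acyclic : ∀ I, ¬ Relation.TransGen (matrixStep D N) I I

def unmatchedPart (D : Matrix X X R) (N : Finset (X × X)) : Matrix X X R :=
  fun I J => if (I, J) ∈ N then 0 else D I J

def matchedPart (D : Matrix X X R) (N : Finset (X × X)) : Matrix X X R :=
  fun I J => if (I, J) ∈ N then D I J else 0

/-- Transposed with respect to `D`: it leads from the lower end of a matched edge to the upper one,
without the minus sign of the path weights. -/
def matchedInv (D : Matrix X X R) (N : Finset (X × X)) : Matrix X X R :=
  fun I J => if (J, I) ∈ N then Ring.inverse (D J I) else 0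

/-- The geometric series for `(1 + V S)⁻¹`. It may stop at the number of vertices, since each
nonzero entry of `V S` is a path of length two in an acyclic graph. -/
def matchedSum (D : Matrix X X R) (N : Finset (X × X)) : Matrix X X R :=
  ∑ l ∈ Finset.range (Fintype.card X), (-(unmatchedPart D N * matchedInv D N)) ^ l

/-- A cell lies on no edge of `N`. -/
def IsCritical (N : Finset (X × X)) (I : X) : Prop := ∀ e ∈ N, I ≠ e.1 ∧ I ≠ e.2

namespace IsMatrixMatching

variable {deg : X → ℕ} {D : Matrix X X R} {N : Finset (X × X)} (h : IsMatrixMatching deg D N)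
include h

theorem ne_of_lower_upper [Nontrivial R] {I J K : X} (h1 : (I, J) ∈ N) (h2 : (J, K) ∈ N) : False := by
  have := h.matching _ h1 _ h2 (Or.inr (Or.inr (Or.inl rfl)))
  obtain ⟨rfl, rfl⟩ := Prod.mk.inj this
  have h3 := h.deg_eq I I (h.invertible _ h1).ne_zero
  omega

theorem upper_mul [Nontrivial R] (I K : X) : (matchedPart D N * matchedInv D N) I K =
    if I = K ∧ ∃ J, (I, J) ∈ N then 1 else 0 := by
  rw [Matrix.mul_apply]
  split_ifs with hI
  · obtain ⟨rfl, J, hJ⟩ := hI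
    rw [Finset.sum_eq_single J]
    · simp [matchedPart, matchedInv, hJ, Ring.mul_inverse_cancel _ (h.invertible _ hJ)]
    · intro J' _ hne
      have : (I, J') ∉ N := fun h' => hne (congrArg Prod.snd (h.matching _ h' _ hJ (Or.inl rfl)))
      simp [matchedPart, this]
    · simp
  · apply Finset.sum_eq_zero
    intro J _
    simp only [matchedPart, matchedInv]
    split_ifs with h1 h2
    · have := h.matching _ h1 _ h2 (Or.inr (Or.inr (Or.inr rfl)))
      exact absurd ⟨congrArg Prod.fst this, J, h1⟩ hI
    all_goals simp

theorem lower_mul [Nontrivial R] (I K : X) : (matchedInv D N * matchedPart D N) I K =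
    if I = K ∧ ∃ J, (J, I) ∈ N then 1 else 0 := by
  rw [Matrix.mul_apply]
  split_ifs with hI
  · obtain ⟨rfl, J, hJ⟩ := hI
    rw [Finset.sum_eq_single J]
    · simp [matchedPart, matchedInv, hJ, Ring.inverse_mul_cancel _ (h.invertible _ hJ)]
    · intro J' _ hne
      have : (J', I) ∉ N := fun h' => hne (congrArg Prod.fst (h.matching _ h' _ hJ
        (Or.inr (Or.inr (Or.inr rfl)))))
      simp [matchedInv, this]
    · simp
  · apply Finset.sum_eq_zero
    intro J _
    simp only [matchedPart, matchedInv]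
    split_ifs with h1 h2
    · have := h.matching _ h1 _ h2 (Or.inl rfl)
      exact absurd ⟨congrArg Prod.snd this, J, h1⟩ hI
    all_goals simp

theorem upper_eq [Nontrivial R] : matchedPart D N * matchedInv D N =
    Matrix.diagonal fun I => if ∃ J, (I, J) ∈ N then 1 else 0 := by
  ext I K
  rw [h.upper_mul, Matrix.diagonal_apply]
  by_cases hI : I = K <;> simp [hI]

theorem lower_eq [Nontrivial R] : matchedInv D N * matchedPart D N =
    Matrix.diagonal fun I => if ∃ J, (J, I) ∈ N then 1 else 0 := by
  ext I K
  rw [h.lower_mul, Matrix.diagonal_apply]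
  by_cases hI : I = K <;> simp [hI]

/-- Every cell is an upper end, a lower end or critical, and these cases exclude each other. -/
theorem proj_eq [Nontrivial R] :
    (1 - matchedPart D N * matchedInv D N - matchedInv D N * matchedPart D N) =
    Matrix.diagonal fun I => if IsCritical N I then 1 else 0 := by
  rw [h.upper_eq, h.lower_eq, ← Matrix.diagonal_one, Matrix.diagonal_sub, Matrix.diagonal_sub]
  congr 1
  funext I
  by_cases h1 : ∃ J, (I, J) ∈ N
  · have h2 : ¬ ∃ J, (J, I) ∈ N := by
      rintro ⟨K, hK⟩; obtain ⟨J, hJ⟩ := h1; exact h.ne_of_lower_upper hK hJ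
    have h3 : ¬ IsCritical N I := by
      obtain ⟨J, hJ⟩ := h1; exact fun hc => (hc _ hJ).1 rfl
    simp only [if_pos h1, if_neg h2, if_neg h3]; simp
  · by_cases h2 : ∃ J, (J, I) ∈ N
    · have h3 : ¬ IsCritical N I := by
        obtain ⟨J, hJ⟩ := h2; exact fun hc => (hc _ hJ).2 rfl
      simp only [if_neg h1, if_pos h2, if_neg h3]; simp
    · have h3 : IsCritical N I := by
        intro e he
        exact ⟨fun h' => h1 ⟨e.2, by rw [h']; exact he⟩, fun h' => h2 ⟨e.1, by rw [h']; exact he⟩⟩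
      simp only [if_neg h1, if_neg h2, if_pos h3]; simp

theorem unmatched_step {I J : X} (hI : unmatchedPart D N I J ≠ 0) : matrixStep D N I J := by
  by_cases h1 : (I, J) ∈ N
  · simp [unmatchedPart, h1] at hI
  · simp only [unmatchedPart, h1, if_false] at hI
    exact Or.inl ⟨hI, h1⟩

theorem inv_step {I J : X} (hI : matchedInv D N I J ≠ 0) : (J, I) ∈ N := by
  by_contra h1; simp [matchedInv, h1] at hI

theorem matchedSum_inv : (1 + unmatchedPart D N * matchedInv D N) * matchedSum D N = 1 ∧
    matchedSum D N * (1 + unmatchedPart D N * matchedInv D N) = 1 := by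
  have hn : (-(unmatchedPart D N * matchedInv D N)) ^ Fintype.card X = 0 := by
    apply pow_card_eq_zero_of_acyclic _ _ h.acyclic
    intro I J hIJ
    rw [Matrix.neg_apply, neg_ne_zero, Matrix.mul_apply] at hIJ
    obtain ⟨K, -, hK⟩ := Finset.exists_ne_zero_of_sum_ne_zero hIJ
    exact (Relation.TransGen.single (h.unmatched_step (left_ne_zero_of_mul hK))).tail
      (Or.inr (h.inv_step (right_ne_zero_of_mul hK)))
  have h1 := mul_neg_geom_sum (-(unmatchedPart D N * matchedInv D N)) (Fintype.card X)
  have h2 := geom_sum_mul_neg (-(unmatchedPart D N * matchedInv D N)) (Fintype.card X)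
  rw [hn, sub_zero, sub_neg_eq_add] at h1 h2
  exact ⟨h1, h2⟩

theorem isMorseData [Nontrivial R] : IsMorseData D (unmatchedPart D N) (matchedInv D N)
    (matchedPart D N) (matchedSum D N) where
  hD := by
    ext I J
    simp only [Matrix.add_apply, unmatchedPart, matchedPart]
    split_ifs <;> simp
  DD := h.sq
  SS := by
    ext I J
    rw [Matrix.mul_apply]
    apply Finset.sum_eq_zero
    intro K _
    by_contra hne
    exact h.ne_of_lower_upper (h.inv_step (right_ne_zero_of_mul hne))
      (h.inv_step (left_ne_zero_of_mul hne))
  EE := by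
    ext I J
    rw [Matrix.mul_apply]
    apply Finset.sum_eq_zero
    intro K _
    simp only [matchedPart]
    split_ifs with h1 h2
    · exact (h.ne_of_lower_upper h1 h2).elim
    all_goals simp
  SES := by
    rw [h.lower_eq]
    ext I J
    rw [Matrix.diagonal_mul]
    by_cases h1 : (J, I) ∈ N
    · rw [if_pos ⟨J, h1⟩, one_mul]
    · simp [matchedInv, h1]
  ESE := by
    rw [h.upper_eq]
    ext I J
    rw [Matrix.diagonal_mul]
    by_cases h1 : (I, J) ∈ N
    · rw [if_pos ⟨J, h1⟩, one_mul]
    · simp [matchedPart, h1]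
  GV := h.matchedSum_inv.2
  VG := h.matchedSum_inv.1

end IsMatrixMatching

/-- The part of a matrix that lowers the degree by `d`. -/
def dropPart (deg : X → ℕ) (d : ℤ) (A : Matrix X X R) : Matrix X X R :=
  fun I J => if (deg I : ℤ) = deg J + d then A I J else 0

omit [Fintype X] [DecidableEq X] in
theorem dropPart_add (deg : X → ℕ) (d : ℤ) (A B : Matrix X X R) :
    dropPart deg d (A + B) = dropPart deg d A + dropPart deg d B := by
  ext I J; simp only [dropPart, Matrix.add_apply]; split_ifs <;> simp

omit [Fintype X] [DecidableEq X] in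
theorem dropPart_sub (deg : X → ℕ) (d : ℤ) (A B : Matrix X X R) :
    dropPart deg d (A - B) = dropPart deg d A - dropPart deg d B := by
  ext I J; simp only [dropPart, Matrix.sub_apply]; split_ifs <;> simp

theorem dropPart_mul (deg : X → ℕ) (d e : ℤ) (A B : Matrix X X R)
    (hB : ∀ I J, B I J ≠ 0 → (deg I : ℤ) = deg J + e) :
    dropPart deg d (A * B) = dropPart deg (d - e) A * B := by
  ext I J
  simp only [dropPart, Matrix.mul_apply]
  have : ∀ K, (if (deg I : ℤ) = deg K + (d - e) then A I K else 0) * B K J =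
      if (deg I : ℤ) = deg J + d then A I K * B K J else 0 := by
    intro K
    by_cases hK : B K J = 0
    · simp [hK]
    · have := hB K J hK
      by_cases h1 : (deg I : ℤ) = deg J + d
      · rw [if_pos h1, if_pos (by omega)]
      · rw [if_neg h1, if_neg (by omega), zero_mul]
  simp_rw [this]
  split_ifs <;> simp

namespace IsMatrixMatching

variable {deg : X → ℕ} {D : Matrix X X R} {N : Finset (X × X)} (h : IsMatrixMatching deg D N)
include h

/-- `V - S` is the weight matrix of the graph with reversed matching. It is nilpotent by acyclicity,
so the sum over all paths is a finite Neumann series. -/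
theorem weight_inv : (1 - (unmatchedPart D N - matchedInv D N)) *
      (∑ l ∈ Finset.range (Fintype.card X), (unmatchedPart D N - matchedInv D N) ^ l) = 1 ∧
    (∑ l ∈ Finset.range (Fintype.card X), (unmatchedPart D N - matchedInv D N) ^ l) *
      (1 - (unmatchedPart D N - matchedInv D N)) = 1 := by
  have hn : (unmatchedPart D N - matchedInv D N) ^ Fintype.card X = 0 := by
    apply pow_card_eq_zero_of_acyclic _ _ h.acyclic
    intro I J hIJ
    rw [Matrix.sub_apply] at hIJ
    by_cases h1 : unmatchedPart D N I J = 0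
    · rw [h1, zero_sub, neg_ne_zero] at hIJ
      exact .single (Or.inr (h.inv_step hIJ))
    · exact .single (h.unmatched_step h1)
  have h1 := mul_neg_geom_sum (unmatchedPart D N - matchedInv D N) (Fintype.card X)
  have h2 := geom_sum_mul_neg (unmatchedPart D N - matchedInv D N) (Fintype.card X)
  rw [hn, sub_zero] at h1 h2
  exact ⟨h1, h2⟩

/-- The path sums between critical cells of consecutive degrees are the coefficients of the
Morse differential. -/
theorem dropPart_pathSum [Nontrivial R] : dropPart deg 1
    ((1 - matchedPart D N * matchedInv D N - matchedInv D N * matchedPart D N) *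
      ∑ l ∈ Finset.range (Fintype.card X), (unmatchedPart D N - matchedInv D N) ^ l) *
    (1 - matchedPart D N * matchedInv D N - matchedInv D N * matchedPart D N) =
    morseDiff (unmatchedPart D N) (matchedInv D N) (matchedPart D N) (matchedSum D N) := by
  have hm := h.isMorseData
  set Γ := ∑ l ∈ Finset.range (Fintype.card X), (unmatchedPart D N - matchedInv D N) ^ l
  have hΓ := h.weight_inv.2
  change Γ * _ = 1 at hΓ
  have hπd := h.proj_eq
  have hπS := hm.proj_mul_S
  have hSπ := hm.S_mul_proj
  unfold morseDiff
  set π := 1 - matchedPart D N * matchedInv D N - matchedInv D N * matchedPart D N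
  have hVd : ∀ I J, unmatchedPart D N I J ≠ 0 → (deg I : ℤ) = deg J + 1 := by
    intro I J hIJ
    have : D I J ≠ 0 := by
      intro h0; apply hIJ; simp [unmatchedPart, h0]
    exact_mod_cast h.deg_eq I J this
  have hSd : ∀ I J, matchedInv D N I J ≠ 0 → (deg I : ℤ) = deg J + (-1) := by
    intro I J hIJ
    have := h.deg_eq _ _ (h.invertible _ (h.inv_step hIJ)).ne_zero
    simp only at this
    omega
  set V := unmatchedPart D N
  set S := matchedInv D N
  set G := matchedSum D N
  set x := π * Γ with hx
  have hx0 : x = π + x * V - x * S := by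
    have : x * (1 - (V - S)) = π := by rw [hx, mul_assoc, hΓ, mul_one]
    rw [← this]; noncomm_ring
  have hπ0 : dropPart deg 0 π = π := by
    rw [hπd]; ext I J
    simp only [dropPart, Matrix.diagonal_apply]
    by_cases h2 : I = J
    · subst h2; simp
    · simp [h2]
  have hπn : ∀ d : ℤ, d ≠ 0 → dropPart deg d π = 0 := by
    intro d hd
    rw [hπd]; ext I J
    simp only [dropPart, Matrix.diagonal_apply, Matrix.zero_apply]
    by_cases h2 : I = J
    · subst h2; simp [hd]
    · simp [h2]
  -- With `x_d` the part of `x = π Γ` that lowers the degree by `d`, the last edge of a path gives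
  -- `x_d = π_d + x_{d-1} V - x_{d+1} S`, because `V` lowers the degree by one and `S` raises it by
  -- one.
  have hrec : ∀ d : ℤ, dropPart deg d x =
      dropPart deg d π + dropPart deg (d - 1) x * V - dropPart deg (d + 1) x * S := by
    intro d
    conv_lhs => rw [hx0]
    rw [dropPart_sub, dropPart_add, dropPart_mul deg d 1 _ _ hVd, dropPart_mul deg d (-1) _ _ hSd,
      sub_neg_eq_add]
  have hSS : S * S = 0 := hm.SS
  -- Paths from critical cells contribute nothing upwards. The induction starts where `d` would
  -- raise the degree above the maximum. Multiplying the recursion at `d + 1` by `S` and using `π S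
  -- = S S = 0` gives `x_d (1 + V S) = 0`, and `1 + V S` is invertible.
  have hzero : ∀ n : ℕ, ∀ d : ℤ, d + ((Finset.univ.sup deg : ℕ) + 1) ≤ n → d < 0 →
      dropPart deg d x = 0 := by
    intro n
    induction n with
    | zero =>
      intro d hd _
      ext I J
      simp only [dropPart, Matrix.zero_apply]
      rw [if_neg]
      have := Finset.le_sup (f := deg) (Finset.mem_univ J)
      push_cast at hd
      omega
    | succ n ih =>
      intro d hd hneg
      have h1 := ih (d - 1) (by push_cast at hd ⊢; omega) (by omega)
      have e1 := hrec d
      rw [hπn d hneg.ne, h1, zero_mul, add_zero, zero_sub] at e1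
      have e2 := hrec (d + 1)
      rw [add_sub_cancel_right] at e2
      have e3 : dropPart deg (d + 1) x * S = dropPart deg d x * V * S := by
        have hp : dropPart deg (d + 1) π * S = 0 := by
          by_cases h0 : d + 1 = 0
          · rw [h0, hπ0, hπS]
          · rw [hπn _ h0, zero_mul]
        rw [e2, sub_mul, add_mul, hp, mul_assoc (dropPart deg (d + 1 + 1) x), hSS]; simp
      have e4 : dropPart deg d x * (1 + V * S) = 0 := by
        rw [mul_add, mul_one, ← mul_assoc, ← e3]
        nth_rewrite 1 [e1]; simp
      calc dropPart deg d x = dropPart deg d x * (1 + V * S) * G := by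
            rw [mul_assoc, hm.VG, mul_one]
        _ = 0 := by rw [e4, zero_mul]
  have hneg : ∀ d : ℤ, d < 0 → dropPart deg d x = 0 := fun d hd =>
    hzero (Finset.univ.sup deg + 1) d (by push_cast; omega) hd
  -- The same elimination with the source term `π` gives `x_0 (1 + V S) = π`, that is, `x_0 = π G`.
  have e0 := hrec 0
  rw [hπ0, hneg (0 - 1) (by norm_num), zero_mul, add_zero, zero_add] at e0
  have e1 := hrec 1
  rw [hπn 1 one_ne_zero, zero_add, sub_self] at e1
  have e1S : dropPart deg 1 x * S = dropPart deg 0 x * V * S := by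
    rw [e1, sub_mul, mul_assoc (dropPart deg (1 + 1) x), hSS]; simp
  rw [e1S] at e0
  have e00 : dropPart deg 0 x = π * G := by
    have : dropPart deg 0 x * (1 + V * S) = π := by
      rw [mul_add, mul_one, ← mul_assoc]; nth_rewrite 1 [e0]; simp
    rw [← this, mul_assoc, hm.VG, mul_one]
  -- A path that ends in a critical cell does not end with a reversed edge, so `S π = 0` removes the
  -- last term.
  calc dropPart deg 1 x * π = dropPart deg 0 x * V * π - dropPart deg (1 + 1) x * (S * π) := by
        nth_rewrite 1 [e1]; rw [sub_mul, mul_assoc _ S π]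
    _ = π * (G * V) * π := by rw [hSπ, e00, mul_zero, sub_zero]; simp only [mul_assoc]

end IsMatrixMatching

end MatrixMorse

end MonomialRing

end

set_option linter.unusedSectionVars false
noncomputable section
open MvPolynomial
open scoped Classical TensorProduct

namespace MonomialRing

universe u v

/-! ### Strands of a complex: exactness in high degrees and its passage to Morse complexes -/

section Support

variable {X R : Type*} [Fintype X] [DecidableEq X] [CommRing R]

/-- The rows of `Z` are supported in `T`. -/
def SuppIn (T : X → Prop) (Z : Matrix X X R) : Prop := ∀ I J, Z I J ≠ 0 → T J

theorem SuppIn.mul {T T' : X → Prop} {Z B : Matrix X X R} (hZ : SuppIn T Z)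
    (hB : ∀ K J, T K → B K J ≠ 0 → T' J) : SuppIn T' (Z * B) := by
  intro I J h
  rw [Matrix.mul_apply] at h
  obtain ⟨K, -, hK⟩ := Finset.exists_ne_zero_of_sum_ne_zero h
  exact hB K J (hZ I K (left_ne_zero_of_mul hK)) (right_ne_zero_of_mul hK)

theorem SuppIn.mul_pow {T : X → Prop} {Z B : Matrix X X R} (hZ : SuppIn T Z)
    (hB : ∀ K J, T K → B K J ≠ 0 → T J) (l : ℕ) : SuppIn T (Z * B ^ l) := by
  induction l with
  | zero => simpa using hZ
  | succ l ih => rw [pow_succ, ← mul_assoc]; exact ih.mul hB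

theorem SuppIn.mul_sum {T : X → Prop} {Z B : Matrix X X R} (hZ : SuppIn T Z)
    (hB : ∀ K J, T K → B K J ≠ 0 → T J) (n : ℕ) :
    SuppIn T (Z * ∑ l ∈ Finset.range n, B ^ l) := by
  intro I J h
  rw [Finset.mul_sum, Matrix.sum_apply] at h
  obtain ⟨l, -, hl⟩ := Finset.exists_ne_zero_of_sum_ne_zero h
  exact hZ.mul_pow hB l I J hl

theorem SuppIn.sub {T : X → Prop} {Z B : Matrix X X R} (hZ : SuppIn T Z) (hB : SuppIn T B) :
    SuppIn T (Z - B) := by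
  intro I J h
  by_cases h1 : Z I J = 0
  · refine hB I J fun h2 => h ?_
    simp [h1, h2]
  · exact hZ I J h1

end Support

variable {k : Type u} [Field k] {σ : Type v} [Fintype σ] {a : Ideal (MvPolynomial σ k)}

/-- The part of the differential between the cells satisfying `Q`. -/
def BasedComplex.strand (C : BasedComplex a) (Q : Cell a → Prop) :
    Matrix (Cell a) (Cell a) (MvPolynomial σ k) :=
  fun I J => if Q I ∧ Q J ∧ C.Edge I J then C.coeff I J else 0

/-- The cells satisfying `Q` form a complex which is exact in degrees at least `d`. -/
structure BasedComplex.ExactAbove (C : BasedComplex a) (Q : Cell a → Prop) (d : ℕ) : Prop where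
  sq : C.strand Q * C.strand Q = 0
  exact : ∀ Z : Matrix (Cell a) (Cell a) (MvPolynomial σ k),
    SuppIn (fun J => Q J ∧ J ∈ C.basis ∧ d ≤ J.card) Z → Z * C.strand Q = 0 →
    ∃ Y, Y * C.strand Q = Z

theorem BasedComplex.strand_ne_zero {C : BasedComplex a} {Q : Cell a → Prop} {I J : Cell a}
    (h : C.strand Q I J ≠ 0) : Q I ∧ Q J ∧ C.Edge I J := by
  by_contra h'; exact h (if_neg h')

theorem BasedComplex.strand_eq {C : BasedComplex a} {Q : Cell a → Prop} {I J : Cell a}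
    (hI : Q I) (hJ : Q J) (h : C.Edge I J) : C.strand Q I J = C.coeff I J :=
  if_pos ⟨hI, hJ, h⟩

theorem BasedComplex.strand_eq_zero {C : BasedComplex a} {Q : Cell a → Prop} {I J : Cell a}
    (h : ¬ (Q I ∧ Q J ∧ C.Edge I J)) : C.strand Q I J = 0 :=
  if_neg h

/-- A strand is exact in the degrees in which an acyclic matching has no critical cell. -/
theorem BasedComplex.exactAbove_of_matching {C : BasedComplex a} {Q : Cell a → Prop} {d : ℕ}
    {N : Matching a} (h : IsMatrixMatching Finset.card (C.strand Q) N)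
    (hc : ∀ I, Q I → I ∈ C.basis → d ≤ I.card → ¬ IsCritical N I) : C.ExactAbove Q d := by
  refine ⟨h.sq, fun Z hZ hZD => ?_⟩
  have hm := h.isMorseData
  apply hm.exact_of_no_critical Z hZD
  have hN : ∀ e ∈ N, Q e.1 ∧ Q e.2 ∧ C.Edge e.1 e.2 := fun e he =>
    strand_ne_zero (h.invertible e he).ne_zero
  have hV : ∀ K L, unmatchedPart (C.strand Q) N K L ≠ 0 → Q K ∧ Q L ∧ C.Edge K L := by
    intro K L hKL
    by_cases h1 : (K, L) ∈ N
    · simp [unmatchedPart, h1] at hKL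
    · simp only [unmatchedPart, h1, if_false] at hKL
      exact strand_ne_zero hKL
  -- Degree bookkeeping: `S` raises the degree by one, `V S` preserves it and the differential
  -- lowers it by one, so the correction term again lives in degrees at least `d`, where no cell is
  -- critical.
  have h1 : SuppIn (fun J => Q J ∧ J ∈ C.basis ∧ d + 1 ≤ J.card)
      (Z * matchedInv (C.strand Q) N) := by
    refine hZ.mul fun K J hK hKJ => ?_
    have := hN _ (h.inv_step hKJ)
    exact ⟨this.1, this.2.2.1, by have := this.2.2.2.2.1; simp only at this; omega⟩
  have h2 : SuppIn (fun J => Q J ∧ J ∈ C.basis ∧ d + 1 ≤ J.card)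
      (Z * matchedInv (C.strand Q) N * matchedSum (C.strand Q) N) := by
    refine h1.mul_sum (fun K J hK hKJ => ?_) _
    rw [Matrix.neg_apply, neg_ne_zero, Matrix.mul_apply] at hKJ
    obtain ⟨L, -, hL⟩ := Finset.exists_ne_zero_of_sum_ne_zero hKJ
    have e1 := hV _ _ (left_ne_zero_of_mul hL)
    have e2 := hN _ (h.inv_step (right_ne_zero_of_mul hL))
    refine ⟨e2.1, e2.2.2.1, ?_⟩
    have e3 := e1.2.2.2.2.1
    have e4 := e2.2.2.2.2.1
    simp only at e4
    omega
  have h3 : SuppIn (fun J => Q J ∧ J ∈ C.basis ∧ d ≤ J.card)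
      (Z * matchedInv (C.strand Q) N * matchedSum (C.strand Q) N * C.strand Q) := by
    refine h2.mul fun K J hK hKJ => ?_
    have e1 := strand_ne_zero hKJ
    exact ⟨e1.2.1, e1.2.2.2.1, by have := e1.2.2.2.2.1; omega⟩
  have h4 := hZ.sub h3
  rw [h.proj_eq]
  refine Matrix.ext fun I J => ?_
  rw [Matrix.mul_diagonal, Matrix.zero_apply]
  by_cases hJ : (Z - Z * matchedInv (C.strand Q) N * matchedSum (C.strand Q) N * C.strand Q) I J = 0
  · rw [hJ, zero_mul]
  · obtain ⟨q1, q2, q3⟩ := h4 I J hJ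
    rw [if_neg (hc J q1 q2 q3), mul_zero]

section Morse

variable {C : BasedComplex a} {N : Matching a} {Q : Cell a → Prop}

/-- The edges of a matching between cells satisfying `Q`. -/
def restrictMatching (N : Matching a) (Q : Cell a → Prop) : Matching a :=
  N.filter fun e => Q e.1 ∧ Q e.2

theorem isMatrixMatching_strand (hN : C.IsAcyclicMatching N)
    (sq : C.strand Q * C.strand Q = 0) :
    IsMatrixMatching Finset.card (C.strand Q) (restrictMatching N Q) where
  sq := sq
  deg_eq I J h := (BasedComplex.strand_ne_zero h).2.2.2.2.1
  matching e he f hf := hN.matching e (Finset.mem_filter.1 he).1 f (Finset.mem_filter.1 hf).1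
  invertible e he := by
    obtain ⟨h1, h2, h3⟩ := Finset.mem_filter.1 he
    rw [BasedComplex.strand_eq h2 h3 (hN.edge e h1)]
    exact hN.invertible e h1
  acyclic I h := by
    refine hN.acyclic I (Relation.TransGen.mono ?_ _ _ h)
    rintro K J (⟨h1, h2⟩ | h1)
    · obtain ⟨q1, q2, q3⟩ := BasedComplex.strand_ne_zero h1
      exact Or.inl ⟨q3, fun h' => h2 (Finset.mem_filter.2 ⟨h', q1, q2⟩)⟩
    · exact Or.inr (Finset.mem_filter.1 h1).1

theorem weight_strand (hN : C.IsAcyclicMatching N) {I J : Cell a} (hI : Q I) (hJ : Q J) :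
    (unmatchedPart (C.strand Q) (restrictMatching N Q) -
      matchedInv (C.strand Q) (restrictMatching N Q)) I J = C.weight N I J := by
  have hm : ∀ {I J}, Q I → Q J → ((I, J) ∈ restrictMatching N Q ↔ (I, J) ∈ N) := fun h1 h2 =>
    ⟨fun h => (Finset.mem_filter.1 h).1, fun h => Finset.mem_filter.2 ⟨h, h1, h2⟩⟩
  simp only [Matrix.sub_apply, unmatchedPart, matchedInv, BasedComplex.weight, hm hI hJ, hm hJ hI]
  by_cases h1 : (J, I) ∈ N
  · have e1 := hN.edge _ h1
    have e2 : ¬ C.Edge I J := fun h => by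
      have := h.2.2.1; have := e1.2.2.1; simp only at this; omega
    have e3 : C.strand Q I J = 0 := if_neg fun h => e2 h.2.2
    simp only [if_pos h1, e3, BasedComplex.strand_eq hJ hI e1]
    simp
  · simp only [if_neg h1, sub_zero]
    by_cases h2 : (I, J) ∈ N
    · simp [h2]
    · by_cases h3 : C.Edge I J
      · simp [h2, h3, BasedComplex.strand_eq hI hJ h3]
      · simp [h3, BasedComplex.strand]

theorem weight_ne_zero_step {I J : Cell a} (h : C.weight N I J ≠ 0) : C.Step N I J := by
  unfold BasedComplex.weight at h
  split_ifs at h with h1 h2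
  · exact Or.inr h1
  · exact Or.inl h2
  · exact absurd rfl h

theorem weight_pow_ne_zero {l : ℕ} {I J : Cell a} (h : (C.weight N ^ l) I J ≠ 0) :
    Relation.ReflTransGen (C.Step N) I J := by
  induction l generalizing J with
  | zero =>
    rw [pow_zero, Matrix.one_apply] at h
    have : I = J := by by_contra h'; simp [h'] at h
    rw [this]
  | succ l ih =>
    rw [pow_succ, Matrix.mul_apply] at h
    obtain ⟨K, -, hK⟩ := Finset.exists_ne_zero_of_sum_ne_zero h
    exact (ih (left_ne_zero_of_mul hK)).tail (weight_ne_zero_step (right_ne_zero_of_mul hK))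

/-- `hconv` is what makes a strand independent of its surroundings: a path between two cells of `Q`
never leaves `Q`, so path weights can be computed inside the strand. -/
theorem weight_pow_strand (hN : C.IsAcyclicMatching N)
    (hconv : ∀ I K J, Q I → Q J → Relation.ReflTransGen (C.Step N) I K →
      Relation.ReflTransGen (C.Step N) K J → Q K) (l : ℕ) {I J : Cell a} (hI : Q I) (hJ : Q J) :
    ((unmatchedPart (C.strand Q) (restrictMatching N Q) -
      matchedInv (C.strand Q) (restrictMatching N Q)) ^ l) I J = (C.weight N ^ l) I J := by
  induction l generalizing J with
  | zero => simp
  | succ l ih =>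
    rw [pow_succ, pow_succ, Matrix.mul_apply, Matrix.mul_apply]
    refine Finset.sum_congr rfl fun K _ => ?_
    by_cases hK : Q K
    · rw [ih hK, weight_strand hN hK hJ]
    · have e1 : (unmatchedPart (C.strand Q) (restrictMatching N Q) -
          matchedInv (C.strand Q) (restrictMatching N Q)) K J = 0 := by
        have : (J, K) ∉ restrictMatching N Q := fun h => hK (Finset.mem_filter.1 h).2.2
        simp [unmatchedPart, matchedInv, BasedComplex.strand, hK, this]
      rw [e1, mul_zero]
      by_contra h
      have h' := Ne.symm h
      exact hK (hconv I K J hI hJ (weight_pow_ne_zero (left_ne_zero_of_mul h'))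
        (.single (weight_ne_zero_step (right_ne_zero_of_mul h'))))

theorem pow_apply_eq_zero_of_row {X R : Type*} [Fintype X] [DecidableEq X] [CommRing R]
    {W : Matrix X X R} {I J : X} (hne : I ≠ J) (h : (∀ K, W I K = 0) ∨ (∀ K, W K J = 0)) (l : ℕ) :
    (W ^ l) I J = 0 := by
  cases l with
  | zero => simp [hne]
  | succ l =>
    rcases h with h | h
    · rw [pow_succ', Matrix.mul_apply]; exact Finset.sum_eq_zero fun K _ => by rw [h, zero_mul]
    · rw [pow_succ, Matrix.mul_apply]; exact Finset.sum_eq_zero fun K _ => by rw [h, mul_zero]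

/-- Passing to the Morse complex commutes with restriction to `Q`. By `hQ` a matched pair lies in
`Q` entirely or not at all, so being critical means the same in both settings; by `hconv` the paths
are the same. -/
theorem strand_morse (hN : C.IsAcyclicMatching N) (sq : C.strand Q * C.strand Q = 0)
    (hQ : ∀ e ∈ N, Q e.1 ↔ Q e.2)
    (hconv : ∀ I K J, Q I → Q J → Relation.ReflTransGen (C.Step N) I K →
      Relation.ReflTransGen (C.Step N) K J → Q K) :
    (C.morse N).strand Q = morseDiff (unmatchedPart (C.strand Q) (restrictMatching N Q))
      (matchedInv (C.strand Q) (restrictMatching N Q))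
      (matchedPart (C.strand Q) (restrictMatching N Q))
      (matchedSum (C.strand Q) (restrictMatching N Q)) := by
  have h := isMatrixMatching_strand hN sq
  rw [← h.dropPart_pathSum, h.proj_eq]
  refine Matrix.ext fun I J => ?_
  rw [Matrix.mul_diagonal]
  simp only [dropPart, Matrix.diagonal_mul]
  set w := unmatchedPart (C.strand Q) (restrictMatching N Q) -
      matchedInv (C.strand Q) (restrictMatching N Q) with hw
  have hcrit : ∀ I, Q I → (IsCritical (restrictMatching N Q) I ↔ IsCritical N I) := by
    intro I hI
    refine ⟨fun hc e he => ?_, fun hc e he => hc e (Finset.mem_filter.1 he).1⟩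
    refine ⟨fun h' => ?_, fun h' => ?_⟩
    · have q : Q e.1 := h' ▸ hI
      exact (hc e (Finset.mem_filter.2 ⟨he, q, (hQ e he).1 q⟩)).1 h'
    · have q : Q e.2 := h' ▸ hI
      exact (hc e (Finset.mem_filter.2 ⟨he, (hQ e he).2 q, q⟩)).2 h'
  -- Cells outside the strand have zero rows and columns, so path sums that begin or end there
  -- vanish.
  have hout : ∀ K, ¬ (Q K ∧ K ∈ C.basis) → (∀ L, w K L = 0) ∧ (∀ L, w L K = 0) := by
    intro K hK
    have hs : ∀ L, C.strand Q K L = 0 ∧ C.strand Q L K = 0 := fun L =>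
      ⟨BasedComplex.strand_eq_zero fun h' => hK ⟨h'.1, h'.2.2.1⟩, BasedComplex.strand_eq_zero fun h' => hK ⟨h'.2.1, h'.2.2.2.1⟩⟩
    constructor
    · intro L
      simp only [hw, Matrix.sub_apply, unmatchedPart, matchedInv, (hs L).1, (hs L).2]
      simp
    · intro L
      simp only [hw, Matrix.sub_apply, unmatchedPart, matchedInv, (hs L).1, (hs L).2]
      simp
  by_cases hcard : I.card = J.card + 1
  · have hne : I ≠ J := fun h' => by rw [h'] at hcard; omega
    rw [if_pos (by exact_mod_cast hcard), Matrix.sum_apply]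
    by_cases hI : Q I ∧ I ∈ C.basis
    · by_cases hJ : Q J ∧ J ∈ C.basis
      · have hsum : ∑ l ∈ Finset.range (Fintype.card (Cell a)), (w ^ l) I J = C.pathSum N I J := by
          rw [BasedComplex.pathSum, Matrix.sum_apply]
          exact Finset.sum_congr rfl fun l _ => weight_pow_strand hN hconv l hI.1 hJ.1
        rw [hsum]
        simp only [hcrit I hI.1, hcrit J hJ.1]
        have hco : (C.morse N).coeff I J = C.pathSum N I J := if_pos hcard
        by_cases c1 : IsCritical N I
        · by_cases c2 : IsCritical N J
          · rw [if_pos c1, if_pos c2, one_mul, mul_one]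
            by_cases h0 : C.pathSum N I J = 0
            · rw [h0]
              refine BasedComplex.strand_eq_zero fun h' => ?_
              exact h'.2.2.2.2.2 (hco.trans h0)
            · rw [BasedComplex.strand_eq hI.1 hJ.1, hco]
              exact ⟨Finset.mem_filter.2 ⟨hI.2, c1⟩, Finset.mem_filter.2 ⟨hJ.2, c2⟩, hcard,
                by rw [hco]; exact h0⟩
          · rw [if_neg c2, mul_zero]
            exact BasedComplex.strand_eq_zero fun h' => c2 (Finset.mem_filter.1 h'.2.2.2.1).2
        · rw [if_neg c1, zero_mul, zero_mul]
          exact BasedComplex.strand_eq_zero fun h' => c1 (Finset.mem_filter.1 h'.2.2.1).2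
      · rw [Finset.sum_eq_zero fun l _ => pow_apply_eq_zero_of_row hne (Or.inr (hout J hJ).2) l]
        rw [mul_zero, zero_mul]
        exact BasedComplex.strand_eq_zero fun h' => hJ ⟨h'.2.1, (Finset.mem_filter.1 h'.2.2.2.1).1⟩
    · rw [Finset.sum_eq_zero fun l _ => pow_apply_eq_zero_of_row hne (Or.inl (hout I hI).1) l]
      rw [mul_zero, zero_mul]
      exact BasedComplex.strand_eq_zero fun h' => hI ⟨h'.1, (Finset.mem_filter.1 h'.2.2.1).1⟩
  · rw [if_neg (by exact_mod_cast hcard), zero_mul]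
    exact BasedComplex.strand_eq_zero fun h' => hcard h'.2.2.2.2.1

/-- Exactness of a strand passes to the Morse complex. -/
theorem BasedComplex.ExactAbove.morse {d : ℕ} (hC : C.ExactAbove Q d) (hN : C.IsAcyclicMatching N)
    (hQ : ∀ e ∈ N, Q e.1 ↔ Q e.2)
    (hconv : ∀ I K J, Q I → Q J → Relation.ReflTransGen (C.Step N) I K →
      Relation.ReflTransGen (C.Step N) K J → Q K) : (C.morse N).ExactAbove Q d := by
  have h := isMatrixMatching_strand hN hC.sq
  have hm := h.isMorseData
  have hs := strand_morse hN hC.sq hQ hconv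
  refine ⟨by rw [hs]; exact hm.morseDiff_sq, fun Z hZ hZD => ?_⟩
  rw [hs] at hZD ⊢
  have hcrit : ∀ J, J ∈ (C.morse N).basis → IsCritical (restrictMatching N Q) J := fun J hJ e he =>
    (Finset.mem_filter.1 hJ).2 e (Finset.mem_filter.1 he).1
  have hS : Z * matchedInv (C.strand Q) (restrictMatching N Q) = 0 := by
    refine Matrix.ext fun I J => ?_
    rw [Matrix.mul_apply, Matrix.zero_apply]
    refine Finset.sum_eq_zero fun K _ => ?_
    by_contra hne
    exact (hcrit K (hZ _ _ (left_ne_zero_of_mul hne)).2.1 _ (h.inv_step (right_ne_zero_of_mul hne))).2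
      rfl
  have hE : Z * matchedPart (C.strand Q) (restrictMatching N Q) = 0 := by
    refine Matrix.ext fun I J => ?_
    rw [Matrix.mul_apply, Matrix.zero_apply]
    refine Finset.sum_eq_zero fun K _ => ?_
    by_contra hne
    have hmem : (K, J) ∈ restrictMatching N Q := by
      by_contra h'
      exact right_ne_zero_of_mul hne (if_neg h')
    exact (hcrit K (hZ _ _ (left_ne_zero_of_mul hne)).2.1 _ hmem).1 rfl
  have hG := hm.G_mul_D Z hS hE
  rw [hZD, zero_mul] at hG
  have hZ' : SuppIn (fun J => Q J ∧ J ∈ C.basis ∧ d ≤ J.card) Z := fun I J hIJ =>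
    ⟨(hZ I J hIJ).1, (Finset.mem_filter.1 (hZ I J hIJ).2.1).1, (hZ I J hIJ).2.2⟩
  have hsupp : SuppIn (fun J => Q J ∧ J ∈ C.basis ∧ d ≤ J.card)
      (Z * matchedSum (C.strand Q) (restrictMatching N Q)) := by
    refine hZ'.mul_sum (fun K J hK hKJ => ?_) _
    rw [Matrix.neg_apply, neg_ne_zero, Matrix.mul_apply] at hKJ
    obtain ⟨L, -, hL⟩ := Finset.exists_ne_zero_of_sum_ne_zero hKJ
    have e1 : K.card = L.card + 1 := by
      have := left_ne_zero_of_mul hL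
      by_cases h1 : (K, L) ∈ restrictMatching N Q
      · simp [unmatchedPart, h1] at this
      · simp only [unmatchedPart, h1, if_false] at this
        exact (strand_ne_zero this).2.2.2.2.1
    have e2 := h.inv_step (right_ne_zero_of_mul hL)
    have e3 := hN.edge _ (Finset.mem_filter.1 e2).1
    exact ⟨(Finset.mem_filter.1 e2).2.1, e3.1, by have := e3.2.2.1; simp only at this; omega⟩
  obtain ⟨Y, hY⟩ := hC.exact _ hsupp hG
  exact hm.exact_transfer Z Y hS hY

/-- A strand that is exact in high degrees and has zero differential has no cell there. -/
theorem BasedComplex.ExactAbove.card_lt {d : ℕ} (hC : C.ExactAbove Q d) (h0 : C.strand Q = 0)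
    {I : Cell a} (hI : I ∈ C.basis) (hQ : Q I) : I.card < d := by
  by_contra hd
  -- Since the differential is zero, the cell `I` itself is a cycle; exactness would make it a
  -- boundary, but all boundaries vanish.
  obtain ⟨Y, hY⟩ := hC.exact (Matrix.single I I 1) (by
    intro K J hKJ
    have : J = I := by
      by_contra hne
      exact hKJ (Matrix.single_apply_of_col_ne _ _ (Ne.symm hne) _)
    subst this
    exact ⟨hQ, hI, not_lt.1 hd⟩) (by rw [h0, mul_zero])
  rw [h0, mul_zero] at hY
  have := congrFun (congrFun hY I) I
  simp at this

end Morse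

end MonomialRing

end

set_option linter.unusedSectionVars false
noncomputable section
open MvPolynomial
open scoped Classical TensorProduct

namespace MonomialRing

universe u v

/-! ### Sets of generators as graphs: components and vertex counts -/

section Cells

variable {k : Type u} [Field k] {σ : Type v} [Fintype σ] {a : Ideal (MvPolynomial σ k)}

/-- The minimal generators are squarefree quadratic monomials. -/
def IsEdgeIdeal (a : Ideal (MvPolynomial σ k)) : Prop :=
  ∀ m ∈ minGens a, ∃ i j, i ≠ j ∧ m = edgeMon i j

/-- The variables that divide `m_I`. -/
def verts (I : Cell a) : Finset σ := (lcmOf I).support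

theorem mem_verts {I : Cell a} {p : σ} : p ∈ verts I ↔ ∃ m ∈ I, p ∈ (m : σ →₀ ℕ).support := by
  induction I using Finset.induction_on with
  | empty => simp [verts, lcmOf, bot_eq_zero]
  | insert m I hm ih =>
    have : lcmOf (insert m I) = (m : σ →₀ ℕ) ⊔ lcmOf I := by simp [lcmOf, Finset.sup_insert]
    rw [verts, this, Finsupp.support_sup, Finset.mem_union]
    simp only [Finset.mem_insert, exists_eq_or_imp]
    rw [← ih]
    rfl

theorem verts_union (I K : Cell a) : verts (I ∪ K) = verts I ∪ verts K := by
  ext p; simp only [mem_verts, Finset.mem_union]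
  constructor
  · rintro ⟨m, h1 | h1, h2⟩
    exacts [Or.inl ⟨m, h1, h2⟩, Or.inr ⟨m, h1, h2⟩]
  · rintro (⟨m, h1, h2⟩ | ⟨m, h1, h2⟩)
    exacts [⟨m, Or.inl h1, h2⟩, ⟨m, Or.inr h1, h2⟩]

theorem verts_mono {I K : Cell a} (h : I ⊆ K) : verts I ⊆ verts K := by
  intro p hp
  obtain ⟨m, h1, h2⟩ := mem_verts.1 hp
  exact mem_verts.2 ⟨m, h h1, h2⟩

@[simp] theorem verts_empty : verts (∅ : Cell a) = ∅ := by
  ext p; simp [mem_verts]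

theorem isCoprimeMon_iff {α β : σ →₀ ℕ} : IsCoprimeMon α β ↔ Disjoint α.support β.support := by
  rw [IsCoprimeMon, ← Finsupp.support_eq_empty, Finsupp.support_inf, Finset.disjoint_iff_inter_eq_empty]

theorem isCoprimeMon_lcm {I K : Cell a} :
    IsCoprimeMon (lcmOf I) (lcmOf K) ↔ Disjoint (verts I) (verts K) := isCoprimeMon_iff

theorem edgeMon_support {i j : σ} : (edgeMon i j).support = {i, j} := by
  ext p
  simp only [edgeMon, Finsupp.mem_support_iff, Finsupp.add_apply, Finsupp.single_apply,
    Finset.mem_insert, Finset.mem_singleton]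
  rw [eq_comm (a := p), eq_comm (a := p)]
  by_cases h1 : i = p <;> by_cases h2 : j = p <;> simp [h1, h2]

theorem edgeMon_comm (i j : σ) : edgeMon i j = edgeMon j i := add_comm _ _

theorem edgeMon_inj {i j i' j' : σ} (hij : i ≠ j) (h : edgeMon i j = edgeMon i' j') :
    s(i, j) = s(i', j') := by
  have h1 : ({i, j} : Finset σ) = {i', j'} := by rw [← edgeMon_support, h, edgeMon_support]
  have hi : i ∈ ({i', j'} : Finset σ) := by rw [← h1]; simp
  have hj : j ∈ ({i', j'} : Finset σ) := by rw [← h1]; simp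
  simp only [Finset.mem_insert, Finset.mem_singleton] at hi hj
  rw [Sym2.eq_iff]
  rcases hi with rfl | rfl <;> rcases hj with rfl | rfl
  · exact absurd rfl hij
  · exact Or.inl ⟨rfl, rfl⟩
  · exact Or.inr ⟨rfl, rfl⟩
  · exact absurd rfl hij

theorem edgeMon_le_one {i j : σ} (hij : i ≠ j) (p : σ) : edgeMon i j p ≤ 1 := by
  simp only [edgeMon, Finsupp.add_apply, Finsupp.single_apply]
  split_ifs with h1 h2
  · exact absurd (h1.trans h2.symm) hij
  all_goals simp

variable (ha : IsEdgeIdeal a)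
include ha

theorem exists_edge (m : minGens a) : ∃ i j, i ≠ j ∧ (m : σ →₀ ℕ) = edgeMon i j := ha m.1 m.2

theorem lcmOf_le_one (I : Cell a) (p : σ) : lcmOf I p ≤ 1 := by
  induction I using Finset.induction_on with
  | empty => simp [lcmOf, bot_eq_zero]
  | insert m I hm ih =>
    have : lcmOf (insert m I) = (m : σ →₀ ℕ) ⊔ lcmOf I := by simp [lcmOf, Finset.sup_insert]
    rw [this, Finsupp.sup_apply]
    obtain ⟨i, j, hij, h⟩ := exists_edge ha m
    rw [h]
    exact sup_le (edgeMon_le_one hij p) ih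

theorem lcmOf_apply (I : Cell a) (p : σ) : lcmOf I p = if p ∈ verts I then 1 else 0 := by
  have := lcmOf_le_one ha I p
  split_ifs with h
  · have := Finsupp.mem_support_iff.1 h; omega
  · exact Finsupp.notMem_support_iff.1 h

theorem lcmOf_eq_iff {I J : Cell a} : lcmOf I = lcmOf J ↔ verts I = verts J := by
  constructor
  · intro h; rw [verts, h, verts]
  · intro h; ext p; rw [lcmOf_apply ha, lcmOf_apply ha, h]

theorem degree_lcmOf (I : Cell a) : (lcmOf I).degree = (verts I).card := by
  rw [Finsupp.degree_apply, Finset.card_eq_sum_ones]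
  refine Finset.sum_congr rfl fun p hp => ?_
  rw [lcmOf_apply ha, if_pos hp]

theorem lcmOf_union {I K : Cell a} (h : Disjoint (verts I) (verts K)) :
    lcmOf (I ∪ K) = lcmOf I + lcmOf K := by
  ext p
  rw [Finsupp.add_apply, lcmOf_apply ha, lcmOf_apply ha, lcmOf_apply ha]
  simp only [verts_union, Finset.mem_union]
  have := Finset.disjoint_left.1 h
  by_cases h1 : p ∈ verts I <;> by_cases h2 : p ∈ verts K <;> simp [h1, h2]
  exact this h1 h2

theorem support_nonempty (m : minGens a) : (m : σ →₀ ℕ).support.Nonempty := by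
  obtain ⟨i, j, hij, h⟩ := exists_edge ha m
  rw [h, edgeMon_support]; simp

theorem verts_eq_empty {I : Cell a} : verts I = ∅ ↔ I = ∅ := by
  refine ⟨fun h => ?_, fun h => by rw [h, verts_empty]⟩
  by_contra hI
  obtain ⟨m, hm⟩ := Finset.nonempty_iff_ne_empty.2 hI
  obtain ⟨p, hp⟩ := support_nonempty ha m
  have : p ∈ verts I := mem_verts.2 ⟨m, hm, hp⟩
  simp [h] at this

theorem disjoint_of_verts {I K : Cell a} (h : Disjoint (verts I) (verts K)) : Disjoint I K := by
  rw [Finset.disjoint_left]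
  intro m h1 h2
  obtain ⟨p, hp⟩ := support_nonempty ha m
  exact Finset.disjoint_left.1 h (mem_verts.2 ⟨m, h1, hp⟩) (mem_verts.2 ⟨m, h2, hp⟩)

/-- Any two variables of a generator in `I` are joined in the graph of `I`. -/
theorem reachable_of_mem {I : Cell a} {m : minGens a} (hm : m ∈ I) {p q : σ}
    (hp : p ∈ (m : σ →₀ ℕ).support) (hq : q ∈ (m : σ →₀ ℕ).support) :
    (cellGraph I).Reachable p q := by
  obtain ⟨i, j, hij, h⟩ := exists_edge ha m
  rw [h, edgeMon_support] at hp hq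
  have hadj : (cellGraph I).Adj i j := ⟨hij, m, hm, h⟩
  simp only [Finset.mem_insert, Finset.mem_singleton] at hp hq
  rcases hp with rfl | rfl <;> rcases hq with rfl | rfl
  exacts [.refl _, hadj.reachable, hadj.reachable.symm, .refl _]

omit ha in
theorem adj_exists {I : Cell a} {p q : σ} (h : (cellGraph I).Adj p q) :
    ∃ m ∈ I, p ∈ (m : σ →₀ ℕ).support ∧ q ∈ (m : σ →₀ ℕ).support := by
  obtain ⟨-, m, hm, h⟩ := h
  exact ⟨m, hm, by rw [h, edgeMon_support]; simp, by rw [h, edgeMon_support]; simp⟩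

omit ha in
theorem cellGraph_mono {I J : Cell a} (h : I ⊆ J) : cellGraph I ≤ cellGraph J := by
  rintro p q ⟨h1, m, hm, h2⟩
  exact ⟨h1, m, h hm, h2⟩

/-- The classes of generators are the connected components of the graph with the generators as
edges: generators with a common variable are joined through it, and consecutive edges of a walk
share a variable. -/
theorem quot_eq_iff {I : Cell a} (x y : I) :
    (Quot.mk (fun m n : I => ¬ IsCoprimeMon (m.1 : σ →₀ ℕ) (n.1 : σ →₀ ℕ)) x = Quot.mk _ y) ↔
      ∀ p ∈ (x.1 : σ →₀ ℕ).support, ∀ q ∈ (y.1 : σ →₀ ℕ).support, (cellGraph I).Reachable p q := by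
  constructor
  · intro h
    have h' := Quot.eqvGen_exact h
    clear h
    induction h' with
    | rel x y h =>
      rw [isCoprimeMon_iff, Finset.not_disjoint_iff] at h
      obtain ⟨s, h1, h2⟩ := h
      intro p hp q hq
      exact (reachable_of_mem ha x.2 hp h1).trans (reachable_of_mem ha y.2 h2 hq)
    | refl x => exact fun p hp q hq => reachable_of_mem ha x.2 hp hq
    | symm x y _ ih => exact fun p hp q hq => (ih q hq p hp).symm
    | trans x y z _ _ ih1 ih2 =>
      intro p hp q hq
      obtain ⟨s, hs⟩ := support_nonempty ha y.1
      exact (ih1 p hp s hs).trans (ih2 s hs q hq)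
  · intro h
    obtain ⟨p, hp⟩ := support_nonempty ha x.1
    obtain ⟨q, hq⟩ := support_nonempty ha y.1
    obtain ⟨w⟩ := h p hp q hq
    clear h
    induction w generalizing x with
    | nil =>
      apply Quot.sound
      rw [isCoprimeMon_iff, Finset.not_disjoint_iff]
      exact ⟨_, hp, hq⟩
    | cons hadj w ih =>
      obtain ⟨m, hm, h1, h2⟩ := adj_exists hadj
      refine Eq.trans (Quot.sound ?_) (ih ⟨m, hm⟩ h2 hq)
      rw [isCoprimeMon_iff, Finset.not_disjoint_iff]
      exact ⟨_, hp, h1⟩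

theorem cl_eq_one_iff {I : Cell a} : cl I = 1 ↔
    I.Nonempty ∧ ∀ p ∈ verts I, ∀ q ∈ verts I, (cellGraph I).Reachable p q := by
  rw [cl, Nat.card_eq_one_iff_unique]
  constructor
  · rintro ⟨h1, ⟨h2⟩⟩
    induction h2 using Quot.ind with | mk x =>
    refine ⟨⟨x.1, x.2⟩, fun p hp q hq => ?_⟩
    obtain ⟨m, hm, hp⟩ := mem_verts.1 hp
    obtain ⟨n, hn, hq⟩ := mem_verts.1 hq
    exact (quot_eq_iff ha ⟨m, hm⟩ ⟨n, hn⟩).1 (Subsingleton.elim _ _) p hp q hq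
  · rintro ⟨⟨x, hx⟩, h⟩
    refine ⟨⟨fun y z => ?_⟩, ⟨Quot.mk _ ⟨x, hx⟩⟩⟩
    induction y using Quot.ind with | mk y =>
    induction z using Quot.ind with | mk z =>
    exact (quot_eq_iff ha y z).2 fun p hp q hq =>
      h p (mem_verts.2 ⟨y, y.2, hp⟩) q (mem_verts.2 ⟨z, z.2, hq⟩)

omit ha in
@[simp] theorem cl_empty : cl (∅ : Cell a) = 0 := by
  rw [cl, Nat.card_eq_zero]
  left
  refine ⟨fun q => ?_⟩
  obtain ⟨x, -⟩ := Quot.exists_rep q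
  exact Finset.notMem_empty _ x.2

theorem cl_pos {I : Cell a} (h : I.Nonempty) : 0 < cl I := by
  obtain ⟨x, hx⟩ := h
  have : Nonempty (Quot fun m n : I => ¬ IsCoprimeMon (m.1 : σ →₀ ℕ) (n.1 : σ →₀ ℕ)) :=
    ⟨Quot.mk _ ⟨x, hx⟩⟩
  exact Nat.card_pos

/-- A walk starting in a part of `I` that is disjoint from the rest stays there. -/
theorem reachable_union {I K : Cell a} (h : Disjoint (verts I) (verts K)) {p q : σ}
    (hp : p ∈ verts I) (hr : (cellGraph (I ∪ K)).Reachable p q) :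
    q ∈ verts I ∧ (cellGraph I).Reachable p q := by
  obtain ⟨w⟩ := hr
  induction w with
  | nil => exact ⟨hp, .refl _⟩
  | @cons s t _ hadj w ih =>
    obtain ⟨h1, m, hm, h2⟩ := hadj
    have hs : s ∈ (m : σ →₀ ℕ).support := by
      rw [h2, edgeMon_support]; exact Finset.mem_insert_self _ _
    have hmI : m ∈ I := by
      rcases Finset.mem_union.1 hm with h3 | h3
      · exact h3
      · exact absurd (mem_verts.2 ⟨m, h3, hs⟩) (Finset.disjoint_left.1 h hp)
    have ht : t ∈ (m : σ →₀ ℕ).support := by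
      rw [h2, edgeMon_support]; exact Finset.mem_insert_of_mem (Finset.mem_singleton_self _)
    have hq := mem_verts.2 ⟨m, hmI, ht⟩
    obtain ⟨e1, e2⟩ := ih hq
    have hadj : (cellGraph I).Adj s t := ⟨h1, m, hmI, h2⟩
    exact ⟨e1, hadj.reachable.trans e2⟩

/-- No walk crosses between coprime parts, so the classes of the union are those of the two parts
side by side. -/
theorem cl_union {I K : Cell a} (h : Disjoint (verts I) (verts K)) : cl (I ∪ K) = cl I + cl K := by
  have h' : Disjoint (verts K) (verts I) := h.symm
  unfold cl
  rw [← Nat.card_sum]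
  symm
  refine Nat.card_congr (Equiv.ofBijective (Sum.elim
    (Quot.map (fun x : I => (⟨x.1, Finset.mem_union_left _ x.2⟩ : (I ∪ K : Cell a))) fun _ _ h => h)
    (Quot.map (fun x : K => (⟨x.1, Finset.mem_union_right _ x.2⟩ : (I ∪ K : Cell a)))
      fun _ _ h => h)) ⟨?_, ?_⟩)
  · rintro (x | x) (y | y) hxy
    all_goals
      obtain ⟨x, rfl⟩ := Quot.exists_rep x
      obtain ⟨y, rfl⟩ := Quot.exists_rep y
      have hxy' := (quot_eq_iff ha _ _).1 hxy
      clear hxy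
    · congr 1
      refine (quot_eq_iff ha _ _).2 fun p hp q hq => ?_
      exact (reachable_union ha h (mem_verts.2 ⟨x, x.2, hp⟩) (hxy' p hp q hq)).2
    · obtain ⟨p, hp⟩ := support_nonempty ha x.1
      obtain ⟨q, hq⟩ := support_nonempty ha y.1
      have := (reachable_union ha h (mem_verts.2 ⟨x, x.2, hp⟩) (hxy' p hp q hq)).1
      exact absurd (mem_verts.2 ⟨y, y.2, hq⟩) (Finset.disjoint_left.1 h this)
    · obtain ⟨p, hp⟩ := support_nonempty ha x.1
      obtain ⟨q, hq⟩ := support_nonempty ha y.1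
      have := (reachable_union ha h (mem_verts.2 ⟨y, y.2, hq⟩) (hxy' p hp q hq).symm).1
      exact absurd (mem_verts.2 ⟨x, x.2, hp⟩) (Finset.disjoint_left.1 h this)
    · congr 1
      refine (quot_eq_iff ha _ _).2 fun p hp q hq => ?_
      have h3 := hxy' p hp q hq
      rw [Finset.union_comm] at h3
      exact (reachable_union ha h' (mem_verts.2 ⟨x, x.2, hp⟩) h3).2
  · intro z
    induction z using Quot.ind with | mk z =>
    rcases Finset.mem_union.1 z.2 with hz | hz
    · exact ⟨Sum.inl (Quot.mk _ ⟨z.1, hz⟩), rfl⟩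
    · exact ⟨Sum.inr (Quot.mk _ ⟨z.1, hz⟩), rfl⟩

/-- `D` is one of the classes of `I`. -/
structure IsComp (I D : Cell a) : Prop where
  subset : D ⊆ I
  conn : cl D = 1
  disj : Disjoint (verts D) (verts (I \ D))

theorem exists_comp {I : Cell a} {m : minGens a} (hm : m ∈ I) : ∃ D, IsComp I D ∧ m ∈ D := by
  obtain ⟨p, hp⟩ := support_nonempty ha m
  set D : Cell a := I.filter fun n => ∃ q ∈ (n : σ →₀ ℕ).support, (cellGraph I).Reachable p q with hD
  have hmD : m ∈ D := Finset.mem_filter.2 ⟨hm, p, hp, .refl _⟩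
  have hall : ∀ q ∈ verts D, (cellGraph I).Reachable p q := by
    intro q hq
    obtain ⟨n, hn, hq⟩ := mem_verts.1 hq
    obtain ⟨hn1, s, hs, hr⟩ := Finset.mem_filter.1 hn
    exact hr.trans (reachable_of_mem ha hn1 hs hq)
  have hdisj : Disjoint (verts D) (verts (I \ D)) := by
    rw [Finset.disjoint_left]
    intro q h1 h2
    obtain ⟨n, hn, hq⟩ := mem_verts.1 h2
    obtain ⟨hn1, hn2⟩ := Finset.mem_sdiff.1 hn
    exact hn2 (Finset.mem_filter.2 ⟨hn1, q, hq, hall q h1⟩)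
  have hun : D ∪ (I \ D) = I := Finset.union_sdiff_of_subset (Finset.filter_subset _ _)
  have hpD : p ∈ verts D := mem_verts.2 ⟨m, hmD, hp⟩
  refine ⟨D, ⟨Finset.filter_subset _ _, ?_, hdisj⟩, hmD⟩
  rw [cl_eq_one_iff ha]
  have h1 : ∀ q ∈ verts D, (cellGraph D).Reachable p q := by
    intro q hq
    have := hall q hq
    rw [← hun] at this
    exact (reachable_union ha hdisj hpD this).2
  exact ⟨⟨m, hmD⟩, fun q hq r hr => (h1 q hq).symm.trans (h1 r hr)⟩

omit ha in
theorem IsComp.union_sdiff {I D : Cell a} (h : IsComp I D) : D ∪ (I \ D) = I :=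
  Finset.union_sdiff_of_subset h.subset

omit ha in
theorem nonempty_of_cl {D : Cell a} (h : cl D = 1) : D.Nonempty := by
  by_contra h'
  rw [Finset.not_nonempty_iff_eq_empty] at h'
  subst h'
  simp at h

theorem IsComp.union {D K : Cell a} (hD : cl D = 1) (h : Disjoint (verts D) (verts K)) :
    IsComp (D ∪ K) D := by
  refine ⟨Finset.subset_union_left, hD, ?_⟩
  rw [Finset.union_sdiff_cancel_left (disjoint_of_verts ha h)]
  exact h

/-- Connected cells inside `D ∪ K` with `D`, `K` coprime lie in one of them. -/
theorem subset_of_conn {D K F : Cell a} (h : Disjoint (verts D) (verts K)) (hF : cl F = 1)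
    (hsub : F ⊆ D ∪ K) : F ⊆ D ∨ F ⊆ K := by
  obtain ⟨hne, hconn⟩ := (cl_eq_one_iff ha).1 hF
  by_contra hcon
  push Not at hcon
  obtain ⟨h1, h2⟩ := hcon
  obtain ⟨x, hx, hxD⟩ := Finset.not_subset.1 h1
  obtain ⟨y, hy, hyK⟩ := Finset.not_subset.1 h2
  have hxK : x ∈ K := (Finset.mem_union.1 (hsub hx)).resolve_left hxD
  have hyD : y ∈ D := (Finset.mem_union.1 (hsub hy)).resolve_right hyK
  obtain ⟨p, hp⟩ := support_nonempty ha x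
  obtain ⟨q, hq⟩ := support_nonempty ha y
  have := (hconn q (mem_verts.2 ⟨y, hy, hq⟩) p (mem_verts.2 ⟨x, hx, hp⟩)).mono (cellGraph_mono hsub)
  have := (reachable_union ha h (mem_verts.2 ⟨y, hyD, hq⟩) this).1
  exact Finset.disjoint_left.1 h this (mem_verts.2 ⟨x, hxK, hp⟩)

/-- A connected cell cannot be spread over two coprime parts. This lets statements about cells be
proved one component at a time. -/
theorem isComp_union_iff {D K F : Cell a} (h : Disjoint (verts D) (verts K)) :
    IsComp (D ∪ K) F ↔ IsComp D F ∨ IsComp K F := by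
  have key : ∀ D K F : Cell a, Disjoint (verts D) (verts K) → IsComp D F → IsComp (D ∪ K) F := by
    intro D K F h hF
    refine ⟨hF.subset.trans Finset.subset_union_left, hF.conn, ?_⟩
    have : (D ∪ K) \ F ⊆ (D \ F) ∪ K := by
      intro x hx
      simp only [Finset.mem_sdiff, Finset.mem_union] at hx ⊢
      tauto
    refine Finset.disjoint_of_subset_right (verts_mono this) ?_
    rw [verts_union, Finset.disjoint_union_right]
    exact ⟨hF.disj, Finset.disjoint_of_subset_left (verts_mono hF.subset) h⟩
  constructor
  · intro hF
    rcases subset_of_conn ha h hF.conn hF.subset with h1 | h1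
    · exact Or.inl ⟨h1, hF.conn, Finset.disjoint_of_subset_right
        (verts_mono (Finset.sdiff_subset_sdiff Finset.subset_union_left le_rfl)) hF.disj⟩
    · exact Or.inr ⟨h1, hF.conn, Finset.disjoint_of_subset_right
        (verts_mono (Finset.sdiff_subset_sdiff Finset.subset_union_right le_rfl)) hF.disj⟩
  · rintro (hF | hF)
    · exact key D K F h hF
    · rw [Finset.union_comm]; exact key K D F h.symm hF

theorem isComp_of_conn {D F : Cell a} (hD : cl D = 1) : IsComp D F ↔ F = D := by
  constructor
  · intro hF
    have h1 := hF.union_sdiff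
    rcases subset_of_conn ha hF.disj hD h1.ge with h2 | h2
    · exact hF.subset.antisymm h2
    · obtain ⟨x, hx⟩ := nonempty_of_cl hF.conn
      exact absurd hx (Finset.mem_sdiff.1 (h2 (hF.subset hx))).2
  · rintro rfl
    exact ⟨le_rfl, hD, by simp⟩

/-- Induction on the classes of a cell. -/
theorem cell_induction {p : Cell a → Prop} (h0 : p ∅)
    (h1 : ∀ D K : Cell a, cl D = 1 → Disjoint (verts D) (verts K) → p K → p (D ∪ K)) (I : Cell a) :
    p I := by
  induction I using Finset.strongInduction with
  | H I ih =>
    rcases I.eq_empty_or_nonempty with rfl | ⟨m, hm⟩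
    · exact h0
    · obtain ⟨D, hD, hmD⟩ := exists_comp ha hm
      rw [← hD.union_sdiff]
      refine h1 D _ hD.conn hD.disj (ih _ ?_)
      exact Finset.sdiff_ssubset hD.subset ⟨m, hmD⟩

/-- The tree identity, summed over the components. The resulting count is what ties the exponent of
`t` in `clSum` to the degree of `m_I`. -/
theorem card_add_cl_of_comp {I : Cell a} (h : ∀ D, IsComp I D → D.card + 1 = (verts D).card) :
    I.card + cl I = (verts I).card := by
  induction I using cell_induction ha with
  | h0 => simp
  | h1 D K hD hdisj ih =>
    rw [Finset.card_union_of_disjoint (disjoint_of_verts ha hdisj), cl_union ha hdisj, verts_union,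
      Finset.card_union_of_disjoint hdisj, ← ih fun F hF => h F ((isComp_union_iff ha hdisj).2 (Or.inr hF)),
      ← h D (IsComp.union ha hD hdisj), hD]
    omega

/-- The graph lives on all variables; restricting it to those that occur removes the isolated
vertices, which would spoil connectedness and the count of vertices. -/
theorem connected_induce {D : Cell a} (h : cl D = 1) :
    ((cellGraph D).induce (verts D : Set σ)).Connected := by
  obtain ⟨hne, hconn⟩ := (cl_eq_one_iff ha).1 h
  have hv : (verts D).Nonempty := by
    rw [Finset.nonempty_iff_ne_empty, Ne, verts_eq_empty ha]
    exact hne.ne_empty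
  obtain ⟨p, hp⟩ := hv
  have : Nonempty (verts D : Set σ) := ⟨⟨p, hp⟩⟩
  refine ⟨?_⟩
  rintro ⟨q, hq⟩ ⟨r, hr⟩
  obtain ⟨w⟩ := hconn q hq r hr
  clear hconn
  induction w with
  | nil => exact .refl _
  | cons hadj w ih =>
    obtain ⟨m, hm, h1, h2⟩ := adj_exists hadj
    have hq' := mem_verts.2 ⟨m, hm, h2⟩
    refine SimpleGraph.Reachable.trans ?_ (ih hq' hr)
    exact SimpleGraph.Adj.reachable (by simpa using hadj)

theorem card_edgeSet_induce (D : Cell a) :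
    Nat.card ((cellGraph D).induce (verts D : Set σ)).edgeSet = D.card := by
  set f : Sym2 (verts D : Set σ) → (σ →₀ ℕ) :=
    fun e => Sym2.lift ⟨fun i j => edgeMon i.1 j.1, fun i j => edgeMon_comm _ _⟩ e with hf
  have hinj : Set.InjOn f ((cellGraph D).induce (verts D : Set σ)).edgeSet := by
    intro e he e' he' hee
    induction e using Sym2.ind with | _ i j =>
    induction e' using Sym2.ind with | _ i' j' =>
    have hij : i.1 ≠ j.1 := fun h => (SimpleGraph.mem_edgeSet _).1 he |>.1 h
    have := edgeMon_inj hij hee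
    rw [Sym2.eq_iff] at this ⊢
    simp only [Subtype.ext_iff]
    exact this
  have himg : f '' ((cellGraph D).induce (verts D : Set σ)).edgeSet =
      (Finset.image (Subtype.val : minGens a → σ →₀ ℕ) D : Finset (σ →₀ ℕ)) := by
    ext β
    simp only [Set.mem_image, Finset.coe_image, Finset.mem_coe]
    constructor
    · rintro ⟨e, he, rfl⟩
      induction e using Sym2.ind with | _ i j =>
      obtain ⟨m, hm, h⟩ := ((SimpleGraph.mem_edgeSet _).1 he).2
      exact ⟨m, hm, h⟩
    · rintro ⟨m, hm, rfl⟩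
      obtain ⟨i, j, hij, h⟩ := exists_edge ha m
      have hi : i ∈ verts D := mem_verts.2 ⟨m, hm, by rw [h, edgeMon_support]; simp⟩
      have hj : j ∈ verts D := mem_verts.2 ⟨m, hm, by rw [h, edgeMon_support]; simp⟩
      exact ⟨s(⟨i, hi⟩, ⟨j, hj⟩), (SimpleGraph.mem_edgeSet _).2 ⟨hij, m, hm, h⟩, h.symm⟩
  rw [Nat.card_coe_set_eq, ← hinj.ncard_image, himg, Set.ncard_coe_finset,
    Finset.card_image_of_injective _ Subtype.val_injective]

theorem card_verts_le {D : Cell a} (h : cl D = 1) : (verts D).card ≤ D.card + 1 := by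
  have := (connected_induce ha h).card_vert_le_card_edgeSet_add_one
  rw [card_edgeSet_induce ha] at this
  simpa using this

theorem card_verts_of_acyclic {D : Cell a} (h : cl D = 1) (hc : (cellGraph D).IsAcyclic) :
    D.card + 1 = (verts D).card := by
  have ht : ((cellGraph D).induce (verts D : Set σ)).IsTree :=
    ⟨connected_induce ha h, hc.induce _⟩
  have := (SimpleGraph.isTree_iff_connected_and_card.1 ht).2
  rw [card_edgeSet_induce ha] at this
  simpa using this

end Cells

end MonomialRing

end

set_option linter.unusedSectionVars false
noncomputable section
open MvPolynomial
open scoped Classical TensorProduct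

namespace MonomialRing

universe u v

/-! ### Broken circuits and Whitney's involution -/

section Whitney

variable {k : Type u} [Field k] {σ : Type v} [Fintype σ] {a : Ideal (MvPolynomial σ k)}
variable {ι : Type*} [LinearOrder ι] (ρ : minGens a → ι)

/-- The generators in `I` that are smaller than `m`. -/
def below (m : minGens a) (I : Cell a) : Cell a := I.filter fun n => ρ n < ρ m

/-- `m` is the largest edge of a circuit in the graph of `I ∪ {m}`. -/
def Bad (I : Cell a) (m : minGens a) : Prop :=
  ∀ p ∈ (m : σ →₀ ℕ).support, ∀ q ∈ (m : σ →₀ ℕ).support, (cellGraph (below ρ m I)).Reachable p q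

variable {ρ}

theorem Bad.mono {I J : Cell a} (h : I ⊆ J) {m : minGens a} (hb : Bad ρ I m) : Bad ρ J m :=
  fun p hp q hq => (hb p hp q hq).mono (cellGraph_mono (Finset.filter_subset_filter _ h))

theorem bad_congr {I J : Cell a} {m : minGens a} (h : below ρ m I = below ρ m J) :
    Bad ρ I m ↔ Bad ρ J m := by
  unfold Bad; rw [h]

/-- Whether `n` is bad depends only on strictly smaller generators, so for `n` up to `m` it does not
matter whether `m` belongs to the cell. Hence toggling the smallest bad generator leaves it the
smallest bad one. -/
theorem below_congr {I J : Cell a} {m n : minGens a} (h : I.erase m = J.erase m)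
    (hn : ρ n ≤ ρ m) : below ρ n I = below ρ n J := by
  ext x
  have := congrArg (x ∈ ·) h
  simp only [Finset.mem_erase, eq_iff_iff] at this
  simp only [below, Finset.mem_filter]
  by_cases hx : x = m
  · subst hx
    simp [hn]
  · simp only [ne_eq, hx, not_false_eq_true, true_and] at this
    rw [this]

variable (ρ) in
/-- The smallest bad generator. -/
def IsMinBad (I : Cell a) (m : minGens a) : Prop := Bad ρ I m ∧ ∀ n, Bad ρ I n → ρ m ≤ ρ n

theorem IsMinBad.congr {I J : Cell a} {m : minGens a} (hm : IsMinBad ρ I m)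
    (h : I.erase m = J.erase m) : IsMinBad ρ J m := by
  refine ⟨(bad_congr (below_congr h le_rfl)).1 hm.1, fun n hn => ?_⟩
  by_contra hlt
  push Not at hlt
  exact absurd (hm.2 n ((bad_congr (below_congr h hlt.le)).2 hn)) (not_le.2 hlt)

theorem exists_isMinBad {I : Cell a} {m : minGens a} (hm : Bad ρ I m) : ∃ n, IsMinBad ρ I n := by
  obtain ⟨n, hn, h⟩ := Finset.exists_min_image (Finset.univ.filter (Bad ρ I)) ρ
    ⟨m, by simpa using hm⟩
  exact ⟨n, by simpa using hn, fun x hx => h x (by simpa using hx)⟩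

theorem IsMinBad.unique (hρ : Function.Injective ρ) {I : Cell a} {m n : minGens a}
    (hm : IsMinBad ρ I m) (hn : IsMinBad ρ I n) : m = n :=
  hρ (le_antisymm (hm.2 n hn.1) (hn.2 m hm.1))

theorem below_subset_erase (m : minGens a) (I : Cell a) : below ρ m I ⊆ I.erase m := by
  intro x hx
  obtain ⟨h1, h2⟩ := Finset.mem_filter.1 hx
  exact Finset.mem_erase.2 ⟨fun h => by simp [h] at h2, h1⟩

theorem erase_toggle (m : minGens a) (I : Cell a) :
    (insert m I).erase m = (I.erase m).erase m := by
  ext x; simp only [Finset.mem_erase, Finset.mem_insert]; tauto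

theorem insert_erase_self (m : minGens a) (I : Cell a) :
    insert m I = insert m (I.erase m) := by
  ext x; simp only [Finset.mem_erase, Finset.mem_insert]; tauto

variable (ρ) in
/-- The position of the smallest bad generator. -/
def level (I : Cell a) : WithTop ι := (Finset.univ.filter (Bad ρ I)).inf fun m => (ρ m : WithTop ι)

theorem level_mono {I J : Cell a} (h : J ⊆ I) : level ρ I ≤ level ρ J :=
  Finset.inf_mono fun m hm => by
    simp only [Finset.mem_filter, Finset.mem_univ, true_and] at hm ⊢
    exact hm.mono h

theorem IsMinBad.level_eq {I : Cell a} {m : minGens a} (h : IsMinBad ρ I m) :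
    level ρ I = ρ m := by
  apply le_antisymm
  · exact Finset.inf_le (f := fun m => (ρ m : WithTop ι)) (by simpa using h.1)
  · refine Finset.le_inf fun n hn => ?_
    exact WithTop.coe_le_coe.2 (h.2 n (by simpa using hn))

theorem isMinBad_of_level (hρ : Function.Injective ρ) {I : Cell a} {m : minGens a}
    (h : level ρ I = ρ m) : IsMinBad ρ I m := by
  by_cases hb : ∃ n, Bad ρ I n
  · obtain ⟨n, hn⟩ := hb
    obtain ⟨n, hn⟩ := exists_isMinBad hn
    have := hn.level_eq.symm.trans h
    rw [WithTop.coe_inj] at this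
    rwa [← hρ this]
  · push Not at hb
    have : Finset.univ.filter (Bad ρ I) = ∅ := by simpa [Finset.filter_eq_empty_iff] using hb
    rw [level, this, Finset.inf_empty] at h
    exact absurd h.symm (WithTop.coe_ne_top)

/-- The signed monomial `(-1)^{|I|} m_I`. -/
def kTerm (I : Cell a) : MvPowerSeries σ ℤ := MvPowerSeries.monomial (lcmOf I) ((-1) ^ I.card)

/-- The K-polynomial `Σ_I (-1)^{|I|} m_I`. -/
def kSeries (a : Ideal (MvPolynomial σ k)) : MvPowerSeries σ ℤ :=
  ∑ I : Cell a, kTerm I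

section Edge

variable (ha : IsEdgeIdeal a)
include ha

theorem bad_iff {I : Cell a} {m : minGens a} {i j : σ} (h : (m : σ →₀ ℕ) = edgeMon i j) :
    Bad ρ I m ↔ (cellGraph (below ρ m I)).Reachable i j := by
  constructor
  · intro hb
    exact hb i (by rw [h, edgeMon_support]; simp) j (by rw [h, edgeMon_support]; simp)
  · intro hr p hp q hq
    rw [h, edgeMon_support, Finset.mem_insert, Finset.mem_singleton] at hp hq
    rcases hp with rfl | rfl <;> rcases hq with rfl | rfl
    exacts [.refl _, hr, hr.symm, .refl _]

omit ha in
theorem mem_verts_of_reachable {I : Cell a} {p q : σ} (hne : p ≠ q)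
    (h : (cellGraph I).Reachable p q) : p ∈ verts I := by
  obtain ⟨w⟩ := h
  cases w with
  | nil => exact absurd rfl hne
  | cons hadj w =>
    obtain ⟨m, hm, h1, -⟩ := adj_exists hadj
    exact mem_verts.2 ⟨m, hm, h1⟩

/-- The ends of a bad generator are already joined by other generators of the cell, so its presence
affects neither the variables nor, below, the components. Comparing `insert` with `erase` covers
both cases, `m` in `I` or not. -/
theorem Bad.verts_eq {I : Cell a} {m : minGens a} (hb : Bad ρ I m) :
    verts (insert m I) = verts (I.erase m) := by
  apply Finset.Subset.antisymm
  · obtain ⟨i, j, hij, h⟩ := exists_edge ha m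
    have hr := ((bad_iff ha h).1 hb).mono (cellGraph_mono (below_subset_erase m I))
    intro p hp
    rw [insert_erase_self] at hp
    obtain ⟨x, hx, hpx⟩ := mem_verts.1 hp
    rcases Finset.mem_insert.1 hx with rfl | hx
    · rw [h, edgeMon_support, Finset.mem_insert, Finset.mem_singleton] at hpx
      rcases hpx with rfl | rfl
      · exact mem_verts_of_reachable hij hr
      · exact mem_verts_of_reachable hij.symm hr.symm
    · exact mem_verts.2 ⟨x, hx, hpx⟩
  · exact verts_mono ((Finset.erase_subset _ _).trans (Finset.subset_insert _ _))

theorem Bad.reachable {I : Cell a} {m : minGens a} (hb : Bad ρ I m) {p q : σ}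
    (h : (cellGraph (insert m I)).Reachable p q) : (cellGraph (I.erase m)).Reachable p q := by
  obtain ⟨w⟩ := h
  induction w with
  | nil => exact .refl _
  | cons hadj w ih =>
    refine SimpleGraph.Reachable.trans ?_ ih
    obtain ⟨h1, n, hn, h2⟩ := hadj
    by_cases hnm : n = m
    · subst hnm
      exact ((bad_iff ha h2).1 hb).mono (cellGraph_mono (below_subset_erase n I))
    · refine SimpleGraph.Adj.reachable ⟨h1, n, ?_, h2⟩
      exact Finset.mem_erase.2 ⟨hnm, (Finset.mem_insert.1 hn).resolve_left hnm⟩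

theorem cl_eq_of_reachable {I J : Cell a} (hsub : J ⊆ I) (hv : verts I = verts J)
    (hr : ∀ p q, (cellGraph I).Reachable p q → (cellGraph J).Reachable p q) : cl I = cl J := by
  symm
  unfold cl
  refine Nat.card_congr (Equiv.ofBijective
    (Quot.map (fun x : J => (⟨x.1, hsub x.2⟩ : I)) fun _ _ h => h) ⟨?_, ?_⟩)
  · intro x y hxy
    obtain ⟨x, rfl⟩ := Quot.exists_rep x
    obtain ⟨y, rfl⟩ := Quot.exists_rep y
    exact (quot_eq_iff ha _ _).2 fun p hp q hq => hr p q ((quot_eq_iff ha _ _).1 hxy p hp q hq)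
  · intro z
    obtain ⟨z, rfl⟩ := Quot.exists_rep z
    obtain ⟨p, hp⟩ := support_nonempty ha z.1
    have : p ∈ verts J := hv ▸ mem_verts.2 ⟨z, z.2, hp⟩
    obtain ⟨y, hy, hpy⟩ := mem_verts.1 this
    refine ⟨Quot.mk _ ⟨y, hy⟩, Quot.sound ?_⟩
    rw [isCoprimeMon_iff, Finset.not_disjoint_iff]
    exact ⟨p, hpy, hp⟩

theorem Bad.cl_eq {I : Cell a} {m : minGens a} (hb : Bad ρ I m) :
    cl (insert m I) = cl (I.erase m) :=
  cl_eq_of_reachable ha ((Finset.erase_subset _ _).trans (Finset.subset_insert _ _))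
    (hb.verts_eq ha) fun _ _ h => hb.reachable ha h

-- Deleting the largest edge of a circuit leaves a path of strictly smaller generators between its
-- ends. Injectivity of `ρ` turns "at most" into "less than".
omit ha in
theorem bad_of_cycle (hρ : Function.Injective ρ) (ha : IsEdgeIdeal a) {I J : Cell a}
    {m : minGens a} {i j v : σ} (hm : (m : σ →₀ ℕ) = edgeMon i j) (hJ : J ⊆ insert m I)
    (c : (cellGraph J).Walk v v) (hc : c.IsCycle) (hij : s(i, j) ∈ c.edges)
    (hmax : ∀ n : minGens a, ∀ r s, s(r, s) ∈ c.edges → (n : σ →₀ ℕ) = edgeMon r s → ρ n ≤ ρ m) :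
    Bad ρ I m := by
  rw [bad_iff ha hm]
  set G := cellGraph (J.filter fun n => ρ n ≤ ρ m) with hG
  have hsub : ∀ e ∈ c.edges, e ∈ G.edgeSet := by
    intro e he
    have h1 := c.edges_subset_edgeSet he
    induction e using Sym2.ind with | _ r s =>
    obtain ⟨hne, n, hn, h2⟩ := (SimpleGraph.mem_edgeSet _).1 h1
    exact (SimpleGraph.mem_edgeSet _).2 ⟨hne, n,
      Finset.mem_filter.2 ⟨hn, hmax n r s he h2⟩, h2⟩
  have h1 := (SimpleGraph.adj_and_reachable_delete_edges_iff_exists_cycle (G := G)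
    (v := i) (w := j)).2 ⟨v, c.transfer G hsub, hc.transfer hsub, by
      rw [SimpleGraph.Walk.edges_transfer]; exact hij⟩
  refine h1.2.mono ?_
  intro p q hpq
  rw [SimpleGraph.deleteEdges_adj] at hpq
  obtain ⟨⟨hne, n, hn, h2⟩, h3⟩ := hpq
  obtain ⟨h4, h5⟩ := Finset.mem_filter.1 hn
  have hnm : n ≠ m := by
    rintro rfl
    apply h3
    rw [Set.mem_singleton_iff]
    exact edgeMon_inj hne (h2.symm.trans hm)
  exact ⟨hne, n, Finset.mem_filter.2 ⟨(Finset.mem_insert.1 (hJ h4)).resolve_left hnm,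
    lt_of_le_of_ne h5 fun h => hnm (hρ h)⟩, h2⟩

theorem isAcyclic_of_not_bad (hρ : Function.Injective ρ) {I : Cell a} (h : ∀ m, ¬ Bad ρ I m) :
    (cellGraph I).IsAcyclic := by
  intro v c hc
  set T : Finset (minGens a) := I.filter fun m => ∃ i j, s(i, j) ∈ c.edges ∧ (m : σ →₀ ℕ) = edgeMon i j
  have hmem : ∀ r s, s(r, s) ∈ c.edges → ∀ n : minGens a, (n : σ →₀ ℕ) = edgeMon r s → n ∈ T := by
    intro r s hrs n hn
    obtain ⟨hne, x, hx, h2⟩ := (SimpleGraph.mem_edgeSet _).1 (c.edges_subset_edgeSet hrs)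
    have : n = x := Subtype.ext (hn.trans h2.symm)
    subst this
    exact Finset.mem_filter.2 ⟨hx, r, s, hrs, hn⟩
  have hne : T.Nonempty := by
    cases c with
    | nil => exact absurd rfl hc.ne_nil
    | cons hadj w =>
      obtain ⟨m, hm⟩ := hadj.2
      exact ⟨m, hmem _ _ (by simp) m hm.2⟩
  obtain ⟨m, hmT, hmax⟩ := Finset.exists_max_image T ρ hne
  obtain ⟨hmI, i, j, hij, hm⟩ := Finset.mem_filter.1 hmT
  exact h m (bad_of_cycle hρ ha hm (Finset.subset_insert _ _) c hc hij
    fun n r s hrs hn => hmax n (hmem r s hrs n hn))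

/-- Conversely, the path of smaller generators between the ends of `m` is closed by `m` itself to a
circuit with largest edge `m`. -/
theorem exists_cycle_of_bad {I : Cell a} {m : minGens a} (hb : Bad ρ I m) :
    ∃ (v : σ) (c : (cellGraph (insert m I)).Walk v v), c.IsCycle ∧
      (∃ i j, s(i, j) ∈ c.edges ∧ (m : σ →₀ ℕ) = edgeMon i j) ∧
      ∀ i j, s(i, j) ∈ c.edges → ∃ n : minGens a, (n : σ →₀ ℕ) = edgeMon i j ∧ ρ n ≤ ρ m := by
  obtain ⟨i, j, hij, h⟩ := exists_edge ha m
  set G := cellGraph (insert m (below ρ m I)) with hG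
  have hle : G ≤ cellGraph (insert m I) :=
    cellGraph_mono (Finset.insert_subset_insert _ (Finset.filter_subset _ _))
  have hadj : G.Adj i j := ⟨hij, m, Finset.mem_insert_self _ _, h⟩
  have hr : (G.deleteEdges {s(i, j)}).Reachable i j := by
    refine ((bad_iff ha h).1 hb).mono ?_
    rintro p q ⟨hne, n, hn, h2⟩
    rw [SimpleGraph.deleteEdges_adj]
    refine ⟨⟨hne, n, Finset.mem_insert_of_mem hn, h2⟩, fun h3 => ?_⟩
    rw [Set.mem_singleton_iff] at h3
    have : n = m := Subtype.ext (by
      rw [h2, h]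
      rcases Sym2.eq_iff.1 h3 with ⟨rfl, rfl⟩ | ⟨rfl, rfl⟩
      · rfl
      · exact edgeMon_comm _ _)
    subst this
    exact lt_irrefl _ (Finset.mem_filter.1 hn).2
  obtain ⟨v, c, hc, he⟩ := SimpleGraph.adj_and_reachable_delete_edges_iff_exists_cycle.1 ⟨hadj, hr⟩
  refine ⟨v, c.mapLe hle, (SimpleGraph.Walk.isCycle_mapLe hle).2 hc, ⟨i, j, ?_, h⟩, ?_⟩
  · rw [SimpleGraph.Walk.edges_mapLe_eq_edges]; exact he
  · intro r s hrs
    rw [SimpleGraph.Walk.edges_mapLe_eq_edges] at hrs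
    obtain ⟨hne, n, hn, h2⟩ := (SimpleGraph.mem_edgeSet _).1 (c.edges_subset_edgeSet hrs)
    refine ⟨n, h2, ?_⟩
    rcases Finset.mem_insert.1 hn with rfl | hn
    · exact le_rfl
    · exact (Finset.mem_filter.1 hn).2.le

theorem isNBC_iff (ord : MonomialOrder σ) (I : Cell a) :
    IsNBC ord I ↔ ∀ m, ¬ Bad (fun m : minGens a => ord.toSyn (m : σ →₀ ℕ)) I m := by
  rw [IsNBC, ← not_exists]
  refine not_congr (exists_congr fun m => ⟨?_, ?_⟩)
  · rintro ⟨v, c, hc, ⟨i, j, hij, hm⟩, hmax⟩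
    exact bad_of_cycle (fun x y h => Subtype.ext (ord.toSyn.injective h)) ha hm le_rfl c hc hij
      fun n r s hrs hn => by rw [hn]; exact hmax r s hrs
  · intro hb
    obtain ⟨v, c, hc, h1, h2⟩ := exists_cycle_of_bad ha hb
    refine ⟨v, c, hc, h1, fun i j hij => ?_⟩
    obtain ⟨n, hn, h3⟩ := h2 i j hij
    rw [← hn]; exact h3

theorem card_add_cl_of_not_bad (hρ : Function.Injective ρ) {I : Cell a} (h : ∀ m, ¬ Bad ρ I m) :
    I.card + cl I = (verts I).card := by
  refine card_add_cl_of_comp ha fun D hD => card_verts_of_acyclic ha hD.conn ?_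
  exact (isAcyclic_of_not_bad ha hρ h).anti (cellGraph_mono hD.subset)

/-- Whitney's theorem in multigraded form: on the cells with a bad generator, toggling the smallest
one is an involution that keeps the lcm and changes the sign. -/
theorem sum_not_bad (hρ : Function.Injective ρ) :
    ∑ I : Cell a with ∀ m, ¬ Bad ρ I m, kTerm I = kSeries a := by
  rw [kSeries, ← Finset.sum_filter_add_sum_filter_not Finset.univ (fun I => ∀ m, ¬ Bad ρ I m),
    left_eq_add]
  have hex : ∀ I ∈ Finset.univ.filter (fun I : Cell a => ¬ ∀ m, ¬ Bad ρ I m),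
      ∃ m, IsMinBad ρ I m := by
    intro I hI
    have := (Finset.mem_filter.1 hI).2
    push Not at this
    obtain ⟨m, hm⟩ := this
    exact exists_isMinBad hm
  set g : ∀ I ∈ Finset.univ.filter (fun I : Cell a => ¬ ∀ m, ¬ Bad ρ I m), Cell a := fun I hI =>
    if (hex I hI).choose ∈ I then I.erase (hex I hI).choose else insert (hex I hI).choose I with hg
  have hg' : ∀ I hI m, IsMinBad ρ I m → g I hI = if m ∈ I then I.erase m else insert m I := by
    intro I hI m hm
    have : (hex I hI).choose = m := (hex I hI).choose_spec.unique hρ hm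
    simp only [hg, this]
  have hgm : ∀ I hI m, IsMinBad ρ I m → IsMinBad ρ (g I hI) m := by
    intro I hI m hm
    refine hm.congr ?_
    rw [hg' I hI m hm]
    split_ifs with h
    · simp
    · rw [erase_toggle]; simp
  have hmem : ∀ I hI, g I hI ∈ Finset.univ.filter (fun I : Cell a => ¬ ∀ m, ¬ Bad ρ I m) := by
    intro I hI
    obtain ⟨m, hm⟩ := hex I hI
    exact Finset.mem_filter.2 ⟨Finset.mem_univ _, fun h => h m (hgm I hI m hm).1⟩
  refine Finset.sum_involution g ?_ ?_ hmem ?_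
  · intro I hI
    obtain ⟨m, hm⟩ := hex I hI
    have hv := hm.1.verts_eq ha
    rw [hg' I hI m hm]
    unfold kTerm
    split_ifs with h
    · have h1 : lcmOf (I.erase m) = lcmOf I := by
        rw [lcmOf_eq_iff ha, ← hv, Finset.insert_eq_of_mem h]
      rw [h1, ← map_add, ← Finset.card_erase_add_one h, pow_succ]
      simp
    · have h1 : lcmOf (insert m I) = lcmOf I := by
        rw [lcmOf_eq_iff ha, hv, Finset.erase_eq_of_notMem h]
      rw [h1, ← map_add, Finset.card_insert_of_notMem h, pow_succ]
      simp
  · intro I hI _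
    obtain ⟨m, hm⟩ := hex I hI
    rw [hg' I hI m hm]
    split_ifs with h
    · exact fun h' => by rw [← h'] at h; simp at h
    · exact fun h' => by rw [← h'] at h; simp at h
  · intro I hI
    obtain ⟨m, hm⟩ := hex I hI
    rw [hg' _ (hmem I hI) m (hgm I hI m hm), hg' I hI m hm]
    by_cases h : m ∈ I
    · simp [h]
    · simp [h]

end Edge

end Whitney

end MonomialRing

end

set_option linter.unusedSectionVars false
noncomputable section
open MvPolynomial
open scoped Classical TensorProduct

namespace MonomialRing

universe u v

/-! ### Exact strands of the Taylor resolution -/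

section Taylor

variable {k : Type u} [Field k] {σ : Type v} [Fintype σ] {a : Ideal (MvPolynomial σ k)}

/-- The sign of the face `I ∖ {m}` of `I` in the Taylor resolution. -/
def taylorSign (I : Cell a) (m : minGens a) : MvPolynomial σ k :=
  (-1) ^ (I.filter fun n => (minGens a).equivFin n < (minGens a).equivFin m).card

theorem erase_inj {I : Cell a} {m n : minGens a} (hm : m ∈ I) (h : I.erase m = I.erase n) :
    m = n := by
  by_contra hne
  have : m ∈ I.erase n := Finset.mem_erase.2 ⟨hne, hm⟩
  rw [← h] at this
  simp at this

theorem taylor_coeff_erase {I : Cell a} {m : minGens a} (hm : m ∈ I) :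
    (taylor a).coeff I (I.erase m) =
      taylorSign I m * monomial (lcmOf I - lcmOf (I.erase m)) 1 := by
  simp only [taylor]
  rw [Finset.sum_eq_single m]
  · rw [if_pos rfl]; rfl
  · intro n hn hne
    exact if_neg fun h => hne (erase_inj hm h).symm
  · exact fun h => absurd hm h

theorem taylor_coeff_ne_zero {I J : Cell a} (h : (taylor a).coeff I J ≠ 0) :
    ∃ m ∈ I, J = I.erase m := by
  by_contra hcon
  push Not at hcon
  exact h (Finset.sum_eq_zero fun m hm => if_neg (hcon m hm))

theorem taylor_coeff_of_lcm {I : Cell a} {m : minGens a} (hm : m ∈ I)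
    (h : lcmOf I = lcmOf (I.erase m)) : (taylor a).coeff I (I.erase m) = taylorSign I m := by
  rw [taylor_coeff_erase hm, ← h, tsub_self]
  simp

theorem isUnit_taylorSign (I : Cell a) (m : minGens a) : IsUnit (taylorSign I m) :=
  isUnit_one.neg.pow _

theorem taylor_edge {I : Cell a} {m : minGens a} (hm : m ∈ I)
    (h : lcmOf I = lcmOf (I.erase m)) : (taylor a).Edge I (I.erase m) :=
  ⟨Finset.mem_univ _, Finset.mem_univ _, (Finset.card_erase_add_one hm).symm, by
    rw [taylor_coeff_of_lcm hm h]; exact (isUnit_taylorSign I m).ne_zero⟩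

theorem lcmOf_mono {I J : Cell a} (h : I ⊆ J) : lcmOf I ≤ lcmOf J := Finset.sup_mono h

theorem taylorSign_swap {I : Cell a} {m n : minGens a} (hm : m ∈ I) (hn : n ∈ I) (hne : m ≠ n) :
    taylorSign I m * taylorSign (I.erase m) n + taylorSign I n * taylorSign (I.erase n) m = 0 := by
  have key : ∀ m n : minGens a, m ∈ I → n ∈ I →
      (minGens a).equivFin m < (minGens a).equivFin n →
      taylorSign I m * taylorSign (I.erase m) n + taylorSign I n * taylorSign (I.erase n) m = 0 := by
    intro m n hm hn hlt
    have h1 : taylorSign (I.erase n) m = taylorSign I m := by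
      unfold taylorSign
      congr 2
      ext x
      simp only [Finset.mem_filter, Finset.mem_erase]
      constructor
      · rintro ⟨⟨-, h⟩, h'⟩; exact ⟨h, h'⟩
      · rintro ⟨h, h'⟩
        exact ⟨⟨fun hx => by subst hx; exact absurd h' (not_lt.2 hlt.le), h⟩, h'⟩
    have h2 : taylorSign I n = - taylorSign (I.erase m) n := by
      unfold taylorSign
      rw [Finset.filter_erase, ← Finset.card_erase_add_one (a := m)
        (s := I.filter fun x => (minGens a).equivFin x < (minGens a).equivFin n)
        (Finset.mem_filter.2 ⟨hm, hlt⟩), pow_succ]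
      ring
    rw [h1, h2]; ring
  rcases lt_trichotomy ((minGens a).equivFin m) ((minGens a).equivFin n) with h | h | h
  · exact key m n hm hn h
  · exact absurd ((minGens a).equivFin.injective h) hne
  · rw [add_comm]; exact key n m hn hm h

/-- A set of cells with the same least common multiple that contains every cell between two of its
members. -/
structure IsStrand (Q : Cell a → Prop) : Prop where
  lcm_eq : ∀ I J, Q I → Q J → lcmOf I = lcmOf J
  convex : ∀ I J K, K ⊆ J → J ⊆ I → Q I → Q K → Q J

theorem taylor_strand_erase {Q : Cell a → Prop} (hQ : IsStrand Q) {I : Cell a} {m : minGens a}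
    (hm : m ∈ I) (hI : Q I) (hJ : Q (I.erase m)) :
    (taylor a).strand Q I (I.erase m) = taylorSign I m := by
  have h := hQ.lcm_eq _ _ hI hJ
  rw [BasedComplex.strand_eq hI hJ (taylor_edge hm h), taylor_coeff_of_lcm hm h]

/-- From `I` to `I ∖ {m, n}` there are two ways, according to which generator goes first. Convexity
puts both intermediate cells into `Q`, and their signs are opposite. -/
theorem taylor_strand_sq {Q : Cell a → Prop} (hQ : IsStrand Q) :
    (taylor a).strand Q * (taylor a).strand Q = 0 := by
  refine Matrix.ext fun I K => ?_
  rw [Matrix.mul_apply, Matrix.zero_apply]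
  have hne : ∀ I J, (taylor a).strand Q I J ≠ 0 → Q I ∧ Q J ∧ ∃ m ∈ I, J = I.erase m := by
    intro I J h
    obtain ⟨h1, h2, h3⟩ := BasedComplex.strand_ne_zero h
    exact ⟨h1, h2, taylor_coeff_ne_zero h3.2.2.2⟩
  by_cases hex : ∃ m n, m ∈ I ∧ n ∈ I ∧ m ≠ n ∧ K = (I.erase m).erase n ∧ Q I ∧ Q K
  · obtain ⟨m, n, hm, hn, hmn, rfl, hI, hK⟩ := hex
    have hQm : Q (I.erase m) := hQ.convex _ _ _ (Finset.erase_subset _ _)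
      (Finset.erase_subset _ _) hI hK
    have hQn : Q (I.erase n) := by
      refine hQ.convex _ _ _ ?_ (Finset.erase_subset _ _) hI hK
      rw [Finset.erase_right_comm]; exact Finset.erase_subset _ _
    have hnm : n ∈ I.erase m := Finset.mem_erase.2 ⟨hmn.symm, hn⟩
    have hmn' : m ∈ I.erase n := Finset.mem_erase.2 ⟨hmn, hm⟩
    have hsub : ({I.erase m, I.erase n} : Finset (Cell a)) ⊆ Finset.univ := Finset.subset_univ _
    rw [← Finset.sum_subset hsub, Finset.sum_pair fun h => hmn (erase_inj hm h)]
    · rw [taylor_strand_erase hQ hm hI hQm, taylor_strand_erase hQ hnm hQm hK,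
        taylor_strand_erase hQ hn hI hQn, Finset.erase_right_comm, taylor_strand_erase hQ hmn' hQn]
      · exact taylorSign_swap hm hn hmn
      · rw [Finset.erase_right_comm]; exact hK
    · intro J _ hJ
      by_contra h
      obtain ⟨-, -, x, hx, rfl⟩ := hne _ _ (left_ne_zero_of_mul h)
      obtain ⟨-, -, y, hy, hxy⟩ := hne _ _ (right_ne_zero_of_mul h)
      have : x ∉ (I.erase m).erase n := by rw [hxy]; simp
      simp only [Finset.mem_erase, not_and] at this
      by_cases hxn : x = n
      · subst hxn; simp at hJ
      · by_cases hxm : x = m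
        · subst hxm; simp at hJ
        · exact this hxn hxm hx
  · refine Finset.sum_eq_zero fun J _ => ?_
    by_contra h
    obtain ⟨hI, -, x, hx, rfl⟩ := hne _ _ (left_ne_zero_of_mul h)
    obtain ⟨-, hK, y, hy, rfl⟩ := hne _ _ (right_ne_zero_of_mul h)
    exact hex ⟨x, y, hx, (Finset.mem_erase.1 hy).2, (Finset.mem_erase.1 hy).1.symm, rfl, hI, hK⟩

variable {ι : Type*} [LinearOrder ι] {ρ : minGens a → ι}

variable (ρ) in
/-- Removing and adding the smallest bad generator, as a matching of the cells satisfying `Q`. -/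
def whitneyMatching (Q : Cell a → Prop) : Matching a :=
  Finset.univ.filter fun e => Q e.1 ∧ Q e.2 ∧ ∃ m ∈ e.1, IsMinBad ρ e.1 m ∧ e.2 = e.1.erase m

theorem mem_whitneyMatching {Q : Cell a → Prop} {e : Cell a × Cell a} :
    e ∈ whitneyMatching ρ Q ↔
      Q e.1 ∧ Q e.2 ∧ ∃ m ∈ e.1, IsMinBad ρ e.1 m ∧ e.2 = e.1.erase m := by
  simp [whitneyMatching]

theorem IsMinBad.erase {I : Cell a} {m : minGens a} (h : IsMinBad ρ I m) :
    IsMinBad ρ (I.erase m) m := h.congr (by simp)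

theorem IsMinBad.insert {I : Cell a} {m : minGens a} (h : IsMinBad ρ I m) :
    IsMinBad ρ (insert m I) m := h.congr (by simp)

variable (ρ) in
/-- A potential that increases along the paths of the graph with the Whitney matching reversed. -/
def whitneyPotential (I : Cell a) : WithTop ι ×ₗ (ℕ ×ₗ ℤ) :=
  toLex (level ρ I, toLex (if ∃ m ∈ I, level ρ I = ρ m then 1 else 0, -(I.card : ℤ)))

/-- Removing a generator other than the smallest bad one increases the potential. -/
theorem whitneyPotential_erase (hρ : Function.Injective ρ) {I : Cell a} {m : minGens a}
    (hm : m ∈ I) (hne : ¬ IsMinBad ρ I m) :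
    whitneyPotential ρ I < whitneyPotential ρ (I.erase m) := by
  unfold whitneyPotential
  rw [Prod.Lex.toLex_lt_toLex]
  rcases (level_mono (ρ := ρ) (Finset.erase_subset m I)).lt_or_eq with h | h
  · exact Or.inl h
  · right
    refine ⟨h, ?_⟩
    rw [Prod.Lex.toLex_lt_toLex]
    right
    refine ⟨?_, ?_⟩
    · have hiff : (∃ x ∈ I, level ρ I = ρ x) ↔
          ∃ x ∈ I.erase m, level ρ (I.erase m) = ρ x := by
        rw [← h]
        refine exists_congr fun x => ⟨fun ⟨h1, h2⟩ => ⟨Finset.mem_erase.2 ⟨fun hx => ?_, h1⟩, h2⟩,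
          fun ⟨h1, h2⟩ => ⟨(Finset.mem_erase.1 h1).2, h2⟩⟩
        subst hx
        exact hne (isMinBad_of_level hρ h2)
      change (if _ then 1 else 0 : ℕ) = if _ then 1 else 0
      rw [if_congr hiff rfl rfl]
    · have := Finset.card_erase_add_one hm
      simp only
      omega

/-- Adding the smallest bad generator increases the potential. -/
theorem whitneyPotential_insert (hρ : Function.Injective ρ) {I : Cell a} {m : minGens a}
    (hm : m ∈ I) (h : IsMinBad ρ I m) :
    whitneyPotential ρ (I.erase m) < whitneyPotential ρ I := by
  unfold whitneyPotential
  rw [Prod.Lex.toLex_lt_toLex]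
  right
  rw [h.level_eq, h.erase.level_eq]
  refine ⟨rfl, ?_⟩
  rw [Prod.Lex.toLex_lt_toLex]
  left
  rw [if_neg, if_pos ⟨m, hm, rfl⟩]
  · exact Nat.one_pos
  · rintro ⟨n, hn, h1⟩
    have : m = n := hρ (WithTop.coe_inj.1 h1)
    subst this
    simp at hn

/-- Both ends of an edge have the same smallest bad generator, and the upper end contains it while
the lower one does not; so either end determines the edge. -/
theorem whitneyMatching_matching (hρ : Function.Injective ρ) {Q : Cell a → Prop} :
    ∀ e ∈ whitneyMatching ρ Q, ∀ f ∈ whitneyMatching ρ Q,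
      (e.1 = f.1 ∨ e.1 = f.2 ∨ e.2 = f.1 ∨ e.2 = f.2) → e = f := by
  rintro ⟨I, J⟩ he ⟨I', J'⟩ hf h
  obtain ⟨-, -, m, hm, hmin, hJ⟩ := mem_whitneyMatching.1 he
  obtain ⟨-, -, n, hn, hmin', hJ'⟩ := mem_whitneyMatching.1 hf
  simp only at hm hn hmin hmin' hJ hJ' h
  subst hJ
  subst hJ'
  rcases h with h | h | h | h
  · subst h
    rw [hmin.unique hρ hmin']
  · subst h
    rw [hmin.unique hρ hmin'.erase] at hm
    simp at hm
  · rw [← h] at hn hmin'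
    rw [← hmin.erase.unique hρ hmin'] at hn
    simp at hn
  · have h1 := hmin.erase
    rw [h] at h1
    have h2 := h1.unique hρ hmin'.erase
    subst h2
    have : I = I' := by
      rw [← Finset.insert_erase hm, h, Finset.insert_erase hn]
    rw [this]

theorem isMatrixMatching_whitney (hρ : Function.Injective ρ) {Q : Cell a → Prop}
    (hQ : IsStrand Q) :
    IsMatrixMatching Finset.card ((taylor a).strand Q) (whitneyMatching ρ Q) where
  sq := taylor_strand_sq hQ
  deg_eq I J h := (BasedComplex.strand_ne_zero h).2.2.2.2.1
  matching := whitneyMatching_matching hρ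
  invertible := by
    rintro ⟨I, J⟩ he
    obtain ⟨h1, h2, m, hm, hmin, hJ⟩ := mem_whitneyMatching.1 he
    simp only at h1 h2 hm hJ
    subst hJ
    simp only
    rw [taylor_strand_erase hQ hm h1 h2]
    exact isUnit_taylorSign I m
  acyclic := by
    have hstep : ∀ I J, matrixStep ((taylor a).strand Q) (whitneyMatching ρ Q) I J →
        whitneyPotential ρ I < whitneyPotential ρ J := by
      rintro I J (⟨h1, h2⟩ | h1)
      · obtain ⟨q1, q2, q3⟩ := BasedComplex.strand_ne_zero h1
        obtain ⟨m, hm, rfl⟩ := taylor_coeff_ne_zero q3.2.2.2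
        exact whitneyPotential_erase hρ hm fun hmin =>
          h2 (mem_whitneyMatching.2 ⟨q1, q2, m, hm, hmin, rfl⟩)
      · obtain ⟨-, -, m, hm, hmin, hJ⟩ := mem_whitneyMatching.1 h1
        simp only at hm hJ hmin
        subst hJ
        exact whitneyPotential_insert hρ hm hmin
    intro I hI
    have : ∀ J, Relation.TransGen (matrixStep ((taylor a).strand Q) (whitneyMatching ρ Q)) I J →
        whitneyPotential ρ I < whitneyPotential ρ J := by
      intro J hJ
      induction hJ with
      | single h => exact hstep _ _ h
      | tail _ h ih => exact ih.trans (hstep _ _ h)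
    exact lt_irrefl _ (this I hI)

/-- The strands of the Taylor resolution are exact in the degrees where all cells have a circuit. -/
theorem taylor_exactAbove (ha : IsEdgeIdeal a) {Q : Cell a → Prop} (hQ : IsStrand Q)
    (hcl : ∀ I J, lcmOf I = lcmOf J → cl I = cl J → Q I → Q J) {d : ℕ} (hd : 0 < d)
    (hcard : ∀ I, Q I → (verts I).card ≤ d) : (taylor a).ExactAbove Q d := by
  set ρ : minGens a → Fin (minGens a).card := fun m => (minGens a).equivFin m
  have hρ : Function.Injective ρ := (minGens a).equivFin.injective
  refine BasedComplex.exactAbove_of_matching (isMatrixMatching_whitney hρ hQ) ?_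
  intro I hI _ hdI hc
  -- Without a bad generator the cell is a nonempty forest, and then its size is its number of
  -- variables minus its number of classes, hence less than `d`.
  have hex : ∃ m, Bad ρ I m := by
    by_contra hno
    push Not at hno
    have h1 := card_add_cl_of_not_bad ha hρ hno
    have h2 := hcard I hI
    have : 0 < cl I := cl_pos ha (Finset.card_pos.1 (by omega))
    omega
  obtain ⟨m, hm⟩ := hex
  obtain ⟨m, hm⟩ := exists_isMinBad hm
  have hv := hm.1.verts_eq ha
  have hcl' := hm.1.cl_eq ha
  -- Toggling `m` preserves the lcm and the number of classes, so by `hcl` it stays inside `Q` and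
  -- provides an edge through `I`.
  by_cases h : m ∈ I
  · rw [Finset.insert_eq_of_mem h] at hv hcl'
    exact (hc (I, I.erase m) (mem_whitneyMatching.2 ⟨hI, hcl I (I.erase m) ((lcmOf_eq_iff ha).2 hv) hcl' hI,
      m, h, hm, rfl⟩)).1 rfl
  · rw [Finset.erase_eq_of_notMem h] at hv hcl'
    refine (hc (insert m I, I) (mem_whitneyMatching.2 ⟨hcl I _ ((lcmOf_eq_iff ha).2 hv.symm)
      hcl'.symm hI, hI, m, Finset.mem_insert_self _ _, hm.insert, ?_⟩)).2 rfl
    simp [h]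

end Taylor

end MonomialRing

end

set_option linter.unusedSectionVars false
noncomputable section
open MvPolynomial
open scoped Classical TensorProduct

namespace MonomialRing

universe u v

/-! ### First sequences: components, trees and the signed sum -/

section Sequences

variable {k : Type u} [Field k] {σ : Type v} [Fintype σ] {a : Ideal (MvPolynomial σ k)}

theorem IsStandardSequence.induction {i : ℕ} {p : BasedComplex a → Prop}
    (hstep : ∀ C N, p C → IsStandardStep i C N → p (C.morse N)) (L : List (Matching a)) :
    ∀ C, p C → IsStandardSequence i C L → p (morseList C L) := by
  induction L with
  | nil => exact fun C hC _ => hC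
  | cons N L ih => exact fun C hC hL => ih _ (hstep C N hC hL.1) hL.2

theorem mem_morse_basis {C : BasedComplex a} {N : Matching a} {I : Cell a} :
    I ∈ (C.morse N).basis ↔ I ∈ C.basis ∧ IsCritical N I := Finset.mem_filter

theorem mem_morseList_basis {L : List (Matching a)} {C : BasedComplex a} {I : Cell a} :
    I ∈ (morseList C L).basis ↔ I ∈ C.basis ∧ Unmatched L I := by
  induction L generalizing C with
  | nil => simp [morseList, Unmatched]
  | cons N L ih =>
    have : morseList C (N :: L) = morseList (C.morse N) L := rfl
    rw [this, ih, mem_morse_basis, and_assoc]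
    refine and_congr Iff.rfl ?_
    unfold Unmatched IsCritical
    simp only [List.mem_cons, forall_eq_or_imp]

theorem morse_edge_path {C : BasedComplex a} {N : Matching a} {I J : Cell a}
    (h : (C.morse N).Edge I J) : Relation.ReflTransGen (C.Step N) I J := by
  have h1 := h.2.2.2
  have h2 : (C.morse N).coeff I J = C.pathSum N I J := if_pos h.2.2.1
  rw [h2, BasedComplex.pathSum, Matrix.sum_apply] at h1
  obtain ⟨l, -, hl⟩ := Finset.exists_ne_zero_of_sum_ne_zero h1
  exact weight_pow_ne_zero hl

/-- All edges, and so all paths, do not increase the least common multiple. -/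
def LcmAntitone (C : BasedComplex a) : Prop := ∀ I J, C.Edge I J → lcmOf J ≤ lcmOf I

theorem LcmAntitone.path {C : BasedComplex a} (hC : LcmAntitone C) {N : Matching a}
    (hN : ∀ e ∈ N, lcmOf e.1 = lcmOf e.2) {I J : Cell a}
    (h : Relation.ReflTransGen (C.Step N) I J) : lcmOf J ≤ lcmOf I := by
  induction h with
  | refl => exact le_rfl
  | tail _ h ih =>
    refine le_trans ?_ ih
    rcases h with h | h
    · exact hC _ _ h.1
    · exact (hN _ h).le

theorem LcmAntitone.morse {C : BasedComplex a} (hC : LcmAntitone C) {N : Matching a}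
    (hN : ∀ e ∈ N, lcmOf e.1 = lcmOf e.2) : LcmAntitone (C.morse N) :=
  fun _ _ h => hC.path hN (morse_edge_path h)

/-- The least common multiple decreases, or it stays and the number of classes does not drop. -/
def ClLe (I J : Cell a) : Prop := lcmOf J ≤ lcmOf I ∧ (lcmOf I = lcmOf J → cl I ≤ cl J)

theorem ClLe.trans {I J K : Cell a} (h : ClLe I J) (h' : ClLe J K) : ClLe I K := by
  refine ⟨h'.1.trans h.1, fun he => ?_⟩
  have h1 : lcmOf I = lcmOf J := le_antisymm (he.le.trans h'.1) h.1
  exact (h.2 h1).trans (h'.2 (h1.symm.trans he))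

/-- All edges that keep the least common multiple do not decrease the number of classes. -/
def ClMonotone (C : BasedComplex a) : Prop := ∀ I J, C.Edge I J → ClLe I J

theorem ClMonotone.path {C : BasedComplex a} (hC : ClMonotone C) {N : Matching a}
    (hN : IsStandardStep 1 C N) {I J : Cell a}
    (h : Relation.ReflTransGen (C.Step N) I J) : ClLe I J := by
  induction h with
  | refl => exact ⟨le_rfl, fun _ => le_rfl⟩
  | tail _ h ih =>
    refine ih.trans ?_
    rcases h with h | h
    · exact hC _ _ h.1
    · exact ⟨(hN.graded _ h).le, fun _ => by have := hN.cl_diff _ h; simp only at this; omega⟩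

theorem ClMonotone.morse {C : BasedComplex a} (hC : ClMonotone C) {N : Matching a}
    (hN : IsStandardStep 1 C N) : ClMonotone (C.morse N) :=
  fun _ _ h => hC.path hN (morse_edge_path h)

theorem lcmAntitone_taylor : LcmAntitone (taylor a) := by
  intro I J h
  obtain ⟨m, -, rfl⟩ := taylor_coeff_ne_zero h.2.2.2
  exact lcmOf_mono (Finset.erase_subset _ _)

/-- The cells with a given least common multiple. -/
def lcmStrand (α : σ →₀ ℕ) (I : Cell a) : Prop := lcmOf I = α

/-- The connected cells with a given least common multiple. -/
def connStrand (α : σ →₀ ℕ) (I : Cell a) : Prop := lcmOf I = α ∧ cl I = 1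

theorem isStrand_lcmStrand (α : σ →₀ ℕ) : IsStrand (lcmStrand (a := a) α) where
  lcm_eq _ _ hI hJ := hI.trans hJ.symm
  convex _ _ _ h1 h2 hI hK :=
    le_antisymm ((lcmOf_mono h2).trans hI.le) (hK.ge.trans (lcmOf_mono h1))

theorem ExactAbove.morse_lcmStrand {C : BasedComplex a} {N : Matching a} {α : σ →₀ ℕ} {d : ℕ}
    (h : C.ExactAbove (lcmStrand α) d) (hC : LcmAntitone C) (hN : C.IsAcyclicMatching N)
    (hg : ∀ e ∈ N, lcmOf e.1 = lcmOf e.2) : (C.morse N).ExactAbove (lcmStrand α) d := by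
  refine h.morse hN (fun e he => by unfold lcmStrand; rw [hg e he]) ?_
  intro I K J hI hJ h1 h2
  exact le_antisymm ((hC.path hg h1).trans hI.le) (hJ.ge.trans (hC.path hg h2))

/-- Along a path the lcm can only shrink, and while it is constant the number of classes cannot
drop: the edges of `C` do not lower it and the edges of a `1`-admissible matching keep it. So a path
between two connected cells with the same lcm stays among such cells. -/
theorem ExactAbove.morse_connStrand {C : BasedComplex a} {N : Matching a} {α : σ →₀ ℕ} {d : ℕ}
    (h : C.ExactAbove (connStrand α) d) (hC : ClMonotone C) (hN : IsStandardStep 1 C N) :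
    (C.morse N).ExactAbove (connStrand α) d := by
  refine h.morse hN.acyclicMatching (fun e he => ?_) ?_
  · have := hN.cl_diff e he
    unfold connStrand
    rw [hN.graded e he]
    refine and_congr Iff.rfl ⟨fun _ => by omega, fun _ => by omega⟩
  · intro I K J hI hJ h1 h2
    have h1 := hC.path hN h1
    have h2 := hC.path hN h2
    have hK : lcmOf K = α := le_antisymm (h1.1.trans hI.1.le) (hJ.1.ge.trans h2.1)
    refine ⟨hK, ?_⟩
    have e1 := h1.2 (hI.1.trans hK.symm)
    have e2 := h2.2 (hK.trans hJ.1.symm)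
    rw [hI.2] at e1
    rw [hJ.2] at e2
    omega

section Edge

variable (ha : IsEdgeIdeal a)
include ha

/-- As no variable is lost, every generator of `I` shares a variable with one of `J`; so the classes
of `J` map onto those of `I`. -/
theorem cl_le_of_subset {I J : Cell a} (hsub : J ⊆ I) (hv : verts I = verts J) : cl I ≤ cl J := by
  unfold cl
  refine Nat.card_le_card_of_surjective
    (Quot.map (fun x : J => (⟨x.1, hsub x.2⟩ : I)) fun _ _ h => h) ?_
  intro z
  obtain ⟨z, rfl⟩ := Quot.exists_rep z
  obtain ⟨p, hp⟩ := support_nonempty ha z.1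
  have : p ∈ verts J := hv ▸ mem_verts.2 ⟨z, z.2, hp⟩
  obtain ⟨y, hy, hpy⟩ := mem_verts.1 this
  refine ⟨Quot.mk _ ⟨y, hy⟩, Quot.sound ?_⟩
  rw [isCoprimeMon_iff, Finset.not_disjoint_iff]
  exact ⟨p, hpy, hp⟩

theorem clMonotone_taylor : ClMonotone (taylor a) := by
  intro I J h
  obtain ⟨m, -, rfl⟩ := taylor_coeff_ne_zero h.2.2.2
  exact ⟨lcmOf_mono (Finset.erase_subset _ _),
    fun h => cl_le_of_subset ha (Finset.erase_subset _ _) ((lcmOf_eq_iff ha).1 h)⟩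

theorem isStrand_connStrand (α : σ →₀ ℕ) : IsStrand (connStrand (a := a) α) where
  lcm_eq _ _ hI hJ := hI.1.trans hJ.1.symm
  convex I J K h1 h2 hI hK := by
    have hJ := (isStrand_lcmStrand α).convex I J K h1 h2 hI.1 hK.1
    have e1 := cl_le_of_subset ha h2 ((lcmOf_eq_iff ha).1 (hI.1.trans hJ.symm))
    have e2 := cl_le_of_subset ha h1 ((lcmOf_eq_iff ha).1 (hJ.trans hK.1.symm))
    rw [hI.2] at e1
    rw [hK.2] at e2
    exact ⟨hJ, by omega⟩

theorem taylor_exactAbove_lcm {I : Cell a} (hI : I.Nonempty) :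
    (taylor a).ExactAbove (lcmStrand (lcmOf I)) (verts I).card := by
  refine taylor_exactAbove ha (isStrand_lcmStrand _) (fun J K h _ hJ => h.symm.trans hJ) ?_ ?_
  · rw [Finset.card_pos, Finset.nonempty_iff_ne_empty, Ne, verts_eq_empty ha]
    exact hI.ne_empty
  · intro J hJ
    rw [(lcmOf_eq_iff ha).1 hJ]

theorem taylor_exactAbove_conn {I : Cell a} (hI : I.Nonempty) :
    (taylor a).ExactAbove (connStrand (lcmOf I)) (verts I).card := by
  refine taylor_exactAbove ha (isStrand_connStrand ha _)
    (fun J K h h' hJ => ⟨h.symm.trans hJ.1, h'.symm.trans hJ.2⟩) ?_ ?_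
  · rw [Finset.card_pos, Finset.nonempty_iff_ne_empty, Ne, verts_eq_empty ha]
    exact hI.ne_empty
  · intro J hJ
    rw [(lcmOf_eq_iff ha).1 hJ.1]

omit ha in
/-- A cell belongs to the basis if and only if all its classes do. -/
def CompClosed (C : BasedComplex a) : Prop :=
  ∀ I, I ∈ C.basis ↔ ∀ D, IsComp I D → D ∈ C.basis

omit ha in
theorem compClosed_taylor : CompClosed (taylor a) :=
  fun _ => ⟨fun _ _ _ => Finset.mem_univ _, fun _ => Finset.mem_univ _⟩

/-- Here the closure condition on `N` enters: its edges are the base edges between connected cells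
with a coprime `K` added. So a cell is matched exactly if one of its components is, and the first
sequence acts on components. -/
theorem isCritical_iff_comp {C : BasedComplex a} (hC : CompClosed C) {N : Matching a}
    (hN : IsStandardStep 1 C N) {I : Cell a} (hI : I ∈ C.basis) :
    IsCritical N I ↔ ∀ D, IsComp I D → IsCritical N D := by
  obtain ⟨B, hBN, hB, hcl⟩ := hN.closed
  constructor
  · intro hcr D hD e he
    rw [← not_or]
    intro hDe
    obtain ⟨f, hf, K, hcop, rfl, -, -⟩ := (hcl e).1 he
    simp only at hDe
    have hlf := hN.graded f (hBN hf)
    have hvf : verts f.1 = verts f.2 := (lcmOf_eq_iff ha).1 hlf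
    rw [isCoprimeMon_lcm] at hcop
    have hcop2 : Disjoint (verts f.2) (verts K) := hvf ▸ hcop
    -- `D` is an end of the edge and is connected, whereas a nonempty `K` would add a class.
    have hK : K = ∅ := by
      by_contra hne
      have := cl_pos ha (Finset.nonempty_iff_ne_empty.2 hne)
      have h1 := cl_union ha hcop
      have h2 := cl_union ha hcop2
      have h3 := hB f hf
      rcases hDe with h | h
      · have := hD.conn; rw [h] at this; omega
      · have := hD.conn; rw [h] at this; omega
    subst hK
    simp only [Finset.union_empty] at hDe
    have hvD : verts D = verts f.1 := by
      rcases hDe with h | h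
      · rw [h]
      · rw [h, hvf]
    have hd1 : Disjoint (verts f.1) (verts (I \ D)) := hvD ▸ hD.disj
    have hd2 : Disjoint (verts f.2) (verts (I \ D)) := hvf ▸ hd1
    have hbas : ∀ F : Cell a, F ∈ C.basis → cl F = 1 → Disjoint (verts F) (verts (I \ D)) →
        F ∪ (I \ D) ∈ C.basis := by
      intro F hF hF1 hd
      refine (hC _).2 fun G hG => ?_
      rcases (isComp_union_iff ha hd).1 hG with hG | hG
      · rw [(isComp_of_conn ha hF1).1 hG]; exact hF
      · refine (hC I).1 hI G ?_
        rw [← hD.union_sdiff]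
        exact (isComp_union_iff ha hD.disj).2 (Or.inr hG)
    have hedge := hN.acyclicMatching.edge f (hBN hf)
    have hmem := (hcl (f.1 ∪ (I \ D), f.2 ∪ (I \ D))).2 ⟨f, hf, I \ D, isCoprimeMon_lcm.2 hd1, rfl,
      hbas _ hedge.1 (hB f hf).1 hd1, hbas _ hedge.2.1 (hB f hf).2 hd2⟩
    have := hcr _ hmem
    simp only at this
    rcases hDe with h | h
    · rw [← h, hD.union_sdiff] at this; exact this.1 rfl
    · rw [← h, hD.union_sdiff] at this; exact this.2 rfl
  · intro hcomp e he
    obtain ⟨f, hf, K, hcop, rfl, -, -⟩ := (hcl e).1 he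
    have hvf : verts f.1 = verts f.2 := (lcmOf_eq_iff ha).1 (hN.graded f (hBN hf))
    rw [isCoprimeMon_lcm] at hcop
    have hcop2 : Disjoint (verts f.2) (verts K) := hvf ▸ hcop
    constructor
    · rintro rfl
      exact (hcomp _ (IsComp.union ha (hB f hf).1 hcop) f (hBN hf)).1 rfl
    · rintro rfl
      exact (hcomp _ (IsComp.union ha (hB f hf).2 hcop2) f (hBN hf)).2 rfl

theorem CompClosed.morse {C : BasedComplex a} (hC : CompClosed C) {N : Matching a}
    (hN : IsStandardStep 1 C N) : CompClosed (C.morse N) := by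
  intro I
  simp only [mem_morse_basis]
  constructor
  · rintro ⟨h1, h2⟩ D hD
    exact ⟨(hC I).1 h1 D hD, (isCritical_iff_comp ha hC hN h1).1 h2 D hD⟩
  · intro h
    have h1 : I ∈ C.basis := (hC I).2 fun D hD => (h D hD).1
    exact ⟨h1, (isCritical_iff_comp ha hC hN h1).2 fun D hD => (h D hD).2⟩

theorem compClosed_morseList {L : List (Matching a)} (hL : IsStandardSequence 1 (taylor a) L) :
    CompClosed (morseList (taylor a) L) :=
  IsStandardSequence.induction (p := CompClosed) (fun _ _ hC hN => hC.morse ha hN) L _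
    compClosed_taylor hL

omit ha in
theorem mem_basis_iff_unmatched {L : List (Matching a)} {I : Cell a} :
    I ∈ (morseList (taylor a) L).basis ↔ Unmatched L I := by
  rw [mem_morseList_basis]
  exact and_iff_right (Finset.mem_univ _)

theorem unmatched_iff_comp {L : List (Matching a)} (hL : IsStandardSequence 1 (taylor a) L)
    {I : Cell a} : Unmatched L I ↔ ∀ D, IsComp I D → Unmatched L D := by
  have := compClosed_morseList ha hL I
  simpa only [mem_basis_iff_unmatched] using this

theorem exactAbove_conn_morseList {L : List (Matching a)}
    (hL : IsStandardSequence 1 (taylor a) L) {I : Cell a} (hI : I.Nonempty) :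
    (morseList (taylor a) L).ExactAbove (connStrand (lcmOf I)) (verts I).card :=
  (IsStandardSequence.induction
    (p := fun C => ClMonotone C ∧ C.ExactAbove (connStrand (lcmOf I)) (verts I).card)
    (fun _ _ hC hN => ⟨hC.1.morse hN, ExactAbove.morse_connStrand hC.2 hC.1 hN⟩) L _
    ⟨clMonotone_taylor ha, taylor_exactAbove_conn ha hI⟩ hL).2

/-- The connected cells that a first sequence does not match are trees. -/
theorem IsFirstSequence.card_of_conn {L : List (Matching a)} (hL : IsFirstSequence L) {I : Cell a}
    (hI : Unmatched L I) (hcl : cl I = 1) : I.card + 1 = (verts I).card := by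
  -- Completeness makes the differential between connected cells of this lcm zero, and exactness
  -- then leaves no cell with as many generators as variables. Connectedness bounds the size from
  -- below.
  have h1 := exactAbove_conn_morseList ha hL.sequence (nonempty_of_cl hcl)
  have h2 := h1.card_lt (I := I) (by
    refine Matrix.ext fun J K => ?_
    rw [Matrix.zero_apply]
    by_contra hne
    obtain ⟨q1, q2, q3⟩ := BasedComplex.strand_ne_zero hne
    exact hL.complete J K q3 (q1.1.trans q2.1.symm) ⟨q1.2, q2.2⟩)
    (mem_basis_iff_unmatched.2 hI) ⟨rfl, hcl⟩
  have h3 := card_verts_le ha hcl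
  omega

theorem IsFirstSequence.card_add_cl {L : List (Matching a)} (hL : IsFirstSequence L) {I : Cell a}
    (hI : Unmatched L I) : I.card + cl I = (verts I).card :=
  card_add_cl_of_comp ha fun D hD =>
    hL.card_of_conn ha ((unmatched_iff_comp ha hL.sequence).1 hI D hD) hD.conn

end Edge

/-- The two ends of a matched edge have the same lcm and sizes that differ by one, so their terms
cancel. -/
theorem sum_morse_basis {C : BasedComplex a} {N : Matching a} (hN : C.IsAcyclicMatching N)
    (hg : ∀ e ∈ N, lcmOf e.1 = lcmOf e.2) :
    ∑ I ∈ (C.morse N).basis, kTerm I =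
      ∑ I ∈ C.basis, kTerm I := by
  have h1 : (C.morse N).basis = C.basis.filter (IsCritical N) := by
    ext I; rw [mem_morse_basis, Finset.mem_filter]
  rw [h1, ← Finset.sum_filter_add_sum_filter_not C.basis (IsCritical N), left_eq_add]
  have h2 : C.basis.filter (fun I => ¬ IsCritical N I) = N.biUnion fun e => {e.1, e.2} := by
    ext I
    simp only [Finset.mem_filter, Finset.mem_biUnion, Finset.mem_insert, Finset.mem_singleton]
    constructor
    · rintro ⟨-, h⟩
      unfold IsCritical at h
      push Not at h
      obtain ⟨e, he, h⟩ := h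
      exact ⟨e, he, or_iff_not_imp_left.2 h⟩
    · rintro ⟨e, he, h⟩
      have := hN.edge e he
      rcases h with rfl | rfl
      · exact ⟨this.1, fun hc => (hc e he).1 rfl⟩
      · exact ⟨this.2.1, fun hc => (hc e he).2 rfl⟩
  rw [h2, Finset.sum_biUnion]
  · refine Finset.sum_eq_zero fun e he => ?_
    have h3 := (hN.edge e he).2.2.1
    have hne : e.1 ≠ e.2 := fun h => by rw [h] at h3; omega
    rw [Finset.sum_pair hne, kTerm, kTerm, hg e he, h3, ← map_add, pow_succ, mul_neg_one, neg_add_cancel, map_zero]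
  · intro e he f hf hne
    rw [Function.onFun, Finset.disjoint_left]
    intro I h3 h4
    simp only [Finset.mem_insert, Finset.mem_singleton] at h3 h4
    apply hne
    apply hN.matching e he f hf
    rcases h3 with rfl | rfl <;> rcases h4 with h4 | h4 <;> simp [h4]

theorem sum_taylor_basis : ∑ I ∈ (taylor a).basis, kTerm I = kSeries a := rfl

theorem sum_morseList_basis {i : ℕ} {C : BasedComplex a} {L : List (Matching a)}
    (hL : IsStandardSequence i C L)
    (hC : ∑ I ∈ C.basis, kTerm I = kSeries a) :
    ∑ I ∈ (morseList C L).basis, kTerm I =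
      kSeries a :=
  IsStandardSequence.induction (p := fun C => ∑ I ∈ C.basis, kTerm I = kSeries a)
    (fun _ _ h hN => (sum_morse_basis hN.acyclicMatching hN.graded).trans h) L C hC hL

end Sequences

end MonomialRing

end

set_option linter.unusedSectionVars false
noncomputable section
open MvPolynomial
open scoped Classical TensorProduct

namespace MonomialRing

universe u v

/-! ### Standard matchings: the first sequence is complete, the third and later ones are empty -/

section Standard

variable {k : Type u} [Field k] {σ : Type v} [Fintype σ] {a : Ideal (MvPolynomial σ k)}

theorem IsStandardSequence.exists_step {i : ℕ} {p : BasedComplex a → Prop}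
    (hstep : ∀ C N, p C → IsStandardStep i C N → p (C.morse N)) (L : List (Matching a)) :
    ∀ C, p C → IsStandardSequence i C L → ∀ N ∈ L, ∃ C', p C' ∧ IsStandardStep i C' N := by
  induction L with
  | nil => exact fun C _ _ N hN => absurd hN List.not_mem_nil
  | cons N L ih =>
    intro C hC hL N' hN'
    rcases List.mem_cons.1 hN' with rfl | hN'
    · exact ⟨C, hC, hL.1⟩
    · exact ih _ (hstep C N hC hL.1) hL.2 N' hN'

theorem morse_basis_subset (C : BasedComplex a) (N : Matching a) :
    (C.morse N).basis ⊆ C.basis := Finset.filter_subset _ _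

theorem mem_morseUpTo_basis {M : ℕ → List (Matching a)} {n : ℕ} {I : Cell a} :
    I ∈ (morseUpTo M n).basis ↔ ∀ i, 1 ≤ i → i ≤ n → Unmatched (M i) I := by
  induction n with
  | zero => exact ⟨fun _ i h1 h2 => by omega, fun _ => Finset.mem_univ _⟩
  | succ n ih =>
    rw [morseUpTo, mem_morseList_basis, ih]
    constructor
    · rintro ⟨h1, h2⟩ i hi hin
      rcases Nat.lt_or_ge n i with h | h
      · have : i = n + 1 := by omega
        rw [this]; exact h2
      · exact h1 i hi h
    · exact fun h => ⟨fun i h1 h2 => h i h1 (by omega), h (n + 1) (by omega) le_rfl⟩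

theorem morseUpTo_basis_subset {M : ℕ → List (Matching a)} {m n : ℕ} (h : m ≤ n) :
    (morseUpTo M n).basis ⊆ (morseUpTo M m).basis := by
  intro I hI
  rw [mem_morseUpTo_basis] at hI ⊢
  exact fun i h1 h2 => hI i h1 (h2.trans h)

theorem morseUpTo_eq {M : ℕ → List (Matching a)} {n : ℕ} (h : ∀ i, n < i → M i = []) (d : ℕ) :
    morseUpTo M (n + d) = morseUpTo M n := by
  induction d with
  | zero => rfl
  | succ d ih => rw [← add_assoc, morseUpTo, h _ (by omega), ih]; rfl

theorem morseUpTo_induction {M : ℕ → List (Matching a)}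
    (hM : ∀ i, IsStandardSequence (i + 1) (morseUpTo M i) (M (i + 1)))
    {p : BasedComplex a → Prop} (h0 : p (taylor a))
    (hstep : ∀ i C N, p C → IsStandardStep i C N → p (C.morse N)) (n : ℕ) :
    p (morseUpTo M n) := by
  induction n with
  | zero => exact h0
  | succ n ih => exact IsStandardSequence.induction (hstep (n + 1)) _ _ ih (hM n)

variable (ha : IsEdgeIdeal a)
include ha

theorem morseUpTo_exactAbove {M : ℕ → List (Matching a)}
    (hM : ∀ i, IsStandardSequence (i + 1) (morseUpTo M i) (M (i + 1))) {I : Cell a}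
    (hI : I.Nonempty) (n : ℕ) :
    (morseUpTo M n).ExactAbove (lcmStrand (lcmOf I)) (verts I).card :=
  (morseUpTo_induction hM
    (p := fun C => LcmAntitone C ∧ C.ExactAbove (lcmStrand (lcmOf I)) (verts I).card)
    ⟨lcmAntitone_taylor, taylor_exactAbove_lcm ha hI⟩
    (fun _ _ _ hC hN => ⟨hC.1.morse hN.graded,
      ExactAbove.morse_lcmStrand hC.2 hC.1 hN.acyclicMatching hN.graded⟩) n).2

/-- A connected cell with a circuit is not matched after the first sequence, provided that the
first sequence leaves only trees on fewer variables. -/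
theorem isCritical_of_circuit {i : ℕ} (hi : 1 ≤ i) {C C₁ : BasedComplex a} (hC₁ : CompClosed C₁)
    (hsub : C.basis ⊆ C₁.basis) {N : Matching a} (hN : IsStandardStep (i + 1) C N) {I : Cell a}
    (hcl : cl I = 1) (hcard : (verts I).card ≤ I.card)
    (ih : ∀ D ∈ C₁.basis, cl D = 1 → (verts D).card < (verts I).card →
      D.card + 1 = (verts D).card) : IsCritical N I := by
  intro e he
  have hedge := hN.acyclicMatching.edge e he
  have hd := hN.cl_diff e he
  have hcard' := hedge.2.2.1
  constructor
  -- `I` is the upper end. Its partner has `i + 1 ≥ 2` classes, each on fewer variables and thus a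
  -- tree by `ih`, so size plus classes of the partner is the number of variables. But this sum is
  -- also `|I| + i`, which is larger.
  · rintro rfl
    have hv : verts e.2 = verts e.1 := (lcmOf_eq_iff ha).1 (hN.graded e he).symm
    have : e.2.card + cl e.2 = (verts e.2).card := by
      refine card_add_cl_of_comp ha fun D hD => ih D ((hC₁ _).1 (hsub hedge.2.1) D hD) hD.conn ?_
      rw [← hv]
      apply Finset.card_lt_card
      refine ⟨verts_mono hD.subset, fun hle => ?_⟩
      have h1 : verts (e.2 \ D) = ∅ := by
        have h2 : verts (e.2 \ D) ⊆ verts D := (verts_mono Finset.sdiff_subset).trans hle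
        have h3 := hD.disj.mono_left h2
        exact disjoint_self.1 h3
      rw [verts_eq_empty ha] at h1
      have h2 := hD.union_sdiff
      rw [h1, Finset.union_empty] at h2
      have := hD.conn
      rw [h2] at this
      omega
    rw [hv] at this
    omega
  -- `I` is the lower end. The upper end would have `1 - i ≤ 0` classes.
  · rintro rfl
    have : 0 < cl e.1 := cl_pos ha (Finset.card_pos.1 (by omega))
    omega

/-- Strong induction on the number of variables. A connected cell with a circuit that `M_1` leaves
over survives all later sequences. But in the final complex the strand of its lcm has zero
differential and is exact in that degree. -/
theorem IsStandardMatching.card_of_conn {M : ℕ → List (Matching a)} (hM : IsStandardMatching M)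
    (n : ℕ) : ∀ I ∈ (morseUpTo M 1).basis, cl I = 1 → (verts I).card = n →
      I.card + 1 = n := by
  induction n using Nat.strong_induction_on with
  | _ n ih =>
    intro I hI hcl hn
    by_contra hne
    have hle := card_verts_le ha hcl
    have hge : (verts I).card ≤ I.card := by omega
    have hC₁ : CompClosed (morseUpTo M 1) := compClosed_morseList ha (hM.sequence 0)
    have hall : ∀ j, (morseUpTo M (j + 1)).basis ⊆ (morseUpTo M 1).basis ∧
        I ∈ (morseUpTo M (j + 1)).basis := by
      intro j
      induction j with
      | zero => exact ⟨le_rfl, hI⟩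
      | succ j hj =>
        refine IsStandardSequence.induction
          (p := fun C => C.basis ⊆ (morseUpTo M 1).basis ∧ I ∈ C.basis) ?_ _ _ hj
          (hM.sequence (j + 1))
        intro C N hC hN
        refine ⟨(morse_basis_subset C N).trans hC.1, mem_morse_basis.2 ⟨hC.2, ?_⟩⟩
        refine isCritical_of_circuit ha (Nat.le_add_left 1 j) hC₁ hC.1 hN hcl hge ?_
        intro D hD hD1 hlt
        exact ih _ (hn ▸ hlt) D hD hD1 rfl
    obtain ⟨m, hm, hmin⟩ := hM.minimal
    have hmem := (hall m).2
    have hex := morseUpTo_exactAbove ha hM.sequence (nonempty_of_cl hcl) (m + 1)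
    rw [morseUpTo_eq hm 1] at hmem hex
    have := hex.card_lt (by
      refine Matrix.ext fun J K => ?_
      rw [Matrix.zero_apply]
      by_contra hne
      obtain ⟨q1, q2, q3⟩ := BasedComplex.strand_ne_zero hne
      exact hmin J K q3 (q1.trans q2.symm)) hmem rfl
    omega

/-- Trees on the same variables have the same size, so no edge runs between two of them. -/
theorem IsStandardMatching.isFirstSequence {M : ℕ → List (Matching a)}
    (hM : IsStandardMatching M) : IsFirstSequence (M 1) where
  sequence := hM.sequence 0
  complete := by
    rintro I J hE hl ⟨h1, h2⟩
    have e1 := hM.card_of_conn ha _ I hE.1 h1 rfl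
    have e2 := hM.card_of_conn ha _ J hE.2.1 h2 rfl
    rw [(lcmOf_eq_iff ha).1 hl] at e1
    have := hE.2.2.1
    omega

theorem IsStandardMatching.card_add_cl {M : ℕ → List (Matching a)} (hM : IsStandardMatching M)
    {I : Cell a} (hI : I ∈ (morseUpTo M 1).basis) : I.card + cl I = (verts I).card :=
  (hM.isFirstSequence ha).card_add_cl ha (mem_basis_iff_unmatched.1 hI)

/-- Among the cells left by `M_1`, size plus number of classes is determined by the lcm. An edge of
a matching thus raises the number of classes by exactly one, while a base edge raises it from `1` to
`i`; so `i = 2`. -/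
theorem IsStandardMatching.eq_empty {M : ℕ → List (Matching a)} (hM : IsStandardMatching M)
    {i : ℕ} (hi : 3 ≤ i) {N : Matching a} (hN : N ∈ M i) : N = ∅ := by
  obtain ⟨j, rfl⟩ : ∃ j, i = j + 1 := ⟨i - 1, by omega⟩
  obtain ⟨C, hC, hN⟩ := IsStandardSequence.exists_step
    (p := fun C => C.basis ⊆ (morseUpTo M 1).basis)
    (fun C N hC _ => (morse_basis_subset C N).trans hC) _ _
    (morseUpTo_basis_subset (by omega : 1 ≤ j)) (hM.sequence j) N hN
  obtain ⟨B, hBN, hB, hcl⟩ := hN.closed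
  rw [Finset.eq_empty_iff_forall_notMem]
  intro f hf
  obtain ⟨e, he, -⟩ := (hcl f).1 hf
  have hedge := hN.acyclicMatching.edge e (hBN he)
  have e1 := hM.card_add_cl ha (hC hedge.1)
  have e2 := hM.card_add_cl ha (hC hedge.2.1)
  rw [(lcmOf_eq_iff ha).1 (hN.graded e (hBN he))] at e1
  have := hedge.2.2.1
  have := hB e he
  omega

end Standard

/-! ### Existence of a first sequence: Whitney's matching cut into levels -/

section Existence

variable {k : Type u} [Field k] {σ : Type v} [Fintype σ] {a : Ideal (MvPolynomial σ k)}

/-- The position of a generator in an enumeration. -/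
def genIndex (m : minGens a) : ℕ := (minGens a).equivFin m

theorem genIndex_injective : Function.Injective (genIndex (a := a)) := fun _ _ h =>
  (minGens a).equivFin.injective (Fin.ext h)

/-- The edges `I → I ∖ {m}` where the smallest bad generator `m ∈ I` has position `s`. -/
def levelMatching (a : Ideal (MvPolynomial σ k)) (s : ℕ) : Matching a :=
  (whitneyMatching genIndex fun _ => True).filter fun e => level genIndex e.1 = s

/-- The Morse complexes of the successive matchings `levelMatching a s`. -/
def levelComplex (a : Ideal (MvPolynomial σ k)) : ℕ → BasedComplex a
  | 0 => taylor a
  | s + 1 => (levelComplex a s).morse (levelMatching a s)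

theorem mem_levelMatching {s : ℕ} {I J : Cell a} : (I, J) ∈ levelMatching a s ↔
    ∃ m ∈ I, genIndex m = s ∧ IsMinBad genIndex I m ∧ J = I.erase m := by
  rw [levelMatching, Finset.mem_filter, mem_whitneyMatching]
  constructor
  · rintro ⟨⟨-, -, m, h1, h2, h3⟩, h4⟩
    refine ⟨m, h1, ?_, h2, h3⟩
    rw [h2.level_eq] at h4
    exact WithTop.coe_inj.1 h4
  · rintro ⟨m, h1, h2, h3, h4⟩
    refine ⟨⟨trivial, trivial, m, h1, h3, h4⟩, ?_⟩
    rw [h3.level_eq, h2]; rfl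

theorem levelMatching_level {s : ℕ} {I J : Cell a} (h : (I, J) ∈ levelMatching a s) :
    level genIndex I = s ∧ level genIndex J = s := by
  obtain ⟨m, h1, rfl, h3, rfl⟩ := mem_levelMatching.1 h
  exact ⟨h3.level_eq, h3.erase.level_eq⟩

/-- Every cell whose smallest bad generator has position `s` lies on an edge of the `s`-th matching,
and no other cell does; so each step removes exactly one level. -/
theorem mem_levelComplex {s : ℕ} {I : Cell a} :
    I ∈ (levelComplex a s).basis ↔ (s : WithTop ℕ) ≤ level genIndex I := by
  induction s with
  | zero => exact ⟨fun _ => by simp, fun _ => Finset.mem_univ _⟩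
  | succ s ih =>
    rw [levelComplex, mem_morse_basis, ih]
    have hlt : ((s + 1 : ℕ) : WithTop ℕ) ≤ level genIndex I ↔ (s : WithTop ℕ) < level genIndex I := by
      cases h : level (genIndex (a := a)) I with
      | top => simp
      | coe x =>
        have h1 : ((s + 1 : ℕ) : WithTop ℕ) ≤ (x : ℕ) ↔ s + 1 ≤ x := WithTop.coe_le_coe
        have h2 : ((s : ℕ) : WithTop ℕ) < (x : ℕ) ↔ s < x := WithTop.coe_lt_coe
        exact h1.trans (Nat.succ_le_iff.trans h2.symm)
    rw [hlt, lt_iff_le_and_ne]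
    refine and_congr Iff.rfl ⟨fun hc he => ?_, fun hne e he => ?_⟩
    · have hex : ∃ m : minGens a, genIndex m = s := by
        by_contra hno
        push Not at hno
        have hne : (Finset.univ.filter (Bad (genIndex (a := a)) I)).Nonempty := by
          by_contra h0
          rw [Finset.not_nonempty_iff_eq_empty] at h0
          rw [level, h0, Finset.inf_empty] at he
          exact WithTop.coe_ne_top he
        obtain ⟨m, hm⟩ := hne
        obtain ⟨m, hm⟩ := exists_isMinBad (Finset.mem_filter.1 hm).2
        rw [hm.level_eq] at he
        exact hno m (WithTop.coe_inj.1 he).symm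
      obtain ⟨m, hm⟩ := hex
      have hmin : IsMinBad genIndex I m := isMinBad_of_level genIndex_injective (by rw [← he, hm]; rfl)
      by_cases h : m ∈ I
      · exact (hc (I, I.erase m) (mem_levelMatching.2 ⟨m, h, hm, hmin, rfl⟩)).1 rfl
      · refine (hc (insert m I, I) (mem_levelMatching.2 ⟨m, Finset.mem_insert_self _ _, hm,
          hmin.insert, ?_⟩)).2 rfl
        simp [h]
    · have := levelMatching_level he
      exact ⟨fun h => hne (h ▸ this.1.symm), fun h => hne (h ▸ this.2.symm)⟩

/-- The least common multiple decreases, or it stays and the level does not drop. -/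
def LevelLe (I J : Cell a) : Prop :=
  lcmOf J ≤ lcmOf I ∧ (lcmOf I = lcmOf J → level genIndex I ≤ level genIndex J)

theorem LevelLe.trans {I J K : Cell a} (h : LevelLe I J) (h' : LevelLe J K) : LevelLe I K := by
  refine ⟨h'.1.trans h.1, fun he => ?_⟩
  have h1 : lcmOf I = lcmOf J := le_antisymm (he.le.trans h'.1) h.1
  exact (h.2 h1).trans (h'.2 (h1.symm.trans he))

section Edge

variable (ha : IsEdgeIdeal a)
include ha

theorem levelMatching_lcm {s : ℕ} {I J : Cell a} (h : (I, J) ∈ levelMatching a s) :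
    lcmOf I = lcmOf J ∧ cl I = cl J := by
  obtain ⟨m, h1, -, h3, rfl⟩ := mem_levelMatching.1 h
  have e1 := h3.1.verts_eq ha
  have e2 := h3.1.cl_eq ha
  rw [Finset.insert_eq_of_mem h1] at e1 e2
  exact ⟨(lcmOf_eq_iff ha).2 e1, e2⟩

theorem levelLe_path {s : ℕ} (hE : ∀ I J, (levelComplex a s).Edge I J → LevelLe I J) {I J : Cell a}
    (h : Relation.ReflTransGen ((levelComplex a s).Step (levelMatching a s)) I J) :
    LevelLe I J := by
  induction h with
  | refl => exact ⟨le_rfl, fun _ => le_rfl⟩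
  | tail _ h ih =>
    refine ih.trans ?_
    rcases h with h | h
    · exact hE _ _ h.1
    · have e1 := levelMatching_lcm ha h
      have e2 := levelMatching_level h
      exact ⟨e1.1.le, fun _ => by rw [e2.1, e2.2]⟩

theorem levelComplex_edge (s : ℕ) : ∀ I J, (levelComplex a s).Edge I J → LevelLe I J := by
  induction s with
  | zero =>
    intro I J h
    obtain ⟨m, -, rfl⟩ := taylor_coeff_ne_zero h.2.2.2
    exact ⟨lcmOf_mono (Finset.erase_subset _ _), fun _ => level_mono (Finset.erase_subset _ _)⟩
  | succ s ih => exact fun I J h => levelLe_path ha ih (morse_edge_path h)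

/-- The coefficients between cells of the same level that is not yet processed do not change. -/
theorem levelComplex_coeff (s : ℕ) : ∀ I J : Cell a, lcmOf I = lcmOf J →
    level genIndex I = level genIndex J → (s : WithTop ℕ) ≤ level genIndex I →
    I.card = J.card + 1 → (levelComplex a s).coeff I J = (taylor a).coeff I J := by
  induction s with
  | zero => exact fun _ _ _ _ _ _ => rfl
  | succ s ih =>
    intro A B hl hlev hs hcard
    have hs' : (s : WithTop ℕ) < level genIndex A := by
      refine lt_of_lt_of_le ?_ hs
      exact WithTop.coe_lt_coe.2 (Nat.lt_succ_self s)
    have hne : A ≠ B := fun h => by rw [h] at hcard; omega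
    rw [← ih A B hl hlev hs'.le hcard]
    have h0 : (levelComplex a (s + 1)).coeff A B =
        (levelComplex a s).pathSum (levelMatching a s) A B := if_pos hcard
    have hnot : ∀ I J : Cell a, level genIndex I = level genIndex A →
        (I, J) ∉ levelMatching a s ∧ (J, I) ∉ levelMatching a s := by
      intro I J h
      exact ⟨fun h' => hs'.ne' (h.symm.trans (levelMatching_level h').1),
        fun h' => hs'.ne' (h.symm.trans (levelMatching_level h').2)⟩
    -- Along a path that keeps the lcm and the level no reversed edge occurs, as those join cells of
    -- level `s`. So each step lowers the degree by one, and a path with total drop one is a single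
    -- edge.
    have hdeg : ∀ l J, lcmOf A = lcmOf J → level genIndex J = level genIndex A →
        ((levelComplex a s).weight (levelMatching a s) ^ l) A J ≠ 0 → A.card = J.card + l := by
      intro l
      induction l with
      | zero =>
        intro J _ _ h
        rw [pow_zero, Matrix.one_apply] at h
        have : A = J := by by_contra h'; simp [h'] at h
        rw [this]; rfl
      | succ l ihl =>
        intro J hJ hJ' h
        rw [pow_succ, Matrix.mul_apply] at h
        obtain ⟨K, -, hK⟩ := Finset.exists_ne_zero_of_sum_ne_zero h
        have hAK := left_ne_zero_of_mul hK
        have hKJ := weight_ne_zero_step (right_ne_zero_of_mul hK)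
        have p1 := levelLe_path ha (levelComplex_edge ha s) (weight_pow_ne_zero hAK)
        have p2 := levelLe_path ha (levelComplex_edge ha s) (.single hKJ)
        have e1 : lcmOf A = lcmOf K := le_antisymm (hJ.le.trans p2.1) p1.1
        have e2 : level genIndex K = level genIndex A :=
          le_antisymm ((p2.2 (e1.symm.trans hJ)).trans hJ'.le) (p1.2 e1)
        have := ihl K e1 e2 hAK
        rcases hKJ with h1 | h1
        · have := h1.1.2.2.1; omega
        · exact absurd h1 (hnot K J e2).2
    rw [h0, BasedComplex.pathSum, Matrix.sum_apply, Finset.sum_eq_single 1]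
    · rw [pow_one, BasedComplex.weight, if_neg (hnot A B rfl).2]
      by_cases hE : (levelComplex a s).Edge A B
      · rw [if_pos ⟨hE, (hnot A B rfl).1⟩]
      · rw [if_neg fun h => hE h.1]
        by_contra h
        exact hE ⟨mem_levelComplex.2 hs'.le, mem_levelComplex.2 (hlev ▸ hs'.le), hcard, Ne.symm h⟩
    · intro l _ hl1
      by_contra h
      have := hdeg l B hl hlev.symm h
      omega
    · intro h
      exfalso
      apply h
      rw [Finset.mem_range, Fintype.one_lt_card_iff]
      exact ⟨A, B, hne⟩

/-- A potential that increases along the paths of the graph with `levelMatching a s` reversed. -/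
def levelPotential (s : ℕ) (I : Cell a) : (σ →₀ ℕ)ᵒᵈ ×ₗ (WithTop ℕ ×ₗ (ℕ ×ₗ ℤ)) :=
  toLex (OrderDual.toDual (lcmOf I), toLex (level genIndex I,
    toLex (if ∃ m ∈ I, level genIndex I = genIndex m ∧ genIndex m = s then 1 else 0, -(I.card : ℤ))))

theorem levelPotential_lt {s : ℕ} {I J : Cell a}
    (h : (levelComplex a s).Step (levelMatching a s) I J) :
    levelPotential s I < levelPotential s J := by
  unfold levelPotential
  rw [Prod.Lex.toLex_lt_toLex, Prod.Lex.toLex_lt_toLex, Prod.Lex.toLex_lt_toLex]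
  simp only [OrderDual.toDual_lt_toDual, OrderDual.toDual_inj]
  rcases h with ⟨h1, h2⟩ | h1
  · have hle := levelComplex_edge ha s I J h1
    rcases hle.1.lt_or_eq with hlt | heq
    · exact Or.inl hlt
    · right
      refine ⟨heq.symm, ?_⟩
      rcases (hle.2 heq.symm).lt_or_eq with hlt | heq'
      · exact Or.inl hlt
      · right
        refine ⟨heq', Or.inr ?_⟩
        have hc := h1.2.2.2
        rw [levelComplex_coeff ha s I J heq.symm heq' (mem_levelComplex.1 h1.1) h1.2.2.1] at hc
        obtain ⟨m, hm, rfl⟩ := taylor_coeff_ne_zero hc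
        constructor
        · refine if_congr (exists_congr fun x => ⟨fun ⟨q1, q2⟩ => ⟨Finset.mem_erase.2 ⟨?_, q1⟩,
            heq' ▸ q2⟩, fun ⟨q1, q2⟩ => ⟨(Finset.mem_erase.1 q1).2, heq' ▸ q2⟩⟩) rfl rfl
          rintro rfl
          exact h2 (mem_levelMatching.2 ⟨x, hm, q2.2,
            isMinBad_of_level genIndex_injective q2.1, rfl⟩)
        · have := Finset.card_erase_add_one hm
          omega
  · have e1 := levelMatching_lcm ha h1
    have e2 := levelMatching_level h1
    right
    refine ⟨e1.1.symm, Or.inr ⟨by rw [e2.1, e2.2], Or.inl ?_⟩⟩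
    obtain ⟨m, q1, q2, q3, rfl⟩ := mem_levelMatching.1 h1
    rw [if_neg, if_pos ⟨m, q1, q3.level_eq, q2⟩]
    · exact Nat.one_pos
    · rintro ⟨n, hn, -, h4⟩
      have : n = m := genIndex_injective (h4.trans q2.symm)
      subst this
      simp at hn

theorem isAcyclicMatching_level (s : ℕ) :
    (levelComplex a s).IsAcyclicMatching (levelMatching a s) := by
  have hco : ∀ I J, (I, J) ∈ levelMatching a s → I.card = J.card + 1 ∧
      IsUnit ((levelComplex a s).coeff I J) := by
    intro I J h
    have e1 := levelMatching_lcm ha h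
    have e2 := levelMatching_level h
    obtain ⟨m, q1, q2, q3, rfl⟩ := mem_levelMatching.1 h
    have hc := (Finset.card_erase_add_one q1).symm
    refine ⟨hc, ?_⟩
    rw [levelComplex_coeff ha s _ _ e1.1 (e2.1.trans e2.2.symm) e2.1.ge hc,
      taylor_coeff_of_lcm q1 e1.1]
    exact isUnit_taylorSign _ _
  refine ⟨?_, ?_, fun e he => (hco e.1 e.2 he).2, ?_⟩
  · intro e he
    have e2 := levelMatching_level he
    exact ⟨mem_levelComplex.2 e2.1.ge, mem_levelComplex.2 e2.2.ge, (hco e.1 e.2 he).1,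
      (hco e.1 e.2 he).2.ne_zero⟩
  · exact fun e he f hf => whitneyMatching_matching genIndex_injective e
      (Finset.mem_filter.1 he).1 f (Finset.mem_filter.1 hf).1
  · intro I hI
    have : ∀ J, Relation.TransGen ((levelComplex a s).Step (levelMatching a s)) I J →
        levelPotential s I < levelPotential s J := by
      intro J hJ
      induction hJ with
      | single h => exact levelPotential_lt ha h
      | tail _ h ih => exact ih.trans (levelPotential_lt ha h)
    exact lt_irrefl _ (this I hI)

/-- The smaller generators that join the ends of `m` all lie in the component of `m`. -/
theorem IsMinBad.of_comp {I D : Cell a} {m : minGens a} (hD : IsComp I D) (hm : m ∈ D)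
    (h : IsMinBad genIndex I m) : IsMinBad genIndex D m := by
  refine ⟨?_, fun n hn => h.2 n (hn.mono hD.subset)⟩
  obtain ⟨i, j, hij, he⟩ := exists_edge ha m
  rw [bad_iff ha he]
  have hr := (bad_iff ha he).1 h.1
  have hi := mem_verts_of_reachable hij hr
  have hsplit : below genIndex m I = below genIndex m D ∪ below genIndex m (I \ D) := by
    rw [below, below, below, ← Finset.filter_union, hD.union_sdiff]
  have hdisj : Disjoint (verts (below genIndex m D)) (verts (below genIndex m (I \ D))) :=
    Finset.disjoint_of_subset_left (verts_mono (Finset.filter_subset _ _))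
      (Finset.disjoint_of_subset_right (verts_mono (Finset.filter_subset _ _)) hD.disj)
  rw [hsplit] at hr hi
  refine (reachable_union ha hdisj ?_ hr).2
  rw [verts_union, Finset.mem_union] at hi
  refine hi.resolve_right fun h' => ?_
  have h1 : i ∈ verts D := mem_verts.2 ⟨m, hm, by rw [he, edgeMon_support]; simp⟩
  exact Finset.disjoint_left.1 hD.disj h1 (verts_mono (Finset.filter_subset _ _) h')

/-- The levels are needed for the closure condition. A coprime `K` may contain a bad generator
smaller than `m`, in which case the toggle of `D ∪ K` is not the toggle of `D`; but such cells have
left the basis before level `s` is reached. -/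
theorem isStandardStep_level (s : ℕ) :
    IsStandardStep 1 (levelComplex a s) (levelMatching a s) where
  acyclicMatching := isAcyclicMatching_level ha s
  graded e he := (levelMatching_lcm ha he).1
  cl_diff e he := by rw [(levelMatching_lcm ha he).2]
  closed := by
    refine ⟨(levelMatching a s).filter fun e => cl e.1 = 1 ∧ cl e.2 = 1, Finset.filter_subset _ _,
      fun e he => (Finset.mem_filter.1 he).2, ?_⟩
    rintro ⟨I, J⟩
    constructor
    · intro hf
      have hedge := (isAcyclicMatching_level ha s).edge _ hf
      obtain ⟨m, q1, q2, q3, rfl⟩ := mem_levelMatching.1 hf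
      obtain ⟨D, hD, hmD⟩ := exists_comp ha q1
      have hmem : (D, D.erase m) ∈ levelMatching a s :=
        mem_levelMatching.2 ⟨m, hmD, q2, q3.of_comp ha hD hmD, rfl⟩
      have hcl := (levelMatching_lcm ha hmem).2
      have e1 : D ∪ (I \ D) = I := hD.union_sdiff
      have e2 : D.erase m ∪ (I \ D) = I.erase m := by
        nth_rewrite 2 [← e1]
        rw [Finset.erase_union_distrib, Finset.erase_eq_of_notMem (s := I \ D)]
        simp [hmD]
      refine ⟨(D, D.erase m), Finset.mem_filter.2 ⟨hmem, hD.conn, hcl ▸ hD.conn⟩, I \ D,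
        isCoprimeMon_lcm.2 hD.disj, ?_, ?_, ?_⟩
      · simp only [e1, e2]
      · simp only [e1]; exact hedge.1
      · simp only [e2]; exact hedge.2.1
    · rintro ⟨⟨D, D'⟩, he, K, hcop, hf, hb1, hb2⟩
      obtain ⟨he, -⟩ := Finset.mem_filter.1 he
      obtain ⟨m, q1, q2, q3, rfl⟩ := mem_levelMatching.1 he
      rw [isCoprimeMon_lcm] at hcop
      simp only at hf hb1 hb2 q1 q3 hcop
      obtain ⟨rfl, rfl⟩ := Prod.mk.inj hf
      refine mem_levelMatching.2 ⟨m, Finset.mem_union_left _ q1, q2,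
        ⟨q3.1.mono Finset.subset_union_left, fun n hn => ?_⟩, ?_⟩
      -- A bad generator of `D ∪ K` before position `s` would put the level of this cell below `s`,
      -- and the cell would no longer belong to the basis.
      · have h1 := mem_levelComplex.1 hb1
        have h2 : level genIndex (D ∪ K) ≤ genIndex n :=
          Finset.inf_le (f := fun m => (genIndex m : WithTop ℕ)) (by simpa using hn)
        rw [q2]
        exact WithTop.coe_le_coe.1 (h1.trans h2)
      · rw [Finset.erase_union_distrib, Finset.erase_eq_of_notMem (s := K)]
        exact Finset.disjoint_left.1 (disjoint_of_verts ha hcop) q1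

theorem isStandardSequence_level (n : ℕ) : ∀ s,
    IsStandardSequence 1 (levelComplex a s) ((List.range' s n).map (levelMatching a)) ∧
    morseList (levelComplex a s) ((List.range' s n).map (levelMatching a)) =
      levelComplex a (s + n) := by
  induction n with
  | zero => exact fun s => ⟨trivial, rfl⟩
  | succ n ih =>
    intro s
    rw [List.range'_succ, List.map_cons]
    obtain ⟨h1, h2⟩ := ih (s + 1)
    refine ⟨⟨isStandardStep_level ha s, h1⟩, ?_⟩
    rw [show s + (n + 1) = s + 1 + n by omega, ← h2]
    rfl

/-- After all positions have been processed no remaining cell has a bad generator. So the connected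
ones are trees, and equal lcm forces equal size. -/
theorem exists_isFirstSequence : ∃ L : List (Matching a), IsFirstSequence L := by
  obtain ⟨h1, h2⟩ := isStandardSequence_level ha (minGens a).card 0
  refine ⟨_, h1, ?_⟩
  have hbad : ∀ I ∈ (levelComplex a (0 + (minGens a).card)).basis,
      ∀ m, ¬ Bad (genIndex (a := a)) I m := by
    intro I hI m hm
    have h1 := mem_levelComplex.1 hI
    have h2 : level genIndex I ≤ genIndex m :=
      Finset.inf_le (f := fun m => (genIndex m : WithTop ℕ)) (by simpa using hm)
    have h3 := WithTop.coe_le_coe.1 (h1.trans h2)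
    have h4 := ((minGens a).equivFin m).2
    unfold genIndex at h3
    simp only [Nat.cast_id] at h3
    omega
  rintro I J hE hl ⟨c1, c2⟩
  change (morseList (levelComplex a 0) _).Edge I J at hE
  rw [h2] at hE
  have e1 := card_add_cl_of_not_bad ha genIndex_injective (hbad I hE.1)
  have e2 := card_add_cl_of_not_bad ha genIndex_injective (hbad J hE.2.1)
  rw [(lcmOf_eq_iff ha).1 hl] at e1
  have := hE.2.2.1
  omega

end Edge

end Existence

end MonomialRing

end

set_option linter.unusedSectionVars false
noncomputable section
open MvPolynomial
open scoped Classical TensorProduct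

namespace MonomialRing

universe u v

/-! ### The Stanley–Reisner ideal of an order complex -/

section PosetIdeal

variable {k : Type u} [Field k] {P : Type v} [Fintype P] [PartialOrder P]

/-- The support of the monomial is a chain. -/
def ChainSupp (β : P →₀ ℕ) : Prop := IsChain (· ≤ ·) (β.support : Set P)

theorem ChainSupp.mono {β γ : P →₀ ℕ} (h : ChainSupp γ) (hle : β ≤ γ) : ChainSupp β :=
  IsChain.mono (Finset.coe_subset.2 (Finsupp.support_mono hle)) h

theorem prod_X_eq_monomial (F : Finset P) :
    ∏ i ∈ F, (X i : MvPolynomial P k) = monomial (∑ i ∈ F, Finsupp.single i 1) 1 := by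
  induction F using Finset.induction_on with
  | empty => simp
  | insert i s hi ih => rw [Finset.prod_insert hi, Finset.sum_insert hi, ih, X, monomial_mul, one_mul]

theorem sum_single_apply (F : Finset P) (p : P) :
    (∑ i ∈ F, Finsupp.single i 1 : P →₀ ℕ) p = if p ∈ F then 1 else 0 := by
  rw [Finsupp.finsetSum_apply]
  simp [Finsupp.single_apply]

theorem sum_single_le_iff (F : Finset P) (β : P →₀ ℕ) :
    ∑ i ∈ F, Finsupp.single i 1 ≤ β ↔ F ⊆ β.support := by
  constructor
  · intro h p hp
    have := h p
    rw [sum_single_apply, if_pos hp] at this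
    exact Finsupp.mem_support_iff.2 (by omega)
  · intro h p
    rw [sum_single_apply]
    split_ifs with hp
    · exact Nat.one_le_iff_ne_zero.2 (Finsupp.mem_support_iff.1 (h hp))
    · exact Nat.zero_le _

theorem mem_posetIdeal {f : MvPolynomial P k} :
    f ∈ posetIdeal k P ↔ ∀ β ∈ f.support, ¬ ChainSupp β := by
  have h : posetIdeal k P = Ideal.span ((fun s => monomial s (1 : k)) ''
      {s | ∃ F : Finset P, F.Nonempty ∧ F ∉ orderComplex P ∧ s = ∑ i ∈ F, Finsupp.single i 1}) := by
    rw [posetIdeal, stanleyReisner]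
    congr 1
    ext f
    constructor
    · rintro ⟨F, h1, h2, rfl⟩
      exact ⟨_, ⟨F, h1, h2, rfl⟩, (prod_X_eq_monomial F).symm⟩
    · rintro ⟨_, ⟨F, h1, h2, rfl⟩, rfl⟩
      exact ⟨F, h1, h2, (prod_X_eq_monomial F).symm⟩
  rw [h, mem_ideal_span_monomial_image]
  refine forall₂_congr fun β _ => ⟨?_, fun hβ => ?_⟩
  · rintro ⟨_, ⟨F, h1, h2, rfl⟩, h3⟩ hc
    exact h2 ⟨h1, IsChain.mono (Finset.coe_subset.2 ((sum_single_le_iff F β).1 h3)) hc⟩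
  · refine ⟨_, ⟨β.support, ?_, fun h => hβ h.2, rfl⟩, (sum_single_le_iff _ β).2 subset_rfl⟩
    by_contra he
    rw [Finset.not_nonempty_iff_eq_empty] at he
    exact hβ (by simp [ChainSupp, he])

theorem monomial_mem_posetIdeal {β : P →₀ ℕ} :
    monomial β (1 : k) ∈ posetIdeal k P ↔ ¬ ChainSupp β := by
  rw [mem_posetIdeal, support_monomial, if_neg one_ne_zero]
  simp

/-- Incomparability. -/
def Incomp (i j : P) : Prop := ¬ i ≤ j ∧ ¬ j ≤ i

theorem Incomp.ne {i j : P} (h : Incomp i j) : i ≠ j := fun e => h.1 e.le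

theorem Incomp.symm {i j : P} (h : Incomp i j) : Incomp j i := ⟨h.2, h.1⟩

theorem not_chainSupp_iff {β : P →₀ ℕ} :
    ¬ ChainSupp β ↔ ∃ i ∈ β.support, ∃ j ∈ β.support, Incomp i j := by
  constructor
  · intro h
    by_contra hno
    push Not at hno
    refine h fun i hi j hj _ => ?_
    by_contra hc
    exact hno i hi j hj ⟨fun h => hc (Or.inl h), fun h => hc (Or.inr h)⟩
  · rintro ⟨i, hi, j, hj, h⟩ hc
    rcases hc hi hj h.ne with h' | h'
    exacts [h.1 h', h.2 h']

theorem edgeMon_le_iff {i j : P} (hij : i ≠ j) {β : P →₀ ℕ} :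
    edgeMon i j ≤ β ↔ i ∈ β.support ∧ j ∈ β.support := by
  have : edgeMon i j = ∑ p ∈ {i, j}, Finsupp.single p 1 := by rw [Finset.sum_pair hij, edgeMon]
  rw [this, sum_single_le_iff, Finset.insert_subset_iff, Finset.singleton_subset_iff]

/-- An order complex is flag: a set that is not a chain contains two incomparable elements, so these
pairs are the minimal nonfaces. -/
theorem mem_minGens_posetIdeal {m : P →₀ ℕ} :
    m ∈ minGens (posetIdeal k P) ↔ ∃ i j, Incomp i j ∧ m = edgeMon i j := by
  have hedge {i j : P} (h : Incomp i j) : ¬ ChainSupp (edgeMon i j) :=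
    not_chainSupp_iff.2 ⟨i, by simp [edgeMon_support], j, by simp [edgeMon_support], h⟩
  rw [minGens, Set.Finite.mem_toFinset, Set.mem_ofPred_eq]
  simp only [monomial_mem_posetIdeal]
  constructor
  · intro h
    obtain ⟨i, hi, j, hj, hij⟩ := not_chainSupp_iff.1 h.1
    have hle := (edgeMon_le_iff hij.ne).2 ⟨hi, hj⟩
    exact ⟨i, j, hij, le_antisymm (h.2 (hedge hij) hle) hle⟩
  · rintro ⟨i, j, hij, rfl⟩
    refine ⟨hedge hij, fun γ hγ hle => ?_⟩
    obtain ⟨p, hp, q, hq, hpq⟩ := not_chainSupp_iff.1 hγ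
    have hs := Finsupp.support_mono hle
    rw [edgeMon_support] at hs
    have h1 := hs hp
    have h2 := hs hq
    refine (edgeMon_le_iff hij.ne).2 ?_
    simp only [Finset.mem_insert, Finset.mem_singleton] at h1 h2
    rcases h1 with rfl | rfl <;> rcases h2 with rfl | rfl
    exacts [(hpq.ne rfl).elim, ⟨hp, hq⟩, ⟨hq, hp⟩, (hpq.ne rfl).elim]

theorem isEdgeIdeal_posetIdeal : IsEdgeIdeal (posetIdeal k P) := by
  intro m hm
  obtain ⟨i, j, h, rfl⟩ := mem_minGens_posetIdeal.1 hm
  exact ⟨i, j, h.ne, rfl⟩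

theorem finrank_component (β : P →₀ ℕ) :
    Module.finrank k (component (posetIdeal k P) β) = if ChainSupp β then 1 else 0 := by
  rw [component]
  split_ifs with h
  · refine finrank_span_singleton fun h0 => ?_
    rw [Ideal.Quotient.eq_zero_iff_mem, monomial_mem_posetIdeal] at h0
    exact h0 h
  · rw [Ideal.Quotient.eq_zero_iff_mem.2 (monomial_mem_posetIdeal.2 h), Submodule.span_zero_singleton,
      finrank_bot]

end PosetIdeal

/-! ### Power series: the substitution `x_i ↦ ε t x_i` -/

section SeriesHom

variable {σ : Type v} [Fintype σ]

/-- The part of degree `i`, multiplied by `ε ^ i`. -/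
def homogPart (ε : ℤ) (i : ℕ) (f : MvPowerSeries σ ℤ) : MvPowerSeries σ ℤ :=
  fun α => if α.degree = i then ε ^ i * MvPowerSeries.coeff α f else 0

theorem coeff_homogPart (ε : ℤ) (i : ℕ) (f : MvPowerSeries σ ℤ) (α : σ →₀ ℕ) :
    MvPowerSeries.coeff α (homogPart ε i f) =
      if α.degree = i then ε ^ i * MvPowerSeries.coeff α f else 0 := rfl

/-- The substitution `x^α ↦ ε^|α| x^α t^|α|`. -/
def homogenize (ε : ℤ) : MvPowerSeries σ ℤ →+* Series σ where
  toFun f := PowerSeries.mk fun i => homogPart ε i f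
  map_one' := by
    ext i α
    rw [PowerSeries.coeff_mk, PowerSeries.coeff_one, coeff_homogPart, MvPowerSeries.coeff_one]
    by_cases h : α = 0
    · subst h
      by_cases hi : i = 0
      · subst hi; simp
      · simp [hi, Ne.symm hi]
    · by_cases hi : i = 0 <;> simp [h, hi, MvPowerSeries.coeff_one]
  map_mul' f g := by
    ext i α
    rw [PowerSeries.coeff_mk, PowerSeries.coeff_mul, map_sum, coeff_homogPart]
    simp only [PowerSeries.coeff_mk, MvPowerSeries.coeff_mul, coeff_homogPart]
    rw [Finset.sum_comm]
    have key : ∀ x ∈ Finset.HasAntidiagonal.antidiagonal α, (∑ p ∈ Finset.HasAntidiagonal.antidiagonal i,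
        (if x.1.degree = p.1 then ε ^ p.1 * MvPowerSeries.coeff x.1 f else 0) *
          (if x.2.degree = p.2 then ε ^ p.2 * MvPowerSeries.coeff x.2 g else 0)) =
        if α.degree = i then ε ^ i * (MvPowerSeries.coeff x.1 f * MvPowerSeries.coeff x.2 g)
          else 0 := by
      intro x hx
      rw [Finset.HasAntidiagonal.mem_antidiagonal] at hx
      have hd : α.degree = x.1.degree + x.2.degree := by rw [← hx, map_add]
      split_ifs with h
      · rw [Finset.sum_eq_single (x.1.degree, x.2.degree)]
        · rw [if_pos rfl, if_pos rfl, ← h, hd, pow_add]; ring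
        · intro p _ hp
          by_cases h1 : x.1.degree = p.1
          · rw [if_neg (fun h2 : x.2.degree = p.2 => hp (Prod.ext h1.symm h2.symm)), mul_zero]
          · rw [if_neg h1, zero_mul]
        · intro hn
          exact (hn (Finset.HasAntidiagonal.mem_antidiagonal.2 (by omega))).elim
      · refine Finset.sum_eq_zero fun p hp => ?_
        rw [Finset.HasAntidiagonal.mem_antidiagonal] at hp
        by_cases h1 : x.1.degree = p.1
        · rw [if_neg (by omega : ¬ x.2.degree = p.2), mul_zero]
        · rw [if_neg h1, zero_mul]
    refine Eq.trans ?_ (Finset.sum_congr rfl key).symm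
    by_cases h : α.degree = i
    · simp only [if_pos h, Finset.mul_sum]
    · simp only [if_neg h, Finset.sum_const_zero]
  map_zero' := by
    ext i α
    simp [coeff_homogPart]
  map_add' f g := by
    ext i α
    rw [PowerSeries.coeff_mk, map_add, PowerSeries.coeff_mk, PowerSeries.coeff_mk, map_add]
    simp only [coeff_homogPart, map_add]
    split_ifs <;> ring

theorem homogenize_eq (ε : ℤ) (f : MvPowerSeries σ ℤ) :
    homogenize ε f = PowerSeries.mk fun i => homogPart ε i f := rfl

theorem homogenize_monomial (ε : ℤ) (α : σ →₀ ℕ) (c : ℤ) :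
    homogenize ε (MvPowerSeries.monomial α c) =
      PowerSeries.monomial α.degree (MvPowerSeries.monomial α (ε ^ α.degree * c)) := by
  ext i β
  rw [homogenize_eq, PowerSeries.coeff_mk, PowerSeries.coeff_monomial, coeff_homogPart,
    MvPowerSeries.coeff_monomial, apply_ite (MvPowerSeries.coeff β), MvPowerSeries.coeff_monomial,
    map_zero]
  by_cases h : β = α
  · subst h
    by_cases hi : i = β.degree
    · subst hi; simp
    · simp [hi, Ne.symm hi]
  · simp [h]

theorem homogenize_X (ε : ℤ) (i : σ) :
    homogenize ε (MvPowerSeries.X i) = PowerSeries.C (MvPowerSeries.C ε) * (tvar σ * xvar i) := by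
  rw [MvPowerSeries.X, homogenize_monomial, tvar, xvar, Finsupp.degree_single, pow_one, mul_one,
    ← PowerSeries.commute_X, ← mul_assoc, ← map_mul, PowerSeries.X_eq,
    ← PowerSeries.monomial_zero_eq_C_apply, PowerSeries.monomial_mul_monomial, zero_add, mul_one,
    MvPowerSeries.X, ← MvPowerSeries.monomial_zero_eq_C_apply, MvPowerSeries.monomial_mul_monomial,
    zero_add, mul_one]

theorem homogenize_prod_neg_one :
    homogenize (-1) (∏ i : σ, (1 - MvPowerSeries.X i)) = ∏ i : σ, (1 + tvar σ * xvar i) := by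
  rw [map_prod]
  refine Finset.prod_congr rfl fun i _ => ?_
  rw [map_sub, map_one, homogenize_X]
  simp

theorem homogenize_prod_one :
    homogenize 1 (∏ i : σ, (1 - MvPowerSeries.X i)) = ∏ i : σ, (1 - tvar σ * xvar i) := by
  rw [map_prod]
  refine Finset.prod_congr rfl fun i _ => ?_
  rw [map_sub, map_one, homogenize_X]
  simp

theorem toSeries_monomial (d : ℕ) (α : σ →₀ ℕ) (c : ℤ) :
    toSeries (Polynomial.monomial d (monomial α c)) =
      PowerSeries.monomial d (MvPowerSeries.monomial α c) := by
  rw [toSeries, Polynomial.map_monomial, Polynomial.coe_monomial,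
    MvPolynomial.coeToMvPowerSeries.ringHom_apply, MvPolynomial.coe_monomial]

/-- `toSeries` as a ring homomorphism. -/
def toSeriesHom (σ : Type v) : Polynomial (MvPolynomial σ ℤ) →+* Series σ :=
  Polynomial.coeToPowerSeries.ringHom.comp
    (Polynomial.mapRingHom (MvPolynomial.coeToMvPowerSeries.ringHom (R := ℤ) (σ := σ)))

theorem toSeriesHom_apply (W : Polynomial (MvPolynomial σ ℤ)) : toSeriesHom σ W = toSeries W := rfl

theorem toSeries_injective : Function.Injective (toSeries (σ := σ)) := by
  intro V W h
  have h1 := Polynomial.coe_injective _ h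
  exact Polynomial.map_injective _ (MvPolynomial.coe_injective σ ℤ) h1

end SeriesHom

/-! ### The common value of all sums over families of cells -/

section Denominator

variable {k : Type u} [Field k] {σ : Type v} [Fintype σ] {a : Ideal (MvPolynomial σ k)}

/-- `Σ_I (-1)^{|I| + deg m_I} m_I t^{deg m_I}`. -/
def denominator (a : Ideal (MvPolynomial σ k)) : Polynomial (MvPolynomial σ ℤ) :=
  ∑ I : Cell a, Polynomial.monomial (lcmOf I).degree
    (monomial (lcmOf I) ((-1) ^ (lcmOf I).degree * (-1) ^ I.card))

theorem toSeries_denominator : toSeries (denominator a) = homogenize (-1) (kSeries a) := by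
  rw [← toSeriesHom_apply, denominator, kSeries, map_sum, map_sum]
  refine Finset.sum_congr rfl fun I _ => ?_
  rw [toSeriesHom_apply, toSeries_monomial, kTerm, homogenize_monomial]

theorem toSeries_denominator_comp :
    toSeries ((denominator a).comp (-Polynomial.X)) = homogenize 1 (kSeries a) := by
  rw [← toSeriesHom_apply, denominator, kSeries, ← Polynomial.coe_compRingHom_apply, map_sum, map_sum,
    map_sum]
  refine Finset.sum_congr rfl fun I _ => ?_
  rw [kTerm, homogenize_monomial, ← toSeries_monomial, ← toSeriesHom_apply,
    Polynomial.coe_compRingHom_apply]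
  congr 1
  rw [Polynomial.monomial_comp, ← Polynomial.C_mul_X_pow_eq_monomial]
  generalize (lcmOf I).degree = d
  rcases Nat.even_or_odd d with hd | hd
  · rw [hd.neg_pow (Polynomial.X : Polynomial (MvPolynomial σ ℤ))]
    simp [hd.neg_pow]
  · rw [hd.neg_pow (Polynomial.X : Polynomial (MvPolynomial σ ℤ))]
    simp only [hd.neg_pow, one_pow, map_neg, neg_mul, mul_neg, one_mul]
    ring

/-- The criterion behind all four descriptions of `W`. By the forest count, `cl(I) + |I|` is the
degree of `m_I`; so `clSum F` is the substitution `x ↦ -t x` applied to the signed sum over `F`, and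
the latter is `K`. The empty set supplies the summand `1`. -/
theorem clSum_eq_denominator (ha : IsEdgeIdeal a) {F : Cell a → Prop} (h0 : F ∅)
    (hF : ∀ I, F I → I.Nonempty → I.card + cl I = (verts I).card)
    (hs : ∑ I : Cell a with F I, kTerm I = kSeries a) : clSum F = denominator a := by
  apply toSeries_injective
  rw [toSeries_denominator, ← hs, map_sum, clSum, ← toSeriesHom_apply, map_add, map_one, map_sum]
  have h1 : Finset.univ.filter F = insert ∅ (Finset.univ.filter fun I : Cell a => F I ∧ I.Nonempty) := by
    ext I
    rcases I.eq_empty_or_nonempty with rfl | hI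
    · simp [h0]
    · simp [hI, hI.ne_empty]
  rw [h1, Finset.sum_insert (by simp)]
  congr 1
  · rw [kTerm, homogenize_monomial]
    have : lcmOf (∅ : Cell a) = 0 := rfl
    simp [this]
  · refine Finset.sum_congr rfl fun I hI => ?_
    obtain ⟨h2, h3⟩ := (Finset.mem_filter.1 hI).2
    have h4 := hF I h2 h3
    rw [toSeriesHom_apply, toSeries_monomial, kTerm, homogenize_monomial, degree_lcmOf ha, ← h4,
      add_comm (cl I), pow_add]
    congr 2
    -- The sign `(-1)^{|I|}` comes once from the degree and once from the signed sum; what is left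
    -- is `(-1)^{cl(I)}`.
    rw [mul_right_comm, ← mul_pow]
    simp

end Denominator

/-! ### Inclusion–exclusion and the Hilbert series -/

section Chains

variable {k : Type u} [Field k] {σ : Type v} [Fintype σ]

/-- The sum of the monomials in the variables outside `s`. -/
def onesOff (s : Finset σ) : MvPowerSeries σ ℤ := fun α => if Disjoint α.support s then 1 else 0

theorem coeff_onesOff (s : Finset σ) (α : σ →₀ ℕ) :
    MvPowerSeries.coeff α (onesOff s) = if Disjoint α.support s then 1 else 0 := rfl

/-- Subtracting the shift by `x_i` cancels exactly the monomials in which `x_i` occurs. Iterated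
over all variables this inverts `∏ (1 - x_i)`. -/
theorem onesOff_mul {s : Finset σ} {i : σ} (hi : i ∉ s) :
    onesOff s * (1 - MvPowerSeries.X i) = onesOff (insert i s) := by
  ext α
  rw [mul_sub, mul_one, map_sub, MvPowerSeries.X, MvPowerSeries.coeff_mul_monomial]
  simp only [coeff_onesOff, mul_one, Finset.disjoint_insert_right]
  have hle : Finsupp.single i 1 ≤ α ↔ i ∈ α.support := by
    rw [Finsupp.single_le_iff, Finsupp.mem_support_iff]; omega
  by_cases h : i ∈ α.support
  · have hd : Disjoint (α - Finsupp.single i 1).support s ↔ Disjoint α.support s := by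
      simp only [Finset.disjoint_right, Finsupp.mem_support_iff, Finsupp.tsub_apply]
      refine forall₂_congr fun p hp => ?_
      have : i ≠ p := fun e => hi (e ▸ hp)
      rw [Finsupp.single_eq_of_ne' this]
      simp
    simp [hle, h, hd]
  · simp [hle, h]

theorem onesOff_mul_prod : onesOff (∅ : Finset σ) * ∏ i : σ, (1 - MvPowerSeries.X i) = 1 := by
  have h (s : Finset σ) : onesOff (∅ : Finset σ) * ∏ i ∈ s, (1 - MvPowerSeries.X i) = onesOff s := by
    induction s using Finset.induction_on with
    | empty => simp
    | insert i s hi ih => rw [Finset.prod_insert hi, mul_left_comm, ih, mul_comm, onesOff_mul hi]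
  rw [h]
  ext α
  rw [coeff_onesOff, MvPowerSeries.coeff_one]
  congr 1
  rw [Finset.disjoint_iff_inter_eq_empty, Finset.inter_univ, Finsupp.support_eq_empty]

variable {a : Ideal (MvPolynomial σ k)}

theorem coeff_sum_kTerm_mul_ones (F : Finset (Cell a)) (α : σ →₀ ℕ) :
    MvPowerSeries.coeff α ((∑ I ∈ F, kTerm I) * onesOff ∅) =
      ∑ I ∈ F with lcmOf I ≤ α, (-1) ^ I.card := by
  rw [Finset.sum_mul, map_sum, Finset.sum_filter]
  refine Finset.sum_congr rfl fun I _ => ?_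
  rw [kTerm, MvPowerSeries.coeff_monomial_mul, coeff_onesOff]
  simp

end Chains

section ChainSeries

variable (k : Type u) [Field k] (P : Type v) [Fintype P] [PartialOrder P]

/-- The sum of the monomials that do not vanish in `k[Δ(P)]`. -/
def chainSeries : MvPowerSeries P ℤ := fun α => if ChainSupp α then 1 else 0

theorem coeff_chainSeries (α : P →₀ ℕ) :
    MvPowerSeries.coeff α (chainSeries P) = if ChainSupp α then 1 else 0 := rfl

/-- The cells whose lcm divides `x^α` are all subsets of the set of generators dividing `x^α`. Their
signs cancel unless that set is empty, which means that the support of `α` is a chain. -/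
theorem kSeries_mul_ones : kSeries (posetIdeal k P) * onesOff ∅ = chainSeries P := by
  ext α
  rw [kSeries, coeff_sum_kTerm_mul_ones, coeff_chainSeries]
  have h1 : (Finset.univ.filter fun I : Cell (posetIdeal k P) => lcmOf I ≤ α) =
      (Finset.univ.filter fun m : minGens (posetIdeal k P) => (m : P →₀ ℕ) ≤ α).powerset := by
    ext I
    simp only [Finset.mem_filter, Finset.mem_univ, true_and, Finset.mem_powerset, lcmOf,
      Finset.sup_le_iff]
    exact ⟨fun h m hm => by simpa using h m hm, fun h m hm => by simpa using h hm⟩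
  rw [h1, Finset.sum_powerset_neg_one_pow_card]
  congr 1
  rw [Finset.filter_eq_empty_iff, eq_iff_iff, ← not_iff_not, not_chainSupp_iff]
  constructor
  · intro h
    push Not at h
    obtain ⟨m, -, hm⟩ := h
    obtain ⟨i, j, hij, he⟩ := mem_minGens_posetIdeal.1 m.2
    rw [he, edgeMon_le_iff hij.ne] at hm
    exact ⟨i, hm.1, j, hm.2, hij⟩
  · rintro ⟨i, hi, j, hj, hij⟩ h
    exact h (Finset.mem_univ ⟨edgeMon i j, mem_minGens_posetIdeal.2 ⟨i, j, hij, rfl⟩⟩)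
      ((edgeMon_le_iff hij.ne).2 ⟨hi, hj⟩)

theorem chainSeries_mul_prod :
    chainSeries P * ∏ i : P, (1 - MvPowerSeries.X i) = kSeries (posetIdeal k P) := by
  rw [← kSeries_mul_ones k P, mul_assoc, onesOff_mul_prod, mul_one]

/-- As `∏ (1 - x_i)` is invertible, a signed sum over cells may be compared with `K` after division
by it, that is, by counting the cells whose lcm divides a given monomial. -/
theorem sum_kTerm_eq_kSeries {F : Finset (Cell (posetIdeal k P))}
    (h : ∀ α : P →₀ ℕ, ∑ I ∈ F with lcmOf I ≤ α, (-1) ^ I.card = if ChainSupp α then (1 : ℤ) else 0) :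
    ∑ I ∈ F, kTerm I = kSeries (posetIdeal k P) := by
  have : (∑ I ∈ F, kTerm I) * onesOff ∅ = chainSeries P := by
    ext α
    rw [coeff_sum_kTerm_mul_ones, h, coeff_chainSeries]
  rw [← chainSeries_mul_prod k P, ← this, mul_assoc, onesOff_mul_prod, mul_one]

theorem hilbertSeries_eq : hilbertSeries (posetIdeal k P) = homogenize 1 (chainSeries P) := by
  rw [hilbertSeries, homogenize_eq]
  refine congrArg PowerSeries.mk (funext fun i => MvPowerSeries.ext fun α => ?_)
  rw [coeff_homogPart, coeff_chainSeries, one_pow, one_mul]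
  change (if α.degree = i then (Module.finrank k (component (posetIdeal k P) α) : ℤ) else 0) = _
  rw [finrank_component]
  push_cast
  rfl

end ChainSeries

end MonomialRing
end

set_option linter.unusedSectionVars false
noncomputable section
open MvPolynomial
open scoped Classical TensorProduct

namespace MonomialRing

universe u v

/-! ### Koszulness: contraction of the bar complex in terms of words -/

section BarWords

variable (k : Type u) [Field k] {P : Type v} [Fintype P] [PartialOrder P]

/-- Prepending a letter to a word. -/
def consMap (x : P →₀ ℕ) : (List (P →₀ ℕ) →₀ k) →ₗ[k] (List (P →₀ ℕ) →₀ k) :=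
  Finsupp.lmapDomain k k (List.cons x)

/-- A word of bar generators as an element of the free module. -/
abbrev word (l : List (P →₀ ℕ)) : List (P →₀ ℕ) →₀ k := Finsupp.single l 1

/-- All variables of the first monomial are at most all variables of the second. -/
def Below (x y : P →₀ ℕ) : Prop := ∀ p ∈ x.support, ∀ q ∈ y.support, p ≤ q

/-- The number of pairs of letters of `x` and `y` in descending order. -/
def inversions (x y : P →₀ ℕ) : ℕ := ∑ p, ∑ q, if q < p then x p * y q else 0

/-- The number of inversions of a word. -/
def wordRank : List (P →₀ ℕ) → ℕ
  | [] => 0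
  | x :: l => inversions x l.sum + wordRank l

/-- The boundary of a word with merges of adjacent letters restricted by `Q`. -/
def wordD (Q : (P →₀ ℕ) → (P →₀ ℕ) → Prop) : List (P →₀ ℕ) → (List (P →₀ ℕ) →₀ k)
  | [] => 0
  | [_] => 0
  | x :: y :: l => (if Q x y then word k ((x + y) :: l) else 0) - consMap k x (wordD Q (y :: l))

/-- The least variable of a monomial whose support is a chain. -/
def IsLeastVar (p : P) (w : P →₀ ℕ) : Prop := p ∈ w.support ∧ ∀ q ∈ w.support, p ≤ q

/-- The first letter is split off a composite first monomial; otherwise the first non-ascending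
place is passed. -/
def wordH : List (P →₀ ℕ) → (List (P →₀ ℕ) →₀ k)
  | [] => 0
  | w :: l =>
    if 2 ≤ w.degree then
      if h : ∃ p, IsLeastVar p w then
        word k (Finsupp.single h.choose 1 :: (w - Finsupp.single h.choose 1) :: l) else 0
    else match l with
      | [] => 0
      | v :: m => if Below w v then 0 else - consMap k w (wordH (v :: m))

/-- All letters are nonzero monomials of `k[Δ(P)]`. -/
def GoodWord (l : List (P →₀ ℕ)) : Prop := ∀ x ∈ l, x ≠ 0 ∧ ChainSupp x

variable {k}

theorem goodWord_cons {x : P →₀ ℕ} {l : List (P →₀ ℕ)} :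
    GoodWord (x :: l) ↔ (x ≠ 0 ∧ ChainSupp x) ∧ GoodWord l := by
  simp [GoodWord]

theorem consMap_single (x : P →₀ ℕ) (l : List (P →₀ ℕ)) (c : k) :
    consMap k x (Finsupp.single l c) = Finsupp.single (x :: l) c := by
  simp [consMap]

theorem consMap_mem {x : P →₀ ℕ} {f : List (P →₀ ℕ) →₀ k} {s t : Set (List (P →₀ ℕ))}
    (hf : f ∈ Finsupp.supported k k s) (h : ∀ l ∈ s, x :: l ∈ t) :
    consMap k x f ∈ Finsupp.supported k k t := by
  rw [Finsupp.supported_eq_span_single] at hf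
  refine Submodule.span_induction ?_ (by simp) (fun a b _ _ ha hb => ?_) (fun c a _ ha => ?_) hf
  · rintro _ ⟨l, hl, rfl⟩
    rw [consMap_single]
    exact Finsupp.single_mem_supported k _ (h l hl)
  · rw [map_add]; exact add_mem ha hb
  · rw [map_smul]; exact Submodule.smul_mem _ _ ha

theorem linear_eq_on_supported {M : Type*} [AddCommGroup M] [Module k M]
    {f g : (List (P →₀ ℕ) →₀ k) →ₗ[k] M} {s : Set (List (P →₀ ℕ))}
    (h : ∀ l ∈ s, f (word k l) = g (word k l)) {z : List (P →₀ ℕ) →₀ k}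
    (hz : z ∈ Finsupp.supported k k s) : f z = g z := by
  rw [Finsupp.supported_eq_span_single] at hz
  refine LinearMap.eqOn_span ?_ hz
  rintro _ ⟨l, hl, rfl⟩
  exact h l hl

theorem linear_mem_of_supported {M : Type*} [AddCommGroup M] [Module k M]
    {f : (List (P →₀ ℕ) →₀ k) →ₗ[k] M} {s : Set (List (P →₀ ℕ))} {N : Submodule k M}
    (h : ∀ l ∈ s, f (word k l) ∈ N) {z : List (P →₀ ℕ) →₀ k}
    (hz : z ∈ Finsupp.supported k k s) : f z ∈ N := by
  rw [Finsupp.supported_eq_span_single] at hz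
  refine Submodule.span_le (p := N.comap f).2 ?_ hz
  rintro _ ⟨l, hl, rfl⟩
  exact h l hl

variable (k) in
/-- The boundary map on words. -/
def wordDiff (Q : (P →₀ ℕ) → (P →₀ ℕ) → Prop) :
    (List (P →₀ ℕ) →₀ k) →ₗ[k] (List (P →₀ ℕ) →₀ k) :=
  Finsupp.linearCombination k (wordD k Q)

variable (P k) in
/-- The homotopy on words. -/
def wordHtpy : (List (P →₀ ℕ) →₀ k) →ₗ[k] (List (P →₀ ℕ) →₀ k) :=
  Finsupp.linearCombination k (wordH k)

theorem wordDiff_word (Q : (P →₀ ℕ) → (P →₀ ℕ) → Prop) (l : List (P →₀ ℕ)) :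
    wordDiff k Q (word k l) = wordD k Q l := by
  rw [wordDiff, Finsupp.linearCombination_single, one_smul]

theorem wordHtpy_word (l : List (P →₀ ℕ)) : wordHtpy k P (word k l) = wordH k l := by
  rw [wordHtpy, Finsupp.linearCombination_single, one_smul]

/-! ### The monomials -/

theorem ChainSupp.exists_least {w : P →₀ ℕ} (h : ChainSupp w) (h0 : w ≠ 0) :
    ∃ p, IsLeastVar p w := by
  have hne : w.support.Nonempty := Finsupp.support_nonempty_iff.2 h0
  obtain ⟨p, hp, hmin⟩ := w.support.exists_minimal hne
  refine ⟨p, hp, fun q hq => ?_⟩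
  rcases eq_or_ne p q with rfl | hpq
  · exact le_rfl
  · rcases h hp hq hpq with h' | h'
    · exact h'
    · exact hmin hq h'

theorem IsLeastVar.unique {p q : P} {w : P →₀ ℕ} (hp : IsLeastVar p w) (hq : IsLeastVar q w) :
    p = q := le_antisymm (hp.2 q hq.1) (hq.2 p hp.1)

theorem wordH_split {w : P →₀ ℕ} {p : P} (hw : 2 ≤ w.degree) (hp : IsLeastVar p w)
    (l : List (P →₀ ℕ)) :
    wordH k (w :: l) = word k (Finsupp.single p 1 :: (w - Finsupp.single p 1) :: l) := by
  have h : ∃ p, IsLeastVar p w := ⟨p, hp⟩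
  cases l <;> rw [wordH, if_pos hw, dif_pos h, h.choose_spec.unique hp]

theorem wordH_below {w v : P →₀ ℕ} (hw : ¬ 2 ≤ w.degree) (h : Below w v) (l : List (P →₀ ℕ)) :
    wordH k (w :: v :: l) = 0 := by
  rw [wordH, if_neg hw, if_pos h]

theorem wordH_not_below {w v : P →₀ ℕ} (hw : ¬ 2 ≤ w.degree) (h : ¬ Below w v)
    (l : List (P →₀ ℕ)) : wordH k (w :: v :: l) = - consMap k w (wordH k (v :: l)) := by
  rw [wordH, if_neg hw, if_neg h]

theorem support_add_nat (x y : P →₀ ℕ) : (x + y).support = x.support ∪ y.support := by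
  ext p
  simp only [Finsupp.mem_support_iff, Finsupp.add_apply, Finset.mem_union]
  omega

theorem Below.chain {x y : P →₀ ℕ} (h : Below x y) (hx : ChainSupp x) (hy : ChainSupp y) :
    ChainSupp (x + y) := by
  rw [ChainSupp, support_add_nat, Finset.coe_union]
  rintro p (hp | hp) q (hq | hq) hne
  exacts [hx hp hq hne, Or.inl (h p hp q hq), Or.inr (h q hq p hp), hy hp hq hne]

theorem inversions_add_left (x y z : P →₀ ℕ) :
    inversions (x + y) z = inversions x z + inversions y z := by
  simp only [inversions, ← Finset.sum_add_distrib]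
  refine Finset.sum_congr rfl fun p _ => Finset.sum_congr rfl fun q _ => ?_
  split_ifs
  · rw [Finsupp.add_apply, add_mul]
  · rfl

theorem inversions_add_right (x y z : P →₀ ℕ) :
    inversions x (y + z) = inversions x y + inversions x z := by
  simp only [inversions, ← Finset.sum_add_distrib]
  refine Finset.sum_congr rfl fun p _ => Finset.sum_congr rfl fun q _ => ?_
  split_ifs
  · rw [Finsupp.add_apply, mul_add]
  · rfl

theorem inversions_eq_zero {x y : P →₀ ℕ} (h : Below x y) : inversions x y = 0 := by
  refine Finset.sum_eq_zero fun p _ => Finset.sum_eq_zero fun q _ => ?_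
  split_ifs with hpq
  · by_contra hne
    obtain ⟨hp, hq⟩ := mul_ne_zero_iff.1 hne
    exact (h p (Finsupp.mem_support_iff.2 hp) q (Finsupp.mem_support_iff.2 hq)).not_gt hpq
  · rfl

theorem inversions_pos {x y : P →₀ ℕ} (hc : ChainSupp (x + y)) (h : ¬ Below x y) :
    0 < inversions x y := by
  rw [Below] at h
  push Not at h
  obtain ⟨p, hp, q, hq, hpq⟩ := h
  have hlt : q < p := by
    have hne : p ≠ q := fun e => hpq e.le
    rw [ChainSupp, support_add_nat, Finset.coe_union] at hc
    rcases hc (Or.inl hp) (Or.inr hq) hne with h' | h'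
    · exact (hpq h').elim
    · exact lt_of_le_of_ne h' hne.symm
  refine Finset.sum_pos' (fun _ _ => Nat.zero_le _) ⟨p, Finset.mem_univ _,
    Finset.sum_pos' (fun _ _ => Nat.zero_le _) ⟨q, Finset.mem_univ _, ?_⟩⟩
  rw [if_pos hlt]
  exact Nat.mul_pos (Nat.pos_of_ne_zero (Finsupp.mem_support_iff.1 hp))
    (Nat.pos_of_ne_zero (Finsupp.mem_support_iff.1 hq))

/-! ### Words of given length, degree and rank -/

/-- Good words of length `n`, degree `α` and rank less than `r`. -/
def rankLt (n : ℕ) (α : P →₀ ℕ) (r : ℕ) : Set (List (P →₀ ℕ)) :=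
  {l | GoodWord l ∧ l.length = n ∧ l.sum = α ∧ wordRank l < r}

theorem cons_mem_rankLt {x : P →₀ ℕ} (hx : x ≠ 0 ∧ ChainSupp x) {n : ℕ} {α : P →₀ ℕ} {r : ℕ} :
    ∀ l ∈ rankLt n α r, x :: l ∈ rankLt (n + 1) (x + α) (inversions x α + r) := by
  rintro l ⟨h1, rfl, rfl, h4⟩
  exact ⟨goodWord_cons.2 ⟨hx, h1⟩, rfl, rfl, Nat.add_lt_add_left h4 _⟩

/-- A merge removes exactly the inversions between the two letters. So merges of ascending letters
preserve the rank and all other nonzero merges lower it. -/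
theorem wordRank_merge (x y : P →₀ ℕ) (l : List (P →₀ ℕ)) :
    wordRank (x :: y :: l) = inversions x y + wordRank ((x + y) :: l) := by
  simp only [wordRank, List.sum_cons, inversions_add_left, inversions_add_right]
  ring

/-- The number `s` bounds from below the rank lost in an admitted merge: `0` for the full boundary
and `1` for its crossing part. -/
theorem wordD_mem_of {Q : (P →₀ ℕ) → (P →₀ ℕ) → Prop} (hQ : ∀ x y, Q x y → ChainSupp x →
    ChainSupp y → ChainSupp (x + y)) {s : ℕ} (hs : ∀ x y, Q x y → s ≤ inversions x y) :
    ∀ {l : List (P →₀ ℕ)}, GoodWord l → ∀ r, wordRank l < r + s → ∀ n, l.length = n + 1 →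
      wordD k Q l ∈ Finsupp.supported k k (rankLt n l.sum r)
  | [], _, _, _, _, _ => by rw [wordD]; exact zero_mem _
  | [_], _, _, _, _, _ => by rw [wordD]; exact zero_mem _
  | x :: y :: l, hl, r, hr, n, hn => by
    rw [wordD]
    obtain ⟨hx, hyl⟩ := goodWord_cons.1 hl
    obtain ⟨hy, hl'⟩ := goodWord_cons.1 hyl
    refine sub_mem ?_ ?_
    · split_ifs with h
      · refine Finsupp.single_mem_supported k _ ⟨goodWord_cons.2 ⟨⟨fun e => hx.1 ?_, hQ _ _ h hx.2 hy.2⟩,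
          hl'⟩, by simpa using hn, by simp [add_assoc], ?_⟩
        · exact (add_eq_zero.1 e).1
        · have := hs x y h
          rw [wordRank_merge] at hr
          omega
      · exact zero_mem _
    · obtain ⟨n, rfl⟩ : ∃ m, n = m + 1 := ⟨l.length, by simpa using hn.symm⟩
      rw [wordRank] at hr
      -- A word with nonzero boundary admits some merge and so has rank at least `s`. This keeps the
      -- truncated subtraction in the rank bound for the tail honest.
      have hs0 : ∀ t : List (P →₀ ℕ), 2 ≤ t.length → GoodWord t → wordD k Q t ≠ 0 → s ≤ wordRank t := by
        intro t
        induction t with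
        | nil => intro h; simp at h
        | cons a t ih =>
          intro h1 h2 h3
          obtain _ | ⟨b, t⟩ := t
          · simp at h1
          · rw [wordD] at h3
            by_cases h4 : Q a b
            · rw [wordRank_merge]
              exact (hs a b h4).trans (Nat.le_add_right _ _)
            · rw [if_neg h4, zero_sub, neg_ne_zero] at h3
              have h5 : wordD k Q (b :: t) ≠ 0 := fun e => h3 (by rw [e, map_zero])
              have h6 : 2 ≤ (b :: t).length := by
                obtain _ | ⟨c, t⟩ := t
                · exact (h5 (by rw [wordD])).elim
                · simp
              exact (ih h6 (goodWord_cons.1 h2).2 h5).trans (Nat.le_add_left _ _)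
      by_cases h0 : wordD k Q (y :: l) = 0
      · rw [h0, map_zero]; exact zero_mem _
      · have h6 : 2 ≤ (y :: l).length := by
          obtain _ | ⟨c, t⟩ := l
          · exact (h0 (by rw [wordD])).elim
          · simp
        have h7 := hs0 _ h6 hyl h0
        refine consMap_mem (wordD_mem_of hQ hs hyl (r - inversions x (y :: l).sum) (by omega) n
          (by simpa using hn)) fun m hm => ?_
        have := cons_mem_rankLt hx m hm
        rw [Nat.add_sub_cancel' (by omega)] at this
        exact this

theorem single_add_sub {p : P} {w : P →₀ ℕ} (h : IsLeastVar p w) :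
    Finsupp.single p 1 + (w - Finsupp.single p 1) = w := by
  have := Finsupp.mem_support_iff.1 h.1
  exact add_tsub_cancel_of_le (Finsupp.single_le_iff.2 (by omega))

theorem degree_sub_single {p : P} {w : P →₀ ℕ} (h : IsLeastVar p w) :
    (w - Finsupp.single p 1).degree + 1 = w.degree := by
  conv_rhs => rw [← single_add_sub h, map_add, Finsupp.degree_single]
  exact add_comm _ _

theorem chainSupp_single (p : P) : ChainSupp (Finsupp.single p 1) := by
  rw [ChainSupp, Finsupp.support_single _ one_ne_zero, Finset.coe_singleton]
  exact Set.Subsingleton.isChain (Set.subsingleton_singleton)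

theorem IsLeastVar.below {p : P} {w v : P →₀ ℕ} (h : IsLeastVar p w) (hv : v ≤ w) :
    Below (Finsupp.single p 1) v := by
  intro q hq r hr
  rw [Finsupp.support_single _ one_ne_zero, Finset.mem_singleton] at hq
  subst hq
  exact h.2 r (Finsupp.support_mono hv hr)

/-- Splitting off the least variable creates no inversion, so the homotopy respects the filtration
by rank. -/
theorem wordH_mem : ∀ {l : List (P →₀ ℕ)}, GoodWord l → ∀ r, wordRank l < r →
      wordH k l ∈ Finsupp.supported k k (rankLt (l.length + 1) l.sum r)
  | [], _, _, _ => by rw [wordH]; exact zero_mem _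
  | w :: l, hl, r, hr => by
    obtain ⟨hw, hl'⟩ := goodWord_cons.1 hl
    by_cases h2 : 2 ≤ w.degree
    · obtain ⟨p, hp⟩ := hw.2.exists_least hw.1
      rw [wordH_split h2 hp]
      have hd := degree_sub_single hp
      refine Finsupp.single_mem_supported k _ ⟨goodWord_cons.2 ⟨⟨by simp, chainSupp_single p⟩,
        goodWord_cons.2 ⟨⟨fun e => ?_, hw.2.mono tsub_le_self⟩, hl'⟩⟩, rfl, ?_, ?_⟩
      · rw [e, map_zero] at hd; omega
      · rw [List.sum_cons, List.sum_cons, ← add_assoc, single_add_sub hp, List.sum_cons]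
      · rw [wordRank_merge, inversions_eq_zero (hp.below tsub_le_self), zero_add, single_add_sub hp]
        exact hr
    · obtain _ | ⟨v, l⟩ := l
      · rw [wordH, if_neg h2]; exact zero_mem _
      · by_cases hb : Below w v
        · rw [wordH_below h2 hb]; exact zero_mem _
        · rw [wordH_not_below h2 hb]
          rw [wordRank] at hr
          refine neg_mem (consMap_mem (wordH_mem hl' (r - inversions w (v :: l).sum) (by omega))
            fun m hm => ?_)
          have := cons_mem_rankLt hw m hm
          rw [Nat.add_sub_cancel' (by omega)] at this
          exact this

/-! ### The homotopy -/

/-- Words whose first letter is above the same monomials as `v`. -/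
def headLike (v : P →₀ ℕ) : Set (List (P →₀ ℕ)) :=
  {l | ∃ y m, l = y :: m ∧ ∀ w : P →₀ ℕ, Below w v ↔ Below w y}

/-- After a single variable `w`, boundary and homotopy look at the next letter only through the
relation `Below w`. All words in the boundary of `v :: l` answer this question as `v` does, so the
case distinction extends to linear combinations. `wordH_head` does the same for the homotopy. -/
theorem wordD_head {v : P →₀ ℕ} (hv : v ≠ 0) (l : List (P →₀ ℕ)) :
    wordD k Below (v :: l) ∈ Finsupp.supported k k (headLike v) := by
  obtain _ | ⟨u, l⟩ := l
  · rw [wordD]; exact zero_mem _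
  · rw [wordD]
    refine sub_mem ?_ (consMap_mem (Finsupp.mem_supported k _ |>.2 (Set.subset_univ _))
      fun m _ => ⟨v, m, rfl, fun _ => Iff.rfl⟩)
    split_ifs with h
    · refine Finsupp.single_mem_supported k _ ⟨v + u, l, rfl, fun w => ?_⟩
      rw [Below, Below, support_add_nat]
      refine ⟨fun hw p hp q hq => ?_, fun hw p hp q hq => hw p hp q (Finset.mem_union_left _ hq)⟩
      rcases Finset.mem_union.1 hq with hq | hq
      · exact hw p hp q hq
      · obtain ⟨t, ht⟩ := Finsupp.support_nonempty_iff.2 hv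
        exact (hw p hp t ht).trans (h t ht q hq)
    · exact zero_mem _

theorem wordH_head {v : P →₀ ℕ} (hv : v ≠ 0 ∧ ChainSupp v) (l : List (P →₀ ℕ)) :
    wordH k (v :: l) ∈ Finsupp.supported k k (headLike v) := by
  by_cases h2 : 2 ≤ v.degree
  · obtain ⟨p, hp⟩ := hv.2.exists_least hv.1
    rw [wordH_split h2 hp]
    refine Finsupp.single_mem_supported k _ ⟨_, _, rfl, fun w => ?_⟩
    rw [Below, Below, Finsupp.support_single _ one_ne_zero]
    refine ⟨fun hw q hq r hr => ?_, fun hw q hq r hr => ?_⟩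
    · rw [Finset.mem_singleton] at hr
      exact hr ▸ hw q hq p hp.1
    · exact (hw q hq p (Finset.mem_singleton_self p)).trans (hp.2 r hr)
  · obtain _ | ⟨u, l⟩ := l
    · rw [wordH, if_neg h2]; exact zero_mem _
    · by_cases hb : Below v u
      · rw [wordH_below h2 hb]; exact zero_mem _
      · rw [wordH_not_below h2 hb]
        exact neg_mem (consMap_mem (Finsupp.mem_supported k _ |>.2 (Set.subset_univ _))
          fun m _ => ⟨v, m, rfl, fun _ => Iff.rfl⟩)

theorem wordHtpy_cons_split {w : P →₀ ℕ} {p : P} (hw : 2 ≤ w.degree) (hp : IsLeastVar p w)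
    (z : List (P →₀ ℕ) →₀ k) : wordHtpy k P (consMap k w z) =
      consMap k (Finsupp.single p 1) (consMap k (w - Finsupp.single p 1) z) := by
  refine linear_eq_on_supported (f := wordHtpy k P ∘ₗ consMap k w)
    (g := consMap k (Finsupp.single p 1) ∘ₗ consMap k (w - Finsupp.single p 1)) (s := Set.univ)
    (fun l _ => ?_) (Finsupp.mem_supported k _ |>.2 (Set.subset_univ _))
  rw [LinearMap.comp_apply, LinearMap.comp_apply, consMap_single, consMap_single, consMap_single,
    wordHtpy_word, wordH_split hw hp]

theorem wordHtpy_cons_below {w v : P →₀ ℕ} (hw : ¬ 2 ≤ w.degree) (h : Below w v)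
    {z : List (P →₀ ℕ) →₀ k} (hz : z ∈ Finsupp.supported k k (headLike v)) :
    wordHtpy k P (consMap k w z) = 0 := by
  refine linear_eq_on_supported (f := wordHtpy k P ∘ₗ consMap k w) (g := 0) (fun l hl => ?_) hz
  obtain ⟨y, m, rfl, hy⟩ := hl
  rw [LinearMap.comp_apply, consMap_single, wordHtpy_word, wordH_below hw ((hy w).1 h)]
  rfl

theorem wordHtpy_cons_not_below {w v : P →₀ ℕ} (hw : ¬ 2 ≤ w.degree) (h : ¬ Below w v)
    {z : List (P →₀ ℕ) →₀ k} (hz : z ∈ Finsupp.supported k k (headLike v)) :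
    wordHtpy k P (consMap k w z) = - consMap k w (wordHtpy k P z) := by
  refine linear_eq_on_supported (f := wordHtpy k P ∘ₗ consMap k w)
    (g := - (consMap k w ∘ₗ wordHtpy k P)) (fun l hl => ?_) hz
  obtain ⟨y, m, rfl, hy⟩ := hl
  rw [LinearMap.comp_apply, consMap_single, wordHtpy_word, wordH_not_below hw (fun h' => h ((hy w).2 h')),
    LinearMap.neg_apply, LinearMap.comp_apply, wordHtpy_word]

theorem wordDiff_cons_not_below {w v : P →₀ ℕ} (h : ¬ Below w v)
    {z : List (P →₀ ℕ) →₀ k} (hz : z ∈ Finsupp.supported k k (headLike v)) :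
    wordDiff k Below (consMap k w z) = - consMap k w (wordDiff k Below z) := by
  refine linear_eq_on_supported (f := wordDiff k Below ∘ₗ consMap k w)
    (g := - (consMap k w ∘ₗ wordDiff k Below)) (fun l hl => ?_) hz
  obtain ⟨y, m, rfl, hy⟩ := hl
  rw [LinearMap.comp_apply, consMap_single, wordDiff_word, wordD, if_neg (fun h' => h ((hy w).2 h')),
    LinearMap.neg_apply, LinearMap.comp_apply, wordDiff_word, zero_sub]

theorem eq_single_of_degree {w : P →₀ ℕ} {p : P} (hp : IsLeastVar p w) (h : ¬ 2 ≤ w.degree) :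
    w = Finsupp.single p 1 := by
  have h1 := degree_sub_single hp
  have h2 : (w - Finsupp.single p 1).degree = 0 := by omega
  rw [Finsupp.degree_eq_zero_iff] at h2
  rw [← single_add_sub hp, h2, add_zero]

theorem below_sub_iff {w v : P →₀ ℕ} {p : P} (hw : 2 ≤ w.degree) (hp : IsLeastVar p w) :
    Below (w - Finsupp.single p 1) v ↔ Below w v := by
  constructor
  · intro h q hq r hr
    have hne : w - Finsupp.single p 1 ≠ 0 := fun e => by
      have := degree_sub_single hp
      rw [e, map_zero] at this
      omega
    obtain ⟨t, ht⟩ := Finsupp.support_nonempty_iff.2 hne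
    have htw := Finsupp.support_mono (tsub_le_self (a := w) (b := Finsupp.single p 1)) ht
    by_cases hqp : q = p
    · exact hqp ▸ (hp.2 t htw).trans (h t ht r hr)
    · refine h q ?_ r hr
      rw [Finsupp.mem_support_iff, Finsupp.tsub_apply, Finsupp.single_eq_of_ne hqp]
      exact Finsupp.mem_support_iff.1 hq
  · exact fun h q hq r hr => h q (Finsupp.support_mono tsub_le_self hq) r hr

/-- A composite first letter is split and merged again; a variable below the next letter is merged
with it and split again; a variable not below the next letter is inert, and the recursion passes to
the tail. The length hypothesis guarantees a composite letter somewhere, so the recursion ends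
before the word does. -/
theorem homotopy_word : ∀ {l : List (P →₀ ℕ)}, GoodWord l → l.length < l.sum.degree →
    wordDiff k Below (wordH k l) + wordHtpy k P (wordD k Below l) = word k l
  | [], _, h => by simp at h
  | w :: l, hl, h => by
    obtain ⟨hw, hl'⟩ := goodWord_cons.1 hl
    obtain ⟨p, hp⟩ := hw.2.exists_least hw.1
    by_cases h2 : 2 ≤ w.degree
    · rw [wordH_split h2 hp, wordDiff_word, wordD, if_pos (hp.below tsub_le_self), single_add_sub hp]
      obtain _ | ⟨v, l⟩ := l
      · simp [wordD]
      · rw [wordD, wordD, map_sub, map_sub, wordHtpy_cons_split h2 hp]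
        by_cases hb : Below w v
        · rw [if_pos ((below_sub_iff h2 hp).2 hb), if_pos hb, wordHtpy_word]
          have hp' : IsLeastVar p (w + v) := by
            refine ⟨?_, fun q hq => ?_⟩
            · rw [support_add_nat]; exact Finset.mem_union_left _ hp.1
            · rw [support_add_nat] at hq
              rcases Finset.mem_union.1 hq with hq | hq
              exacts [hp.2 q hq, hb p hp.1 q hq]
          have h3 : w + v - Finsupp.single p 1 = w - Finsupp.single p 1 + v := by
            conv_lhs => rw [← single_add_sub hp, add_assoc]
            exact add_tsub_cancel_left _ _
          rw [wordH_split (by rw [map_add]; omega) hp', h3, consMap_single]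
          abel
        · rw [if_neg (fun h => hb ((below_sub_iff h2 hp).1 h)), if_neg hb, map_zero, map_zero]
          abel
    · have hws := eq_single_of_degree hp h2
      have hdw : w.degree = 1 := by rw [hws, Finsupp.degree_single]
      obtain _ | ⟨v, l⟩ := l
      · simp [hdw] at h
      · obtain ⟨hv, hl''⟩ := goodWord_cons.1 hl'
        -- In the ascending case only the merge of `w` and `v` survives the homotopy, which splits
        -- it into `w` and `v` again since `w` is the least variable of the product.
        by_cases hb : Below w v
        · rw [wordH_below h2 hb, map_zero, zero_add, wordD, if_pos hb, map_sub,
            wordHtpy_cons_below h2 hb (wordD_head hv.1 l), sub_zero, wordHtpy_word]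
          have hp' : IsLeastVar p (w + v) := by
            refine ⟨?_, fun q hq => ?_⟩
            · rw [support_add_nat]; exact Finset.mem_union_left _ hp.1
            · rw [support_add_nat] at hq
              rcases Finset.mem_union.1 hq with hq | hq
              exacts [hp.2 q hq, hb p hp.1 q hq]
          have hdv : v.degree ≠ 0 := fun e => hv.1 ((Finsupp.degree_eq_zero_iff v).1 e)
          rw [wordH_split (by rw [map_add]; omega) hp', ← hws, add_tsub_cancel_left]
        · rw [wordH_not_below h2 hb, map_neg, wordDiff_cons_not_below hb (wordH_head hv l), neg_neg,
            wordD, if_neg hb, zero_sub, map_neg, wordHtpy_cons_not_below h2 hb (wordD_head hv.1 l),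
            neg_neg, ← map_add, homotopy_word hl' ?_, consMap_single]
          rw [List.sum_cons, map_add, List.length_cons] at h
          omega

/-! ### The boundary -/

/-- The product of the monomials does not vanish in `k[Δ(P)]`. -/
def ChainMul (x y : P →₀ ℕ) : Prop := ChainSupp (x + y)

theorem wordDiff_cons_cons {Q : (P →₀ ℕ) → (P →₀ ℕ) → Prop} (x y : P →₀ ℕ)
    (z : List (P →₀ ℕ) →₀ k) : wordDiff k Q (consMap k x (consMap k y z)) =
      (if Q x y then consMap k (x + y) z else 0) - consMap k x (wordDiff k Q (consMap k y z)) := by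
  refine linear_eq_on_supported (f := wordDiff k Q ∘ₗ consMap k x ∘ₗ consMap k y)
    (g := (if Q x y then consMap k (x + y) else 0) - consMap k x ∘ₗ wordDiff k Q ∘ₗ consMap k y)
    (s := Set.univ) (fun l _ => ?_) (Finsupp.mem_supported k _ |>.2 (Set.subset_univ _)) |>.trans ?_
  · rw [LinearMap.comp_apply, LinearMap.comp_apply, consMap_single, consMap_single, wordDiff_word,
      wordD, LinearMap.sub_apply, LinearMap.comp_apply, LinearMap.comp_apply, consMap_single,
      wordDiff_word]
    split_ifs
    · rw [consMap_single]
    · rfl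
  · rw [LinearMap.sub_apply]
    split_ifs <;> rfl

variable (k) in
-- Associativity of the product: a threefold product that does not vanish has nonvanishing partial
-- products, so the two ways of merging three letters cancel.
theorem wordDiff_wordD : ∀ l : List (P →₀ ℕ), wordDiff k ChainMul (wordD k ChainMul l) = 0
  | [] => by rw [wordD, map_zero]
  | [_] => by rw [wordD, map_zero]
  | [x, y] => by
    rw [wordD, wordD, map_zero, sub_zero]
    split_ifs
    · rw [wordDiff_word, wordD]
    · rw [map_zero]
  | x :: y :: z :: l => by
    have ih : wordDiff k ChainMul (wordD k ChainMul (y :: z :: l)) = 0 := wordDiff_wordD (y :: z :: l)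
    rw [wordD, map_sub] at ih
    rw [wordD, wordD, map_sub, map_sub, map_sub, wordDiff_cons_cons, ← sub_eq_zero.1 ih]
    have h1 : ChainMul (x + y) z → ChainMul x y := fun h => ChainSupp.mono h (by simp)
    have h2 : ChainMul (x + y) z → ChainMul y z := fun h => ChainSupp.mono h (by
      rw [add_assoc]; simp)
    have h3 : ChainMul (x + y) z ↔ ChainMul x (y + z) := by rw [ChainMul, ChainMul, add_assoc]
    have e1 : wordDiff k ChainMul (if ChainMul x y then word k ((x + y) :: z :: l) else 0) =
        (if ChainMul (x + y) z then word k ((x + y + z) :: l) else 0) -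
          (if ChainMul x y then consMap k (x + y) (wordD k ChainMul (z :: l)) else 0) := by
      by_cases h : ChainMul x y
      · rw [if_pos h, if_pos h, wordDiff_word, wordD]
      · rw [if_neg h, if_neg h, if_neg (fun h' => h (h1 h')), map_zero, sub_zero]
    have e2 : wordDiff k ChainMul (consMap k x (if ChainMul y z then word k ((y + z) :: l) else 0)) =
        (if ChainMul (x + y) z then word k ((x + y + z) :: l) else 0) -
          consMap k x (wordDiff k ChainMul (if ChainMul y z then word k ((y + z) :: l) else 0)) := by
      by_cases h : ChainMul y z
      · rw [if_pos h, consMap_single, wordDiff_word, wordDiff_word, wordD, if_congr h3 rfl rfl, add_assoc]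
      · rw [if_neg h, if_neg (fun h' => h (h2 h'))]
        simp
    rw [e1, e2]
    abel

theorem wordDiff_wordDiff (z : List (P →₀ ℕ) →₀ k) :
    wordDiff k ChainMul (wordDiff k ChainMul z) = 0 := by
  induction z using Finsupp.induction_linear with
  | zero => rw [map_zero, map_zero]
  | add f g hf hg => rw [map_add, map_add, hf, hg, add_zero]
  | single l c =>
    rw [← mul_one c, ← smul_eq_mul, ← Finsupp.smul_single, map_smul, map_smul, wordDiff_word,
      wordDiff_wordD, smul_zero]

/-- The product does not vanish and has inversions. -/
def Crossing (x y : P →₀ ℕ) : Prop := ChainMul x y ∧ ¬ Below x y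

theorem wordD_eq_add : ∀ {l : List (P →₀ ℕ)}, GoodWord l →
    wordD k ChainMul l = wordD k Below l + wordD k Crossing l
  | [], _ => by simp [wordD]
  | [_], _ => by simp [wordD]
  | x :: y :: l, hl => by
    obtain ⟨hx, hyl⟩ := goodWord_cons.1 hl
    obtain ⟨hy, hl'⟩ := goodWord_cons.1 hyl
    rw [wordD, wordD, wordD, wordD_eq_add hyl, map_add]
    by_cases hb : Below x y
    · have : ChainMul x y := hb.chain hx.2 hy.2
      simp only [this, hb, Crossing, if_true, not_true, and_false, if_false]
      abel
    · by_cases hc : ChainMul x y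
      · simp only [hc, hb, Crossing, if_true, not_false_eq_true, and_true, if_false]
        abel
      · simp only [hc, hb, Crossing, false_and, if_false]
        abel

/-- The good words of length `n` and degree `α`. -/
def goodWords (n : ℕ) (α : P →₀ ℕ) : Set (List (P →₀ ℕ)) :=
  {l | GoodWord l ∧ l.length = n ∧ l.sum = α}

theorem rankLt_subset (n : ℕ) (α : P →₀ ℕ) (r : ℕ) : rankLt n α r ⊆ goodWords n α :=
  fun _ h => ⟨h.1, h.2.1, h.2.2.1⟩

/-- A perturbation argument. The homotopy contracts the rank-preserving part of the differential, so
a cycle `z` agrees with the boundary of its homotopy up to a cycle of smaller rank, to which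
induction applies. -/
theorem exact_of_rankLt {n : ℕ} {α : P →₀ ℕ} (hn : n < α.degree) (r : ℕ) :
    ∀ z ∈ Finsupp.supported k k (rankLt n α r), wordDiff k ChainMul z = 0 →
      ∃ y ∈ Finsupp.supported k k (goodWords (n + 1) α), wordDiff k ChainMul y = z := by
  induction r with
  | zero =>
    intro z hz _
    have : rankLt n α 0 = ∅ := Set.eq_empty_of_forall_notMem fun l hl => by simp [rankLt] at hl
    rw [this, Finsupp.supported_empty, Submodule.mem_bot] at hz
    exact ⟨0, zero_mem _, by rw [map_zero, hz]⟩
  | succ r ih =>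
    intro z hz h0
    have hH : ∀ s, ∀ z ∈ Finsupp.supported k k (rankLt n α s),
        wordHtpy k P z ∈ Finsupp.supported k k (rankLt (n + 1) α s) := fun s z hz =>
      linear_mem_of_supported (fun l hl => by
        rw [wordHtpy_word]
        obtain ⟨h1, rfl, rfl, h4⟩ := hl
        exact wordH_mem h1 s h4) hz
    have hy := hH _ z hz
    -- The ascending merges contribute exactly `z`; what remains involves a crossing merge, which
    -- costs at least one inversion.
    have hR : wordDiff k ChainMul (wordHtpy k P z) + wordHtpy k P (wordDiff k ChainMul z) - z ∈
        Finsupp.supported k k (rankLt n α r) := by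
      have key : wordDiff k ChainMul (wordHtpy k P z) + wordHtpy k P (wordDiff k ChainMul z) - z =
          wordDiff k Crossing (wordHtpy k P z) + wordHtpy k P (wordDiff k Crossing z) := by
        have e1 : wordDiff k ChainMul (wordHtpy k P z) =
            wordDiff k Below (wordHtpy k P z) + wordDiff k Crossing (wordHtpy k P z) :=
          linear_eq_on_supported (f := wordDiff k ChainMul)
            (g := wordDiff k Below + wordDiff k Crossing) (fun l hl => by
              rw [LinearMap.add_apply, wordDiff_word, wordDiff_word, wordDiff_word,
                wordD_eq_add hl.1]) hy
        have e2 : wordDiff k ChainMul z = wordDiff k Below z + wordDiff k Crossing z :=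
          linear_eq_on_supported (f := wordDiff k ChainMul)
            (g := wordDiff k Below + wordDiff k Crossing) (fun l hl => by
              rw [LinearMap.add_apply, wordDiff_word, wordDiff_word, wordDiff_word,
                wordD_eq_add hl.1]) hz
        have e3 : wordDiff k Below (wordHtpy k P z) + wordHtpy k P (wordDiff k Below z) = z :=
          linear_eq_on_supported (f := wordDiff k Below ∘ₗ wordHtpy k P + wordHtpy k P ∘ₗ wordDiff k Below)
            (g := LinearMap.id) (fun l hl => by
              rw [LinearMap.add_apply, LinearMap.comp_apply, LinearMap.comp_apply, wordDiff_word,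
                wordHtpy_word, homotopy_word hl.1 (by rw [hl.2.1, hl.2.2.1]; exact hn)]
              rfl) hz
        rw [e1, e2, map_add]
        nth_rewrite 5 [← e3]
        abel
      have hc : ∀ m s, ∀ z ∈ Finsupp.supported k k (rankLt (m + 1) α (s + 1)),
          wordDiff k Crossing z ∈ Finsupp.supported k k (rankLt m α s) := fun m s z hz =>
        linear_mem_of_supported (fun l hl => by
          rw [wordDiff_word]
          obtain ⟨h1, h2, rfl, h4⟩ := hl
          exact wordD_mem_of (s := 1) (fun _ _ h _ _ => h.1) (fun _ _ h => inversions_pos h.1 h.2)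
            h1 s h4 m h2) hz
      rw [key]
      refine add_mem (hc n r _ hy) ?_
      obtain _ | n := n
      · have : wordDiff k Crossing z = 0 :=
          linear_eq_on_supported (f := wordDiff k Crossing) (g := 0) (fun l hl => by
            rw [List.length_eq_zero_iff.1 hl.2.1, wordDiff_word, wordD]; rfl) hz
        rw [this, map_zero]
        exact zero_mem _
      · refine linear_mem_of_supported (fun l hl => ?_) (hc n r z hz)
        rw [wordHtpy_word]
        obtain ⟨h1, h2, rfl, h4⟩ := hl
        exact h2 ▸ wordH_mem h1 r h4
    rw [h0, map_zero, add_zero] at hR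
    obtain ⟨y, hy1, hy2⟩ := ih _ hR (by rw [map_sub, wordDiff_wordDiff, h0, sub_zero])
    refine ⟨wordHtpy k P z - y, sub_mem (Finsupp.supported_mono (rankLt_subset _ _ _) hy) hy1, ?_⟩
    rw [map_sub, hy2]
    abel

theorem exact_words {n : ℕ} {α : P →₀ ℕ} (hn : n < α.degree) {z : List (P →₀ ℕ) →₀ k}
    (hz : z ∈ Finsupp.supported k k (goodWords n α)) (h0 : wordDiff k ChainMul z = 0) :
    ∃ y ∈ Finsupp.supported k k (goodWords (n + 1) α), wordDiff k ChainMul y = z := by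
  refine exact_of_rankLt hn (z.support.sup wordRank + 1) z ?_ h0
  rw [Finsupp.mem_supported] at hz ⊢
  exact fun l hl => ⟨(hz hl).1, (hz hl).2.1, (hz hl).2.2, Nat.lt_succ_of_le (Finset.le_sup hl)⟩

end BarWords

end MonomialRing
end

set_option linter.unusedSectionVars false
noncomputable section
open MvPolynomial
open scoped Classical TensorProduct

namespace MonomialRing

universe u v

/-! ### The bar complex of `k[Δ(P)]` in its monomial basis -/

section IrrelevantBasis

variable (k : Type u) [Field k] (P : Type v) [Fintype P] [PartialOrder P]

variable {P} in
theorem monomial_mem_irrelevant {β : P →₀ ℕ} (h : β ≠ 0) :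
    Ideal.Quotient.mk (posetIdeal k P) (monomial β 1) ∈ irrelevant (posetIdeal k P) := by
  obtain ⟨i, hi⟩ := Finsupp.support_nonempty_iff.2 h
  have h1 : (monomial β 1 : MvPolynomial P k) = monomial (β - Finsupp.single i 1) 1 * X i := by
    rw [X, monomial_mul, one_mul, tsub_add_cancel_of_le]
    rw [Finsupp.single_le_iff]
    exact Nat.one_le_iff_ne_zero.2 (Finsupp.mem_support_iff.1 hi)
  rw [h1, map_mul]
  exact Ideal.mul_mem_left _ _ (Ideal.subset_span ⟨i, rfl⟩)

/-- The constant coefficient on `k[Δ(P)]`. -/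
def quotientConstCoeff : MvPolynomial P k ⧸ posetIdeal k P →+* k :=
  Ideal.Quotient.lift _ constantCoeff fun f hf => by
    rw [constantCoeff_eq]
    by_contra h
    exact mem_posetIdeal.1 hf 0 (mem_support_iff.2 h) (by simp [ChainSupp])

theorem constCoeff_of_mem_irrelevant {x : MvPolynomial P k ⧸ posetIdeal k P}
    (hx : x ∈ irrelevant (posetIdeal k P)) : quotientConstCoeff k P x = 0 := by
  have h : irrelevant (posetIdeal k P) ≤ RingHom.ker (quotientConstCoeff k P) := by
    refine Ideal.span_le.2 ?_
    rintro _ ⟨i, rfl⟩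
    rw [SetLike.mem_coe, RingHom.mem_ker, quotientConstCoeff, Ideal.Quotient.lift_mk, constantCoeff_X]
  exact h hx

variable {P}

/-- The class of a monomial of positive degree, as an element of the irrelevant ideal. -/
def irrMon (β : P →₀ ℕ) : irrelevant (posetIdeal k P) :=
  if h : β ≠ 0 then ⟨Ideal.Quotient.mk _ (monomial β 1), monomial_mem_irrelevant k h⟩ else 0

theorem irrMon_zero : irrMon k (0 : P →₀ ℕ) = 0 := dif_neg (by simp)

theorem irrMon_val {β : P →₀ ℕ} (h : β ≠ 0) :
    (irrMon k β : MvPolynomial P k ⧸ posetIdeal k P) = Ideal.Quotient.mk _ (monomial β 1) := by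
  rw [irrMon, dif_pos h]

theorem irrMon_of_not_chain {β : P →₀ ℕ} (h : ¬ ChainSupp β) : irrMon k β = 0 := by
  by_cases h0 : β = 0
  · rw [h0, irrMon_zero]
  · refine Subtype.ext ?_
    rw [irrMon_val k h0, Ideal.Quotient.eq_zero_iff_mem.2 (monomial_mem_posetIdeal.2 h)]
    rfl

theorem irrMon_mul {β γ : P →₀ ℕ} (hβ : β ≠ 0) (hγ : γ ≠ 0) :
    idealMul k (irrelevant (posetIdeal k P)) (irrMon k β) (irrMon k γ) = irrMon k (β + γ) := by
  have h : β + γ ≠ 0 := fun h => hβ (add_eq_zero.1 h).1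
  refine Subtype.ext ?_
  change (irrMon k β : MvPolynomial P k ⧸ posetIdeal k P) * irrMon k γ = _
  rw [irrMon_val k hβ, irrMon_val k hγ, irrMon_val k h, ← map_mul, monomial_mul, one_mul]

/-- The nonzero monomials of positive degree. -/
abbrev IrrIndex (P : Type v) [PartialOrder P] : Type v := {β : P →₀ ℕ // β ≠ 0 ∧ ChainSupp β}

theorem smul_mk_monomial (c : k) (β : P →₀ ℕ) :
    c • Ideal.Quotient.mk (posetIdeal k P) (monomial β 1) =
      Ideal.Quotient.mk (posetIdeal k P) (monomial β c) := by
  have : (monomial β c : MvPolynomial P k) = c • monomial β 1 := by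
    rw [smul_monomial, smul_eq_mul, mul_one]
  rw [this]
  rfl

variable (P) in
theorem linearIndependent_irrMon :
    LinearIndependent k fun β : IrrIndex P => irrMon k β.1 := by
  rw [linearIndependent_iff']
  intro s g h i hi
  by_contra hne
  have h1 : (∑ j ∈ s, monomial j.1 (g j) : MvPolynomial P k) ∈ posetIdeal k P := by
    rw [← Ideal.Quotient.eq_zero_iff_mem, map_sum]
    have := congrArg ((irrelevant (posetIdeal k P)).subtype.restrictScalars k) h
    rw [map_sum, map_zero] at this
    rw [← this]
    refine Finset.sum_congr rfl fun j _ => ?_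
    rw [map_smul, ← smul_mk_monomial]
    congr 1
    exact (irrMon_val k j.2.1).symm
  refine mem_posetIdeal.1 h1 i.1 (mem_support_iff.2 ?_) i.2.2
  rw [coeff_sum, Finset.sum_eq_single i]
  · rwa [coeff_monomial, if_pos rfl]
  · intro j _ hj
    rw [coeff_monomial, if_neg (fun e => hj (Subtype.ext e))]
  · exact fun h => (h hi).elim

variable (P) in
theorem span_irrMon : ⊤ ≤ Submodule.span k (Set.range fun β : IrrIndex P => irrMon k β.1) := by
  rintro x -
  obtain ⟨f, hf⟩ := Ideal.Quotient.mk_surjective x.1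
  have h0 : coeff 0 f = 0 := by
    have := constCoeff_of_mem_irrelevant k P x.2
    rwa [← hf, quotientConstCoeff, Ideal.Quotient.lift_mk, constantCoeff_eq] at this
  have hx : x = ∑ β ∈ f.support, coeff β f • irrMon k β := by
    refine Subtype.ext ?_
    change _ = (irrelevant (posetIdeal k P)).subtype.restrictScalars k _
    rw [map_sum, ← hf]
    conv_lhs => rw [f.as_sum, map_sum]
    refine Finset.sum_congr rfl fun β hβ => ?_
    have hβ0 : β ≠ 0 := by
      rintro rfl
      exact mem_support_iff.1 hβ h0
    rw [map_smul, ← smul_mk_monomial, ← irrMon_val k hβ0]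
    rfl
  rw [hx]
  refine Submodule.sum_mem _ fun β hβ => Submodule.smul_mem _ _ ?_
  by_cases hc : ChainSupp β
  · refine Submodule.subset_span ⟨⟨β, ?_, hc⟩, rfl⟩
    rintro rfl
    exact mem_support_iff.1 hβ h0
  · rw [irrMon_of_not_chain k hc]
    exact zero_mem _

variable (P) in
/-- The monomial basis of the irrelevant ideal of `k[Δ(P)]`. -/
def irrBasis : Module.Basis (IrrIndex P) k (irrelevant (posetIdeal k P)) :=
  Module.Basis.mk (linearIndependent_irrMon k P) (span_irrMon k P)

theorem irrBasis_apply (β : IrrIndex P) : irrBasis k P β = irrMon k β.1 := by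
  rw [irrBasis, Module.Basis.mk_apply]

/-- The grading of the irrelevant ideal. -/
abbrev irrGrading (β : P →₀ ℕ) : Submodule k (irrelevant (posetIdeal k P)) :=
  (component (posetIdeal k P) β).comap ((irrelevant (posetIdeal k P)).subtype.restrictScalars k)

/-- In degree zero the component of the ring is the line of constants, but it meets the irrelevant
ideal only in zero; this agrees with the value of `irrMon` at `0`. -/
theorem mem_irrGrading {β : P →₀ ℕ} {x : irrelevant (posetIdeal k P)} :
    x ∈ irrGrading k β ↔ ∃ c : k, x = c • irrMon k β := by
  rw [Submodule.mem_comap, component, Submodule.mem_span_singleton]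
  constructor
  · rintro ⟨c, hc⟩
    by_cases h0 : β = 0
    · subst h0
      refine ⟨0, Subtype.ext ?_⟩
      have h1 := constCoeff_of_mem_irrelevant k P x.2
      have h2 : (x : MvPolynomial P k ⧸ posetIdeal k P) = Ideal.Quotient.mk _ (monomial 0 c) := by
        rw [← smul_mk_monomial, hc]; rfl
      rw [h2, quotientConstCoeff, Ideal.Quotient.lift_mk, constantCoeff_monomial, if_pos rfl] at h1
      rw [h2, h1, zero_smul, map_zero, map_zero]
      rfl
    · refine ⟨c, Subtype.ext ?_⟩
      refine hc.symm.trans ?_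
      rw [← irrMon_val k h0]
      rfl
  · rintro ⟨c, rfl⟩
    by_cases h0 : β = 0
    · subst h0
      refine ⟨0, ?_⟩
      rw [irrMon_zero, smul_zero, map_zero, zero_smul]
    · refine ⟨c, ?_⟩
      rw [map_smul, ← irrMon_val k h0]
      rfl

end IrrelevantBasis

section BarTransfer

variable (k : Type u) [Field k] {P : Type v} [Fintype P] [PartialOrder P]

variable (P) in
/-- The bar complex in terms of words. -/
def wordMap (n : ℕ) : (⨂[k]^n (irrelevant (posetIdeal k P))) →ₗ[k] (List (P →₀ ℕ) →₀ k) :=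
  Finsupp.lmapDomain k k (fun g : Fin n → IrrIndex P => List.ofFn fun i => (g i).1) ∘ₗ
    ((Basis.piTensorProduct fun _ : Fin n => irrBasis k P).repr : _ →ₗ[k] _)

theorem wordMap_injective (n : ℕ) : Function.Injective (wordMap k P n) := by
  intro x y h
  have hinj : Function.Injective fun g : Fin n → IrrIndex P => List.ofFn fun i => (g i).1 :=
    fun g h e => funext fun i => Subtype.ext (congrFun (List.ofFn_injective e) i)
  exact (Basis.piTensorProduct fun _ : Fin n => irrBasis k P).repr.injective
    (Finsupp.mapDomain_injective hinj h)

/-- A word, or zero if one of the letters vanishes. -/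
def goodPart (l : List (P →₀ ℕ)) : List (P →₀ ℕ) →₀ k := if GoodWord l then word k l else 0

theorem wordMap_tprod {n : ℕ} (g : Fin n → P →₀ ℕ) :
    wordMap k P n (PiTensorProduct.tprod k fun i => irrMon k (g i)) = goodPart k (List.ofFn g) := by
  rw [goodPart]
  split_ifs with h
  · have hg : ∀ i, g i ≠ 0 ∧ ChainSupp (g i) := fun i => h _ ((List.mem_ofFn' _ _).2 ⟨i, rfl⟩)
    have h1 : (PiTensorProduct.tprod k fun i => irrMon k (g i)) =
        Basis.piTensorProduct (fun _ : Fin n => irrBasis k P) fun i => ⟨g i, hg i⟩ := by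
      rw [Basis.piTensorProduct_apply]
      simp only [irrBasis_apply]
    rw [h1, wordMap, LinearMap.comp_apply, LinearEquiv.coe_coe, Module.Basis.repr_self,
      Finsupp.lmapDomain_apply, Finsupp.mapDomain_single]
  · rw [GoodWord] at h
    push Not at h
    obtain ⟨x, hx, h⟩ := h
    obtain ⟨i, rfl⟩ := (List.mem_ofFn' _ _).1 hx
    have h1 : irrMon k (g i) = 0 := by
      by_cases h0 : g i = 0
      · rw [h0, irrMon_zero]
      · exact irrMon_of_not_chain k (h h0)
    exact ((wordMap k P n).compMultilinearMap (PiTensorProduct.tprod k)).map_coord_zero i h1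

/-- The product of the letters at the places `j` and `j + 1`. -/
def mergeAt : ℕ → List (P →₀ ℕ) → List (P →₀ ℕ)
  | 0, x :: y :: l => (x + y) :: l
  | j + 1, x :: l => x :: mergeAt j l
  | _, l => l

theorem ofFn_contractNth {n : ℕ} (j : Fin n) (g : Fin (n + 1) → P →₀ ℕ) :
    List.ofFn (Fin.contractNth j.castSucc (· + ·) g) = mergeAt j (List.ofFn g) := by
  induction n with
  | zero => exact j.elim0
  | succ n ih =>
    rw [List.ofFn_succ, List.ofFn_succ (f := g)]
    refine Fin.cases ?_ (fun j => ?_) j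
    · rw [List.ofFn_succ]
      rfl
    · have h1 : mergeAt (j.succ : Fin (n + 1)) (g 0 :: List.ofFn fun i => g i.succ) =
          g 0 :: mergeAt j (List.ofFn fun i : Fin (n + 1) => g i.succ) := rfl
      rw [h1, ← ih]
      congr 1
      congr 1
      funext i
      simp only [Fin.contractNth, Fin.val_castSucc, Fin.val_succ, Nat.add_lt_add_iff_right,
        Nat.add_right_cancel_iff]
      split_ifs <;> rfl

theorem wordMap_face {n : ℕ} (j : Fin n) (g : Fin (n + 1) → P →₀ ℕ) (hg : ∀ i, g i ≠ 0) :
    wordMap k P n (barFace (idealMul k (irrelevant (posetIdeal k P))) n j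
      (PiTensorProduct.tprod k fun i => irrMon k (g i))) = goodPart k (mergeAt j (List.ofFn g)) := by
  rw [← ofFn_contractNth, ← wordMap_tprod, barFace, PiTensorProduct.lift.tprod]
  congr 1
  refine congrArg (PiTensorProduct.tprod k) (funext fun i => ?_)
  simp only [Fin.contractNth]
  split_ifs
  · rfl
  · exact irrMon_mul k (hg _) (hg _)
  · rfl

theorem wordD_eq_sum : ∀ {n : ℕ} {l : List (P →₀ ℕ)}, GoodWord l → l.length = n + 1 →
    wordD k ChainMul l = ∑ j : Fin n, (-1 : k) ^ (j : ℕ) • goodPart k (mergeAt j l)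
  | 0, [x], _, _ => by rw [wordD]; simp
  | n + 1, x :: y :: l, hl, hn => by
    obtain ⟨hx, hyl⟩ := goodWord_cons.1 hl
    obtain ⟨hy, hl'⟩ := goodWord_cons.1 hyl
    rw [wordD, Fin.sum_univ_succ, wordD_eq_sum hyl (by simpa using hn), map_sum, sub_eq_add_neg,
      ← Finset.sum_neg_distrib]
    congr 1
    · simp only [Fin.val_zero, pow_zero, one_smul, mergeAt, goodPart, goodWord_cons]
      refine if_congr ⟨fun h => ⟨⟨fun e => hx.1 (add_eq_zero.1 e).1, h⟩, hl'⟩, fun h => h.1.2⟩ rfl rfl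
    · refine Finset.sum_congr rfl fun j _ => ?_
      rw [map_smul, Fin.val_succ, pow_succ, mul_neg_one, neg_smul]
      congr 2
      have h1 : mergeAt (j + 1) (x :: y :: l) = x :: mergeAt j (y :: l) := rfl
      rw [h1, goodPart, goodPart, goodWord_cons]
      by_cases h : GoodWord (mergeAt j (y :: l))
      · rw [if_pos h, if_pos ⟨hx, h⟩, consMap_single]
      · rw [if_neg h, if_neg (fun h' => h h'.2), map_zero]

/-- On pure tensors of monomials each face multiplies two neighbours, and the product is again a
monomial or zero. So the bar complex is the word complex in which nonvanishing merges are allowed.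
-/
theorem wordMap_barD {n : ℕ} (z : ⨂[k]^(n + 1) (irrelevant (posetIdeal k P))) :
    wordMap k P n (barD (idealMul k (irrelevant (posetIdeal k P))) n z) =
      wordDiff k ChainMul (wordMap k P (n + 1) z) := by
  suffices h : wordMap k P n ∘ₗ barD (idealMul k (irrelevant (posetIdeal k P))) n =
      wordDiff k ChainMul ∘ₗ wordMap k P (n + 1) from LinearMap.congr_fun h z
  refine (Basis.piTensorProduct fun _ : Fin (n + 1) => irrBasis k P).ext fun g => ?_
  have hgood : GoodWord (List.ofFn fun i => (g i).1) := fun x hx => by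
    obtain ⟨i, rfl⟩ := (List.mem_ofFn' _ _).1 hx
    exact (g i).2
  rw [Basis.piTensorProduct_apply]
  simp only [irrBasis_apply]
  rw [LinearMap.comp_apply, LinearMap.comp_apply, wordMap_tprod, goodPart, if_pos hgood,
    wordDiff_word, wordD_eq_sum k hgood (List.length_ofFn), barD, LinearMap.sum_apply, map_sum]
  refine Finset.sum_congr rfl fun j _ => ?_
  rw [LinearMap.smul_apply, map_smul, wordMap_face k j _ fun i => (g i).2.1]

theorem map_barComponent (n : ℕ) (α : P →₀ ℕ) :
    (barComponent (irrGrading k (P := P)) n α).map (wordMap k P n) =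
      Finsupp.supported k k (goodWords n α) := by
  apply le_antisymm
  · rw [barComponent, Submodule.map_span, Submodule.span_le]
    rintro _ ⟨_, ⟨β, g, hg, rfl, rfl⟩, rfl⟩
    choose c hc using fun j => (mem_irrGrading k).1 (hg j)
    have : g = fun j => c j • irrMon k (β j) := funext hc
    rw [this, MultilinearMap.map_smul_univ, map_smul, wordMap_tprod]
    refine Submodule.smul_mem _ _ ?_
    rw [goodPart]
    split_ifs with h
    · exact Finsupp.single_mem_supported k _ ⟨h, List.length_ofFn, List.sum_ofFn⟩
    · exact zero_mem _
  · rw [Finsupp.supported_eq_span_single, Submodule.span_le]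
    rintro _ ⟨l, ⟨h1, rfl, rfl⟩, rfl⟩
    refine ⟨PiTensorProduct.tprod k fun i => irrMon k (l.get i), Submodule.subset_span
      ⟨l.get, _, fun i => (mem_irrGrading k).2 ⟨1, (one_smul k _).symm⟩, ?_, rfl⟩, ?_⟩
    · rw [← List.sum_ofFn, List.ofFn_get]
    · rw [wordMap_tprod, List.ofFn_get, goodPart, if_pos h1]

end BarTransfer

end MonomialRing
end

set_option linter.unusedSectionVars false
noncomputable section
open MvPolynomial
open scoped Classical TensorProduct

namespace MonomialRing

universe u v

/-! ### Tor dimensions as Euler characteristics -/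

section Counting

variable {P : Type v} [Fintype P] [PartialOrder P]

/-- The finite set of good words of length `n` and degree `α`. -/
def goodFin : ℕ → (P →₀ ℕ) → Finset (List (P →₀ ℕ))
  | 0, α => if α = 0 then {[]} else ∅
  | n + 1, α => (Finset.HasAntidiagonal.antidiagonal α).biUnion fun x =>
      if x.1 ≠ 0 ∧ ChainSupp x.1 then (goodFin n x.2).image (List.cons x.1) else ∅

theorem coe_goodFin (n : ℕ) : ∀ α : P →₀ ℕ, (goodFin n α : Set (List (P →₀ ℕ))) = goodWords n α := by
  induction n with
  | zero =>
    intro α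
    ext l
    rw [Finset.mem_coe, goodFin]
    constructor
    · intro h
      split_ifs at h with h0
      · rw [Finset.mem_singleton] at h
        subst h
        exact ⟨by simp [GoodWord], rfl, by simp [h0]⟩
      · simp at h
    · rintro ⟨h1, h2, rfl⟩
      rw [List.length_eq_zero_iff] at h2
      subst h2
      simp
  | succ n ih =>
    intro α
    ext l
    rw [Finset.mem_coe, goodFin, Finset.mem_biUnion]
    constructor
    · rintro ⟨x, hx, hl⟩
      rw [Finset.HasAntidiagonal.mem_antidiagonal] at hx
      split_ifs at hl with h
      · obtain ⟨m, hm, rfl⟩ := Finset.mem_image.1 hl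
        rw [← Finset.mem_coe, ih] at hm
        obtain ⟨h1, h2, h3⟩ := hm
        exact ⟨goodWord_cons.2 ⟨h, h1⟩, by simp [h2], by rw [List.sum_cons, h3, hx]⟩
      · simp at hl
    · rintro ⟨h1, h2, rfl⟩
      obtain _ | ⟨x, m⟩ := l
      · simp at h2
      · obtain ⟨h3, h4⟩ := goodWord_cons.1 h1
        refine ⟨(x, m.sum), by rw [Finset.HasAntidiagonal.mem_antidiagonal, List.sum_cons], ?_⟩
        rw [if_pos h3]
        refine Finset.mem_image_of_mem _ ?_
        rw [← Finset.mem_coe, ih]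
        exact ⟨h4, by simpa using h2, rfl⟩

variable (P) in
/-- The sum of the monomials of positive degree that do not vanish in `k[Δ(P)]`. -/
def irrSeries : MvPowerSeries P ℤ := chainSeries P - 1

theorem coeff_irrSeries (α : P →₀ ℕ) :
    MvPowerSeries.coeff α (irrSeries P) = if α ≠ 0 ∧ ChainSupp α then 1 else 0 := by
  rw [irrSeries, map_sub, coeff_chainSeries, MvPowerSeries.coeff_one]
  by_cases h : α = 0
  · subst h
    have : ChainSupp (0 : P →₀ ℕ) := by simp [ChainSupp]
    simp [this]
  · simp [h]

/-- Splitting off the first letter is multiplication by the series `H - 1` of the possible letters.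
-/
theorem card_goodFin (n : ℕ) : ∀ α : P →₀ ℕ,
    ((goodFin n α).card : ℤ) = MvPowerSeries.coeff α (irrSeries P ^ n) := by
  induction n with
  | zero =>
    intro α
    rw [goodFin, pow_zero, MvPowerSeries.coeff_one]
    split_ifs <;> simp
  | succ n ih =>
    intro α
    rw [goodFin, pow_succ', MvPowerSeries.coeff_mul, Finset.card_biUnion, Nat.cast_sum]
    · refine Finset.sum_congr rfl fun x _ => ?_
      rw [coeff_irrSeries, ← ih]
      split_ifs
      · rw [one_mul, Finset.card_image_of_injective _ (List.cons_injective)]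
      · simp
    · intro x hx y hy hne
      refine Finset.disjoint_left.2 fun l h1 h2 => ?_
      dsimp only at h1 h2
      split_ifs at h1 h2
      · obtain ⟨m, -, rfl⟩ := Finset.mem_image.1 h1
        obtain ⟨m', -, h3⟩ := Finset.mem_image.1 h2
        have h4 : y.1 = x.1 := (List.cons.inj h3).1
        rw [Finset.mem_coe, Finset.HasAntidiagonal.mem_antidiagonal] at hx hy
        rw [h4, ← hx] at hy
        exact hne (Prod.ext h4.symm (add_left_cancel hy).symm)
      all_goals simp at h1 h2

theorem length_le_degree : ∀ {l : List (P →₀ ℕ)}, GoodWord l → l.length ≤ l.sum.degree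
  | [], _ => by simp
  | x :: l, h => by
    obtain ⟨h1, h2⟩ := goodWord_cons.1 h
    have := length_le_degree h2
    have h3 : x.degree ≠ 0 := fun e => h1.1 ((Finsupp.degree_eq_zero_iff x).1 e)
    rw [List.length_cons, List.sum_cons, map_add]
    omega

theorem goodWords_eq_empty {n : ℕ} {α : P →₀ ℕ} (h : α.degree < n) : goodWords n α = ∅ := by
  refine Set.eq_empty_of_forall_notMem fun l hl => ?_
  have := length_le_degree hl.1
  rw [hl.2.1, hl.2.2] at this
  omega

variable (P) in
/-- The inverse of the Hilbert series. -/
def inverseSeries : MvPowerSeries P ℤ := fun α =>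
  ∑ n ∈ Finset.range (α.degree + 1), (-1) ^ n * MvPowerSeries.coeff α (irrSeries P ^ n)

/-- Letters have positive degree, so `(H - 1)^n` has no terms of degree less than `n`, and the
geometric series may be cut off anywhere beyond the degree of `α`. -/
theorem coeff_inverseSeries {α : P →₀ ℕ} {N : ℕ} (hN : α.degree ≤ N) :
    MvPowerSeries.coeff α (inverseSeries P) =
      MvPowerSeries.coeff α (∑ n ∈ Finset.range (N + 1), (-irrSeries P) ^ n) := by
  have h1 : MvPowerSeries.coeff α (inverseSeries P) =
    ∑ n ∈ Finset.range (α.degree + 1), (-1) ^ n * MvPowerSeries.coeff α (irrSeries P ^ n) := rfl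
  have h2 (n : ℕ) : MvPowerSeries.coeff α ((-irrSeries P) ^ n) =
      (-1) ^ n * MvPowerSeries.coeff α (irrSeries P ^ n) := by
    rcases Nat.even_or_odd n with h | h <;> simp [h.neg_pow]
  rw [h1, map_sum]
  simp only [h2]
  refine Finset.sum_subset (Finset.range_subset_range.2 (by omega)) fun n _ hn => ?_
  rw [← card_goodFin]
  have : goodFin n α = ∅ := by
    rw [← Finset.coe_eq_empty, coe_goodFin, goodWords_eq_empty]
    rw [Finset.mem_range] at hn
    omega
  simp [this]

variable (P) in
theorem inverseSeries_mul : inverseSeries P * chainSeries P = 1 := by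
  ext α
  have h1 : MvPowerSeries.coeff α (inverseSeries P * chainSeries P) =
      MvPowerSeries.coeff α
        ((∑ n ∈ Finset.range (α.degree + 1), (-irrSeries P) ^ n) * chainSeries P) := by
    rw [MvPowerSeries.coeff_mul, MvPowerSeries.coeff_mul]
    refine Finset.sum_congr rfl fun x hx => ?_
    rw [Finset.HasAntidiagonal.mem_antidiagonal] at hx
    rw [coeff_inverseSeries (N := α.degree)]
    rw [← hx, map_add]
    exact Nat.le_add_right _ _
  have h2 : chainSeries P = -(-irrSeries P - 1) := by rw [irrSeries]; ring
  have h3 : MvPowerSeries.coeff α ((-irrSeries P) ^ (α.degree + 1)) = 0 := by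
    have : MvPowerSeries.coeff α (irrSeries P ^ (α.degree + 1)) = 0 := by
      rw [← card_goodFin]
      have : goodFin (α.degree + 1) α = ∅ := by
        rw [← Finset.coe_eq_empty, coe_goodFin, goodWords_eq_empty (Nat.lt_succ_self _)]
      simp [this]
    rcases Nat.even_or_odd (α.degree + 1) with h | h <;> simp [h.neg_pow, this]
  rw [h1, h2, mul_neg, geom_sum_mul, neg_sub, map_sub, h3, sub_zero]

end Counting

section LinearAlgebra

variable {k : Type*} [Field k] {U V W X : Type*} [AddCommGroup U] [Module k U] [AddCommGroup V]
  [Module k V] [AddCommGroup W] [Module k W] [AddCommGroup X] [Module k X]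

theorem map_inf_ker {Φ : U →ₗ[k] V} {Ψ : W →ₗ[k] X} (hΨ : Function.Injective Ψ) {f : U →ₗ[k] W}
    {g : V →ₗ[k] X} (h : ∀ z, Ψ (f z) = g (Φ z)) (S : Submodule k U) :
    (S ⊓ LinearMap.ker f).map Φ = S.map Φ ⊓ LinearMap.ker g := by
  ext z
  constructor
  · rintro ⟨y, ⟨h1, h2⟩, rfl⟩
    refine ⟨⟨y, h1, rfl⟩, ?_⟩
    rw [SetLike.mem_coe, LinearMap.mem_ker] at h2 ⊢
    rw [← h, h2, map_zero]
  · rintro ⟨⟨y, h1, rfl⟩, h2⟩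
    rw [SetLike.mem_coe, LinearMap.mem_ker, ← h] at h2
    exact ⟨y, ⟨h1, hΨ (h2.trans (map_zero _).symm)⟩, rfl⟩

theorem eq_bot_of_map {Φ : U →ₗ[k] V} (hΦ : Function.Injective Φ) {S : Submodule k U}
    (h : S.map Φ = ⊥) : S = ⊥ := by
  rw [eq_bot_iff]
  intro x hx
  have h1 : Φ x ∈ (⊥ : Submodule k V) := h ▸ Submodule.mem_map_of_mem hx
  exact (Submodule.mem_bot k).2 (hΦ (((Submodule.mem_bot k).1 h1).trans (map_zero _).symm))

theorem finrank_quotient_of_le {B C : Submodule k U} (h : C ≤ B) :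
    Module.finrank k (C ⧸ B.submoduleOf C) = 0 := by
  have h2 : B.submoduleOf C = ⊤ := Submodule.comap_subtype_eq_top.2 h
  rw [h2]
  exact Module.finrank_zero_of_subsingleton

theorem finrank_quotient_of_eq_bot {Φ : U →ₗ[k] V} (hΦ : Function.Injective Φ)
    {B C : Submodule k U} (h : B = ⊥) :
    Module.finrank k (C ⧸ B.submoduleOf C) = Module.finrank k (C.map Φ) := by
  have h2 : B.submoduleOf C = ⊥ := by
    rw [Submodule.submoduleOf, h, Submodule.comap_bot, Submodule.ker_subtype]
  rw [h2, (Submodule.quotEquivOfEqBot _ rfl).finrank_eq,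
    (Submodule.equivMapOfInjective _ hΦ C).finrank_eq]

end LinearAlgebra

section BarHomology

variable {k : Type u} [Field k] {M : Type v} [AddCommGroup M] [Module k M] {D : Type*}
  [AddCommMonoid D] {μ : M →ₗ[k] M →ₗ[k] M} {ℳ : D → Submodule k M} {n : ℕ} {α : D}
  {V W : Type*} [AddCommGroup V] [Module k V] [AddCommGroup W] [Module k W]

theorem map_barCycles_succ {Φ : (⨂[k]^(n + 1) M) →ₗ[k] V} {Ψ : (⨂[k]^n M) →ₗ[k] W}
    (hΨ : Function.Injective Ψ) {g : V →ₗ[k] W} (h : ∀ z, Ψ (barD μ n z) = g (Φ z)) :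
    (barCycles μ ℳ (n + 1) α).map Φ = (barComponent ℳ (n + 1) α).map Φ ⊓ LinearMap.ker g :=
  map_inf_ker hΨ h _

theorem barHomologyDim_eq_zero {Φ : (⨂[k]^n M) →ₗ[k] V} (hΦ : Function.Injective Φ)
    (h : (barCycles μ ℳ n α).map Φ ≤ (barBoundaries μ ℳ n α).map Φ) :
    barHomologyDim μ ℳ n α = 0 :=
  finrank_quotient_of_le ((Submodule.map_le_map_iff_of_injective hΦ _ _).1 h)

theorem barHomologyDim_eq_finrank {Φ : (⨂[k]^n M) →ₗ[k] V} (hΦ : Function.Injective Φ)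
    (h : (barBoundaries μ ℳ n α).map Φ = ⊥) :
    barHomologyDim μ ℳ n α = Module.finrank k ((barCycles μ ℳ n α).map Φ) :=
  finrank_quotient_of_eq_bot hΦ (eq_bot_of_map hΦ h)

end BarHomology

section TorDim

variable (k : Type u) [Field k] {P : Type v} [Fintype P] [PartialOrder P]

theorem finrank_supported {X : Type*} (s : Finset X) :
    Module.finrank k (Finsupp.supported k k (s : Set X)) = s.card := by
  rw [(Finsupp.supportedEquivFinsupp (M := k) (R := k) (s : Set X)).finrank_eq,
    Module.finrank_finsupp_self]
  simp

theorem finite_supported {X : Type*} (s : Finset X) :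
    Module.Finite k (Finsupp.supported k k (s : Set X)) :=
  Module.Finite.equiv (Finsupp.supportedEquivFinsupp (M := k) (R := k) (s : Set X)).symm

theorem finrank_inf_ker {V W : Type*} [AddCommGroup V] [Module k V] [AddCommGroup W] [Module k W]
    (f : V →ₗ[k] W) (S : Submodule k V) [Module.Finite k S] :
    Module.finrank k (S.map f) + Module.finrank k (S ⊓ LinearMap.ker f : Submodule k V) =
      Module.finrank k S := by
  rw [← (f.domRestrict S).finrank_range_add_finrank_ker, LinearMap.range_domRestrict,
    LinearMap.ker_domRestrict, ← Submodule.map_comap_subtype]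
  congr 1
  exact Submodule.finrank_map_subtype_eq _ _

/-- Cycles in the word complex. -/
def wordCycles (n : ℕ) (α : P →₀ ℕ) : Submodule k (List (P →₀ ℕ) →₀ k) :=
  Finsupp.supported k k (goodWords n α) ⊓ LinearMap.ker (wordDiff k ChainMul)

/-- Boundaries in the word complex. -/
def wordBoundaries (n : ℕ) (α : P →₀ ℕ) : Submodule k (List (P →₀ ℕ) →₀ k) :=
  (Finsupp.supported k k (goodWords (n + 1) α)).map (wordDiff k ChainMul)

theorem wordBoundaries_eq {n : ℕ} {α : P →₀ ℕ} (h : n < α.degree) :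
    wordBoundaries k n α = wordCycles k n α := by
  apply le_antisymm
  · rintro _ ⟨z, hz, rfl⟩
    refine ⟨linear_mem_of_supported (fun l hl => ?_) hz, wordDiff_wordDiff z⟩
    rw [wordDiff_word]
    obtain ⟨h1, h2, rfl⟩ := hl
    exact Finsupp.supported_mono (rankLt_subset _ _ _) (wordD_mem_of (s := 0)
      (fun _ _ h _ _ => h) (fun _ _ _ => Nat.zero_le _) h1 _ (Nat.lt_succ_self _) n h2)
  · rintro z ⟨hz, h0⟩
    exact exact_words h hz h0

/-- Rank–nullity step by step: below the degree of `α` boundaries are cycles and conversely, so the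
dimensions of the cycles are the alternating partial sums of the numbers of words. -/
theorem finrank_wordCycles {α : P →₀ ℕ} : ∀ {n : ℕ}, n ≤ α.degree →
    (-1) ^ n * (Module.finrank k (wordCycles k n α) : ℤ) =
      ∑ j ∈ Finset.range (n + 1), (-1) ^ j * MvPowerSeries.coeff α (irrSeries P ^ j) := by
  intro n
  induction n with
  | zero =>
    intro _
    have h : wordCycles k 0 α = Finsupp.supported k k (goodFin 0 α : Set (List (P →₀ ℕ))) := by
      rw [wordCycles, coe_goodFin, inf_eq_left]
      intro z hz
      refine (Submodule.mem_bot k).1 (linear_mem_of_supported (fun l hl => ?_) hz)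
      rw [List.length_eq_zero_iff.1 hl.2.1, wordDiff_word, wordD]
      exact zero_mem _
    rw [h, finrank_supported, card_goodFin]
    simp
  | succ n ih =>
    intro hn
    have h1 := ih (by omega)
    rw [Finset.sum_range_succ, ← h1, ← wordBoundaries_eq k (n := n) (by omega), ← card_goodFin,
      ← finrank_supported k, coe_goodFin]
    have : Module.Finite k (Finsupp.supported k k (goodWords (n + 1) α)) := by
      rw [← coe_goodFin]
      exact finite_supported k _
    have h2 := finrank_inf_ker k (wordDiff k ChainMul) (Finsupp.supported k k (goodWords (n + 1) α))
    rw [wordBoundaries, wordCycles, ← h2]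
    push_cast
    ring

theorem map_barCycles (n : ℕ) (α : P →₀ ℕ) :
    (barCycles (idealMul k (irrelevant (posetIdeal k P))) (irrGrading k) n α).map (wordMap k P n) =
      wordCycles k n α := by
  obtain _ | n := n
  · rw [barCycles, map_barComponent, wordCycles, eq_comm, inf_eq_left]
    intro z hz
    refine (Submodule.mem_bot k).1 (linear_mem_of_supported (fun l hl => ?_) hz)
    rw [List.length_eq_zero_iff.1 hl.2.1, wordDiff_word, wordD]
    exact zero_mem _
  · rw [wordCycles, ← map_barComponent]
    exact map_barCycles_succ (wordMap_injective k n) (fun z => wordMap_barD k z)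

theorem map_barBoundaries (n : ℕ) (α : P →₀ ℕ) :
    (barBoundaries (idealMul k (irrelevant (posetIdeal k P))) (irrGrading k) n α).map
      (wordMap k P n) = wordBoundaries k n α := by
  rw [barBoundaries, wordBoundaries, ← map_barComponent, ← Submodule.map_comp, ← Submodule.map_comp]
  congr 1
  exact LinearMap.ext fun z => wordMap_barD k z

/-- Below the diagonal the word complex is exact and beyond it there are no words. On the diagonal
there are no longer words, hence no boundaries, and the cycles are counted by the Euler
characteristic. -/
theorem torDim_posetIdeal (n : ℕ) (α : P →₀ ℕ) :
    (torDim (component (posetIdeal k P)) (irrelevant (posetIdeal k P)) n α : ℤ) =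
      if α.degree = n then (-1) ^ n * MvPowerSeries.coeff α (inverseSeries P) else 0 := by
  change (barHomologyDim (idealMul k (irrelevant (posetIdeal k P))) (irrGrading k) n α : ℤ) = _
  have hinj := wordMap_injective (k := k) (P := P) n
  rcases lt_trichotomy α.degree n with h | h | h
  · rw [if_neg h.ne, barHomologyDim_eq_zero hinj, Nat.cast_zero]
    rw [map_barCycles, wordCycles, goodWords_eq_empty h, Finsupp.supported_empty, bot_inf_eq]
    exact bot_le
  · rw [if_pos h, barHomologyDim_eq_finrank hinj, map_barCycles]
    · have h3 := finrank_wordCycles k (α := α) h.ge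
      have h4 : MvPowerSeries.coeff α (inverseSeries P) = ∑ j ∈ Finset.range (n + 1),
        (-1) ^ j * MvPowerSeries.coeff α (irrSeries P ^ j) := by rw [← h]; rfl
      rw [h4, ← h3, ← mul_assoc, ← mul_pow]
      simp
    · rw [map_barBoundaries, wordBoundaries, goodWords_eq_empty (by omega),
        Finsupp.supported_empty, Submodule.map_bot]
  · rw [if_neg h.ne', barHomologyDim_eq_zero hinj, Nat.cast_zero]
    rw [map_barCycles, map_barBoundaries, wordBoundaries_eq k h]

variable (P) in
theorem poincareSeries_eq :
    poincareSeries (posetIdeal k P) = homogenize (-1) (inverseSeries P) := by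
  rw [poincareSeries, homogenize_eq]
  refine congrArg PowerSeries.mk (funext fun i => MvPowerSeries.ext fun α => ?_)
  rw [coeff_homogPart]
  exact torDim_posetIdeal k i α

end TorDim

end MonomialRing
end

set_option linter.unusedSectionVars false
noncomputable section
open MvPolynomial
open scoped Classical TensorProduct

namespace MonomialRing

universe u v

/-! ### Traces and the Cartier–Foata inversion -/

section Traces

variable {Y : Type*} (ind : Y → Y → Prop)

/-- Exchanging two adjacent independent letters. -/
inductive Swap : List Y → List Y → Prop
  | head (a b : Y) (v : List Y) (h : ind a b) : Swap (a :: b :: v) (b :: a :: v)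
  | cons (a : Y) {u v : List Y} (h : Swap u v) : Swap (a :: u) (a :: v)

/-- Words up to exchanges of independent letters. -/
def Trace : Type _ := Quot (Swap ind)

/-- The trace of a word. -/
def Trace.mk (w : List Y) : Trace ind := Quot.mk _ w

variable {ind}

namespace Trace

theorem sound {u v : List Y} (h : Swap ind u v) : mk ind u = mk ind v := Quot.sound h

theorem exists_rep (T : Trace ind) : ∃ w, mk ind w = T := Quot.exists_rep T

/-- Prepending a letter. -/
def push (y : Y) : Trace ind → Trace ind := Quot.map (List.cons y) fun _ _ h => Swap.cons y h

theorem push_mk (y : Y) (w : List Y) : push y (mk ind w) = mk ind (y :: w) := rfl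

variable (hs : ∀ a b, ind a b → ind b a)

theorem push_comm {a b : Y} (h : ind a b) (T : Trace ind) : push a (push b T) = push b (push a T) := by
  obtain ⟨w, rfl⟩ := exists_rep T
  exact sound (Swap.head a b w h)

/-- Removing the first occurrence of a letter. -/
def pop (hirr : ∀ a, ¬ ind a a) (y : Y) : Trace ind → Trace ind :=
  Quot.lift (fun w => mk ind (w.erase y)) fun u v h => by
    induction h with
    | head a b v h =>
      have hab : a ≠ b := fun e => hirr b (e ▸ h)
      by_cases h1 : a = y
      · subst h1
        rw [List.erase_cons_head, List.erase_cons_tail (by simpa using hab.symm),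
          List.erase_cons_head]
      · by_cases h2 : b = y
        · subst h2
          rw [List.erase_cons_head, List.erase_cons_tail (by simpa using h1), List.erase_cons_head]
        · simp only [List.erase_cons_tail (show ¬ (a == y) = true by simpa using h1),
            List.erase_cons_tail (show ¬ (b == y) = true by simpa using h2)]
          exact sound (Swap.head a b _ h)
    | @cons a u v h ih =>
      by_cases h1 : a = y
      · subst h1
        rw [List.erase_cons_head, List.erase_cons_head]
        exact sound h
      · rw [List.erase_cons_tail (by simpa using h1), List.erase_cons_tail (by simpa using h1),
          ← push_mk, ← push_mk, ih]

variable (ind) in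
/-- The letter can be moved to the front of the word. -/
def WordFront (y : Y) : List Y → Prop
  | [] => False
  | z :: w => z = y ∨ (ind y z ∧ WordFront y w)

include hs in
theorem wordFront_swap {y : Y} {u v : List Y} (h : Swap ind u v) :
    WordFront ind y u = WordFront ind y v := by
  induction h with
  | head a b v h =>
    rw [eq_iff_iff]
    simp only [WordFront]
    constructor
    · rintro (rfl | ⟨h1, rfl | h2⟩)
      exacts [Or.inr ⟨h, Or.inl rfl⟩, Or.inl rfl, Or.inr ⟨h2.1, Or.inr ⟨h1, h2.2⟩⟩]
    · rintro (rfl | ⟨h1, rfl | h2⟩)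
      exacts [Or.inr ⟨hs _ _ h, Or.inl rfl⟩, Or.inl rfl, Or.inr ⟨h2.1, Or.inr ⟨h1, h2.2⟩⟩]
  | cons a h ih => simp only [WordFront, ih]

/-- The letter can be moved to the front of the trace. -/
def Front (y : Y) : Trace ind → Prop := Quot.lift (WordFront ind y) fun _ _ h => wordFront_swap hs h

theorem front_mk {y : Y} {w : List Y} : Front hs y (mk ind w) ↔ WordFront ind y w := Iff.rfl

variable (hirr : ∀ a, ¬ ind a a)

theorem pop_push (y : Y) (T : Trace ind) : pop hirr y (push y T) = T := by
  obtain ⟨w, rfl⟩ := exists_rep T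
  exact congrArg (mk ind) (List.erase_cons_head y w)

include hirr in
theorem push_injective (y : Y) : Function.Injective (push (ind := ind) y) := fun S T h => by
  rw [← pop_push hirr y S, h, pop_push]

theorem front_push_self (y : Y) (T : Trace ind) : Front hs y (push y T) := by
  obtain ⟨w, rfl⟩ := exists_rep T
  exact Or.inl rfl

theorem front_push_of_ne {y z : Y} (h : z ≠ y) (T : Trace ind) :
    Front hs y (push z T) ↔ ind y z ∧ Front hs y T := by
  obtain ⟨w, rfl⟩ := exists_rep T
  exact or_iff_right h

include hirr in
theorem front_push {y z : Y} (h : ind y z) (T : Trace ind) :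
    Front hs y (push z T) ↔ Front hs y T := by
  have hne : z ≠ y := by
    rintro rfl
    exact hirr z h
  rw [front_push_of_ne hs hne]
  exact and_iff_right h

include hirr in
theorem push_pop {y : Y} {T : Trace ind} (h : Front hs y T) : push y (pop hirr y T) = T := by
  obtain ⟨w, rfl⟩ := exists_rep T
  rw [front_mk] at h
  change mk ind (y :: w.erase y) = _
  induction w with
  | nil => exact h.elim
  | cons z w ih =>
    rcases h with rfl | ⟨h1, h2⟩
    · rw [List.erase_cons_head]
    · have hne : z ≠ y := fun e => hirr y (e ▸ h1)
      rw [List.erase_cons_tail (by simpa using hne), sound (Swap.head y z _ h1), ← push_mk, ih h2,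
        push_mk]

/-- If both letters can come first, then on the way one of them has passed the other. -/
theorem front_ind {y z : Y} (hne : y ≠ z) {T : Trace ind} (hy : Front hs y T) (hz : Front hs z T) :
    ind y z := by
  obtain ⟨w, rfl⟩ := exists_rep T
  rw [front_mk] at hy hz
  induction w with
  | nil => exact hy.elim
  | cons a w ih =>
    rcases hy with rfl | ⟨h1, h2⟩
    · rcases hz with h | h
      · exact (hne h).elim
      · exact hs _ _ h.1
    · rcases hz with rfl | h
      · exact h1
      · exact ih h2 h.2

theorem exists_front {T : Trace ind} (h : T ≠ mk ind []) : ∃ y, Front hs y T := by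
  obtain ⟨w, rfl⟩ := exists_rep T
  obtain _ | ⟨y, w⟩ := w
  · exact (h rfl).elim
  · exact ⟨y, Or.inl rfl⟩

/-- Prepending a word. -/
def pushList (l : List Y) (T : Trace ind) : Trace ind := l.foldr push T

include hirr in
theorem pushList_injective (l : List Y) : Function.Injective (pushList (ind := ind) l) := by
  induction l with
  | nil => exact fun _ _ h => h
  | cons y l ih => exact fun _ _ h => ih (push_injective hirr y h)

-- The letters of the list are removed one at a time; removing one of them leaves the others in
-- front because they are independent of it.
include hirr in
theorem exists_pushList_iff {l : List Y} (hl : l.Pairwise ind) (S : Trace ind) :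
    (∃ T, pushList l T = S) ↔ ∀ y ∈ l, Front hs y S := by
  induction l generalizing S with
  | nil => simp [pushList]
  | cons y l ih =>
    rw [List.pairwise_cons] at hl
    have h1 : (∃ T, pushList (y :: l) T = S) ↔
        Front hs y S ∧ ∃ T, pushList l T = pop hirr y S := by
      constructor
      · rintro ⟨T, rfl⟩
        refine ⟨front_push_self hs y _, T, ?_⟩
        exact (pop_push hirr y _).symm
      · rintro ⟨h, T, hT⟩
        refine ⟨T, ?_⟩
        change push y (pushList l T) = S
        rw [hT, push_pop hs hirr h]
    rw [h1, ih hl.2, List.forall_mem_cons]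
    refine and_congr_right fun h => forall₂_congr fun z hz => ?_
    conv_rhs => rw [← push_pop hs hirr h]
    rw [front_push hs hirr (hs _ _ (hl.1 z hz))]

variable {D : Type*} [AddCommMonoid D] (deg : Y → D)

/-- The degree of a trace. -/
def degree : Trace ind → D := Quot.lift (fun w => (w.map deg).sum) fun u v h => by
  induction h with
  | head a b v h =>
    simp only [List.map_cons, List.sum_cons]
    rw [← add_assoc, ← add_assoc, add_comm (deg a)]
  | cons a h ih => simp only [List.map_cons, List.sum_cons, ih]

theorem degree_mk (w : List Y) : degree deg (mk ind w) = (w.map deg).sum := rfl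

theorem degree_pushList (l : List Y) (T : Trace ind) :
    degree deg (pushList l T) = (l.map deg).sum + degree deg T := by
  obtain ⟨w, rfl⟩ := exists_rep T
  have : pushList l (mk ind w) = mk ind (l ++ w) := by
    induction l with
    | nil => rfl
    | cons y l ih => exact congrArg (push y) ih
  rw [this, degree_mk, degree_mk, List.map_append, List.sum_append]

end Trace

end Traces

section TraceSeries

open Trace

variable {Y : Type*} [Fintype Y] {ind : Y → Y → Prop} (hs : ∀ a b, ind a b → ind b a)
  (hirr : ∀ a, ¬ ind a a) {P : Type v} [Fintype P] {deg : Y → P →₀ ℕ} (hd : ∀ y, deg y ≠ 0)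

include hd in
theorem length_le_degree_sum (w : List Y) : w.length ≤ (w.map deg).sum.degree := by
  induction w with
  | nil => simp
  | cons y w ih =>
    have h3 : (deg y).degree ≠ 0 := fun e => hd y ((Finsupp.degree_eq_zero_iff _).1 e)
    rw [List.map_cons, List.sum_cons, map_add, List.length_cons]
    omega

include hd in
theorem finite_traces (α : P →₀ ℕ) : Finite {T : Trace ind // degree deg T = α} := by
  refine ((List.finite_length_le Y α.degree).image (Trace.mk ind)).subset
    (t := {T : Trace ind | degree deg T = α}) ?_
  rintro T (rfl : degree deg T = α)
  obtain ⟨w, rfl⟩ := exists_rep T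
  exact ⟨w, length_le_degree_sum hd w, rfl⟩

variable (ind) in
/-- Pairwise independent letters. -/
def IsClique (c : Finset Y) : Prop := ∀ y ∈ c, ∀ z ∈ c, y ≠ z → ind y z

theorem IsClique.pairwise {c : Finset Y} (h : IsClique ind c) : c.toList.Pairwise ind :=
  List.Nodup.pairwise_of_forall_ne (Finset.nodup_toList c) fun a ha b hb hne =>
    h a (Finset.mem_toList.1 ha) b (Finset.mem_toList.1 hb) hne

variable (ind deg) in
/-- The generating series of the traces. -/
def traceSeries : MvPowerSeries P ℤ := fun α => (Nat.card {T : Trace ind // degree deg T = α} : ℤ)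

variable (ind deg) in
/-- The alternating generating series of the cliques. -/
def cliqueSeries : MvPowerSeries P ℤ :=
  ∑ c : Finset Y with IsClique ind c, MvPowerSeries.monomial (∑ y ∈ c, deg y) ((-1) ^ c.card)

include hs hirr hd in
theorem card_traces_sub {c : Finset Y} (hc : IsClique ind c) (α : P →₀ ℕ) :
    (if ∑ y ∈ c, deg y ≤ α then Nat.card {T : Trace ind // degree deg T = α - ∑ y ∈ c, deg y} else 0) =
      Nat.card {T : {T : Trace ind // degree deg T = α} // ∀ y ∈ c, Front hs y T.1} := by
  have hsum : (c.toList.map deg).sum = ∑ y ∈ c, deg y := Finset.sum_map_toList c deg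
  split_ifs with h
  · refine Nat.card_congr (Equiv.ofBijective (fun T => ⟨⟨pushList c.toList T.1, ?_⟩, ?_⟩) ⟨?_, ?_⟩)
    · rw [degree_pushList, hsum, T.2, add_tsub_cancel_of_le h]
    · intro y hy
      exact (exists_pushList_iff hs hirr hc.pairwise _).1 ⟨T.1, rfl⟩ y (Finset.mem_toList.2 hy)
    · intro S T hST
      exact Subtype.ext (pushList_injective hirr c.toList (congrArg (fun x => x.1.1) hST))
    · rintro ⟨⟨S, hS⟩, hf⟩
      obtain ⟨T, rfl⟩ := (exists_pushList_iff hs hirr hc.pairwise S).2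
        fun y hy => hf y (Finset.mem_toList.1 hy)
      refine ⟨⟨T, ?_⟩, rfl⟩
      rw [degree_pushList, hsum] at hS
      rw [← hS, add_tsub_cancel_left]
  · symm
    have : IsEmpty {T : {T : Trace ind // degree deg T = α} // ∀ y ∈ c, Front hs y T.1} := by
      refine ⟨fun S => h ?_⟩
      obtain ⟨⟨S, hS⟩, hf⟩ := S
      obtain ⟨T, rfl⟩ := (exists_pushList_iff hs hirr hc.pairwise S).2
        fun y hy => hf y (Finset.mem_toList.1 hy)
      rw [degree_pushList, hsum] at hS
      rw [← hS]
      exact le_self_add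
    exact Nat.card_of_isEmpty

-- For a fixed trace the cliques that can be taken off its front are all subsets of the set of its
-- front letters, because front letters are pairwise independent. The alternating sum over them
-- vanishes unless there is no front letter, that is, unless the trace is empty.
include hs hirr hd in
theorem traceSeries_mul_cliqueSeries : traceSeries ind deg * cliqueSeries ind deg = 1 := by
  ext α
  have hfin (β : P →₀ ℕ) : Fintype {T : Trace ind // degree deg T = β} :=
    @Fintype.ofFinite _ (finite_traces hd β)
  rw [cliqueSeries, Finset.mul_sum, map_sum]
  have h1 : ∀ c ∈ Finset.univ.filter (fun c : Finset Y => IsClique ind c),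
      MvPowerSeries.coeff α (traceSeries ind deg *
        MvPowerSeries.monomial (∑ y ∈ c, deg y) ((-1) ^ c.card)) =
      ∑ T : {T : Trace ind // degree deg T = α},
        if ∀ y ∈ c, Front hs y T.1 then (-1) ^ c.card else 0 := by
    intro c hc
    have h2 := card_traces_sub hs hirr hd (Finset.mem_filter.1 hc).2 α
    rw [MvPowerSeries.coeff_mul_monomial, ← Finset.sum_filter, Finset.sum_const, nsmul_eq_mul]
    rw [Nat.card_eq_fintype_card (α := {T : {T : Trace ind // degree deg T = α} // _}),
      Fintype.card_subtype] at h2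
    rw [← h2]
    split_ifs
    · rfl
    · simp
  rw [Finset.sum_congr rfl h1, Finset.sum_comm]
  have h3 : ∀ T : {T : Trace ind // degree deg T = α},
      (∑ c ∈ Finset.univ.filter (fun c : Finset Y => IsClique ind c),
        if ∀ y ∈ c, Front hs y T.1 then (-1 : ℤ) ^ c.card else 0) =
      if T.1 = Trace.mk ind [] then 1 else 0 := by
    intro T
    rw [← Finset.sum_filter, Finset.filter_filter]
    have h4 : (Finset.univ.filter fun c : Finset Y => IsClique ind c ∧ ∀ y ∈ c, Front hs y T.1) =
        (Finset.univ.filter fun y => Front hs y T.1).powerset := by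
      ext c
      simp only [Finset.mem_filter, Finset.mem_univ, true_and, Finset.mem_powerset]
      constructor
      · exact fun h y hy => by simpa using h.2 y hy
      · intro h
        have h5 : ∀ y ∈ c, Front hs y T.1 := fun y hy => by simpa using h hy
        exact ⟨fun y hy z hz hne => front_ind hs hne (h5 y hy) (h5 z hz), h5⟩
    rw [h4, Finset.sum_powerset_neg_one_pow_card]
    congr 1
    rw [Finset.filter_eq_empty_iff, eq_iff_iff]
    constructor
    · intro h
      by_contra hne
      obtain ⟨y, hy⟩ := exists_front hs hne
      exact h (Finset.mem_univ y) hy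
    · intro h y _ hy
      rw [h] at hy
      exact hy
  rw [Finset.sum_congr rfl fun T _ => h3 T, ← Finset.sum_filter, Finset.sum_const, nsmul_eq_mul,
    mul_one, MvPowerSeries.coeff_one]
  split_ifs with h
  · subst h
    rw [Finset.card_eq_one.2 ⟨⟨Trace.mk ind [], rfl⟩, ?_⟩, Nat.cast_one]
    ext T
    simp only [Finset.mem_filter, Finset.mem_univ, true_and, Finset.mem_singleton]
    exact ⟨fun h => Subtype.ext h, fun h => congrArg Subtype.val h⟩
  · rw [Finset.filter_eq_empty_iff.2, Finset.card_empty, Nat.cast_zero]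
    intro T _ hT
    have := T.2
    rw [hT] at this
    exact h this.symm

end TraceSeries

end MonomialRing
end

set_option linter.unusedSectionVars false
noncomputable section
open MvPolynomial
open scoped Classical TensorProduct

namespace MonomialRing

universe u v

/-! ### The algebra `R` has a basis of traces -/

section RAlgebra

variable {k : Type u} [Field k] {σ : Type v} [Fintype σ] {a : Ideal (MvPolynomial σ k)}
  (L : List (Matching a))

/-- The variables `Y_I` and `Y_J` are related by a relation of `R`. -/
def YInd (I J : YIndex L) : Prop := IsCoprimeMon (lcmOf I.1) (lcmOf J.1)

/-- The multidegree of `Y_I`. -/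
def yDeg (I : YIndex L) : σ →₀ ℕ := lcmOf I.1

variable {L}

theorem YInd.symm (I J : YIndex L) (h : YInd L I J) : YInd L J I := by
  rw [YInd, isCoprimeMon_iff] at h ⊢
  exact Disjoint.symm h

/-- The sign in the relation of `Y_I` and `Y_J`. -/
def ySign (I J : YIndex L) : kˣ := (-1) ^ ((I.1.card + 1) * (J.1.card + 1))

theorem ySign_comm (I J : YIndex L) : ySign I J = ySign J I := by
  rw [ySign, ySign, mul_comm]

theorem ySign_mul_self (I J : YIndex L) : ySign I J * ySign I J = 1 := by
  rw [ySign, ← mul_pow]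
  simp

/-- The sign of moving `Y_I` to its place in the order of the variables. -/
def moveSign (I J : YIndex L) : kˣ :=
  if Fintype.equivFin (YIndex L) J < Fintype.equivFin (YIndex L) I then ySign I J else 1

/-- The sign of moving `Y_I` past the smaller letters of a trace. -/
def traceSign (I : YIndex L) : Trace (YInd L) → kˣ :=
  Quot.lift (fun w => (w.map (moveSign I)).prod) fun u v h => by
    induction h with
    | head x y v h =>
      simp only [List.map_cons, List.prod_cons]
      rw [← mul_assoc, ← mul_assoc, mul_comm (moveSign I x)]
    | cons x h ih => simp only [List.map_cons, List.prod_cons, ih]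

theorem traceSign_push (I J : YIndex L) (T : Trace (YInd L)) :
    traceSign I (Trace.push J T) = moveSign I J * traceSign I T := by
  obtain ⟨w, rfl⟩ := Trace.exists_rep T
  exact List.prod_cons

/-- The signed left multiplication by `Y_I` on traces. -/
def traceAct (I : YIndex L) : (Trace (YInd L) →₀ k) →ₗ[k] (Trace (YInd L) →₀ k) :=
  Finsupp.linearCombination k fun T => Finsupp.single (Trace.push I T) (traceSign I T : k)

theorem traceAct_single (I : YIndex L) (T : Trace (YInd L)) (c : k) :
    traceAct I (Finsupp.single T c) = Finsupp.single (Trace.push I T) (c * traceSign I T) := by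
  rw [traceAct, Finsupp.linearCombination_single, Finsupp.smul_single, smul_eq_mul]

/-- The sign is charged only when the later variable passes the earlier one, so exactly one of the
two orders of the operators carries it. -/
theorem traceAct_comm {I J : YIndex L} (hne : I ≠ J) (h : YInd L I J) :
    traceAct I * traceAct J = ((ySign I J : kˣ) : k) • (traceAct J * traceAct I) := by
  refine Finsupp.lhom_ext fun T c => ?_
  rw [LinearMap.smul_apply, Module.End.mul_apply, Module.End.mul_apply, traceAct_single,
    traceAct_single, traceAct_single, traceAct_single, Finsupp.smul_single, traceSign_push,
    traceSign_push, Trace.push_comm h]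
  congr 1
  have h1 : moveSign I J = ySign I J * moveSign J I := by
    rw [moveSign, moveSign]
    have hne' : Fintype.equivFin (YIndex L) I ≠ Fintype.equivFin (YIndex L) J :=
      fun e => hne ((Fintype.equivFin (YIndex L)).injective e)
    rcases lt_or_gt_of_ne hne' with h' | h'
    · rw [if_neg h'.not_gt, if_pos h', ySign_comm J I, ySign_mul_self]
    · rw [if_pos h', if_neg h'.not_gt, mul_one]
  rw [h1]
  push_cast
  rw [smul_eq_mul]
  ring

variable (hirr : ∀ I : YIndex L, ¬ YInd L I I)

/-- The representation of `R` on traces. -/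
def traceRep : RAlg L →ₐ[k] Module.End k (Trace (YInd L) →₀ k) :=
  RingQuot.liftAlgHom k ⟨FreeAlgebra.lift k traceAct, fun x y h => by
    obtain ⟨I, J, h⟩ := h
    -- The relations concern distinct variables only, by `hirr`; a relation of a variable with
    -- itself could force its square to vanish.
    rw [map_mul, map_smul, map_mul, FreeAlgebra.lift_ι_apply, FreeAlgebra.lift_ι_apply,
      traceAct_comm (fun e => hirr I (by nth_rewrite 2 [e]; exact h)) h]
    congr 1⟩

variable (L) in
/-- The image in `R` of a word. -/
def rWord (w : List (YIndex L)) : RAlg L :=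
  RingQuot.mkAlgHom k (YRel L) (w.map (FreeAlgebra.ι k)).prod

theorem rWord_cons (I : YIndex L) (w : List (YIndex L)) :
    rWord L (I :: w) = RingQuot.mkAlgHom k (YRel L) (FreeAlgebra.ι k I) * rWord L w := by
  rw [rWord, List.map_cons, List.prod_cons, map_mul, rWord]

/-- The value of the representation at the empty trace. -/
def traceEval : RAlg L →ₗ[k] (Trace (YInd L) →₀ k) :=
  (LinearMap.applyₗ (Finsupp.single (Trace.mk (YInd L) []) (1 : k))).comp (traceRep hirr).toLinearMap

theorem traceEval_rWord (w : List (YIndex L)) : ∃ c : kˣ,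
    traceEval hirr (rWord L w) = c • Finsupp.single (Trace.mk (YInd L) w) (1 : k) := by
  induction w with
  | nil =>
    refine ⟨1, ?_⟩
    rw [one_smul, rWord, List.map_nil, List.prod_nil, map_one]
    change traceRep hirr 1 _ = _
    rw [map_one]
    rfl
  | cons I w ih =>
    obtain ⟨c, hc⟩ := ih
    refine ⟨c * traceSign I (Trace.mk _ w), ?_⟩
    have h1 : traceEval hirr (rWord L (I :: w)) = traceAct I (traceEval hirr (rWord L w)) := by
      rw [rWord_cons]
      change traceRep hirr (_ * _) _ = _
      rw [map_mul, Module.End.mul_apply]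
      congr 1
      rw [traceRep, RingQuot.liftAlgHom_mkAlgHom_apply, FreeAlgebra.lift_ι_apply]
    rw [h1, hc, Units.smul_def, map_smul, traceAct_single, Trace.push_mk, Units.smul_def,
      Finsupp.smul_single, Finsupp.smul_single]
    congr 1
    simp

theorem rWord_swap {u v : List (YIndex L)} (h : Swap (YInd L) u v) :
    ∃ c : kˣ, rWord L u = c • rWord L v := by
  induction h with
  | head x y v h =>
    refine ⟨ySign x y, ?_⟩
    rw [rWord_cons, rWord_cons, rWord_cons, rWord_cons, ← mul_assoc, ← mul_assoc, ← map_mul,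
      ← map_mul, RingQuot.mkAlgHom_rel k (YRel.comm x y h), map_smul, Units.smul_def,
      smul_mul_assoc, ySign]
    push_cast
    rfl
  | cons x h ih =>
    obtain ⟨c, hc⟩ := ih
    exact ⟨c, by rw [rWord_cons, rWord_cons, hc, mul_smul_comm]⟩

/-- The line spanned by the words of a trace. -/
def traceLine : Trace (YInd L) → Submodule k (RAlg L) :=
  Quot.lift (fun w => Submodule.span k {rWord L w}) fun u v h => by
    obtain ⟨c, hc⟩ := rWord_swap h
    rw [hc]
    exact Submodule.span_singleton_group_smul_eq k c _

/-- The element of `R` given by a word of the trace. -/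
def rTrace (T : Trace (YInd L)) : RAlg L := rWord L T.exists_rep.choose

theorem rWord_mem (w : List (YIndex L)) :
    rWord L w ∈ Submodule.span k {rTrace (Trace.mk (YInd L) w)} := by
  have h1 : Submodule.span k {rTrace (Trace.mk (YInd L) w)} = traceLine (Trace.mk (YInd L) w) := by
    conv_rhs => rw [← (Trace.mk (YInd L) w).exists_rep.choose_spec]
    rfl
  rw [h1]
  exact Submodule.subset_span rfl

-- Letting `R` act on the empty trace sends a word to a unit multiple of the basis vector of its
-- trace, so different traces cannot be related.
include hirr in
theorem linearIndependent_rTrace : LinearIndependent k (rTrace (L := L)) := by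
  refine LinearIndependent.of_comp (traceEval hirr) ?_
  choose c hc using fun T : Trace (YInd L) => traceEval_rWord hirr T.exists_rep.choose
  have h1 : traceEval hirr ∘ rTrace (L := L) = c • fun T => Finsupp.single T (1 : k) := by
    funext T
    rw [Function.comp_apply, rTrace, hc, T.exists_rep.choose_spec]
    rfl
  rw [h1]
  exact (Finsupp.basisSingleOne.linearIndependent.units_smul c)

variable (hdeg : ∀ I : YIndex L, I.1.card + 1 = (lcmOf I.1).degree)

include hdeg in
theorem card_word (w : List (YIndex L)) : (w.map fun I => I.1.card + 1).sum =
    (w.map fun I => lcmOf I.1).sum.degree := by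
  induction w with
  | nil => simp
  | cons I w ih => simp only [List.map_cons, List.sum_cons, map_add, ← ih, ← hdeg]

-- By `hdeg`, which is the tree count, the homological degree of a word is the total degree of its
-- multidegree. So `R` lives on the diagonal, and its components are spanned by the traces of that
-- multidegree.
include hirr hdeg in
theorem finrank_rComponent (i : ℕ) (α : σ →₀ ℕ) :
    Module.finrank k (RComponent L i α) =
      if α.degree = i then Nat.card {T : Trace (YInd L) // Trace.degree (yDeg L) T = α} else 0 := by
  have hd : ∀ I : YIndex L, yDeg L I ≠ 0 := fun I e => by
    have := hdeg I
    change lcmOf I.1 = 0 at e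
    rw [e, map_zero] at this
    omega
  have hfin : Fintype {T : Trace (YInd L) // Trace.degree (yDeg L) T = α} :=
    @Fintype.ofFinite _ (finite_traces hd α)
  split_ifs with h
  · have h1 : RComponent L i α = Submodule.span k (Set.range
        fun T : {T : Trace (YInd L) // Trace.degree (yDeg L) T = α} => rTrace T.1) := by
      apply le_antisymm
      · rw [RComponent, Submodule.span_le]
        rintro _ ⟨w, -, hw, rfl⟩
        have h2 : rTrace (Trace.mk (YInd L) w) ∈ Set.range
          fun T : {T : Trace (YInd L) // Trace.degree (yDeg L) T = α} => rTrace T.1 :=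
            ⟨⟨Trace.mk _ w, hw⟩, rfl⟩
        exact Submodule.span_mono (Set.singleton_subset_iff.2 h2) (rWord_mem w)
      · rw [Submodule.span_le]
        rintro _ ⟨⟨T, hT⟩, rfl⟩
        have h2 : (T.exists_rep.choose.map fun I => lcmOf I.1).sum = α := by
          rw [← hT]
          conv_rhs => rw [← T.exists_rep.choose_spec]
          rfl
        exact Submodule.subset_span ⟨T.exists_rep.choose, by rw [card_word hdeg, h2, h], h2, rfl⟩
    have h3 : LinearIndependent k
      fun T : {T : Trace (YInd L) // Trace.degree (yDeg L) T = α} => rTrace T.1 :=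
      (linearIndependent_rTrace hirr).comp _ Subtype.val_injective
    rw [h1, finrank_span_eq_card h3, Nat.card_eq_fintype_card]
  · have h1 : RComponent L i α = ⊥ := by
      rw [RComponent, Submodule.span_eq_bot]
      rintro _ ⟨w, hw1, hw2, rfl⟩
      rw [card_word hdeg, hw2] at hw1
      exact (h hw1).elim
    rw [h1, finrank_bot]

variable (L) in
/-- The Hilbert series of `R`, with a sign for the parity of the degree. -/
def rSeries : MvPowerSeries σ ℤ := fun α =>
  (-1) ^ α.degree * (Nat.card {T : Trace (YInd L) // Trace.degree (yDeg L) T = α} : ℤ)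

theorem coeff_rSeries (α : σ →₀ ℕ) : MvPowerSeries.coeff α (rSeries L) =
    (-1) ^ α.degree * (Nat.card {T : Trace (YInd L) // Trace.degree (yDeg L) T = α} : ℤ) := rfl

include hirr hdeg in
theorem hilbR_one_t_eq : hilbR_one_t L = homogenize (-1) (rSeries L) := by
  rw [hilbR_one_t, homogenize_eq]
  refine congrArg PowerSeries.mk (funext fun i => MvPowerSeries.ext fun α => ?_)
  rw [coeff_homogPart, coeff_rSeries]
  change (Module.finrank k (RComponent L i α) : ℤ) = _
  rw [finrank_rComponent hirr hdeg]
  split_ifs with h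
  · rw [h, ← mul_assoc, ← mul_pow]
    simp
  · rfl

include hirr hdeg in
theorem hilbR_t_neg_one_eq : hilbR_t_neg_one L = homogenize 1 (rSeries L) := by
  rw [hilbR_t_neg_one, homogenize_eq]
  refine congrArg PowerSeries.mk (funext fun d => MvPowerSeries.ext fun α => ?_)
  rw [coeff_homogPart, coeff_rSeries]
  change (if α.degree = d then
    ∑ᶠ i : ℕ, (-1) ^ i * (Module.finrank k (RComponent L i α) : ℤ) else 0) = _
  split_ifs with h
  · rw [finsum_eq_single _ α.degree, finrank_rComponent hirr hdeg, if_pos rfl, one_pow, one_mul]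
    intro i hi
    rw [finrank_rComponent hirr hdeg, if_neg hi.symm, Nat.cast_zero, mul_zero]
  · rfl

end RAlgebra

end MonomialRing
end

set_option linter.unusedSectionVars false
noncomputable section
open MvPolynomial
open scoped Classical TensorProduct

namespace MonomialRing

universe u v

/-! ### Unmatched cells as cliques, and the inversion of the Hilbert series of `R` -/

section Cliques

variable {k : Type u} [Field k] {σ : Type v} [Fintype σ] {a : Ideal (MvPolynomial σ k)}
  {L : List (Matching a)}

/-- The union of the cells of a clique. -/
def cliqueCell (c : Finset (YIndex L)) : Cell a := c.biUnion Subtype.val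

theorem verts_cliqueCell (c : Finset (YIndex L)) :
    verts (cliqueCell c) = c.biUnion fun D => verts D.1 := by
  ext p
  simp only [mem_verts, cliqueCell, Finset.mem_biUnion]
  constructor
  · rintro ⟨m, ⟨D, hD, hm⟩, hp⟩
    exact ⟨D, hD, m, hm, hp⟩
  · rintro ⟨D, hD, m, hm, hp⟩
    exact ⟨m, ⟨D, hD, hm⟩, hp⟩

theorem cliqueCell_insert (D : YIndex L) (c : Finset (YIndex L)) :
    cliqueCell (insert D c) = D.1 ∪ cliqueCell c := Finset.biUnion_insert

theorem disjoint_cliqueCell {D : YIndex L} {c : Finset (YIndex L)} (hD : D ∉ c)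
    (hc : IsClique (YInd L) (insert D c)) : Disjoint (verts D.1) (verts (cliqueCell c)) := by
  rw [verts_cliqueCell, Finset.disjoint_biUnion_right]
  intro E hE
  have := hc D (Finset.mem_insert_self _ _) E (Finset.mem_insert_of_mem hE) (fun e => hD (e ▸ hE))
  rw [YInd, isCoprimeMon_iff] at this
  exact this

theorem IsClique.of_insert {D : YIndex L} {c : Finset (YIndex L)}
    (hc : IsClique (YInd L) (insert D c)) : IsClique (YInd L) c := fun y hy z hz hne =>
  hc y (Finset.mem_insert_of_mem hy) z (Finset.mem_insert_of_mem hz) hne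

variable (ha : IsEdgeIdeal a)
include ha

theorem YInd.irrefl (I : YIndex L) : ¬ YInd L I I := by
  intro h
  rw [YInd, isCoprimeMon_iff, disjoint_self, Finset.bot_eq_empty] at h
  exact (nonempty_of_cl I.2.2).ne_empty ((verts_eq_empty ha).1 h)

theorem isComp_cliqueCell_iff {c : Finset (YIndex L)} (hc : IsClique (YInd L) c) {F : Cell a} :
    IsComp (cliqueCell c) F ↔ ∃ D ∈ c, D.1 = F := by
  induction c using Finset.induction_on with
  | empty =>
    constructor
    · intro h
      obtain ⟨x, hx⟩ := nonempty_of_cl h.conn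
      have := h.subset hx
      simp [cliqueCell] at this
    · rintro ⟨D, hD, -⟩
      simp at hD
  | insert D c hD ih =>
    rw [cliqueCell_insert, isComp_union_iff ha (disjoint_cliqueCell hD hc), ih hc.of_insert,
      isComp_of_conn ha D.2.2, Finset.exists_mem_insert, eq_comm]

theorem lcmOf_cliqueCell {c : Finset (YIndex L)} (hc : IsClique (YInd L) c) :
    lcmOf (cliqueCell c) = ∑ D ∈ c, yDeg L D := by
  induction c using Finset.induction_on with
  | empty => rfl
  | insert D c hD ih =>
    rw [cliqueCell_insert, lcmOf_union ha (disjoint_cliqueCell hD hc), ih hc.of_insert,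
      Finset.sum_insert hD, yDeg]

theorem card_cliqueCell {c : Finset (YIndex L)} (hc : IsClique (YInd L) c) :
    (cliqueCell c).card = ∑ D ∈ c, D.1.card := by
  induction c using Finset.induction_on with
  | empty => rfl
  | insert D c hD ih =>
    rw [cliqueCell_insert, Finset.card_union_of_disjoint
      (disjoint_of_verts ha (disjoint_cliqueCell hD hc)), ih hc.of_insert, Finset.sum_insert hD]

theorem cliqueCell_comps {I : Cell a} (hL : IsStandardSequence 1 (taylor a) L)
    (hI : Unmatched L I) :
    cliqueCell (Finset.univ.filter fun D : YIndex L => IsComp I D.1) = I := by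
  ext m
  simp only [cliqueCell, Finset.mem_biUnion, Finset.mem_filter, Finset.mem_univ, true_and]
  constructor
  · rintro ⟨D, hD, hm⟩
    exact hD.subset hm
  · intro hm
    obtain ⟨D, hD, hmD⟩ := exists_comp ha hm
    exact ⟨⟨D, (unmatched_iff_comp ha hL).1 hI D hD, hD.conn⟩, hD, hmD⟩

theorem isClique_comps (I : Cell a) :
    IsClique (YInd L) (Finset.univ.filter fun D : YIndex L => IsComp I D.1) := by
  intro D hD E hE hne
  have hD := (Finset.mem_filter.1 hD).2
  have hE := (Finset.mem_filter.1 hE).2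
  rw [YInd, isCoprimeMon_iff]
  rw [← hD.union_sdiff, isComp_union_iff ha hD.disj, isComp_of_conn ha hD.conn] at hE
  rcases hE with h | h
  · exact (hne (Subtype.ext h.symm)).elim
  · exact Finset.disjoint_of_subset_right (verts_mono h.subset) hD.disj

/-- An unmatched cell is the union of its components, which are unmatched, connected and pairwise
coprime; conversely every union of such cells is unmatched, since a first sequence acts on
components. -/
theorem sum_unmatched_eq_sum_cliques (hL : IsStandardSequence 1 (taylor a) L) :
    ∑ I : Cell a with Unmatched L I, kTerm I =
      ∑ c : Finset (YIndex L) with IsClique (YInd L) c, kTerm (cliqueCell c) := by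
  symm
  refine Finset.sum_bij' (fun c _ => cliqueCell c)
    (fun I _ => Finset.univ.filter fun D : YIndex L => IsComp I D.1) ?_ ?_ ?_ ?_ ?_
  · intro c hc
    have hc := (Finset.mem_filter.1 hc).2
    refine Finset.mem_filter.2 ⟨Finset.mem_univ _, (unmatched_iff_comp ha hL).2 fun D hD => ?_⟩
    obtain ⟨E, -, rfl⟩ := (isComp_cliqueCell_iff ha hc).1 hD
    exact E.2.1
  · exact fun I _ => Finset.mem_filter.2 ⟨Finset.mem_univ _, isClique_comps ha I⟩
  · intro c hc
    have hc := (Finset.mem_filter.1 hc).2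
    ext D
    simp only [Finset.mem_filter, Finset.mem_univ, true_and, isComp_cliqueCell_iff ha hc]
    exact ⟨fun ⟨E, hE, h⟩ => Subtype.ext h ▸ hE, fun h => ⟨D, h, rfl⟩⟩
  · exact fun I hI => cliqueCell_comps ha hL (Finset.mem_filter.1 hI).2
  · exact fun _ _ => rfl

theorem IsStandardSequence.sum_unmatched (hL : IsStandardSequence 1 (taylor a) L) :
    ∑ I : Cell a with Unmatched L I, kTerm I = kSeries a := by
  rw [← sum_morseList_basis hL sum_taylor_basis]
  refine Finset.sum_congr ?_ fun _ _ => rfl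
  ext I
  rw [mem_basis_iff_unmatched]
  simp

/-- After `x ↦ -x` the two factors are the trace series and the clique series. -/
theorem IsFirstSequence.rSeries_mul_kSeries (hL : IsFirstSequence L) :
    rSeries L * kSeries a = 1 := by
  have hdeg : ∀ I : YIndex L, I.1.card + 1 = (yDeg L I).degree := fun I => by
    rw [yDeg, degree_lcmOf ha]
    exact hL.card_of_conn ha I.2.1 I.2.2
  have hd : ∀ I : YIndex L, yDeg L I ≠ 0 := fun I e => by
    have := hdeg I
    rw [e, map_zero] at this
    omega
  have h1 : rSeries L = MvPowerSeries.rescale (fun _ => (-1 : ℤ)) (traceSeries (YInd L) (yDeg L)) := by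
    ext α
    rw [MvPowerSeries.coeff_rescale, coeff_rSeries]
    congr 1
    rw [Finsupp.prod, Finset.prod_pow_eq_pow_sum, Finsupp.degree_apply]
  have h2 : kSeries a =
      MvPowerSeries.rescale (fun _ => (-1 : ℤ)) (cliqueSeries (YInd L) (yDeg L)) := by
    rw [← hL.sequence.sum_unmatched ha, sum_unmatched_eq_sum_cliques ha hL.sequence, cliqueSeries,
      map_sum]
    refine Finset.sum_congr rfl fun c hc => ?_
    have hc := (Finset.mem_filter.1 hc).2
    ext α
    rw [kTerm, MvPowerSeries.coeff_rescale, MvPowerSeries.coeff_monomial,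
      MvPowerSeries.coeff_monomial, lcmOf_cliqueCell ha hc, card_cliqueCell ha hc]
    split_ifs with h
    · have h3 : (α.prod fun _ n => (-1 : ℤ) ^ n) = (-1) ^ α.degree := by
        rw [Finsupp.prod, Finset.prod_pow_eq_pow_sum, Finsupp.degree_apply]
      -- Each tree has one more variable than edges, so the sign by degree and the sign by number of
      -- generators differ by `(-1)` to the size of the clique.
      have h4 : α.degree = ∑ D ∈ c, D.1.card + c.card := by
        rw [h, map_sum, Finset.card_eq_sum_ones, ← Finset.sum_add_distrib]
        exact Finset.sum_congr rfl fun D _ => (hdeg D).symm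
      rw [h3, h4, pow_add, mul_assoc, ← mul_pow]
      simp
    · rw [mul_zero]
  rw [h1, h2, ← map_mul, traceSeries_mul_cliqueSeries YInd.symm (YInd.irrefl ha) hd, map_one]

end Cliques

end MonomialRing
end

set_option linter.unusedSectionVars false
noncomputable section
open MvPolynomial
open scoped Classical TensorProduct

namespace MonomialRing

universe u v

/-! ### Sting-chains as forests assembled from blocks -/

section Forest

variable {k : Type u} [Field k] {σ : Type v} [Fintype σ] {a : Ideal (MvPolynomial σ k)}
  (ha : IsEdgeIdeal a)

include ha in
/-- Attaching an edge at a new vertex to a forest gives a forest. -/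
theorem card_add_cl_insert {I : Cell a} {m : minGens a} {x y : σ} (hxy : x ≠ y)
    (hm : (m : σ →₀ ℕ) = edgeMon x y) (hy : y ∉ verts I) (hI : I.card + cl I = (verts I).card) :
    (insert m I).card + cl (insert m I) = (verts (insert m I)).card := by
  have hmI : m ∉ I := fun h => hy (mem_verts.2 ⟨m, h, by rw [hm, edgeMon_support]; simp⟩)
  have hv : verts {m} = {x, y} := by
    ext p
    simp only [mem_verts, Finset.mem_singleton, exists_eq_left, hm, edgeMon_support,
      Finset.mem_insert]
  have hadj (J : Cell a) : (cellGraph (insert m J)).Adj x y :=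
    ⟨hxy, m, Finset.mem_insert_self _ _, hm⟩
  have hvi (J : Cell a) : verts (insert m J) = {x, y} ∪ verts J := by
    rw [Finset.insert_eq, verts_union, hv]
  -- The new edge either hangs on the component of `x` or is a component of its own.
  have hcl : cl (insert m I) = cl I + if x ∈ verts I then 0 else 1 := by
    split_ifs with hx
    · obtain ⟨n, hn, hxn⟩ := mem_verts.1 hx
      obtain ⟨D, hD, hnD⟩ := exists_comp ha hn
      have hxD : x ∈ verts D := mem_verts.2 ⟨n, hnD, hxn⟩
      have h1 : cl (insert m D) = 1 := by
        rw [cl_eq_one_iff ha]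
        have hr : ∀ p ∈ verts (insert m D), (cellGraph (insert m D)).Reachable x p := by
          intro p hp
          rw [hvi, Finset.mem_union, Finset.mem_insert, Finset.mem_singleton] at hp
          rcases hp with (rfl | rfl) | hp
          · rfl
          · exact (hadj D).reachable
          · exact (((cl_eq_one_iff ha).1 hD.conn).2 x hxD p hp).mono
              (cellGraph_mono (Finset.subset_insert _ _))
        exact ⟨Finset.insert_nonempty _ _, fun p hp q hq => (hr p hp).symm.trans (hr q hq)⟩
      have h2 : Disjoint (verts (insert m D)) (verts (I \ D)) := by
        rw [hvi, Finset.disjoint_union_left, Finset.disjoint_insert_left,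
          Finset.disjoint_singleton_left]
        exact ⟨⟨Finset.disjoint_left.1 hD.disj hxD, fun h => hy (verts_mono Finset.sdiff_subset h)⟩,
          hD.disj⟩
      have h3 := cl_union ha h2
      rw [Finset.insert_union, hD.union_sdiff, h1] at h3
      have h4 := cl_union ha hD.disj
      rw [hD.union_sdiff, hD.conn] at h4
      omega
    · have h1 : Disjoint (verts {m}) (verts I) := by
        rw [hv, Finset.disjoint_insert_left, Finset.disjoint_singleton_left]
        exact ⟨hx, hy⟩
      have h2 : cl ({m} : Cell a) = 1 := by
        rw [cl_eq_one_iff ha]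
        refine ⟨Finset.singleton_nonempty _, ?_⟩
        rw [hv]
        have h3 : (cellGraph {m}).Reachable x y := (hadj ∅).reachable
        intro p hp q hq
        simp only [Finset.mem_insert, Finset.mem_singleton] at hp hq
        rcases hp with rfl | rfl <;> rcases hq with rfl | rfl
        exacts [.refl _, h3, h3.symm, .refl _]
      rw [Finset.insert_eq, cl_union ha h1, h2, add_comm]
  have hcard : (verts (insert m I)).card = (verts I).card + (1 + if x ∈ verts I then 0 else 1) := by
    rw [hvi, Finset.insert_union, Finset.singleton_union]
    split_ifs with hx
    · rw [Finset.insert_eq_of_mem (Finset.mem_insert_of_mem hx), Finset.card_insert_of_notMem hy]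
    · rw [Finset.card_insert_of_notMem (by simp [hxy, hx]), Finset.card_insert_of_notMem hy]
  rw [Finset.card_insert_of_notMem hmI, hcl, hcard, ← hI]
  omega

end Forest

section StingChains

variable {k : Type u} [Field k] {P : Type v} [Fintype P] [PartialOrder P]

section Edges

variable {a : Ideal (MvPolynomial P k)} {I J : Cell a} {p q : P}

theorem EdgeMem.symm (h : EdgeMem I p q) : EdgeMem I q p := by
  obtain ⟨m, h1, h2⟩ := h
  exact ⟨m, h1, h2.trans (edgeMon_comm _ _)⟩

theorem edgeMem_union : EdgeMem (I ∪ J) p q ↔ EdgeMem I p q ∨ EdgeMem J p q := by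
  simp only [EdgeMem, Finset.mem_union, or_and_right, exists_or]

theorem EdgeMem.mono (h : EdgeMem I p q) (hIJ : I ⊆ J) : EdgeMem J p q := by
  obtain ⟨m, h1, h2⟩ := h
  exact ⟨m, hIJ h1, h2⟩

theorem EdgeMem.left_mem (h : EdgeMem I p q) : p ∈ verts I := by
  obtain ⟨m, h1, h2⟩ := h
  exact mem_verts.2 ⟨m, h1, by rw [h2, edgeMon_support]; simp⟩

theorem EdgeMem.right_mem (h : EdgeMem I p q) : q ∈ verts I := h.symm.left_mem

end Edges

variable {I J : Cell (posetIdeal k P)} {p q : P}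

theorem EdgeMem.incomp (h : EdgeMem I p q) : Incomp p q := by
  obtain ⟨m, -, h⟩ := h
  obtain ⟨i, j, hij, h'⟩ := mem_minGens_posetIdeal.1 m.2
  have := edgeMon_inj hij.ne (h'.symm.trans h)
  rcases Sym2.eq_iff.1 this with ⟨rfl, rfl⟩ | ⟨rfl, rfl⟩
  exacts [hij, hij.symm]

theorem exists_edgeMem_of_mem_verts (h : p ∈ verts I) : ∃ q, EdgeMem I p q := by
  obtain ⟨m, hm, hp⟩ := mem_verts.1 h
  obtain ⟨i, j, hij, h'⟩ := mem_minGens_posetIdeal.1 m.2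
  rw [h', edgeMon_support, Finset.mem_insert, Finset.mem_singleton] at hp
  rcases hp with rfl | rfl
  exacts [⟨j, m, hm, h'⟩, ⟨i, m, hm, h'.trans (edgeMon_comm _ _)⟩]

variable {l : P → ℕ} (hl : Function.Injective l)

include hl in
theorem exists_ordered_edge (m : minGens (posetIdeal k P)) :
    ∃ p q, l p < l q ∧ (m : P →₀ ℕ) = edgeMon p q := by
  obtain ⟨i, j, hij, h⟩ := mem_minGens_posetIdeal.1 m.2
  rcases lt_or_gt_of_ne (hl.ne hij.ne) with h' | h'
  exacts [⟨i, j, h', h⟩, ⟨j, i, h', h.trans (edgeMon_comm _ _)⟩]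

include hl in
theorem subset_of_edgeMem (h : ∀ p q, l p < l q → EdgeMem I p q → EdgeMem J p q) : I ⊆ J := by
  intro m hm
  obtain ⟨p, q, hpq, h'⟩ := exists_ordered_edge hl m
  obtain ⟨n, hn, h''⟩ := h p q hpq ⟨m, hm, h'⟩
  rwa [Subtype.ext (h'.trans h''.symm)]

include hl in
theorem exists_ordered_of_mem_verts (h : p ∈ verts I) :
    ∃ x y, l x < l y ∧ EdgeMem I x y ∧ (p = x ∨ p = y) := by
  obtain ⟨q, hq⟩ := exists_edgeMem_of_mem_verts h
  rcases lt_or_gt_of_ne (hl.ne hq.incomp.ne) with h' | h'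
  exacts [⟨p, q, h', hq, Or.inl rfl⟩, ⟨q, p, h', hq.symm, Or.inr rfl⟩]

/-- The edges `{p, q}` with `l p < l q` and `φ p q`. -/
def edgesWith (l : P → ℕ) (φ : P → P → Prop) (I : Cell (posetIdeal k P)) : Cell (posetIdeal k P) :=
  I.filter fun m => ∃ p q, l p < l q ∧ (m : P →₀ ℕ) = edgeMon p q ∧ φ p q

theorem edgesWith_subset {φ : P → P → Prop} : edgesWith l φ I ⊆ I := Finset.filter_subset _ _

theorem edgeMem_edgesWith {φ : P → P → Prop} (hpq : l p < l q) :
    EdgeMem (edgesWith l φ I) p q ↔ EdgeMem I p q ∧ φ p q := by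
  constructor
  · rintro ⟨m, hm, h⟩
    obtain ⟨h1, p', q', h2, h3, h4⟩ := Finset.mem_filter.1 hm
    have hne : p ≠ q := fun e => by simp [e] at hpq
    rcases Sym2.eq_iff.1 (edgeMon_inj hne (h.symm.trans h3)) with ⟨rfl, rfl⟩ | ⟨rfl, rfl⟩
    · exact ⟨⟨m, h1, h⟩, h4⟩
    · omega
  · rintro ⟨⟨m, hm, h⟩, h'⟩
    exact ⟨m, Finset.mem_filter.2 ⟨hm, p, q, hpq, h, h'⟩, h⟩

variable (l) in
/-- A sting-chain whose spine is the single edge `{u, w}`. -/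
structure IsBlock (u w : P) (I : Cell (posetIdeal k P)) : Prop where
  lt : l u < l w
  spine : EdgeMem I u w
  edge : ∀ p q, l p < l q → EdgeMem I p q →
    (p = u ∧ q = w) ∨ (p = u ∧ l q < l w) ∨ (l u < l p ∧ q = w ∧ u < p)

variable (l) in
/-- The sets obtained from `∅` by successively adding sting-chains with one spine edge from
above. -/
inductive IsStingForest : Cell (posetIdeal k P) → Prop
  | empty : IsStingForest ∅
  | union {u w : P} {I J : Cell (posetIdeal k P)} : IsBlock l u w I → IsStingForest J →
      (∀ p ∈ verts J, l w ≤ l p) → IsStingForest (I ∪ J)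

variable {u w v : P}

include hl in
theorem IsBlock.le_of_mem (h : IsBlock l u w I) (hp : p ∈ verts I) : l u ≤ l p ∧ l p ≤ l w := by
  have := h.lt
  obtain ⟨x, y, hxy, he, hp⟩ := exists_ordered_of_mem_verts hl hp
  rcases h.edge x y hxy he with ⟨rfl, rfl⟩ | ⟨rfl, h2⟩ | ⟨h1, rfl, -⟩ <;>
    rcases hp with rfl | rfl <;> constructor <;> omega

-- An interior vertex `v` of a block has only one edge: an edge to `u` requires `v` to be
-- incomparable with `u`, an edge to `w` requires `u < v`.
include hl in
theorem IsBlock.eq_of_edgeMem (h : IsBlock l u w I) (hu : v ≠ u) (hw : v ≠ w) (h1 : EdgeMem I v p)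
    (h2 : EdgeMem I v q) : p = q := by
  have key {p : P} (hp : EdgeMem I v p) : (p = u ∧ ¬ u < v) ∨ (p = w ∧ u < v) := by
    rcases lt_or_gt_of_ne (hl.ne hp.incomp.ne) with h' | h'
    · rcases h.edge _ _ h' hp with ⟨h3, -⟩ | ⟨h3, -⟩ | ⟨-, h3, h4⟩
      exacts [(hu h3).elim, (hu h3).elim, Or.inr ⟨h3, h4⟩]
    · rcases h.edge _ _ h' hp.symm with ⟨-, h3⟩ | ⟨h3, -⟩ | ⟨-, h3, -⟩
      · exact (hw h3).elim
      · subst h3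
        exact Or.inl ⟨rfl, fun h4 => hp.incomp.2 h4.le⟩
      · exact (hw h3).elim
  rcases key h1 with ⟨h3, h4⟩ | ⟨h3, h4⟩ <;> rcases key h2 with ⟨h5, h6⟩ | ⟨h5, h6⟩
  exacts [h3.trans h5.symm, (h4 h6).elim, (h6 h4).elim, h3.trans h5.symm]

include hl in
/-- Each edge of a block besides the spine has an end in the interior. -/
theorem IsBlock.exists_interior (h : IsBlock l u w I) {m : minGens (posetIdeal k P)} (hm : m ∈ I)
    (hne : (m : P →₀ ℕ) ≠ edgeMon u w) :
    ∃ x v, x ≠ v ∧ (m : P →₀ ℕ) = edgeMon x v ∧ l u < l v ∧ l v < l w := by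
  obtain ⟨x, y, hxy, he⟩ := exists_ordered_edge hl m
  have hne' : x ≠ y := fun e => by simp [e] at hxy
  rcases h.edge x y hxy ⟨m, hm, he⟩ with ⟨rfl, rfl⟩ | ⟨rfl, h2⟩ | ⟨h1, rfl, -⟩
  exacts [(hne he).elim, ⟨x, y, hne', he, hxy, h2⟩,
    ⟨y, x, hne'.symm, he.trans (edgeMon_comm _ _), h1, hxy⟩]

-- The block is attached to `J` edge by edge: first the spine, whose lower end is new since all of
-- `J` lies at or above `w`, then the stings, each with an interior vertex not used before.
include hl in
theorem IsBlock.card_add_cl (h : IsBlock l u w I) (hJ : J.card + cl J = (verts J).card)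
    (hw : ∀ p ∈ verts J, l w ≤ l p) : (I ∪ J).card + cl (I ∪ J) = (verts (I ∪ J)).card := by
  have ha := isEdgeIdeal_posetIdeal (k := k) (P := P)
  obtain ⟨m₀, hm₀, hm₀'⟩ := h.spine
  have key : ∀ S ⊆ I.erase m₀, (S ∪ insert m₀ J).card + cl (S ∪ insert m₀ J) =
      (verts (S ∪ insert m₀ J)).card := by
    intro S
    induction S using Finset.induction_on with
    | empty =>
      intro _
      rw [Finset.empty_union]
      refine card_add_cl_insert ha (x := w) (y := u) h.spine.incomp.ne.symm
        (hm₀'.trans (edgeMon_comm _ _)) (fun hu => ?_) hJ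
      exact absurd h.lt (not_lt.2 (hw u hu))
    | insert m S hmS ih =>
      intro hS
      rw [Finset.insert_union]
      obtain ⟨hmI, hSI⟩ := Finset.insert_subset_iff.1 hS
      obtain ⟨hmne, hmI⟩ := Finset.mem_erase.1 hmI
      obtain ⟨x, v, hxv, hm, h1, h2⟩ := h.exists_interior hl hmI
        fun e => hmne (Subtype.ext (e.trans hm₀'.symm))
      refine card_add_cl_insert ha hxv hm (fun hv => ?_) (ih hSI)
      have huv : v ≠ u := fun e => by simp [e] at h1
      have hwv : v ≠ w := fun e => by simp [e] at h2
      rw [Finset.insert_eq, verts_union, verts_union, Finset.mem_union, Finset.mem_union] at hv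
      rcases hv with hv | hv | hv
      · obtain ⟨y, hy⟩ := exists_edgeMem_of_mem_verts hv
        have hyx := h.eq_of_edgeMem hl huv hwv (hy.mono (hSI.trans (Finset.erase_subset _ _)))
          (EdgeMem.symm ⟨m, hmI, hm⟩)
        subst hyx
        obtain ⟨n, hn, hn'⟩ := hy.symm
        exact hmS (by rwa [Subtype.ext (hm.trans hn'.symm)])
      · obtain ⟨n, hn, hn'⟩ := mem_verts.1 hv
        rw [Finset.mem_singleton.1 hn, hm₀', edgeMon_support, Finset.mem_insert,
          Finset.mem_singleton] at hn'
        exact hn'.elim huv hwv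
      · exact absurd h2 (not_lt.2 (hw v hv))
  have := key _ subset_rfl
  rwa [Finset.union_insert, ← Finset.insert_union, Finset.insert_erase hm₀] at this

include hl in
theorem IsStingForest.card_add_cl (h : IsStingForest l I) : I.card + cl I = (verts I).card := by
  induction h with
  | empty => simp
  | union hI _ hw ih => exact hI.card_add_cl hl ih hw

end StingChains

end MonomialRing

end

set_option linter.unusedSectionVars false
noncomputable section
open MvPolynomial
open scoped Classical TensorProduct

namespace MonomialRing

universe u v

/-! ### The signed sum over sting forests -/

section StingSums

variable {k : Type u} [Field k] {P : Type v} [Fintype P] [PartialOrder P]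
variable {I J : Cell (posetIdeal k P)} {u w v p q p' q' : P} {l : P → ℕ}

theorem edgeMon_ordered_inj (h : l p < l q) (h' : l p' < l q') (he : edgeMon p q = edgeMon p' q') :
    p = p' ∧ q = q' := by
  rcases Sym2.eq_iff.1 (edgeMon_inj (fun e => by simp [e] at h) he) with h1 | ⟨rfl, rfl⟩
  exacts [h1, absurd h h'.not_gt]

variable (k l) in
/-- The possible edges, besides the spine `{u, w}`, of a block on the vertices `U`. -/
def stings (U : Finset P) (u w : P) : Cell (posetIdeal k P) :=
  Finset.univ.filter fun m => ∃ v ∈ U, l u < l v ∧ l v < l w ∧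
    ((m : P →₀ ℕ) = edgeMon u v ∨ (u < v ∧ (m : P →₀ ℕ) = edgeMon v w))

theorem mem_stings {U : Finset P} {m : minGens (posetIdeal k P)} : m ∈ stings k l U u w ↔
    ∃ v ∈ U, l u < l v ∧ l v < l w ∧
      ((m : P →₀ ℕ) = edgeMon u v ∨ (u < v ∧ (m : P →₀ ℕ) = edgeMon v w)) := by
  rw [stings, Finset.mem_filter, and_iff_right (Finset.mem_univ _)]

theorem notMem_stings {U : Finset P} {m : minGens (posetIdeal k P)} (h : l u < l w)
    (hm : (m : P →₀ ℕ) = edgeMon u w) : m ∉ stings k l U u w := by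
  intro h'
  obtain ⟨v, -, h1, h2, h3 | ⟨-, h3⟩⟩ := mem_stings.1 h'
  · rw [(edgeMon_ordered_inj h h1 (hm.symm.trans h3)).2] at h2
    exact h2.false
  · rw [(edgeMon_ordered_inj h h2 (hm.symm.trans h3)).1] at h1
    exact h1.false

/-- Every vertex `v` between `u` and `w` in the linear extension offers a sting. If `u < v`, then
`v` and `w` are incomparable, as otherwise `u < w`; if not, then `u` and `v` are incomparable. -/
theorem stings_eq_empty_iff (hm : StrictMono l) {U : Finset P} (h : Incomp u w) :
    stings k l U u w = ∅ ↔ ∀ v ∈ U, ¬ (l u < l v ∧ l v < l w) := by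
  constructor
  · rintro h0 v hv ⟨h1, h2⟩
    suffices ∃ m, m ∈ stings k l U u w by
      obtain ⟨m, hm⟩ := this
      simp [h0] at hm
    by_cases huv : u < v
    · have hvw : Incomp v w :=
        ⟨fun hle => h.1 (huv.le.trans hle), fun hle => absurd h2 (not_lt.2 (hm.monotone hle))⟩
      exact ⟨⟨_, mem_minGens_posetIdeal.2 ⟨v, w, hvw, rfl⟩⟩,
        mem_stings.2 ⟨v, hv, h1, h2, Or.inr ⟨huv, rfl⟩⟩⟩
    · have huv : Incomp u v :=
        ⟨fun hle => huv (hle.lt_of_ne fun e => by simp [e] at h1),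
          fun hle => absurd h1 (not_lt.2 (hm.monotone hle))⟩
      exact ⟨⟨_, mem_minGens_posetIdeal.2 ⟨u, v, huv, rfl⟩⟩,
        mem_stings.2 ⟨v, hv, h1, h2, Or.inl rfl⟩⟩
  · intro h0
    rw [Finset.eq_empty_iff_forall_notMem]
    intro m hm
    obtain ⟨v, hv, h1, h2, -⟩ := mem_stings.1 hm
    exact h0 v hv ⟨h1, h2⟩

theorem isBlock_insert_iff (hl : Function.Injective l) {U : Finset P} (hu : u ∈ U) (hw : w ∈ U)
    (h : l u < l w) {m : minGens (posetIdeal k P)} (hm : (m : P →₀ ℕ) = edgeMon u w) :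
    IsBlock l u w I ∧ verts I ⊆ U ↔ ∃ X ⊆ stings k l U u w, insert m X = I := by
  constructor
  · rintro ⟨hI, hIU⟩
    obtain ⟨n, hn, hn'⟩ := hI.spine
    obtain rfl : n = m := Subtype.ext (hn'.trans hm.symm)
    refine ⟨I.erase n, fun x hx => ?_, Finset.insert_erase hn⟩
    obtain ⟨hxn, hxI⟩ := Finset.mem_erase.1 hx
    obtain ⟨p, q, hpq, he⟩ := exists_ordered_edge hl x
    have hmem : EdgeMem I p q := ⟨x, hxI, he⟩
    rw [mem_stings]
    rcases hI.edge p q hpq hmem with ⟨rfl, rfl⟩ | ⟨rfl, h2⟩ | ⟨h1, rfl, h2⟩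
    · exact (hxn (Subtype.ext (he.trans hm.symm))).elim
    · exact ⟨q, hIU hmem.right_mem, hpq, h2, Or.inl he⟩
    · exact ⟨p, hIU hmem.left_mem, h1, hpq, Or.inr ⟨h2, he⟩⟩
  · rintro ⟨X, hX, rfl⟩
    refine ⟨⟨h, ⟨m, Finset.mem_insert_self _ _, hm⟩, ?_⟩, ?_⟩
    · rintro p q hpq ⟨n, hn, he⟩
      rcases Finset.mem_insert.1 hn with rfl | hn
      · exact Or.inl (edgeMon_ordered_inj hpq h (he.symm.trans hm))
      · obtain ⟨v, -, h1, h2, h3 | ⟨h3, h4⟩⟩ := mem_stings.1 (hX hn)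
        · obtain ⟨rfl, rfl⟩ := edgeMon_ordered_inj hpq h1 (he.symm.trans h3)
          exact Or.inr (Or.inl ⟨rfl, h2⟩)
        · obtain ⟨rfl, rfl⟩ := edgeMon_ordered_inj hpq h2 (he.symm.trans h4)
          exact Or.inr (Or.inr ⟨h1, rfl, h3⟩)
    · intro p hp
      rw [mem_verts] at hp
      obtain ⟨n, hn, hp⟩ := hp
      rcases Finset.mem_insert.1 hn with rfl | hn
      · rw [hm, edgeMon_support, Finset.mem_insert, Finset.mem_singleton] at hp
        rcases hp with rfl | rfl
        exacts [hu, hw]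
      · obtain ⟨v, hv, h1, h2, h3 | ⟨h3, h4⟩⟩ := mem_stings.1 (hX hn)
        · rw [h3, edgeMon_support, Finset.mem_insert, Finset.mem_singleton] at hp
          rcases hp with rfl | rfl
          exacts [hu, hv]
        · rw [h4, edgeMon_support, Finset.mem_insert, Finset.mem_singleton] at hp
          rcases hp with rfl | rfl
          exacts [hv, hw]

/-- The stings in the interior of a block cancel. -/
theorem sum_isBlock (hl : Function.Injective l) (hmono : StrictMono l) {U : Finset P} (hu : u ∈ U)
    (hw : w ∈ U) (h : l u < l w) :
    ∑ I : Cell (posetIdeal k P) with IsBlock l u w I ∧ verts I ⊆ U, (-1 : ℤ) ^ I.card =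
      if Incomp u w ∧ ∀ v ∈ U, ¬ (l u < l v ∧ l v < l w) then -1 else 0 := by
  by_cases hi : Incomp u w
  · set m : minGens (posetIdeal k P) := ⟨_, mem_minGens_posetIdeal.2 ⟨u, w, hi, rfl⟩⟩ with hm
    have hnot : ∀ X ⊆ stings k l U u w, m ∉ X := fun X hX hmX => notMem_stings h rfl (hX hmX)
    have hset : (Finset.univ.filter fun I : Cell (posetIdeal k P) =>
        IsBlock l u w I ∧ verts I ⊆ U) = (stings k l U u w).powerset.image (insert m) := by
      ext I
      rw [Finset.mem_filter, and_iff_right (Finset.mem_univ _), isBlock_insert_iff hl hu hw h (m := m) rfl,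
        Finset.mem_image]
      simp only [Finset.mem_powerset]
    rw [hset, Finset.sum_image]
    · have : ∀ X ∈ (stings k l U u w).powerset, (-1 : ℤ) ^ (insert m X).card = -(-1) ^ X.card := by
        intro X hX
        rw [Finset.card_insert_of_notMem (hnot X (Finset.mem_powerset.1 hX)), pow_succ, mul_neg_one]
      rw [Finset.sum_congr rfl this, Finset.sum_neg_distrib, Finset.sum_powerset_neg_one_pow_card,
        if_congr ((stings_eq_empty_iff hmono hi).trans (and_iff_right hi).symm) rfl rfl]
      split_ifs <;> rfl
    · intro X hX Y hY hXY
      have hX := hnot X (Finset.mem_powerset.1 hX)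
      have hY := hnot Y (Finset.mem_powerset.1 hY)
      rw [← Finset.erase_insert hX, ← Finset.erase_insert hY]
      exact congrArg (Finset.erase · m) hXY
  · rw [if_neg fun h' => hi h'.1]
    refine Finset.sum_eq_zero fun I hI => ?_
    exact (hi (Finset.mem_filter.1 hI).2.1.spine.incomp).elim

variable (k l) in
/-- `Σ_I (-1)^{|I|}` over the sting forests on vertices in `U`. -/
def stingSum (U : Finset P) : ℤ :=
  ∑ I : Cell (posetIdeal k P) with IsStingForest l I ∧ verts I ⊆ U, (-1) ^ I.card

/-- Cutting at the label of `w` recovers the two parts, as every edge of the block has its lower end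
before `w` and no edge of `J` has. -/
theorem IsBlock.edgesWith_union (hl : Function.Injective l) (hI : IsBlock l u w I)
    (hw : ∀ p ∈ verts J, l w ≤ l p) :
    edgesWith l (fun p _ => l p < l w) (I ∪ J) = I ∧
      edgesWith l (fun p _ => ¬ l p < l w) (I ∪ J) = J := by
  have hIlt {p q : P} (hpq : l p < l q) (h : EdgeMem I p q) : l p < l w :=
    hpq.trans_le (hI.le_of_mem hl h.right_mem).2
  have hJle {p q : P} (h : EdgeMem J p q) : ¬ l p < l w := not_lt.2 (hw p h.left_mem)
  constructor <;> apply Finset.Subset.antisymm <;> refine subset_of_edgeMem hl fun p q hpq h => ?_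
  · obtain ⟨h1, h2⟩ := (edgeMem_edgesWith hpq).1 h
    exact (edgeMem_union.1 h1).resolve_right fun h3 => hJle h3 h2
  · exact (edgeMem_edgesWith hpq).2 ⟨edgeMem_union.2 (Or.inl h), hIlt hpq h⟩
  · obtain ⟨h1, h2⟩ := (edgeMem_edgesWith hpq).1 h
    exact (edgeMem_union.1 h1).resolve_left fun h3 => h2 (hIlt hpq h3)
  · exact (edgeMem_edgesWith hpq).2 ⟨edgeMem_union.2 (Or.inr h), hJle h⟩

theorem IsBlock.disjoint (hl : Function.Injective l) (hI : IsBlock l u w I)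
    (hw : ∀ p ∈ verts J, l w ≤ l p) : Disjoint I J := by
  have h := hI.edgesWith_union hl hw
  rw [← h.1, ← h.2, Finset.disjoint_left]
  intro m h1 h2
  obtain ⟨p, q, hpq, he⟩ := exists_ordered_edge hl m
  exact ((edgeMem_edgesWith hpq).1 ⟨m, h2, he⟩).2 ((edgeMem_edgesWith hpq).1 ⟨m, h1, he⟩).2

theorem IsBlock.le_of_union_eq (hl : Function.Injective l) (hI : IsBlock l u w I)
    (hw : ∀ p ∈ verts J, l w ≤ l p) (h : EdgeMem (I ∪ J) u v) : l v ≤ l w := by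
  rcases edgeMem_union.1 h with h | h
  · exact (hI.le_of_mem hl h.right_mem).2
  · exact absurd hI.lt (not_lt.2 (hw u h.left_mem))

theorem IsStingForest.exists_block (hl : Function.Injective l) (h : IsStingForest l I)
    (hu : u ∈ verts I) (hmin : ∀ p ∈ verts I, l u ≤ l p) : ∃ w B J, IsBlock l u w B ∧
      IsStingForest l J ∧ (∀ p ∈ verts J, l w ≤ l p) ∧ B ∪ J = I := by
  cases h with
  | empty => simp at hu
  | @union u' w B J hB hJ hw =>
    have h1 := hmin u' (verts_mono Finset.subset_union_left hB.spine.left_mem)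
    have h2 : l u' ≤ l u := by
      rw [verts_union, Finset.mem_union] at hu
      rcases hu with hu | hu
      · exact (hB.le_of_mem hl hu).1
      · exact hB.lt.le.trans (hw u hu)
    obtain rfl := hl (le_antisymm h1 h2)
    exact ⟨w, B, J, hB, hJ, hw, rfl⟩

/-- A forest either avoids the lowest vertex `u` or begins with a block at `u`. The upper end `w` of
that block is determined as the largest neighbour of `u`, and then so are the block and the rest. -/
theorem stingSum_eq (hl : Function.Injective l) {U : Finset P}
    (hmin : ∀ p ∈ U, l u ≤ l p) :
    stingSum k l U = stingSum k l (U.erase u) + ∑ w ∈ U.erase u,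
      (∑ I : Cell (posetIdeal k P) with IsBlock l u w I ∧ verts I ⊆ U, (-1 : ℤ) ^ I.card) *
        stingSum k l (U.filter fun p => l w ≤ l p) := by
  rw [stingSum, ← Finset.sum_filter_add_sum_filter_not _ fun I => u ∉ verts I]
  congr 1
  · rw [stingSum, Finset.filter_filter]
    refine Finset.sum_congr (Finset.filter_congr fun I _ => ?_) fun _ _ => rfl
    rw [Finset.subset_erase, and_assoc]
  · simp only [stingSum, Finset.sum_mul_sum]
    simp only [← Finset.sum_product']
    rw [Finset.sum_sigma']
    symm
    refine Finset.sum_bij (fun x _ => x.2.1 ∪ x.2.2) ?_ ?_ ?_ ?_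
    · rintro ⟨w, I, J⟩ hx
      simp only [Finset.mem_sigma, Finset.mem_product, Finset.mem_filter, Finset.mem_univ, true_and,
        Finset.subset_iff] at hx
      obtain ⟨-, ⟨hI, hIU⟩, hJ, hJU⟩ := hx
      simp only [Finset.mem_filter, Finset.mem_univ, true_and, not_not, verts_union,
        Finset.mem_union]
      exact ⟨⟨.union hI hJ fun p hp => (hJU hp).2,
        Finset.union_subset hIU fun p hp => (hJU hp).1⟩, Or.inl hI.spine.left_mem⟩
    · rintro ⟨w, I, J⟩ hx ⟨w', I', J'⟩ hx' he
      simp only [Finset.mem_sigma, Finset.mem_product, Finset.mem_filter, Finset.mem_univ, true_and,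
        Finset.subset_iff] at hx hx' he
      obtain ⟨-, ⟨hI, -⟩, -, hJ⟩ := hx
      obtain ⟨-, ⟨hI', -⟩, -, hJ'⟩ := hx'
      have hJ := fun p hp => (@hJ p hp).2
      have hJ' := fun p hp => (@hJ' p hp).2
      have h1 : l w' ≤ l w := hI.le_of_union_eq hl hJ (by
        rw [he]; exact hI'.spine.mono Finset.subset_union_left)
      have h2 : l w ≤ l w' := hI'.le_of_union_eq hl hJ' (by
        rw [← he]; exact hI.spine.mono Finset.subset_union_left)
      obtain rfl := hl (le_antisymm h1 h2)
      have h3 := hI.edgesWith_union hl hJ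
      rw [he] at h3
      have h4 := hI'.edgesWith_union hl hJ'
      rw [← h3.1, ← h3.2, h4.1, h4.2]
    · intro I hI
      simp only [Finset.mem_filter, Finset.mem_univ, true_and, not_not] at hI
      obtain ⟨⟨hI, hIU⟩, huI⟩ := hI
      obtain ⟨w, B, J, hB, hJ, hw, rfl⟩ := hI.exists_block hl huI fun p hp => hmin p (hIU hp)
      rw [verts_union] at hIU
      refine ⟨⟨w, B, J⟩, ?_, rfl⟩
      simp only [Finset.mem_sigma, Finset.mem_product, Finset.mem_filter, Finset.mem_univ, true_and]
      refine ⟨Finset.mem_erase.2 ⟨hB.spine.incomp.ne.symm,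
        hIU (Finset.mem_union_left _ hB.spine.right_mem)⟩, ⟨hB, Finset.union_subset_left hIU⟩, hJ,
        fun p hp => Finset.mem_filter.2 ⟨Finset.union_subset_right hIU hp, hw p hp⟩⟩
    · rintro ⟨w, I, J⟩ hx
      simp only [Finset.mem_sigma, Finset.mem_product, Finset.mem_filter, Finset.mem_univ, true_and,
        Finset.subset_iff] at hx
      obtain ⟨-, ⟨hI, -⟩, -, hJ⟩ := hx
      rw [Finset.card_union_of_disjoint (hI.disjoint hl fun p hp => (hJ hp).2), pow_add]

/-- Only blocks without interior survive, that is, the single edge from `u` to the next vertex `w`,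
with sign `-1`. So the sum for `U` is the sum without `u`, multiplied by `0` if `u` and `w` are
incomparable and by `1` otherwise. -/
theorem stingSum_eq_ite (hl : Function.Injective l) (hmono : StrictMono l) (U : Finset P) :
    stingSum k l U = if IsChain (· ≤ ·) (U : Set P) then 1 else 0 := by
  induction hn : U.card using Nat.strong_induction_on generalizing U with
  | _ n ih =>
  subst hn
  rcases U.eq_empty_or_nonempty with rfl | hne
  · have : (Finset.univ.filter fun I : Cell (posetIdeal k P) =>
        IsStingForest l I ∧ verts I ⊆ ∅) = {∅} := by
      ext I
      rw [Finset.mem_filter, and_iff_right (Finset.mem_univ _), Finset.mem_singleton,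
        Finset.subset_empty, verts_eq_empty isEdgeIdeal_posetIdeal]
      exact ⟨fun h => h.2, fun h => ⟨h ▸ .empty, h⟩⟩
    rw [stingSum, this]
    simp
  obtain ⟨u, hu, hmin⟩ := Finset.exists_min_image U l hne
  have hlt : ∀ p ∈ U.erase u, l u < l p := fun p hp =>
    lt_of_le_of_ne (hmin p (Finset.mem_of_mem_erase hp)) (hl.ne (Finset.ne_of_mem_erase hp).symm)
  rw [stingSum_eq hl hmin, ih _ (Finset.card_erase_lt_of_mem hu) _ rfl]
  rcases (U.erase u).eq_empty_or_nonempty with h0 | hne'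
  · have hU : U = {u} := by rw [← Finset.insert_erase hu, h0]; rfl
    rw [h0, hU]
    simp
  obtain ⟨w, hw, hwmin⟩ := Finset.exists_min_image _ l hne'
  have hwU := Finset.mem_of_mem_erase hw
  rw [Finset.sum_eq_single w]
  · have h1 : (U.filter fun p => l w ≤ l p) = U.erase u := by
      ext p
      rw [Finset.mem_filter, Finset.mem_erase]
      refine ⟨fun h => ⟨fun e => ?_, h.1⟩, fun h => ⟨h.2, hwmin p (Finset.mem_erase.2 h)⟩⟩
      rw [e] at h
      exact absurd (hlt w hw) (not_lt.2 h.2)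
    have h2 : ∀ v ∈ U, ¬ (l u < l v ∧ l v < l w) := by
      rintro v hv ⟨h1, h2⟩
      exact absurd h2 (not_lt.2 (hwmin v (Finset.mem_erase.2 ⟨fun e => by simp [e] at h1, hv⟩)))
    rw [h1, ih _ (Finset.card_erase_lt_of_mem hu) _ rfl, sum_isBlock hl hmono hu hwU (hlt w hw),
      if_congr (and_iff_left h2) rfl rfl]
    -- In a linear extension, `u` lies below the whole chain as soon as it is comparable with the
    -- next vertex.
    have h3 : IsChain (· ≤ ·) (U : Set P) ↔
        IsChain (· ≤ ·) ((U.erase u : Finset P) : Set P) ∧ ¬ Incomp u w := by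
      constructor
      · intro h
        refine ⟨h.mono (Finset.coe_subset.2 (Finset.erase_subset _ _)), fun hi => ?_⟩
        exact (h hu hwU hi.ne).elim hi.1 hi.2
      · rintro ⟨h, hi⟩
        have huw : u ≤ w := by
          by_contra hle
          exact hi ⟨hle, fun h' => absurd (hlt w hw) (not_lt.2 (hmono.monotone h'))⟩
        rw [← Finset.insert_erase hu, Finset.coe_insert]
        refine h.insert fun p hp _ => Or.inl (huw.trans ?_)
        rcases eq_or_ne w p with rfl | hne
        · exact le_rfl
        · refine (h hw hp hne).resolve_right fun h' => ?_
          exact absurd (hmono (h'.lt_of_ne hne.symm)) (not_lt.2 (hwmin p hp))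
    rw [if_congr h3 rfl rfl]
    generalize IsChain (· ≤ ·) ((U.erase u : Finset P) : Set P) = c
    by_cases hc : c <;> by_cases hi : Incomp u w <;> simp [hc, hi]
  -- For any other upper end `x` the vertex `w` is interior, so the blocks from `u` to `x` cancel.
  · intro x hx hxw
    rw [sum_isBlock hl hmono hu (Finset.mem_of_mem_erase hx) (hlt x hx), if_neg, zero_mul]
    rintro ⟨-, h⟩
    exact h w hwU ⟨hlt w hw, lt_of_le_of_ne (hwmin x hx) (hl.ne hxw.symm)⟩
  · exact fun h => (h hw).elim

theorem sum_isStingForest (hl : Function.Injective l) (hmono : StrictMono l) :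
    ∑ I : Cell (posetIdeal k P) with IsStingForest l I, kTerm I = kSeries (posetIdeal k P) := by
  refine sum_kTerm_eq_kSeries k P fun α => ?_
  rw [Finset.filter_filter]
  refine (Finset.sum_congr (Finset.filter_congr fun I _ => and_congr_right fun _ => ?_)
    fun _ _ => rfl).trans (stingSum_eq_ite (k := k) hl hmono α.support)
  have ha := isEdgeIdeal_posetIdeal (k := k) (P := P)
  constructor
  · exact fun h => Finsupp.support_mono h
  · intro h p
    rw [lcmOf_apply ha]
    split_ifs with hp
    · exact Nat.one_le_iff_ne_zero.2 (Finsupp.mem_support_iff.1 (h hp))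
    · exact Nat.zero_le _

end StingSums

end MonomialRing

end

set_option linter.unusedSectionVars false
noncomputable section
open MvPolynomial
open scoped Classical TensorProduct

namespace MonomialRing

universe u v

/-! ### Chains of sting-chains are sting forests -/

section StingEquiv

variable {k : Type u} [Field k] {P : Type v} [Fintype P] [PartialOrder P]
variable {I J K : Cell (posetIdeal k P)} {u w : P} {l : P → ℕ}

variable (l) in
/-- `c` is the spine of the sting-chain `I`. -/
structure HasSpine (I : Cell (posetIdeal k P)) (r : ℕ) (c : Fin (r + 2) → P) : Prop where
  mono : StrictMono (l ∘ c)
  spine : ∀ j : Fin (r + 1), EdgeMem I (c j.castSucc) (c j.succ)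
  first : c 0 ∈ verts I ∧ ∀ p ∈ verts I, l (c 0) ≤ l p
  last : c (Fin.last _) ∈ verts I ∧ ∀ p ∈ verts I, l p ≤ l (c (Fin.last _))
  edge : ∀ p q : P, l p < l q → EdgeMem I p q → ∃ j : Fin (r + 1),
    (p = c j.castSucc ∧ q = c j.succ) ∨
    (p = c j.castSucc ∧ l q < l (c j.succ) ∧ ¬ EdgeMem I q (c j.succ)) ∨
    (l (c j.castSucc) < l p ∧ q = c j.succ ∧ c j.castSucc < p)

theorem isStingChain_iff : IsStingChain l I ↔ ∃ r c, HasSpine l I r c :=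
  exists_congr fun _ => exists_congr fun _ =>
    ⟨fun ⟨h1, h2, h3, h4, h5⟩ => ⟨h1, h2, h3, h4, h5⟩, fun ⟨h1, h2, h3, h4, h5⟩ => ⟨h1, h2, h3, h4, h5⟩⟩

variable (hl : Function.Injective l)

-- Condition (b) for sting-chains forbids the second edge explicitly; within a block this is
-- automatic.
include hl in
theorem IsBlock.not_edgeMem (h : IsBlock l u w I) {q : P} (hq : l u < l q) (hqw : l q < l w)
    (he : EdgeMem I u q) : ¬ EdgeMem I q w := fun h' => by
  have := h.eq_of_edgeMem hl (fun e => by simp [e] at hq) (fun e => by simp [e] at hqw) he.symm h'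
  exact h.spine.incomp.ne this

include hl in
theorem IsBlock.isStingChain (h : IsBlock l u w I) : IsStingChain l I := by
  rw [isStingChain_iff]
  refine ⟨0, ![u, w], ?_, ?_, ?_, ?_, ?_⟩
  · rw [Fin.strictMono_iff_lt_succ]
    intro j
    obtain rfl := Subsingleton.elim j 0
    exact h.lt
  · intro j
    obtain rfl := Fin.fin_one_eq_zero j
    exact h.spine
  · exact ⟨h.spine.left_mem, fun p hp => (h.le_of_mem hl hp).1⟩
  · exact ⟨h.spine.right_mem, fun p hp => (h.le_of_mem hl hp).2⟩
  · intro p q hpq he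
    refine ⟨0, (h.edge p q hpq he).imp id (Or.imp ?_ ?_)⟩
    · rintro ⟨rfl, h2⟩
      exact ⟨rfl, h2, h.not_edgeMem hl hpq h2 he⟩
    · exact fun ⟨h1, h2, h3⟩ => ⟨h1, h2, h3⟩

-- A block that ends where a spine begins extends the spine by one vertex. The labels of the two
-- parts meet only in `w`, so no sting of one part is spoilt by an edge of the other.
include hl in
theorem IsBlock.union_hasSpine (h : IsBlock l u w I) {r : ℕ} {c : Fin (r + 2) → P}
    (hc : HasSpine l K r c) (hw : c 0 = w) : HasSpine l (I ∪ K) (r + 1) (Fin.cons u c) := by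
  have h0 : ∀ p ∈ verts K, l w ≤ l p := hw ▸ hc.first.2
  have hnI {p : P} (hp : l w < l p) : p ∉ verts I := fun h' =>
    absurd hp (not_lt.2 (h.le_of_mem hl h').2)
  refine ⟨?_, ?_, ?_, ?_, ?_⟩
  · rw [Fin.strictMono_iff_lt_succ]
    intro j
    refine Fin.cases ?_ (fun j => ?_) j
    · simpa [hw] using h.lt
    · simpa using hc.mono (Fin.castSucc_lt_succ (i := j))
  · intro j
    rw [edgeMem_union]
    refine Fin.cases ?_ (fun j => ?_) j
    · left
      simpa [hw] using h.spine
    · right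
      simpa using hc.spine j
  · refine ⟨by rw [verts_union]; exact Finset.mem_union_left _ h.spine.left_mem, fun p hp => ?_⟩
    rw [verts_union, Finset.mem_union] at hp
    rcases hp with hp | hp
    exacts [(h.le_of_mem hl hp).1, h.lt.le.trans (h0 p hp)]
  · rw [← Fin.succ_last, Fin.cons_succ, verts_union]
    refine ⟨Finset.mem_union_right _ hc.last.1, fun p hp => ?_⟩
    rw [Finset.mem_union] at hp
    rcases hp with hp | hp
    · exact ((h.le_of_mem hl hp).2.trans_eq (hw ▸ rfl)).trans (hc.last.2 _ hc.first.1)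
    · exact hc.last.2 p hp
  · intro p q hpq he
    rcases edgeMem_union.1 he with he | he
    · refine ⟨0, ?_⟩
      simp only [Fin.castSucc_zero, Fin.cons_zero, Fin.cons_succ, hw]
      refine (h.edge p q hpq he).imp id (Or.imp ?_ ?_)
      · rintro ⟨rfl, h2⟩
        refine ⟨rfl, h2, fun h' => ?_⟩
        rcases edgeMem_union.1 h' with h' | h'
        · exact h.not_edgeMem hl hpq h2 he h'
        · exact absurd h2 (not_lt.2 (h0 q h'.left_mem))
      · exact fun ⟨h1, h2, h3⟩ => ⟨h1, h2, h3⟩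
    · obtain ⟨j, hj⟩ := hc.edge p q hpq he
      refine ⟨j.succ, ?_⟩
      simp only [Fin.castSucc_succ, Fin.cons_succ]
      refine hj.imp id (Or.imp ?_ id)
      rintro ⟨h1, h2, h3⟩
      refine ⟨h1, h2, fun h' => ?_⟩
      rcases edgeMem_union.1 h' with h' | h'
      · exact hnI ((h0 p he.left_mem).trans_lt hpq) h'.left_mem
      · exact h3 h'

include hl in
/-- The part of a sting-chain up to the first inner vertex of the spine is a block. -/
theorem HasSpine.exists_block {r : ℕ} {c : Fin (r + 2) → P} (h : HasSpine l I r c) :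
    IsBlock l (c 0) (c 1) (edgesWith l (fun _ q => l q ≤ l (c 1)) I) := by
  have h01 : l (c 0) < l (c 1) := h.mono (Fin.zero_lt_one)
  refine ⟨h01, (edgeMem_edgesWith h01).2 ⟨h.spine 0, le_rfl⟩, fun p q hpq he => ?_⟩
  obtain ⟨he, hq⟩ := (edgeMem_edgesWith hpq).1 he
  obtain ⟨j, hj⟩ := h.edge p q hpq he
  have h0 : j = 0 := by
    by_contra hj0
    have h1 : l (c 1) ≤ l (c j.castSucc) := h.mono.monotone (by
      rw [Fin.le_def]
      have : (j : ℕ) ≠ 0 := fun e => hj0 (Fin.ext e)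
      simp
      omega)
    rcases hj with ⟨rfl, -⟩ | ⟨rfl, -⟩ | ⟨h2, -⟩ <;> omega
  subst h0
  exact hj.imp id (Or.imp (fun ⟨h1, h2, _⟩ => ⟨h1, h2⟩) id)

include hl in
theorem HasSpine.tail {r : ℕ} {c : Fin (r + 3) → P} (h : HasSpine l I (r + 1) c) :
    HasSpine l (edgesWith l (fun p _ => l (c 1) ≤ l p) I) r (fun j => c j.succ) := by
  have hsub : edgesWith l (fun p _ => l (c 1) ≤ l p) I ⊆ I := edgesWith_subset
  have hge {p : P} (hp : p ∈ verts (edgesWith l (fun p _ => l (c 1) ≤ l p) I)) : l (c 1) ≤ l p := by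
    obtain ⟨x, y, hxy, he, hp⟩ := exists_ordered_of_mem_verts hl hp
    have := ((edgeMem_edgesWith hxy).1 he).2
    rcases hp with rfl | rfl <;> omega
  have hmono : StrictMono fun j : Fin (r + 2) => l (c j.succ) :=
    h.mono.comp (Fin.strictMono_succ)
  have hspine (j : Fin (r + 1)) : EdgeMem (edgesWith l (fun p _ => l (c 1) ≤ l p) I)
      (c j.castSucc.succ) (c j.succ.succ) :=
    (edgeMem_edgesWith (hmono (Fin.castSucc_lt_succ (i := j)))).2
      ⟨h.spine j.succ, hmono.monotone (Fin.zero_le j.castSucc)⟩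
  refine ⟨hmono, hspine, ⟨(hspine 0).left_mem, fun p hp => hge hp⟩,
    ⟨(hspine (Fin.last _)).right_mem, fun p hp => h.last.2 p (verts_mono hsub hp)⟩, ?_⟩
  intro p q hpq he
  obtain ⟨he, hp⟩ := (edgeMem_edgesWith hpq).1 he
  obtain ⟨j, hj⟩ := h.edge p q hpq he
  revert hj
  refine Fin.cases (fun hj => ?_) (fun j hj => ⟨j, ?_⟩) j
  · exfalso
    have h01 : l (c 0) < l (c 1) := h.mono (Fin.zero_lt_one)
    rcases hj with ⟨rfl, -⟩ | ⟨rfl, -⟩ | ⟨-, rfl, -⟩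
    · exact absurd h01 (not_lt.2 hp)
    · exact absurd h01 (not_lt.2 hp)
    · exact absurd hpq (not_lt.2 hp)
  · exact hj.imp id (Or.imp (fun ⟨h1, h2, h3⟩ => ⟨h1, h2, fun h' => h3 (h'.mono hsub)⟩) id)

include hl in
theorem HasSpine.union_tail {r : ℕ} {c : Fin (r + 2) → P} (h : HasSpine l I r c) :
    edgesWith l (fun _ q => l q ≤ l (c 1)) I ∪ edgesWith l (fun p _ => l (c 1) ≤ l p) I = I := by
  refine (Finset.union_subset edgesWith_subset edgesWith_subset).antisymm
    (subset_of_edgeMem hl fun p q hpq he => ?_)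
  rw [edgeMem_union, edgeMem_edgesWith hpq, edgeMem_edgesWith hpq]
  obtain ⟨j, hj⟩ := h.edge p q hpq he
  by_cases hj0 : j = 0
  · subst hj0
    refine Or.inl ⟨he, ?_⟩
    rcases hj with ⟨-, rfl⟩ | ⟨-, h2, -⟩ | ⟨-, rfl, -⟩
    exacts [le_rfl, h2.le, le_rfl]
  · refine Or.inr ⟨he, ?_⟩
    have h1 : l (c 1) ≤ l (c j.castSucc) := h.mono.monotone (by
      rw [Fin.le_def]
      have : (j : ℕ) ≠ 0 := fun e => hj0 (Fin.ext e)
      simp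
      omega)
    rcases hj with ⟨rfl, -⟩ | ⟨rfl, -⟩ | ⟨h2, -⟩
    exacts [h1, h1, h1.trans h2.le]

-- A sting-chain is cut at the inner vertices of its spine into blocks, which are stacked from above
-- onto `J`.
include hl in
theorem HasSpine.isStingForest_union {r : ℕ} {c : Fin (r + 2) → P} (h : HasSpine l I r c)
    (hJ : IsStingForest l J) (hIJ : ∀ p ∈ verts I, ∀ q ∈ verts J, l p < l q) :
    IsStingForest l (I ∪ J) := by
  induction r generalizing I with
  | zero =>
    have hB := h.exists_block hl
    have hI : edgesWith l (fun _ q => l q ≤ l (c 1)) I = I := by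
      refine edgesWith_subset.antisymm (subset_of_edgeMem hl fun p q hpq he => ?_)
      exact (edgeMem_edgesWith hpq).2 ⟨he, h.last.2 q he.right_mem⟩
    rw [hI] at hB
    exact .union hB hJ fun q hq => (hIJ _ h.last.1 q hq).le
  | succ r ih =>
    have hsub : edgesWith l (fun p _ => l (c 1) ≤ l p) I ⊆ I := edgesWith_subset
    rw [← h.union_tail hl, Finset.union_assoc]
    have ht := h.tail hl
    refine .union (h.exists_block hl) (ih ht fun p hp => hIJ p (verts_mono hsub hp)) fun q hq => ?_
    rw [verts_union, Finset.mem_union] at hq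
    rcases hq with hq | hq
    · exact ht.first.2 q hq
    · exact (hIJ _ (h.spine 0).right_mem q hq).le

variable (l) in
/-- `max(I) < min(J)`. -/
def StingLT (I J : Cell (posetIdeal k P)) : Prop :=
  ∀ p ∈ (lcmOf I).support, ∀ q ∈ (lcmOf J).support, l p < l q

theorem StingLT.foldr {I : Cell (posetIdeal k P)} {L : List (Cell (posetIdeal k P))}
    (hL : ∀ J ∈ L, IsStingChain l J) (h : (I :: L).IsChain (StingLT l)) :
    StingLT l I (L.foldr (· ∪ ·) ∅) := by
  induction L generalizing I with
  | nil => exact fun p _ q hq => by simp [lcmOf, bot_eq_zero] at hq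
  | cons J L ih =>
    rw [List.isChain_cons_cons] at h
    obtain ⟨r, c, hc⟩ := isStingChain_iff.1 (hL J List.mem_cons_self)
    intro p hp q hq
    have hq' : q ∈ verts (J ∪ L.foldr (· ∪ ·) ∅) := hq
    rw [verts_union, Finset.mem_union] at hq'
    rcases hq' with hq' | hq'
    · exact h.1 p hp q hq'
    · exact (h.1 p hp _ hc.first.1).trans
        (ih (fun K hK => hL K (List.mem_cons_of_mem _ hK)) h.2 _ hc.first.1 q hq')

include hl in
theorem isStingForest_of_isChainOfStingChains (h : IsChainOfStingChains l I) :
    IsStingForest l I := by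
  obtain ⟨L, hL, hch, rfl⟩ := h
  induction L with
  | nil => exact .empty
  | cons J L ih =>
    obtain ⟨r, c, hc⟩ := isStingChain_iff.1 (hL J List.mem_cons_self)
    exact hc.isStingForest_union hl
      (ih (fun K hK => hL K (List.mem_cons_of_mem _ hK)) hch.tail)
      (StingLT.foldr (fun K hK => hL K (List.mem_cons_of_mem _ hK)) hch)

-- A new block at the bottom either shares its upper end with the first sting-chain and then
-- lengthens its spine, or lies strictly below it and begins a sting-chain of its own.
include hl in
theorem IsStingForest.isChainOfStingChains (h : IsStingForest l I) : IsChainOfStingChains l I := by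
  induction h with
  | empty => exact ⟨[], by simp, .nil, rfl⟩
  | @union u w I J hI hJ hw ih =>
    obtain ⟨L, hL, hch, rfl⟩ := ih
    cases L with
    | nil => exact ⟨[I], by simpa using hI.isStingChain hl, .singleton _, rfl⟩
    | cons K L =>
      obtain ⟨r, c, hc⟩ := isStingChain_iff.1 (hL K List.mem_cons_self)
      have hwK : ∀ p ∈ verts K, l w ≤ l p := fun p hp =>
        hw p (verts_mono Finset.subset_union_left hp)
      by_cases hwmem : w ∈ verts K
      · have h0 : c 0 = w := hl (le_antisymm (hc.first.2 w hwmem) (hwK _ hc.first.1))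
        refine ⟨(I ∪ K) :: L, ?_, ?_, ?_⟩
        · intro J hJ
          rcases List.mem_cons.1 hJ with rfl | hJ
          · exact isStingChain_iff.2 ⟨_, _, hI.union_hasSpine hl hc h0⟩
          · exact hL J (List.mem_cons_of_mem _ hJ)
        · cases L with
          | nil => exact .singleton _
          | cons M L =>
            rw [List.isChain_cons_cons] at hch ⊢
            refine ⟨fun p hp q hq => ?_, hch.2⟩
            have hp' : p ∈ verts (I ∪ K) := hp
            rw [verts_union, Finset.mem_union] at hp'
            rcases hp' with hp' | hp'
            · exact (hI.le_of_mem hl hp').2.trans_lt (hch.1 w hwmem q hq)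
            · exact hch.1 p hp' q hq
        · exact (Finset.union_assoc _ _ _).symm
      · refine ⟨I :: K :: L, ?_, ?_, rfl⟩
        · intro J hJ
          rcases List.mem_cons.1 hJ with rfl | hJ
          exacts [hI.isStingChain hl, hL J hJ]
        · rw [List.isChain_cons_cons]
          refine ⟨fun p hp q hq => (hI.le_of_mem hl hp).2.trans_lt ?_, hch⟩
          exact lt_of_le_of_ne (hwK q hq) (hl.ne fun e => hwmem (e ▸ hq))

theorem clSum_stingChains (l : P → ℕ) (hl : Function.Injective l) (hm : StrictMono l) :
    denominator (posetIdeal k P) = clSum (a := posetIdeal k P) (IsChainOfStingChains l) := by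
  have hiff : (fun I : Cell (posetIdeal k P) => IsStingForest l I) = IsChainOfStingChains l :=
    funext fun I => propext ⟨fun h => h.isChainOfStingChains hl,
      fun h => isStingForest_of_isChainOfStingChains hl h⟩
  rw [← hiff]
  exact (clSum_eq_denominator isEdgeIdeal_posetIdeal .empty (fun I hI _ => hI.card_add_cl hl)
    (sum_isStingForest hl hm)).symm

end StingEquiv

end MonomialRing

end

set_option linter.unusedSectionVars false
noncomputable section
open MvPolynomial
open scoped Classical TensorProduct

namespace MonomialRing

universe u v

/-! ### Assembling the formulas for `W` -/

section NotBad

variable {k : Type u} [Field k] {σ : Type v} [Fintype σ] {a : Ideal (MvPolynomial σ k)}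

theorem clSum_not_bad (ha : IsEdgeIdeal a) {ι : Type*} [LinearOrder ι] {ρ : minGens a → ι}
    (hρ : Function.Injective ρ) :
    clSum (fun I : Cell a => ∀ m, ¬ Bad ρ I m) = denominator a := by
  have h0 : ∀ m, ¬ Bad ρ (∅ : Cell a) m := by
    intro m hm
    have h1 := hm.verts_eq ha
    rw [Finset.erase_empty, verts_empty, verts_eq_empty ha] at h1
    exact Finset.insert_ne_empty _ _ h1
  refine clSum_eq_denominator ha h0 (fun I hI _ => card_add_cl_of_not_bad ha hρ hI) ?_
  rw [← sum_not_bad ha hρ]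
  exact Finset.sum_congr (Finset.filter_congr_decidable _ _ _) fun _ _ => rfl

end NotBad

section Main

variable {k : Type u} [Field k] {P : Type v} [Fintype P] [PartialOrder P]

/-- `K` is the product of `H` and `∏ (1 - x_i)`, both of which have explicit inverses. -/
theorem isUnit_kSeries : IsUnit (kSeries (posetIdeal k P)) := by
  refine IsUnit.of_mul_eq_one (inverseSeries P * onesOff ∅) ?_
  rw [← chainSeries_mul_prod k P, mul_mul_mul_comm, mul_comm (chainSeries P), inverseSeries_mul,
    mul_comm _ (onesOff ∅), onesOff_mul_prod, one_mul]

theorem isUnit_toSeries_denominator : IsUnit (toSeries (denominator (posetIdeal k P))) := by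
  rw [toSeries_denominator]
  exact isUnit_kSeries.map _

theorem poincareSeries_mul_denominator :
    poincareSeries (posetIdeal k P) * toSeries (denominator (posetIdeal k P)) =
      ∏ i : P, (1 + tvar P * xvar i) := by
  rw [toSeries_denominator, poincareSeries_eq, ← map_mul, ← chainSeries_mul_prod, ← mul_assoc,
    inverseSeries_mul, one_mul, homogenize_prod_neg_one]

theorem isUnit_prod_one_sub : IsUnit (∏ i : P, (1 - tvar P * xvar i)) := by
  rw [← homogenize_prod_one]
  exact (IsUnit.of_mul_eq_one_right _ onesOff_mul_prod).map _

theorem hilbertSeries_mul_prod :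
    hilbertSeries (posetIdeal k P) * ∏ i : P, (1 - tvar P * xvar i) =
      toSeries ((denominator (posetIdeal k P)).comp (-Polynomial.X)) := by
  rw [hilbertSeries_eq, ← homogenize_prod_one, ← map_mul, chainSeries_mul_prod k P,
    toSeries_denominator_comp]

theorem clSum_isNBC (ord : MonomialOrder P) :
    denominator (posetIdeal k P) = clSum (a := posetIdeal k P) (IsNBC ord) := by
  have hinj : Function.Injective fun m : minGens (posetIdeal k P) => ord.toSyn (m : P →₀ ℕ) :=
    fun m n h => Subtype.ext (ord.toSyn.injective h)
  have hiff : (fun I : Cell (posetIdeal k P) =>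
      ∀ m, ¬ Bad (fun m => ord.toSyn (m : P →₀ ℕ)) I m) = IsNBC ord :=
    funext fun I => propext (isNBC_iff isEdgeIdeal_posetIdeal ord I).symm
  exact (clSum_not_bad isEdgeIdeal_posetIdeal hinj).symm.trans (congrArg clSum hiff)

theorem IsFirstSequence.clSum_eq {L : List (Matching (posetIdeal k P))} (hL : IsFirstSequence L) :
    denominator (posetIdeal k P) = clSum (Unmatched L) := by
  have ha := isEdgeIdeal_posetIdeal (k := k) (P := P)
  refine (clSum_eq_denominator ha ((unmatched_iff_comp ha hL.sequence).2 fun D hD => ?_)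
    (fun I hI _ => hL.card_add_cl ha hI) (hL.sequence.sum_unmatched ha)).symm
  exact ((nonempty_of_cl hD.conn).ne_empty (Finset.subset_empty.1 hD.subset)).elim

theorem IsFirstSequence.propertyP {L : List (Matching (posetIdeal k P))} (hL : IsFirstSequence L) :
    PropertyP L := by
  have ha := isEdgeIdeal_posetIdeal (k := k) (P := P)
  have hdeg : ∀ I : YIndex L, I.1.card + 1 = (lcmOf I.1).degree := fun I => by
    rw [degree_lcmOf ha]
    exact hL.card_of_conn ha I.2.1 I.2.2
  -- `H = K / ∏ (1 - x_i)`, and the series of `R` inverts `K`.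
  have h1 : inverseSeries P = (∏ i : P, (1 - MvPowerSeries.X i)) * rSeries L := by
    have h2 := hL.rSeries_mul_kSeries ha
    have h3 := inverseSeries_mul P
    rw [← chainSeries_mul_prod k P] at h2
    generalize (∏ i : P, (1 - MvPowerSeries.X i) : MvPowerSeries P ℤ) = p at h2 ⊢
    linear_combination (-inverseSeries P) * h2 + rSeries L * p * h3
  rw [PropertyP, poincareSeries_eq, hilbR_one_t_eq (YInd.irrefl ha) hdeg, h1, map_mul,
    homogenize_prod_neg_one]
  simp only [mul_comm (tvar P)]

theorem IsFirstSequence.propertyH {L : List (Matching (posetIdeal k P))} (hL : IsFirstSequence L) :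
    PropertyH L := by
  have ha := isEdgeIdeal_posetIdeal (k := k) (P := P)
  have hdeg : ∀ I : YIndex L, I.1.card + 1 = (lcmOf I.1).degree := fun I => by
    rw [degree_lcmOf ha]
    exact hL.card_of_conn ha I.2.1 I.2.2
  have h1 : hilbertSeries (posetIdeal k P) *
      ((∏ i : P, (1 - xvar i * tvar P)) * hilbR_t_neg_one L) = 1 := by
    simp only [mul_comm (xvar _)]
    rw [hilbertSeries_eq, hilbR_t_neg_one_eq (YInd.irrefl ha) hdeg, ← homogenize_prod_one, ← map_mul,
      ← map_mul, ← mul_assoc, chainSeries_mul_prod k P, mul_comm, hL.rSeries_mul_kSeries ha, map_one]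
  have h2 := IsUnit.of_mul_eq_one_right _ h1
  refine ⟨h2, ?_⟩
  rw [← one_mul (Ring.inverse _), Ring.eq_mul_inverse_iff_mul_eq _ _ _ h2, h1]

theorem IsStandardMatching.clSum_eq {M : ℕ → List (Matching (posetIdeal k P))}
    (hM : IsStandardMatching M) :
    denominator (posetIdeal k P) = clSum (fun I => ∀ i, 1 ≤ i → Unmatched (M i) I) := by
  have ha := isEdgeIdeal_posetIdeal (k := k) (P := P)
  obtain ⟨n, hn, -⟩ := hM.minimal
  have hF (I : Cell (posetIdeal k P)) :
      (∀ i, 1 ≤ i → Unmatched (M i) I) ↔ I ∈ (morseUpTo M n).basis := by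
    rw [mem_morseUpTo_basis]
    refine ⟨fun h i h1 _ => h i h1, fun h i h1 => ?_⟩
    by_cases hi : i ≤ n
    · exact h i h1 hi
    · rw [hn i (by omega)]
      intro N hN
      simp at hN
  refine (clSum_eq_denominator ha (fun i hi N hN e he => ?_)
    (fun I hI _ => (hM.isFirstSequence ha).card_add_cl ha (hI 1 le_rfl)) ?_).symm
  -- The empty cell is never matched: both ends of a base edge have at least one class, so they are
  -- nonempty, and adding `K` keeps them so.
  · obtain ⟨j, rfl⟩ : ∃ j, i = j + 1 := ⟨i - 1, by omega⟩
    obtain ⟨C, -, hC⟩ := IsStandardSequence.exists_step (p := fun _ => True) (fun _ _ _ _ => trivial)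
      _ _ trivial (hM.sequence j) N hN
    obtain ⟨B, -, hB, hcl⟩ := hC.closed
    obtain ⟨f, hf, K, -, rfl, -, -⟩ := (hcl e).1 he
    have h1 := nonempty_of_cl (hB f hf).1
    have h2 : f.2.Nonempty := by
      rw [Finset.nonempty_iff_ne_empty]
      intro h0
      have := (hB f hf).2
      rw [h0, cl_empty] at this
      omega
    exact ⟨(h1.mono Finset.subset_union_left).ne_empty.symm,
      (h2.mono Finset.subset_union_left).ne_empty.symm⟩
  · rw [← morseUpTo_induction hM.sequence (p := fun C => ∑ I ∈ C.basis, kTerm I = kSeries _)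
      sum_taylor_basis (fun _ _ _ h hN => (sum_morse_basis hN.acyclicMatching hN.graded).trans h) n]
    refine Finset.sum_congr ?_ fun _ _ => rfl
    ext I
    rw [← hF]
    simp

end Main

end MonomialRing

end

theorem mainTheorem3 {k : Type*} [Field k] {P : Type*} [Fintype P] [PartialOrder P] :
    ∃ W : Polynomial (MvPolynomial P ℤ),
      -- the Poincaré–Betti series and the Hilbert series of `k[Δ(P)]`
      IsUnit (MonomialRing.toSeries W) ∧
      MonomialRing.poincareSeries (MonomialRing.posetIdeal k P) =
        (∏ i : P, (1 + MonomialRing.tvar P * MonomialRing.xvar i)) *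
          Ring.inverse (MonomialRing.toSeries W) ∧
      MonomialRing.hilbertSeries (MonomialRing.posetIdeal k P) =
        MonomialRing.toSeries (W.comp (-Polynomial.X)) *
          Ring.inverse (∏ i : P, (1 - MonomialRing.tvar P * MonomialRing.xvar i)) ∧
      -- the sum over the nbc-sets
      (∀ ord : MonomialOrder P,
        W = MonomialRing.clSum (a := MonomialRing.posetIdeal k P) (MonomialRing.IsNBC ord)) ∧
      -- the sum over the chains of sting-chains
      (∀ l : P → ℕ, Function.Injective l → StrictMono l →
        W = MonomialRing.clSum (a := MonomialRing.posetIdeal k P)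
          (MonomialRing.IsChainOfStingChains l)) ∧
      -- the sum over the sets not matched by a first sequence, and the properties (P) and (H)
      (∃ L : List (MonomialRing.Matching (MonomialRing.posetIdeal k P)),
        MonomialRing.IsFirstSequence L) ∧
      (∀ L : List (MonomialRing.Matching (MonomialRing.posetIdeal k P)),
        MonomialRing.IsFirstSequence L →
          W = MonomialRing.clSum (MonomialRing.Unmatched L) ∧
          MonomialRing.PropertyP L ∧ MonomialRing.PropertyH L) ∧
      -- standard matchings `M = M_1 ∪ M_2` and the sum over the sets they do not match
      (∀ M : ℕ → List (MonomialRing.Matching (MonomialRing.posetIdeal k P)),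
        MonomialRing.IsStandardMatching M →
          MonomialRing.IsFirstSequence (M 1) ∧
          (∀ i, 3 ≤ i → ∀ N ∈ M i, N = ∅) ∧
          W = MonomialRing.clSum (fun I => ∀ i, 1 ≤ i → MonomialRing.Unmatched (M i) I)) := by
  have ha := MonomialRing.isEdgeIdeal_posetIdeal (k := k) (P := P)
  refine ⟨MonomialRing.denominator (MonomialRing.posetIdeal k P),
    MonomialRing.isUnit_toSeries_denominator, ?_, ?_, MonomialRing.clSum_isNBC,
    MonomialRing.clSum_stingChains, MonomialRing.exists_isFirstSequence ha,
    fun L hL => ⟨hL.clSum_eq, hL.propertyP, hL.propertyH⟩,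
    fun M hM => ⟨hM.isFirstSequence ha, fun i hi N hN => hM.eq_empty ha hi hN, hM.clSum_eq⟩⟩
  · rw [Ring.eq_mul_inverse_iff_mul_eq _ _ _ MonomialRing.isUnit_toSeries_denominator,
      MonomialRing.poincareSeries_mul_denominator]
  · rw [Ring.eq_mul_inverse_iff_mul_eq _ _ _ MonomialRing.isUnit_prod_one_sub,
      MonomialRing.hilbertSeries_mul_prod]
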